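/- **Setting.** Let $L>0$, let $\Omega=[0,L]^2\times[0,1]$ be a periodic box, let $Re,Pe>0$, $\Gamma\in\mathbb R$, $\epsilon\neq 0$, and put $\gamma=L^2/(4\pi^2)$. All functions are real and periodic on $\Omega$, $\|\cdot\|_2$ is the $L^2(\Omega)$ norm, $\nabla_h=(\partial_x,\partial_y)$, $\Delta_h=\partial_x^2+\partial_y^2$, $\overline f(z)=L^{-2}\int_{[0,L]^2}f(x,y,z)\,dx\,dy$, and $H^1_h(\Omega)$ is the space of $f\in L^2(\Omega)$ with $\nabla_h f\in L^2(\Omega)$. Let $V$ be the space of $(\mathbf u,w,\theta)\in (H^1(\Omega))^4$, $\mathbf u=(u,v)$, with $\nabla_h\cdot\mathbf u=0$ and $\overline{\mathbf u}=0$, $\overline w=\overline\theta=0$. Consider $$\begin{aligned} &w_t+\mathbf u\cdot\nabla_h w-\phi_z=\Gamma\theta+\tfrac1{Re}\Delta_h w,\\ &\omega_t+\mathbf u\cdot\nabla_h\omega-w_z=\tfrac1{Re}\Delta_h\omega+\epsilon^2\phi_{zz},\\ &\theta_t+\mathbf u\cdot\nabla_h\theta+w\,\overline{w\theta}=\tfrac1{Pe}\Delta_h\theta,\qquad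 \nabla_h\cdot\mathbf u=0, \end{aligned}$$ where $\omega=v_x-u_y=-\Delta_h\phi$ and $\overline\phi=0$. Given $(\mathbf u_0,w_0,\theta_0)\in V$, with $\omega_0=\nabla_h\times\mathbf u_0$, a *strong solution on $[0,T]$* with these initial data is a $V$-valued $(\mathbf u,w,\theta)$ on $[0,T]$ such that - $\mathbf u,w,\theta\in L^\infty(0,T;H^1(\Omega))\cap C([0,T];L^2(\Omega))$ and $\omega\in L^\infty(0,T;L^2(\Omega))\cap C([0,T];(H^1_h(\Omega))')$; - $\nabla_h\omega,\Delta_h w,\Delta_h\theta,\omega_z,\nabla_h w_z,\nabla_h\theta_z,\phi_{zz},\mathbf u_t,w_t,\theta_t\in L^2(\Omega\times(0,T))$ and $\omega_t\in L^2(0,T;(H^1_h(\Omega))')$; - the $w$- and $\theta$-equations hold in $L^2(\Omega\times(0,T))$ and the $\omega$-equation holds in $L^2(0,T;(H^1_h(\Omega))')$; - $\mathbf u(0)=\mathbf u_0$, $w(0)=w_0$, $\theta(0)=\theta_0$, $\omega(0)=\omega_0$. A *global strong solution* is a function on $[0,\infty)$ that is a strong solution on $[0,T]$ for every $T>0$.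 **Theorem.** Let $\kappa\ge1$ with $Pe\neq 2\kappa Re$. There are constants $C,K,T_0$ and functions $C_1,C_2$, all depending only on $L,Re,Pe,\Gamma,\epsilon,\kappa$, such that every global strong solution $(\mathbf u,w,\theta)$ with initial data $(\mathbf u_0,w_0,\theta_0)$ satisfies the following. For all $t\ge0$, $$\|\theta(t)\|_2^2\le e^{-\frac{2}{\gamma Pe}t}\|\theta_0\|_2^2,$$ $$\|\mathbf u(t)\|_2^2+\|w(t)\|_2^2\le e^{-\frac{1}{\kappa\gamma Re}t}\left(\|\mathbf u_0\|_2^2+\|w_0\|_2^2\right)+C\left(e^{-\frac{2}{\gamma Pe}t}+e^{-\frac1{\kappa\gamma Re}t}\right)\|\theta_0\|_2^2.$$ For all $t\ge \max(T_0,0)$, $$\|\omega(t)\|_2^2+\|\nabla_h w(t)\|_2^2+\|\nabla_h\theta(t)\|_2^2\le\left(e^{-\frac{2}{\gamma Pe}t}+e^{-\frac1{\kappa\gamma Re}t}\right)C_1\left(\|\mathbf u_0\|_2,\|w_0\|_2,\|\theta_0\|_2,\|\partial_z\theta_0\|_2\right).$$ For all $t\ge0$, $$\|\mathbf u_z(t)\|_2^2+\|w_z(t)\|_2^2+\|\theta_z(t)\|_2^2\le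 C_2\left(\|\mathbf u_0\|_{H^1},\|w_0\|_{H^1},\|\theta_0\|_{H^1}\right)e^{K\left(\|\theta_0\|_2^2+\|\partial_z\theta_0\|_2^2+1\right)t}.$$ -/

import Mathlib

open MeasureTheory Set
open scoped ENNReal

noncomputable section

namespace RotConv

/-- The three-dimensional periodic domain with fundamental cell `[0,L]² × [0,1]`.  Its `volume` is
the Lebesgue measure of the cell (total mass `L²`). -/
abbrev Torus (L : ℝ) : Type := AddCircle L × AddCircle L × UnitAddCircle

/-- The covering map from `ℝ³`. -/
def proj (L : ℝ) (p : ℝ × ℝ × ℝ) : Torus L :=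
  ((p.1 : AddCircle L), (p.2.1 : AddCircle L), (p.2.2 : UnitAddCircle))

/-- Smooth periodic test functions: the lift to `ℝ³` is `C^∞`. -/
def IsTest {L : ℝ} (ψ : Torus L → ℝ) : Prop :=
  ContDiff ℝ (⊤ : ℕ∞) (fun p : ℝ × ℝ × ℝ => ψ (proj L p))

/-- The classical derivative of a function on the torus in the direction `e`. -/
def dirDeriv {L : ℝ} (e : ℝ × ℝ × ℝ) (ψ : Torus L → ℝ) (q : Torus L) : ℝ :=
  deriv (fun s : ℝ => ψ (q + proj L (s • e))) 0

theorem isOpenQuotientMap_proj {L : ℝ} : IsOpenQuotientMap (proj L) :=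
  IsOpenQuotientMap.prodMap QuotientAddGroup.isOpenQuotientMap_mk
    (IsOpenQuotientMap.prodMap QuotientAddGroup.isOpenQuotientMap_mk
      QuotientAddGroup.isOpenQuotientMap_mk)

theorem IsTest.continuous {L : ℝ} {ψ : Torus L → ℝ} (h : IsTest ψ) : Continuous ψ :=
  (isOpenQuotientMap_proj (L := L)).continuous_comp_iff.mp (ContDiff.continuous h)

theorem dirDeriv_proj {L : ℝ} (e : ℝ × ℝ × ℝ) {ψ : Torus L → ℝ} (h : IsTest ψ) (p : ℝ × ℝ × ℝ) :
    dirDeriv e ψ (proj L p) = fderiv ℝ (fun p : ℝ × ℝ × ℝ => ψ (proj L p)) p e := by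
  have hd : DifferentiableAt ℝ (fun p : ℝ × ℝ × ℝ => ψ (proj L p)) (p + (0 : ℝ) • e) :=
    (ContDiff.differentiable h (by simp)).differentiableAt
  have hl : HasDerivAt (fun s : ℝ => p + s • e) e 0 := by
    simpa using ((hasDerivAt_id (0 : ℝ)).smul_const e).const_add p
  have := (hd.hasFDerivAt.comp_hasDerivAt (0 : ℝ) hl).deriv
  simp only [zero_smul, add_zero] at this
  rw [← this]
  rfl

theorem IsTest.dirDeriv {L : ℝ} (e : ℝ × ℝ × ℝ) {ψ : Torus L → ℝ} (h : IsTest ψ) :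
    IsTest (dirDeriv e ψ) := by
  unfold IsTest
  simp only [dirDeriv_proj e h]
  exact (ContDiff.fderiv_right (m := (⊤ : ℕ∞)) h (by simp)).clm_apply contDiff_const

/-- The `x` direction. -/
def ex : ℝ × ℝ × ℝ := (1, 0, 0)
/-- The `y` direction. -/
def ey : ℝ × ℝ × ℝ := (0, 1, 0)
/-- The `z` direction. -/
def ez : ℝ × ℝ × ℝ := (0, 0, 1)

/-- `L²(Ω)`, real valued. -/
abbrev L2 (L : ℝ) [Fact (0 < L)] : Type := Lp ℝ 2 (volume : Measure (Torus L))

section Spatial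

variable {L : ℝ} [Fact (0 < L)]

/-- `g` is the weak derivative of `f` in the direction `e`, on the periodic domain. -/
def HasWeakDeriv (e : ℝ × ℝ × ℝ) (f g : L2 L) : Prop :=
  ∀ ψ : Torus L → ℝ, IsTest ψ → ∫ q, f q * dirDeriv e ψ q = -∫ q, g q * ψ q

/-- `f` has a weak derivative in `L²(Ω)` in the direction `e`. -/
def WeaklyDiff (e : ℝ × ℝ × ℝ) (f : L2 L) : Prop := ∃ g : L2 L, HasWeakDeriv e f g

open Classical in
/-- The weak derivative of `f` in the direction `e` (zero if there is none in `L²(Ω)`). -/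
def wderiv (e : ℝ × ℝ × ℝ) (f : L2 L) : L2 L :=
  if h : WeaklyDiff e f then h.choose else 0

/-- `g = Δ_h f` in the sense of distributions. -/
def HasHLaplacian (f g : L2 L) : Prop :=
  ∀ ψ : Torus L → ℝ, IsTest ψ →
    ∫ q, f q * (dirDeriv ex (dirDeriv ex ψ) q + dirDeriv ey (dirDeriv ey ψ) q) = ∫ q, g q * ψ q

open Classical in
/-- The weak horizontal Laplacian (zero if there is none in `L²(Ω)`). -/
def lapH (f : L2 L) : L2 L :=
  if h : ∃ g : L2 L, HasHLaplacian f g then h.choose else 0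

/-- The horizontal mean of a function, as a function of `z`. -/
def hmean (f : Torus L → ℝ) (z : UnitAddCircle) : ℝ :=
  (1 / L ^ 2) * ∫ p : AddCircle L × AddCircle L, f (p.1, p.2, z)

/-- The horizontal mean vanishes. -/
def ZeroMean (f : L2 L) : Prop := ∀ᵐ z : UnitAddCircle, hmean (fun q => f q) z = 0

/-- `f ∈ H¹(Ω)`. -/
def InH1 (f : L2 L) : Prop := WeaklyDiff ex f ∧ WeaklyDiff ey f ∧ WeaklyDiff ez f

/-- The norm of `H¹(Ω)`. -/
def h1Norm (f : L2 L) : ℝ :=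
  √(‖f‖ ^ 2 + ‖wderiv ex f‖ ^ 2 + ‖wderiv ey f‖ ^ 2 + ‖wderiv ez f‖ ^ 2)

/-- The vertical vorticity `∇_h × (u, v) = v_x - u_y`. -/
def curlH (u v : L2 L) : L2 L := wderiv ex v - wderiv ey u

/-- The space `V`. -/
structure InV (u v w θ : L2 L) : Prop where
  u_H1 : InH1 u
  v_H1 : InH1 v
  w_H1 : InH1 w
  θ_H1 : InH1 θ
  div_free : wderiv ex u + wderiv ey v = 0
  u_mean : ZeroMean u
  v_mean : ZeroMean v
  w_mean : ZeroMean w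
  θ_mean : ZeroMean θ

theorem integrable_mul_test (f : L2 L) {ψ : Torus L → ℝ} (h : IsTest ψ) :
    Integrable (fun q => f q * ψ q) := by
  have h2 : MemLp ψ 2 (volume : Measure (Torus L)) := by
    obtain ⟨C, hC⟩ := isCompact_univ.exists_bound_of_continuousOn h.continuous.continuousOn
    exact MemLp.of_bound h.continuous.aestronglyMeasurable C
      (Filter.Eventually.of_forall fun q => hC q (mem_univ q))
  exact (Lp.memLp f).integrable_mul h2

theorem integral_add_mul_test (f g : L2 L) {ψ : Torus L → ℝ} (h : IsTest ψ) :
    ∫ q, (f + g) q * ψ q = (∫ q, f q * ψ q) + ∫ q, g q * ψ q := by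
  rw [← integral_add (integrable_mul_test f h) (integrable_mul_test g h)]
  refine integral_congr_ae ?_
  filter_upwards [Lp.coeFn_add f g] with q hq
  rw [hq, Pi.add_apply, add_mul]

theorem integral_smul_mul_test (c : ℝ) (f : L2 L) (ψ : Torus L → ℝ) :
    ∫ q, (c • f) q * ψ q = c * ∫ q, f q * ψ q := by
  rw [← integral_const_mul]
  refine integral_congr_ae ?_
  filter_upwards [Lp.coeFn_smul c f] with q hq
  rw [hq, Pi.smul_apply, smul_eq_mul, mul_assoc]

theorem HasWeakDeriv.add {e : ℝ × ℝ × ℝ} {f g f' g' : L2 L} (h : HasWeakDeriv e f g)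
    (h' : HasWeakDeriv e f' g') : HasWeakDeriv e (f + f') (g + g') := by
  intro ψ hψ
  rw [integral_add_mul_test _ _ (hψ.dirDeriv e), integral_add_mul_test _ _ hψ, h ψ hψ, h' ψ hψ]
  ring

theorem HasWeakDeriv.smul {e : ℝ × ℝ × ℝ} {f g : L2 L} (c : ℝ) (h : HasWeakDeriv e f g) :
    HasWeakDeriv e (c • f) (c • g) := by
  intro ψ hψ
  rw [integral_smul_mul_test, integral_smul_mul_test, h ψ hψ]
  ring

theorem HasWeakDeriv.zero (e : ℝ × ℝ × ℝ) : HasWeakDeriv e (0 : L2 L) 0 := by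
  intro ψ hψ
  have h1 := integral_smul_mul_test (0 : ℝ) (0 : L2 L) ψ
  have h2 := integral_smul_mul_test (0 : ℝ) (0 : L2 L) (RotConv.dirDeriv e ψ)
  simp only [zero_smul, zero_mul] at h1 h2
  rw [h1, h2, neg_zero]

end Spatial

section HorizontalSobolev

variable (L : ℝ) [Fact (0 < L)]

/-- The Hilbert space `H¹_h(Ω)`, realized as the space of triples `(f, f_x, f_y)` in `L²(Ω)³`,
with norm `(‖f‖² + ‖f_x‖² + ‖f_y‖²)^{1/2}`. -/
def H1h : Submodule ℝ (PiLp 2 (fun _ : Fin 3 => L2 L)) where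
  carrier := {F | HasWeakDeriv ex (F 0) (F 1) ∧ HasWeakDeriv ey (F 0) (F 2)}
  add_mem' := fun hF hG => ⟨hF.1.add hG.1, hF.2.add hG.2⟩
  zero_mem' := ⟨HasWeakDeriv.zero ex, HasWeakDeriv.zero ey⟩
  smul_mem' := fun c _ hF => ⟨hF.1.smul c, hF.2.smul c⟩

/-- The dual space `(H¹_h(Ω))'`. -/
abbrev H1hDual : Type := StrongDual ℝ (H1h L)

variable {L}

/-- The embedding of `L²(Ω)` into `(H¹_h(Ω))'`: `f ↦ (ψ ↦ (f, ψ))`. -/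
def toDual (f : L2 L) : H1hDual L :=
  (innerSL ℝ f).comp ((PiLp.proj 2 (fun _ : Fin 3 => L2 L) 0).comp (H1h L).subtypeL)

end HorizontalSobolev

section Evolution

variable {E : Type*} [NormedAddCommGroup E] [NormedSpace ℝ E]

/-- `f ∈ L^p(0,T;E)`. -/
def InLp (p : ℝ≥0∞) (T : ℝ) (f : ℝ → E) : Prop := MemLp f p (volume.restrict (Ioo 0 T))

/-- `g` is the weak time derivative of `f` on `(0,T)`, as `E`-valued functions. -/
def HasTimeDeriv (T : ℝ) (f g : ℝ → E) : Prop :=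
  ∀ η : ℝ → ℝ, ContDiff ℝ (⊤ : ℕ∞) η → HasCompactSupport η → tsupport η ⊆ Ioo 0 T →
    ∫ t in Ioo 0 T, deriv η t • f t = -∫ t in Ioo 0 T, η t • g t

variable {L : ℝ} [Fact (0 < L)]

/-- `∂_e f ∈ L²(Ω × (0,T))`. -/
def DerivInL2 (T : ℝ) (e : ℝ × ℝ × ℝ) (f : ℝ → L2 L) : Prop :=
  (∀ᵐ t ∂volume.restrict (Ioo 0 T), WeaklyDiff e (f t)) ∧ InLp 2 T (fun t => wderiv e (f t))

/-- `∂_e ∂_z f ∈ L²(Ω × (0,T))`. -/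
def DerivZInL2 (T : ℝ) (e : ℝ × ℝ × ℝ) (f : ℝ → L2 L) : Prop :=
  (∀ᵐ t ∂volume.restrict (Ioo 0 T), WeaklyDiff ez (f t)) ∧
    DerivInL2 T e (fun t => wderiv ez (f t))

/-- `Δ_h f ∈ L²(Ω × (0,T))`. -/
def LapInL2 (T : ℝ) (f : ℝ → L2 L) : Prop :=
  (∀ᵐ t ∂volume.restrict (Ioo 0 T), ∃ g, HasHLaplacian (f t) g) ∧ InLp 2 T (fun t => lapH (f t))

/-- `f ∈ L^∞(0,T;H¹(Ω)) ∩ C([0,T];L²(Ω))`. -/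
structure LinftyH1ContL2 (T : ℝ) (f : ℝ → L2 L) : Prop where
  h1 : ∀ᵐ t ∂volume.restrict (Ioo 0 T), InH1 (f t)
  bdd : InLp ∞ T f
  bdd_x : InLp ∞ T (fun t => wderiv ex (f t))
  bdd_y : InLp ∞ T (fun t => wderiv ey (f t))
  bdd_z : InLp ∞ T (fun t => wderiv ez (f t))
  cont : ContinuousOn f (Icc 0 T)

/-- `(u, v, w, θ)`, with vorticity `ω` and horizontal stream function `φ`, is a strong solution on
`[0,T]` with initial data `(u₀, v₀, w₀, θ₀)`.  In the vorticity equation, tested with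
`ψ ∈ H¹_h(Ω)`, the components `ψ.1 0`, `ψ.1 1`, `ψ.1 2` are `ψ`, `ψ_x`, `ψ_y`; the product
`(𝐮·∇_h ω) ψ` is integrable for `𝐮 ∈ H¹`, `∇_h ω ∈ L²`, `ψ ∈ H¹_h`. -/
structure IsStrongSolutionAux (Re Pe Γ ε T : ℝ) (u v w θ ω φ : ℝ → L2 L) (u₀ v₀ w₀ θ₀ : L2 L) :
    Prop where
  mem_V₀ : InV u₀ v₀ w₀ θ₀
  mem_V : ∀ t ∈ Icc 0 T, InV (u t) (v t) (w t) (θ t)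
  vorticity : ∀ t ∈ Icc 0 T, ω t = curlH (u t) (v t)
  stream : ∀ t ∈ Icc 0 T, HasHLaplacian (φ t) (-ω t)
  stream_mean : ∀ t ∈ Icc 0 T, ZeroMean (φ t)
  -- regularity
  u_reg : LinftyH1ContL2 T u
  v_reg : LinftyH1ContL2 T v
  w_reg : LinftyH1ContL2 T w
  θ_reg : LinftyH1ContL2 T θ
  ω_bdd : InLp ∞ T ω
  ω_cont : ContinuousOn (fun t => toDual (ω t)) (Icc 0 T)
  ω_x : DerivInL2 T ex ω
  ω_y : DerivInL2 T ey ω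
  lap_w : LapInL2 T w
  lap_θ : LapInL2 T θ
  ω_z : DerivInL2 T ez ω
  w_zx : DerivZInL2 T ex w
  w_zy : DerivZInL2 T ey w
  θ_zx : DerivZInL2 T ex θ
  θ_zy : DerivZInL2 T ey θ
  φ_zz : DerivZInL2 T ez φ
  u_t : ∃ ut : ℝ → L2 L, InLp 2 T ut ∧ HasTimeDeriv T u ut
  v_t : ∃ vt : ℝ → L2 L, InLp 2 T vt ∧ HasTimeDeriv T v vt
  -- equations
  w_eq : ∃ wt : ℝ → L2 L, InLp 2 T wt ∧ HasTimeDeriv T w wt ∧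
    ∀ᵐ t ∂volume.restrict (Ioo 0 T), ∀ᵐ q : Torus L,
      wt t q + (u t q * wderiv ex (w t) q + v t q * wderiv ey (w t) q) - wderiv ez (φ t) q
        = Γ * θ t q + 1 / Re * lapH (w t) q
  ω_eq : ∃ ωt : ℝ → H1hDual L, InLp 2 T ωt ∧ HasTimeDeriv T (fun t => toDual (ω t)) ωt ∧
    ∀ᵐ t ∂volume.restrict (Ioo 0 T), ∀ ψ : H1h L,
      ωt t ψ
        + (∫ q, (u t q * wderiv ex (ω t) q + v t q * wderiv ey (ω t) q) * ψ.1 0 q)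
        - inner ℝ (wderiv ez (w t)) (ψ.1 0)
        = -(1 / Re) *
            (inner ℝ (wderiv ex (ω t)) (ψ.1 1) + inner ℝ (wderiv ey (ω t)) (ψ.1 2))
          + ε ^ 2 * inner ℝ (wderiv ez (wderiv ez (φ t))) (ψ.1 0)
  θ_eq : ∃ θt : ℝ → L2 L, InLp 2 T θt ∧ HasTimeDeriv T θ θt ∧
    ∀ᵐ t ∂volume.restrict (Ioo 0 T), ∀ᵐ q : Torus L,
      θt t q + (u t q * wderiv ex (θ t) q + v t q * wderiv ey (θ t) q)
          + w t q * hmean (fun q' => w t q' * θ t q') q.2.2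
        = 1 / Pe * lapH (θ t) q
  -- initial condition
  u_init : u 0 = u₀
  v_init : v 0 = v₀
  w_init : w 0 = w₀
  θ_init : θ 0 = θ₀
  ω_init : ω 0 = curlH u₀ v₀

/-- `(u, v, w, θ)` is a strong solution on `[0,T]` with initial data `(u₀, v₀, w₀, θ₀)`. -/
def IsStrongSolution (Re Pe Γ ε T : ℝ) (u v w θ : ℝ → L2 L) (u₀ v₀ w₀ θ₀ : L2 L) : Prop :=
  ∃ ω φ : ℝ → L2 L, IsStrongSolutionAux Re Pe Γ ε T u v w θ ω φ u₀ v₀ w₀ θ₀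

/-- A global strong solution: a strong solution on `[0,T]` for every `T > 0`. -/
def IsGlobalStrongSolution (Re Pe Γ ε : ℝ) (u v w θ : ℝ → L2 L) (u₀ v₀ w₀ θ₀ : L2 L) : Prop :=
  ∀ T : ℝ, 0 < T → IsStrongSolution Re Pe Γ ε T u v w θ u₀ v₀ w₀ θ₀

end Evolution

/-- The Poincaré constant `γ = L² / (4π²)`. -/
def gam (L : ℝ) : ℝ := L ^ 2 / (4 * Real.pi ^ 2)

/-- The horizontal velocity's norm `‖𝐮‖ = (‖u‖² + ‖v‖²)^{1/2}` from the norms of its components. -/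
def vnorm (a b : ℝ) : ℝ := √(a ^ 2 + b ^ 2)

end RotConv

end

/-! Decay. Testing the θ-equation with θ kills the transport, and the nonlocal term contributes
L²∫(mean of wθ)² dz ≥ 0, so Poincaré's inequality with its sharp constant gives the rate for θ. For
the velocity, the w-equation is tested with w and the vorticity equation with the stream function φ:
the couplings φ_z and w_z cancel, ε²φ_zz is dissipative (`Slice.energy`), and buoyancy is absorbed
up to a forcing of size ‖θ‖². Grönwall's inequality with two distinct exponential rates, which is
what Pe ≠ 2κRe provides, gives the second estimate.

Horizontal gradients. Neither w nor θ is diffused vertically. The substitute is that φ_zz tested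
with ω returns -(‖u_z‖² + ‖v_z‖²) (`Slice.inner_stream_zz`). The enstrophy balance has no stretching
term, so the time integral of `growth` = ‖ω‖² + ‖∇_h ω‖² + ‖𝐮_z‖² is bounded by the data, uniformly
in time. On the other hand the supremum over z of the horizontal Dirichlet integral of the velocity
is at most ‖∇_h 𝐮‖² plus products of second horizontal derivatives with 𝐮_z (`hdot_grad_sq_le`),
hence at most `growth`. This is the coefficient with which advection enters the estimates of ∇_h w
and ∇_h θ (`abs_inner_adv_lap_le`), which close by Grönwall.

Nonlocal term. The θ-equation contains no vertical derivative, so its energy balance holds with any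
nonnegative weight χ(z), that is, at almost every height z. With S = ‖θ₀‖² + 2‖θ₀‖‖∂_zθ₀‖, a
one-dimensional trace bound, it gives ∫θ² dx dy ≤ S and ∫₀ᵗ L² (mean of wθ)² ≤ S/2 at almost every
z. The profile of w² is dominated, on a whole time interval, by one integrable function of z
(`Flow.exists_weight`). The two together bound the time integral of the squared norm of the nonlocal
term. For large times, averaging Grönwall's inequality over starting times in a unit window replaces
initial gradients by the dissipated energy; two windows, one for the enstrophy and one for all
gradients, make the bound proportional to the energy at time t - 2, which decays.

Vertical derivatives. The equations cannot be differentiated in z at this regularity, so vertical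
differences are estimated, divided by the step and passed to the limit. For the velocity this is
again advection against `growth` and ‖Δ_h w‖². For θ the difference of the nonlocal term is
estimated at each height: one part has a sign up to a square of the difference of w, and the other
costs half of any bound N(z) for the profile of the difference of θ, because of the S/2 above.
Iterating the resulting inequality (`halving`) removes this loss at the price of a factor 2. In the
final Grönwall rate everything has a time integral bounded uniformly in time except the constant |Γ|
+ O(S + 1), which produces the exponential growth in the last estimate.

Technically, weak derivatives are handled through Fourier coefficients, nonlinear estimates are
proved for trigonometric polynomials and extended by limits, `Slice` records what holds at almost
every time, and `Flow` what holds on an interval. -/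

noncomputable section

namespace RotConv

open Filter Topology ComplexConjugate

/-! ### Characters of the torus and their derivatives. -/

section Characters

variable {L : ℝ}

/-- The characters of the torus. -/
def chr (L : ℝ) (k : ℤ × ℤ × ℤ) : C(Torus L, ℂ) where
  toFun q := fourier k.1 q.1 * (fourier k.2.1 q.2.1 * fourier k.2.2 q.2.2)
  continuous_toFun := by fun_prop

theorem chr_apply (k : ℤ × ℤ × ℤ) (q : Torus L) :
    chr L k q = fourier k.1 q.1 * (fourier k.2.1 q.2.1 * fourier k.2.2 q.2.2) := rfl

theorem chr_neg (k : ℤ × ℤ × ℤ) (q : Torus L) : chr L (-k) q = conj (chr L k q) := by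
  simp only [chr_apply, Prod.fst_neg, Prod.snd_neg, fourier_neg, map_mul]

theorem chr_add (k l : ℤ × ℤ × ℤ) (q : Torus L) : chr L (k + l) q = chr L k q * chr L l q := by
  simp only [chr_apply, Prod.fst_add, Prod.snd_add, fourier_add]
  ring

theorem chr_zero : chr L 0 = 1 := by
  ext q
  simp [chr_apply]

/-- The symbol of the derivative in the direction `e` is `i * sym L e k`. -/
def sym (L : ℝ) (e : ℝ × ℝ × ℝ) (k : ℤ × ℤ × ℤ) : ℝ :=
  2 * Real.pi * (k.1 * e.1 / L + k.2.1 * e.2.1 / L + k.2.2 * e.2.2)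

theorem chr_proj_smul (k : ℤ × ℤ × ℤ) (e : ℝ × ℝ × ℝ) (s : ℝ) :
    chr L k (proj L (s • e)) = Complex.exp ((sym L e k * s : ℝ) * Complex.I) := by
  simp only [chr_apply, proj, fourier_coe_apply, sym, Prod.smul_fst, Prod.smul_snd, smul_eq_mul]
  rw [← Complex.exp_add, ← Complex.exp_add]
  congr 1
  push_cast
  ring

theorem chr_map_add (k : ℤ × ℤ × ℤ) (p q : Torus L) :
    chr L k (p + q) = chr L k p * chr L k q := by
  simp only [chr_apply, Prod.fst_add, Prod.snd_add, fourier_apply, smul_add,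
    AddCircle.toCircle_add, Circle.coe_mul]
  ring

theorem hasDerivAt_chr (k : ℤ × ℤ × ℤ) (e : ℝ × ℝ × ℝ) (q : Torus L) :
    HasDerivAt (fun s : ℝ => chr L k (q + proj L (s • e)))
      (Complex.I * sym L e k * chr L k q) 0 := by
  simp only [chr_map_add, chr_proj_smul]
  have h1 : HasDerivAt (fun s : ℝ => ((sym L e k * s : ℝ) * Complex.I : ℂ))
      (sym L e k * Complex.I) 0 := by
    have := ((hasDerivAt_id (0 : ℝ)).const_mul (sym L e k)).ofReal_comp.mul_const Complex.I
    simpa using this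
  have := (h1.cexp).const_mul (chr L k q)
  convert! this using 1
  simp
  ring

end Characters

/-! ### The Fourier basis of L²(Ω) and Parseval's identity. -/

section Basis

variable {L : ℝ} [Fact (0 < L)]

theorem L_pos : 0 < L := Fact.out

/-- Complex square integrable functions on the torus. -/
abbrev L2C (L : ℝ) [Fact (0 < L)] : Type := Lp ℂ 2 (volume : Measure (Torus L))

/-- The normalized characters. -/
def bvec (L : ℝ) [Fact (0 < L)] (k : ℤ × ℤ × ℤ) : L2C L :=
  (L : ℂ)⁻¹ • ContinuousMap.toLp (E := ℂ) 2 volume ℂ (chr L k)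

theorem integral_fourier {T : ℝ} [Fact (0 < T)] (n : ℤ) :
    ∫ x : AddCircle T, fourier n x = if n = 0 then (T : ℂ) else 0 := by
  rw [AddCircle.volume_eq_smul_haarAddCircle, integral_smul_measure,
    ENNReal.toReal_ofReal (Fact.out : 0 < T).le]
  split_ifs with h
  · simp [h]
  · rw [integral_eq_zero_of_add_right_eq_neg (μ := AddCircle.haarAddCircle)
      (fourier_add_half_inv_index h Fact.out), smul_zero]

theorem integral_chr (k : ℤ × ℤ × ℤ) :
    ∫ q : Torus L, chr L k q = if k = 0 then (L : ℂ) ^ 2 else 0 := by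
  simp only [chr_apply]
  rw [Measure.volume_eq_prod, integral_prod_mul (fun x => fourier k.1 x)
    (fun p : AddCircle L × UnitAddCircle => fourier k.2.1 p.1 * fourier k.2.2 p.2),
    Measure.volume_eq_prod, integral_prod_mul (fun x => fourier k.2.1 x)
    (fun p : UnitAddCircle => fourier k.2.2 p), integral_fourier, integral_fourier,
    integral_fourier]
  obtain ⟨a, b, c⟩ := k
  simp only [Prod.mk_eq_zero]
  split_ifs <;> simp_all [sq]

theorem orthonormal_bvec : Orthonormal ℂ (bvec L) := by
  rw [orthonormal_iff_ite]
  intro m n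
  have hL : (L : ℂ) ≠ 0 := by exact_mod_cast (L_pos (L := L)).ne'
  simp only [bvec, inner_smul_left, inner_smul_right, ContinuousMap.inner_toLp, ← chr_neg,
    ← chr_add]
  rw [integral_chr]
  simp only [map_inv₀, Complex.conj_ofReal]
  by_cases h : m = n
  · subst h
    simp
    field_simp
  · rw [if_neg h, if_neg (fun h' => h (by simpa [add_neg_eq_zero, eq_comm] using h'))]
    simp

/-- Stone–Weierstrass: the characters are closed under products and conjugation, so their span is a
star subalgebra, and the three unit frequencies already separate points. -/
theorem span_chr_closure_eq_top :
    (Submodule.span ℂ (range (chr L))).topologicalClosure = ⊤ := by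
  let A : StarSubalgebra ℂ C(Torus L, ℂ) :=
    { toSubalgebra := Algebra.adjoin ℂ (range (chr L))
      star_mem' := by
        change Algebra.adjoin ℂ (range (chr L)) ≤ star (Algebra.adjoin ℂ (range (chr L)))
        refine Algebra.adjoin_le ?_
        rintro _ ⟨n, rfl⟩
        refine Algebra.subset_adjoin ⟨-n, ?_⟩
        ext1 x
        simp only [chr_neg, starRingEnd_apply, ContinuousMap.star_apply] }
  have hA : Subalgebra.toSubmodule A.toSubalgebra = Submodule.span ℂ (range (chr L)) := by
    apply Algebra.adjoin_eq_span_of_subset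
    refine .trans (fun x ↦ Submonoid.closure_induction (fun _ ↦ id) ⟨0, chr_zero⟩ ?_)
      Submodule.subset_span
    rintro _ _ _ _ ⟨m, rfl⟩ ⟨n, rfl⟩
    exact ⟨m + n, by ext z; simp only [chr_add, ContinuousMap.mul_apply]⟩
  have hinj : ∀ {T : ℝ}, T ≠ 0 → ∀ {x y : AddCircle T},
      (fourier 1 x : ℂ) = fourier 1 y → x = y := by
    intro T hT x y h
    rw [fourier_one, fourier_one] at h
    exact AddCircle.injective_toCircle hT (Subtype.coe_injective h)
  have hsep : A.SeparatesPoints := by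
    intro x y hxy
    by_contra hcon
    have key : ∀ n, chr L n x = chr L n y := by
      intro n
      by_contra h
      exact hcon ⟨_, ⟨chr L n, Algebra.subset_adjoin ⟨n, rfl⟩, rfl⟩, h⟩
    have h1 := key (1, 0, 0)
    have h2 := key (0, 1, 0)
    have h3 := key (0, 0, 1)
    simp only [chr_apply, fourier_zero, mul_one, one_mul] at h1 h2 h3
    have hL := (L_pos (L := L)).ne'
    exact hxy (Prod.ext (hinj hL h1) (Prod.ext (hinj hL h2) (hinj one_ne_zero h3)))
  rw [← hA]
  exact congr_arg (Subalgebra.toSubmodule <| StarSubalgebra.toSubalgebra ·)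
    (ContinuousMap.starSubalgebra_topologicalClosure_eq_top_of_separatesPoints _ hsep)

theorem span_bvec_closure_eq_top : (Submodule.span ℂ (range (bvec L))).topologicalClosure = ⊤ := by
  have hL : (L : ℂ) ≠ 0 := by exact_mod_cast (L_pos (L := L)).ne'
  have h1 : (Submodule.span ℂ (range fun k =>
      ContinuousMap.toLp (E := ℂ) 2 (volume : Measure (Torus L)) ℂ (chr L k))).topologicalClosure
      = ⊤ := by
    simpa only [Submodule.map_span, ContinuousLinearMap.coe_coe, ← range_comp, Function.comp_def]
      using (ContinuousMap.toLp_denseRange ℂ (volume : Measure (Torus L)) ℂ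
        (p := 2) (by simp)).topologicalClosure_map_submodule span_chr_closure_eq_top
  rw [← top_le_iff, ← h1]
  refine Submodule.topologicalClosure_mono (Submodule.span_le.2 ?_)
  rintro _ ⟨k, rfl⟩
  have : ContinuousMap.toLp (E := ℂ) 2 (volume : Measure (Torus L)) ℂ (chr L k)
      = (L : ℂ) • bvec L k := by
    rw [bvec, smul_smul, mul_inv_cancel₀ hL, one_smul]
  simp only [this]
  exact Submodule.smul_mem _ _ (Submodule.subset_span ⟨k, rfl⟩)

/-- The Fourier basis of the torus. -/
def fbasis (L : ℝ) [Fact (0 < L)] : HilbertBasis (ℤ × ℤ × ℤ) ℂ (L2C L) :=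
  HilbertBasis.mk orthonormal_bvec span_bvec_closure_eq_top.ge

theorem coe_fbasis : ⇑(fbasis L) = bvec L := HilbertBasis.coe_mk _ _

/-- Complexification. -/
def cplx (L : ℝ) [Fact (0 < L)] : L2 L →L[ℝ] L2C L :=
  Complex.ofRealCLM.compLpL 2 (volume : Measure (Torus L))

/-- Real part. -/
def rePart (L : ℝ) [Fact (0 < L)] : L2C L →L[ℝ] L2 L :=
  Complex.reCLM.compLpL 2 (volume : Measure (Torus L))

theorem coeFn_cplx (f : L2 L) : cplx L f =ᵐ[volume] fun q => (f q : ℂ) :=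
  Complex.ofRealCLM.coeFn_compLpL f

theorem coeFn_rePart (f : L2C L) : rePart L f =ᵐ[volume] fun q => (f q).re :=
  Complex.reCLM.coeFn_compLpL f

theorem rePart_cplx (f : L2 L) : rePart L (cplx L f) = f := by
  apply Lp.ext
  filter_upwards [coeFn_rePart (cplx L f), coeFn_cplx f] with q h1 h2
  rw [h1, h2, Complex.ofReal_re]

theorem inner_eq_integral (f g : L2 L) : inner ℝ f g = ∫ q, f q * g q := by
  rw [L2.inner_def]
  refine integral_congr_ae (Eventually.of_forall fun q => ?_)
  simp [mul_comm]

theorem re_inner_cplx (f : L2 L) (g : L2C L) :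
    (inner ℂ (cplx L f) g).re = inner ℝ f (rePart L g) := by
  rw [inner_eq_integral, L2.inner_def]
  have := (Complex.reCLM.integral_comp_comm (L2.integrable_inner (𝕜 := ℂ) (cplx L f) g))
  simp only [Complex.reCLM_apply] at this
  rw [← this]
  refine integral_congr_ae ?_
  filter_upwards [coeFn_rePart g, coeFn_cplx f] with q h1 h2
  rw [h1, h2]
  simp [mul_comm]

theorem norm_rePart_le (g : L2C L) : ‖rePart L g‖ ≤ ‖g‖ := by
  refine Lp.norm_le_norm_of_ae_le ?_
  filter_upwards [coeFn_rePart g] with q h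
  rw [h]
  exact Complex.abs_re_le_norm _

/-- The Fourier coefficients. -/
def fc {L : ℝ} [Fact (0 < L)] (k : ℤ × ℤ × ℤ) : L2 L →L[ℝ] ℂ :=
  ((innerSL ℂ (bvec L k)).restrictScalars ℝ).comp (cplx L)

theorem fc_apply (k : ℤ × ℤ × ℤ) (f : L2 L) : fc k f = inner ℂ (bvec L k) (cplx L f) := rfl

theorem coeFn_bvec (k : ℤ × ℤ × ℤ) : bvec L k =ᵐ[volume] fun q => (L : ℂ)⁻¹ * chr L k q := by
  filter_upwards [Lp.coeFn_smul ((L : ℂ)⁻¹)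
    (ContinuousMap.toLp (E := ℂ) 2 (volume : Measure (Torus L)) ℂ (chr L k)),
    ContinuousMap.coeFn_toLp (p := 2) (𝕜 := ℂ) (volume : Measure (Torus L)) (chr L k)] with q h1 h2
  rw [bvec, h1, Pi.smul_apply, h2, smul_eq_mul]

theorem fc_eq_integral (k : ℤ × ℤ × ℤ) (f : L2 L) :
    fc k f = (L : ℂ)⁻¹ * ∫ q, (f q : ℂ) * conj (chr L k q) := by
  rw [fc_apply, L2.inner_def, ← integral_const_mul]
  refine integral_congr_ae ?_
  filter_upwards [coeFn_bvec (L := L) k, coeFn_cplx f] with q h1 h2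
  rw [h1, h2]
  simp
  ring

theorem fc_eq_repr (k : ℤ × ℤ × ℤ) (f : L2 L) : fc k f = (fbasis L).repr (cplx L f) k := by
  rw [HilbertBasis.repr_apply_apply, coe_fbasis, fc_apply]

/-- Functions built from prescribed coefficients live in the complex space. Pairing with the real
part lets them be used as real functions without checking the symmetry of their coefficients. -/
theorem hasSum_inner_rePart (f : L2 L) (g : L2C L) :
    HasSum (fun k => (conj (fc k f) * (fbasis L).repr g k).re) (inner ℝ f (rePart L g)) := by
  rw [← re_inner_cplx]
  have := (fbasis L).hasSum_inner_mul_inner (cplx L f) g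
  convert! Complex.hasSum_re this using 1
  funext k
  rw [HilbertBasis.repr_apply_apply, coe_fbasis, fc_apply, inner_conj_symm]

/-- **Parseval's identity.** -/
theorem hasSum_inner (f g : L2 L) :
    HasSum (fun k => (conj (fc k f) * fc k g).re) (inner ℝ f g) := by
  have := hasSum_inner_rePart f (cplx L g)
  rw [rePart_cplx] at this
  simpa only [fc_eq_repr] using this

theorem hasSum_norm_sq (f : L2 L) : HasSum (fun k => ‖fc k f‖ ^ 2) (‖f‖ ^ 2) := by
  have := hasSum_inner f f
  rw [real_inner_self_eq_norm_sq] at this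
  convert! this using 2 with k
  rw [← Complex.normSq_eq_conj_mul_self, Complex.ofReal_re, Complex.normSq_eq_norm_sq]

theorem ext_fc {f g : L2 L} (h : ∀ k, fc k f = fc k g) : f = g := by
  have := hasSum_norm_sq (f - g)
  simp only [map_sub, h, sub_self, norm_zero] at this
  have h0 : ‖f - g‖ ^ 2 = 0 := this.unique (by simp)
  rw [← sub_eq_zero, ← norm_eq_zero]
  simpa using h0

theorem inner_eq_of_fc {f g f' g' : L2 L}
    (h : ∀ k, (conj (fc k f) * fc k g).re = (conj (fc k f') * fc k g').re) :
    inner ℝ f g = inner ℝ f' g' := by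
  have h1 := hasSum_inner f g
  simp only [h] at h1
  exact h1.unique (hasSum_inner f' g')

end Basis

/-! ### Test functions, weak derivatives as Fourier multipliers, partial sums. -/

section TestFunctions

variable {L : ℝ}

theorem proj_add (p q : ℝ × ℝ × ℝ) : proj L (p + q) = proj L p + proj L q := rfl

theorem exists_proj_eq (q : Torus L) : ∃ p, proj L p = q := by
  obtain ⟨x, y, z⟩ := q
  obtain ⟨a, rfl⟩ := QuotientAddGroup.mk_surjective x
  obtain ⟨b, rfl⟩ := QuotientAddGroup.mk_surjective y
  obtain ⟨c, rfl⟩ := QuotientAddGroup.mk_surjective z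
  exact ⟨(a, b, c), rfl⟩

theorem IsTest.hasDerivAt {ψ : Torus L → ℝ} (h : IsTest ψ) (e : ℝ × ℝ × ℝ) (q : Torus L) (s : ℝ) :
    HasDerivAt (fun s : ℝ => ψ (q + proj L (s • e))) (RotConv.dirDeriv e ψ (q + proj L (s • e)))
      s := by
  obtain ⟨p, rfl⟩ := exists_proj_eq q
  rw [← proj_add, dirDeriv_proj e h]
  have hd : DifferentiableAt ℝ (fun p : ℝ × ℝ × ℝ => ψ (proj L p)) (p + s • e) :=
    (ContDiff.differentiable h (by simp)).differentiableAt
  have hl : HasDerivAt (fun s : ℝ => p + s • e) e s := by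
    simpa using ((hasDerivAt_id s).smul_const e).const_add p
  exact hd.hasFDerivAt.comp_hasDerivAt s hl

theorem dirDeriv_eq_of_hasDerivAt {e : ℝ × ℝ × ℝ} {ψ : Torus L → ℝ} {q : Torus L} {d : ℝ}
    (h : HasDerivAt (fun s : ℝ => ψ (q + proj L (s • e))) d 0) : dirDeriv e ψ q = d := h.deriv

theorem proj_zero_smul (e : ℝ × ℝ × ℝ) (q : Torus L) : q + proj L ((0 : ℝ) • e) = q := by
  have : proj L ((0 : ℝ) • e) = 0 := by simp [proj]
  rw [this, add_zero]

theorem IsTest.mul {ψ χ : Torus L → ℝ} (h : IsTest ψ) (h' : IsTest χ) :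
    IsTest (fun q => ψ q * χ q) := ContDiff.mul h h'

theorem IsTest.add {ψ χ : Torus L → ℝ} (h : IsTest ψ) (h' : IsTest χ) :
    IsTest (fun q => ψ q + χ q) := ContDiff.add h h'

theorem IsTest.const_mul (c : ℝ) {ψ : Torus L → ℝ} (h : IsTest ψ) :
    IsTest (fun q => c * ψ q) := (contDiff_const (c := c)).mul h

theorem dirDeriv_mul {e : ℝ × ℝ × ℝ} {ψ χ : Torus L → ℝ} (h : IsTest ψ) (h' : IsTest χ)
    (q : Torus L) :
    dirDeriv e (fun q => ψ q * χ q) q = dirDeriv e ψ q * χ q + ψ q * dirDeriv e χ q := by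
  have := (h.hasDerivAt e q 0).mul (h'.hasDerivAt e q 0)
  simp only [proj_zero_smul] at this
  exact dirDeriv_eq_of_hasDerivAt this

theorem dirDeriv_add {e : ℝ × ℝ × ℝ} {ψ χ : Torus L → ℝ} (h : IsTest ψ) (h' : IsTest χ)
    (q : Torus L) :
    dirDeriv e (fun q => ψ q + χ q) q = dirDeriv e ψ q + dirDeriv e χ q := by
  have := (h.hasDerivAt e q 0).add (h'.hasDerivAt e q 0)
  simp only [proj_zero_smul] at this
  exact dirDeriv_eq_of_hasDerivAt this

theorem contDiff_chr_proj (k : ℤ × ℤ × ℤ) :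
    ContDiff ℝ (⊤ : ℕ∞) (fun p : ℝ × ℝ × ℝ => chr L k (proj L p)) := by
  have h : (fun p : ℝ × ℝ × ℝ => chr L k (proj L p))
      = fun p => Complex.exp ((sym L p k : ℝ) * Complex.I) := by
    funext p
    have := chr_proj_smul (L := L) k p 1
    simpa using this
  rw [h]
  have h2 : ContDiff ℝ (⊤ : ℕ∞) (fun p : ℝ × ℝ × ℝ => sym L p k) := by
    unfold sym
    fun_prop
  exact ((Complex.ofRealCLM.contDiff.comp h2).mul contDiff_const).cexp

theorem isTest_re_mul_chr (a : ℂ) (k : ℤ × ℤ × ℤ) : IsTest fun q : Torus L => (a * chr L k q).re :=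
  Complex.reCLM.contDiff.comp (contDiff_const.mul (contDiff_chr_proj k))

theorem dirDeriv_re_mul_chr (a : ℂ) (k : ℤ × ℤ × ℤ) (e : ℝ × ℝ × ℝ) (q : Torus L) :
    dirDeriv e (fun q : Torus L => (a * chr L k q).re) q
      = (a * (Complex.I * sym L e k) * chr L k q).re := by
  apply dirDeriv_eq_of_hasDerivAt
  have := Complex.reCLM.hasFDerivAt.comp_hasDerivAt (0 : ℝ) ((hasDerivAt_chr k e q).const_mul a)
  convert! this using 1
  simp only [Complex.reCLM_apply]
  congr 1
  ring

/-- The symbol of the negative horizontal Laplacian. -/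
def hsym (L : ℝ) (k : ℤ × ℤ × ℤ) : ℝ := sym L ex k ^ 2 + sym L ey k ^ 2

theorem hsym_nonneg (k : ℤ × ℤ × ℤ) : 0 ≤ hsym L k := by unfold hsym; positivity

variable [Fact (0 < L)]

theorem _root_.Continuous.memLp_torus {ψ : Torus L → ℝ} (h : Continuous ψ) :
    MemLp ψ 2 (volume : Measure (Torus L)) := by
  obtain ⟨C, hC⟩ := isCompact_univ.exists_bound_of_continuousOn h.continuousOn
  exact MemLp.of_bound h.aestronglyMeasurable C (Eventually.of_forall fun q => hC q (mem_univ q))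

/-- A continuous function as an element of `L²(Ω)`. -/
def contLp (ψ : Torus L → ℝ) (h : Continuous ψ) : L2 L := h.memLp_torus.toLp ψ

theorem coeFn_contLp {ψ : Torus L → ℝ} (h : Continuous ψ) : contLp ψ h =ᵐ[volume] ψ :=
  MemLp.coeFn_toLp _

theorem _root_.Continuous.integrable_torus {E : Type*} [NormedAddCommGroup E] {ψ : Torus L → E}
    (h : Continuous ψ) : Integrable ψ :=
  h.integrable_of_hasCompactSupport (HasCompactSupport.of_compactSpace ψ)

theorem inner_contLp (f : L2 L) {ψ : Torus L → ℝ} (h : Continuous ψ) :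
    inner ℝ f (contLp ψ h) = ∫ q, f q * ψ q := by
  rw [inner_eq_integral]
  refine integral_congr_ae ?_
  filter_upwards [coeFn_contLp h] with q hq
  rw [hq]

theorem hasWeakDeriv_iff_inner {e : ℝ × ℝ × ℝ} {f g : L2 L} : HasWeakDeriv e f g ↔
    ∀ ψ : Torus L → ℝ, ∀ h : IsTest ψ, inner ℝ f (contLp _ (h.dirDeriv e).continuous)
      = - inner ℝ g (contLp ψ h.continuous) := by
  simp only [HasWeakDeriv, inner_contLp]

instance : (volume : Measure (Torus L)).IsAddHaarMeasure := by
  change ((volume : Measure (AddCircle L)).prod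
    ((volume : Measure (AddCircle L)).prod (volume : Measure (AddCircle (1 : ℝ))))).IsAddHaarMeasure
  have : Fact ((0 : ℝ) < 1) := ⟨one_pos⟩
  have : ((volume : Measure (AddCircle L)).prod
    (volume : Measure (AddCircle (1 : ℝ)))).IsAddHaarMeasure := inferInstance
  exact Measure.prod.instIsAddHaarMeasure _ _

/-- The integral of a translate does not depend on the translation; differentiate it under the
integral sign. -/
theorem IsTest.integral_dirDeriv {ψ : Torus L → ℝ} (h : IsTest ψ) (e : ℝ × ℝ × ℝ) :
    ∫ q, RotConv.dirDeriv e ψ q = 0 := by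
  have hc := (h.dirDeriv e).continuous
  obtain ⟨C, hC⟩ := isCompact_univ.exists_bound_of_continuousOn hc.continuousOn
  have hcont : ∀ s : ℝ, Continuous fun q : Torus L => ψ (q + proj L (s • e)) := fun s =>
    h.continuous.comp (continuous_id.add continuous_const)
  have := (hasDerivAt_integral_of_dominated_loc_of_deriv_le (μ := (volume : Measure (Torus L)))
    (F := fun (s : ℝ) q => ψ (q + proj L (s • e)))
    (F' := fun (s : ℝ) q => RotConv.dirDeriv e ψ (q + proj L (s • e))) (x₀ := 0)
    (bound := fun _ => C) (s := univ) univ_mem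
    (Eventually.of_forall fun s => (hcont s).aestronglyMeasurable)
    (hcont 0).integrable_torus
    (hc.comp (continuous_id.add continuous_const)).aestronglyMeasurable
    (Eventually.of_forall fun q s _ => hC _ (mem_univ _))
    (integrable_const _)
    (Eventually.of_forall fun q s _ => h.hasDerivAt e q s)).2
  have h2 : (fun s : ℝ => ∫ q, ψ (q + proj L (s • e))) = fun _ => ∫ q, ψ q := by
    funext s
    exact integral_add_right_eq_self ψ (proj L (s • e))
  rw [h2] at this
  simp only [proj_zero_smul] at this
  exact this.unique (hasDerivAt_const _ _)

theorem IsTest.hasWeakDeriv {ψ : Torus L → ℝ} (h : IsTest ψ) (e : ℝ × ℝ × ℝ) :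
    HasWeakDeriv e (contLp ψ h.continuous) (contLp _ (h.dirDeriv e).continuous) := by
  intro χ hχ
  have h1 := (h.mul hχ).integral_dirDeriv e
  simp only [dirDeriv_mul h hχ] at h1
  rw [integral_add (((h.dirDeriv e).mul hχ).continuous.integrable_torus)
    ((h.mul (hχ.dirDeriv e)).continuous.integrable_torus)] at h1
  have e1 : ∫ q, (contLp ψ h.continuous) q * RotConv.dirDeriv e χ q
      = ∫ q, ψ q * RotConv.dirDeriv e χ q := integral_congr_ae (by
    filter_upwards [coeFn_contLp h.continuous] with q hq
    rw [hq])
  have e2 : ∫ q, (contLp _ (h.dirDeriv e).continuous) q * χ q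
      = ∫ q, RotConv.dirDeriv e ψ q * χ q := integral_congr_ae (by
    filter_upwards [coeFn_contLp (h.dirDeriv e).continuous] with q hq
    rw [hq])
  rw [e1, e2]
  linarith

theorem integral_mul_re_chr (f : L2 L) (a : ℂ) (k : ℤ × ℤ × ℤ) :
    ∫ q, f q * (a * chr L k q).re = (a * L * conj (fc k f)).re := by
  have hL : (L : ℂ) ≠ 0 := by exact_mod_cast (L_pos (L := L)).ne'
  have h1 : a * L * conj (fc k f) = ∫ q, (f q : ℂ) * (a * chr L k q) := by
    rw [fc_eq_integral, map_mul, map_inv₀, Complex.conj_ofReal, ← integral_conj,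
      ← mul_assoc, mul_assoc a, mul_inv_cancel₀ hL, mul_one, ← integral_const_mul]
    refine integral_congr_ae (Eventually.of_forall fun q => ?_)
    simp
    ring
  have hdot : Integrable fun q => (f q : ℂ) * (a * chr L k q) := by
    have hc : MemLp (fun q : Torus L => a * chr L k q) 2 volume := by
      have hc : Continuous (fun q : Torus L => a * chr L k q) := by fun_prop
      obtain ⟨C, hC⟩ := isCompact_univ.exists_bound_of_continuousOn hc.continuousOn
      exact MemLp.of_bound hc.aestronglyMeasurable C
        (Eventually.of_forall fun q => hC q (mem_univ q))
    exact (Lp.memLp f).ofReal.integrable_mul hc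
  rw [h1]
  have := Complex.reCLM.integral_comp_comm hdot
  simp only [Complex.reCLM_apply] at this
  rw [← this]
  refine integral_congr_ae (Eventually.of_forall fun q => ?_)
  simp only [Complex.re_ofReal_mul]

/-- Test functions are real, so one complex identity needs two of them: the real parts of a multiple
of the character with factor 1 and with factor i. -/
theorem HasWeakDeriv.fc {e : ℝ × ℝ × ℝ} {f g : L2 L} (h : HasWeakDeriv e f g)
    (k : ℤ × ℤ × ℤ) : fc k g = Complex.I * sym L e k * fc k f := by
  have hL := L_pos (L := L)
  have key : ∀ a : ℂ, (a * L * (Complex.I * sym L e k) * conj (RotConv.fc k f)).re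
      = -(a * L * conj (RotConv.fc k g)).re := by
    intro a
    have := h _ (isTest_re_mul_chr a k)
    simp only [dirDeriv_re_mul_chr, integral_mul_re_chr] at this
    rw [← this]
    congr 1
    ring
  have h1 := key 1
  have h2 := key Complex.I
  simp at h1 h2
  have e1 : sym L e k * (RotConv.fc k f).im = -(RotConv.fc k g).re := by
    apply mul_left_cancel₀ hL.ne'; linarith
  have e2 : sym L e k * (RotConv.fc k f).re = (RotConv.fc k g).im := by
    apply mul_left_cancel₀ hL.ne'; linarith
  apply Complex.ext
  · simp; linarith
  · simp; linarith

theorem hasWeakDeriv_rePart {e : ℝ × ℝ × ℝ} {f : L2 L} {g : L2C L}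
    (h : ∀ k, (fbasis L).repr g k = Complex.I * sym L e k * fc k f) :
    HasWeakDeriv e f (rePart L g) := by
  rw [hasWeakDeriv_iff_inner]
  intro ψ hψ
  have h1 := hasSum_inner f (contLp _ (hψ.dirDeriv e).continuous)
  have h2 := (hasSum_inner_rePart (contLp ψ hψ.continuous) g).neg
  rw [real_inner_comm] at h2
  refine h1.unique ?_
  convert! h2 using 2 with k
  rw [h, (hψ.hasWeakDeriv e).fc]
  simp
  ring

theorem hasWeakDeriv_iff_fc {e : ℝ × ℝ × ℝ} {f g : L2 L} :
    HasWeakDeriv e f g ↔ ∀ k, fc k g = Complex.I * sym L e k * fc k f := by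
  refine ⟨fun h => h.fc, fun h => ?_⟩
  have := hasWeakDeriv_rePart (g := cplx L g) (e := e) (f := f)
    (fun k => by rw [← fc_eq_repr, h k])
  rwa [rePart_cplx] at this

/-- Riesz–Fischer gives a complex function with these coefficients, and its real part is the
derivative by `hasWeakDeriv_rePart`. -/
theorem weaklyDiff_of_summable {e : ℝ × ℝ × ℝ} {f : L2 L}
    (h : Summable fun k => ‖sym L e k * fc k f‖ ^ 2) : WeaklyDiff e f := by
  have hm : Memℓp (fun k => Complex.I * sym L e k * fc k f) 2 := by
    refine memℓp_gen ?_
    convert! h using 2 with k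
    simp [mul_pow]
  refine ⟨_, hasWeakDeriv_rePart (g := (fbasis L).repr.symm ⟨_, hm⟩) fun k => ?_⟩
  simp

theorem weaklyDiff_of_le {e : ℝ × ℝ × ℝ} {f : L2 L} (g : L2 L)
    (h : ∀ k, ‖sym L e k * fc k f‖ ≤ ‖fc k g‖) : WeaklyDiff e f :=
  weaklyDiff_of_summable ((hasSum_norm_sq g).summable.of_nonneg_of_le (fun _ => by positivity)
    fun k => by gcongr; exact h k)

/-- This is what makes the arbitrary choice in `wderiv` harmless. -/
theorem HasWeakDeriv.unique {e : ℝ × ℝ × ℝ} {f g g' : L2 L} (h : HasWeakDeriv e f g)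
    (h' : HasWeakDeriv e f g') : g = g' :=
  ext_fc fun k => by rw [h.fc, h'.fc]

theorem WeaklyDiff.hasWeakDeriv {e : ℝ × ℝ × ℝ} {f : L2 L} (h : WeaklyDiff e f) :
    HasWeakDeriv e f (wderiv e f) := by
  rw [wderiv, dif_pos h]
  exact h.choose_spec

theorem HasWeakDeriv.wderiv_eq {e : ℝ × ℝ × ℝ} {f g : L2 L} (h : HasWeakDeriv e f g) :
    wderiv e f = g := (WeaklyDiff.hasWeakDeriv ⟨g, h⟩).unique h

theorem hasHLaplacian_iff_inner {f g : L2 L} : HasHLaplacian f g ↔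
    ∀ ψ : Torus L → ℝ, ∀ h : IsTest ψ,
      inner ℝ f (contLp _ ((h.dirDeriv ex).dirDeriv ex).continuous)
        + inner ℝ f (contLp _ ((h.dirDeriv ey).dirDeriv ey).continuous)
      = inner ℝ g (contLp ψ h.continuous) := by
  unfold HasHLaplacian
  refine forall₂_congr fun ψ h => ?_
  rw [inner_contLp, inner_contLp, inner_contLp,
    ← integral_add (integrable_mul_test f ((h.dirDeriv ex).dirDeriv ex))
    (integrable_mul_test f ((h.dirDeriv ey).dirDeriv ey))]
  simp only [mul_add]

theorem HasHLaplacian.fc {f g : L2 L} (h : HasHLaplacian f g) (k : ℤ × ℤ × ℤ) :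
    fc k g = -(hsym L k) * fc k f := by
  have hL := L_pos (L := L)
  have key : ∀ a : ℂ, -(a * L * hsym L k * conj (RotConv.fc k f)).re
      = (a * L * conj (RotConv.fc k g)).re := by
    intro a
    have := h _ (isTest_re_mul_chr a k)
    rw [integral_mul_re_chr] at this
    rw [← this, ← Complex.neg_re]
    have e1 : ∀ e, dirDeriv e (dirDeriv e fun q : Torus L => (a * chr L k q).re)
        = fun q => (a * (Complex.I * sym L e k) * (Complex.I * sym L e k) * chr L k q).re := by
      intro e
      have : (dirDeriv e fun q : Torus L => (a * chr L k q).re)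
          = fun q => (a * (Complex.I * sym L e k) * chr L k q).re := by
        funext q; exact dirDeriv_re_mul_chr a k e q
      rw [this]
      funext q
      exact dirDeriv_re_mul_chr _ k e q
    rw [e1, e1]
    have e2 : ∀ q : Torus L, (a * (Complex.I * sym L ex k) * (Complex.I * sym L ex k) * chr L k q).re
        + (a * (Complex.I * sym L ey k) * (Complex.I * sym L ey k) * chr L k q).re
        = (-(a * hsym L k) * chr L k q).re := by
      intro q
      rw [← Complex.add_re]
      congr 1
      simp only [hsym]
      push_cast
      linear_combination (a * ((sym L ex k : ℂ) ^ 2 + (sym L ey k : ℂ) ^ 2) * chr L k q)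
        * Complex.I_sq
    simp only [e2]
    rw [integral_mul_re_chr]
    congr 1
    ring
  have h1 := key 1
  have h2 := key Complex.I
  simp at h1 h2
  apply Complex.ext
  · simp; apply mul_left_cancel₀ hL.ne'; linarith
  · simp; apply mul_left_cancel₀ hL.ne'; linarith

theorem hasHLaplacian_iff_fc {f g : L2 L} :
    HasHLaplacian f g ↔ ∀ k, fc k g = -(hsym L k) * fc k f := by
  refine ⟨fun h => h.fc, fun h => ?_⟩
  rw [hasHLaplacian_iff_inner]
  intro ψ hψ
  have h1 := hasSum_inner f (contLp _ ((hψ.dirDeriv ex).dirDeriv ex).continuous)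
  have h2 := hasSum_inner f (contLp _ ((hψ.dirDeriv ey).dirDeriv ey).continuous)
  have h3 := hasSum_inner g (contLp ψ hψ.continuous)
  refine (h1.add h2).unique ?_
  convert! h3 using 2 with k
  rw [h, ((hψ.dirDeriv ex).hasWeakDeriv ex).fc, ((hψ.dirDeriv ey).hasWeakDeriv ey).fc,
    (hψ.hasWeakDeriv ex).fc, (hψ.hasWeakDeriv ey).fc]
  simp [hsym, -Complex.ofReal_pow]
  ring

theorem hasHLaplacian_lapH {f : L2 L} (h : ∃ g, HasHLaplacian f g) :
    HasHLaplacian f (lapH f) := by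
  rw [lapH, dif_pos h]
  exact h.choose_spec

/-- The partial sums of the Fourier series, as functions. -/
def truncFun (F : Finset (ℤ × ℤ × ℤ)) (f : L2 L) (q : Torus L) : ℝ :=
  ∑ k ∈ F, ((L : ℂ)⁻¹ * fc k f * chr L k q).re

theorem isTest_truncFun (F : Finset (ℤ × ℤ × ℤ)) (f : L2 L) : IsTest (truncFun F f) :=
  ContDiff.sum fun k _ => isTest_re_mul_chr ((L : ℂ)⁻¹ * fc k f) k

theorem continuous_truncFun (F : Finset (ℤ × ℤ × ℤ)) (f : L2 L) : Continuous (truncFun F f) :=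
  (isTest_truncFun F f).continuous

theorem dirDeriv_truncFun {e : ℝ × ℝ × ℝ} {f g : L2 L} (h : HasWeakDeriv e f g)
    (F : Finset (ℤ × ℤ × ℤ)) : dirDeriv e (truncFun F f) = truncFun F g := by
  funext q
  apply dirDeriv_eq_of_hasDerivAt
  have : ∀ k ∈ F, HasDerivAt (fun s : ℝ => ((L : ℂ)⁻¹ * fc k f * chr L k (q + proj L (s • e))).re)
      ((L : ℂ)⁻¹ * fc k g * chr L k q).re 0 := by
    intro k _
    have h1 := (isTest_re_mul_chr (L := L) ((L : ℂ)⁻¹ * fc k f) k).hasDerivAt e q 0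
    rw [proj_zero_smul, dirDeriv_re_mul_chr] at h1
    rw [h.fc]
    convert! h1 using 2
    ring
  exact HasDerivAt.fun_sum this

/-- The partial sums of the Fourier series. -/
def trunc (F : Finset (ℤ × ℤ × ℤ)) (f : L2 L) : L2 L := contLp _ (continuous_truncFun F f)

theorem coeFn_trunc (F : Finset (ℤ × ℤ × ℤ)) (f : L2 L) : trunc F f =ᵐ[volume] truncFun F f :=
  coeFn_contLp _

/-- The index set need not be symmetric, since the real part is taken at the end. Convergence and
the norm bound for truncations are inherited from the complex series. -/
theorem trunc_eq_rePart (F : Finset (ℤ × ℤ × ℤ)) (f : L2 L) :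
    trunc F f = rePart L (∑ k ∈ F, (fc k f) • bvec L k) := by
  apply Lp.ext
  filter_upwards [coeFn_trunc F f, coeFn_rePart (∑ k ∈ F, (fc k f) • bvec L k),
    Lp.coeFn_finsetSum F (fun k => (fc k f) • bvec L k),
    (ae_all_iff.2 fun k => Lp.coeFn_smul (fc k f) (bvec L k)),
    (ae_all_iff.2 fun k => coeFn_bvec (L := L) k)] with q h1 h2 h3 h4 h5
  rw [h1, h2, h3, truncFun, Finset.sum_apply, Complex.re_sum]
  refine Finset.sum_congr rfl fun k _ => ?_
  rw [h4, Pi.smul_apply, h5, smul_eq_mul]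
  congr 1
  ring

theorem tendsto_trunc (f : L2 L) : Tendsto (fun F => trunc F f) atTop (𝓝 f) := by
  have h := (fbasis L).hasSum_repr (cplx L f)
  have h2 := ((rePart L).continuous.tendsto _).comp h
  rw [rePart_cplx] at h2
  convert! h2 using 2 with F
  rw [trunc_eq_rePart, Function.comp_apply]
  simp only [fc_eq_repr, coe_fbasis]

theorem norm_trunc_le (F : Finset (ℤ × ℤ × ℤ)) (f : L2 L) : ‖trunc F f‖ ≤ ‖f‖ := by
  rw [trunc_eq_rePart]
  refine (norm_rePart_le _).trans (le_of_sq_le_sq ?_ (norm_nonneg _))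
  rw [← inner_self_eq_norm_sq (𝕜 := ℂ), (orthonormal_bvec (L := L)).inner_sum]
  have h2 := sum_le_hasSum F (fun k _ => by positivity) (hasSum_norm_sq f)
  refine le_trans (le_of_eq ?_) h2
  rw [map_sum]
  refine Finset.sum_congr rfl fun k _ => ?_
  rw [← Complex.normSq_eq_conj_mul_self, Complex.normSq_eq_norm_sq]
  exact Complex.ofReal_re _

end TestFunctions

/-! ### Fubini along horizontal slices. -/

section Slicing

variable {L : ℝ} [Fact (0 < L)]

/-- The torus as a product of the horizontal torus and the vertical circle. -/
theorem measurePreserving_assoc :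
    MeasurePreserving (MeasurableEquiv.prodAssoc :
      (AddCircle L × AddCircle L) × UnitAddCircle ≃ᵐ Torus L) volume volume :=
  measurePreserving_prodAssoc _ _ _

theorem integral_torus {F : Torus L → ℝ} (hF : Integrable F) :
    ∫ q, F q = ∫ z : UnitAddCircle, ∫ p : AddCircle L × AddCircle L, F (p.1, p.2, z) := by
  rw [← measurePreserving_assoc.integral_comp MeasurableEquiv.prodAssoc.measurableEmbedding]
  exact integral_prod_symm _ (measurePreserving_assoc.integrable_comp_of_integrable hF)

theorem lintegral_torus {F : Torus L → ℝ≥0∞} (hF : AEMeasurable F) :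
    ∫⁻ q, F q = ∫⁻ z : UnitAddCircle, ∫⁻ p : AddCircle L × AddCircle L, F (p.1, p.2, z) := by
  rw [← measurePreserving_assoc.lintegral_comp_emb MeasurableEquiv.prodAssoc.measurableEmbedding]
  exact lintegral_prod_symm _
    (hF.comp_quasiMeasurePreserving measurePreserving_assoc.quasiMeasurePreserving)

theorem ae_slice {P : Torus L → Prop} (h : ∀ᵐ q, P q) :
    ∀ᵐ z : UnitAddCircle, ∀ᵐ p : AddCircle L × AddCircle L, P (p.1, p.2, z) := by
  have h1 := measurePreserving_assoc.quasiMeasurePreserving.ae h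
  have h2 := (Measure.measurePreserving_swap (μ := (volume : Measure UnitAddCircle))
    (ν := (volume : Measure (AddCircle L × AddCircle L)))).quasiMeasurePreserving.ae h1
  exact Measure.ae_ae_of_ae_prod h2

theorem integrable_slice {F : Torus L → ℝ} (hF : Integrable F) :
    ∀ᵐ z : UnitAddCircle, Integrable fun p : AddCircle L × AddCircle L => F (p.1, p.2, z) := by
  have h1 := (measurePreserving_assoc.integrable_comp_of_integrable hF)
  exact h1.prod_left_ae

theorem integrable_hdot {F : Torus L → ℝ} (hF : Integrable F) :
    Integrable fun z : UnitAddCircle => ∫ p : AddCircle L × AddCircle L, F (p.1, p.2, z) := by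
  have h1 := (measurePreserving_assoc.integrable_comp_of_integrable hF)
  exact h1.integral_prod_right

end Slicing

/-! ### Poincaré inequality and elliptic identities, mode by mode. -/

section Symbols

variable {L : ℝ}

theorem sym_eq_zero_of_hsym {k : ℤ × ℤ × ℤ} (h : hsym L k = 0) :
    sym L ex k = 0 ∧ sym L ey k = 0 := by
  unfold hsym at h
  constructor <;> nlinarith [sq_nonneg (sym L ex k), sq_nonneg (sym L ey k)]

variable [Fact (0 < L)]

theorem gam_pos : 0 < gam L := by
  have := L_pos (L := L)
  unfold gam; positivity

/-- The left factor normalizes the symbol to the integer k₁² + k₂², which is at least 1 once it is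
nonzero. This is the source of the sharp constant γ. -/
theorem one_le_gam_mul_hsym {k : ℤ × ℤ × ℤ} (h : hsym L k ≠ 0) : 1 ≤ gam L * hsym L k := by
  have hL := L_pos (L := L)
  have h1 : gam L * hsym L k = (k.1 ^ 2 + k.2.1 ^ 2 : ℤ) := by
    simp only [gam, hsym, sym, ex, ey]
    push_cast
    field_simp
    ring
  rw [h1]
  have h2 : (k.1 ^ 2 + k.2.1 ^ 2 : ℤ) ≠ 0 := by
    intro h0
    rw [h0] at h1
    have := gam_pos (L := L)
    simp [this.ne', h] at h1
  have h3 : (1 : ℤ) ≤ k.1 ^ 2 + k.2.1 ^ 2 := by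
    have : 0 ≤ k.1 ^ 2 + k.2.1 ^ 2 := by positivity
    omega
  exact_mod_cast h3

theorem norm_I_mul (s : ℝ) (a : ℂ) : ‖Complex.I * s * a‖ ^ 2 = s ^ 2 * ‖a‖ ^ 2 := by
  simp [mul_pow]

/-- With zero horizontal frequency the character depends on z alone, so on each slice it comes out
of the integral and leaves the horizontal mean. -/
theorem ZeroMean.fc_eq_zero {f : L2 L} (h : ZeroMean f) {k : ℤ × ℤ × ℤ} (hk : hsym L k = 0) :
    fc k f = 0 := by
  have hL := (L_pos (L := L)).ne'
  have hk1 : k.1 = 0 ∧ k.2.1 = 0 := by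
    have h1 : sym L ex k = 0 := by
      unfold hsym at hk; nlinarith [sq_nonneg (sym L ex k), sq_nonneg (sym L ey k)]
    have h2 : sym L ey k = 0 := by
      unfold hsym at hk; nlinarith [sq_nonneg (sym L ex k), sq_nonneg (sym L ey k)]
    simp only [sym, ex, ey] at h1 h2
    simp [Real.pi_ne_zero, hL] at h1 h2
    exact ⟨h1, h2⟩
  have key : ∀ a : ℂ, ∫ q, f q * (a * chr L k q).re = 0 := by
    intro a
    rw [integral_torus (integrable_mul_test f (isTest_re_mul_chr a k))]
    refine integral_eq_zero_of_ae ?_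
    filter_upwards [h] with z hz
    have hz' : ∫ p : AddCircle L × AddCircle L, f (p.1, p.2, z) = 0 := by
      simp only [hmean] at hz
      simpa [hL] using hz
    simp only [chr_apply, hk1.1, hk1.2, fourier_zero, one_mul]
    rw [integral_mul_const, hz', zero_mul]
    rfl
  have h1 := key 1
  have h2 := key Complex.I
  rw [integral_mul_re_chr] at h1 h2
  simp [hL] at h1 h2
  exact Complex.ext h1 h2

/-- `f` has no purely vertical Fourier modes. -/
def NoMean (f : L2 L) : Prop := ∀ k, hsym L k = 0 → fc k f = 0

theorem ZeroMean.noMean {f : L2 L} (h : ZeroMean f) : NoMean f := fun _ hk => h.fc_eq_zero hk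

theorem NoMean.of_hasWeakDeriv {e : ℝ × ℝ × ℝ} {f g : L2 L} (hf : NoMean f)
    (h : HasWeakDeriv e f g) : NoMean g := fun k hk => by rw [h.fc, hf k hk]; simp

/-- **Poincaré's inequality** with the sharp constant. -/
theorem poincare {f fx fy : L2 L} (hf : NoMean f) (hx : HasWeakDeriv ex f fx)
    (hy : HasWeakDeriv ey f fy) : ‖f‖ ^ 2 ≤ gam L * (‖fx‖ ^ 2 + ‖fy‖ ^ 2) := by
  refine hasSum_le (fun k => ?_) (hasSum_norm_sq f)
    (((hasSum_norm_sq fx).add (hasSum_norm_sq fy)).mul_left (gam L))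
  rw [hx.fc, hy.fc, norm_I_mul, norm_I_mul, ← add_mul, ← mul_assoc]
  by_cases hk : hsym L k = 0
  · rw [hf k hk]; simp
  · exact le_mul_of_one_le_left (by positivity) (one_le_gam_mul_hsym hk)

/-- No mean condition is needed: purely vertical modes contribute nothing to either side. -/
theorem grad_le_lap {f fx fy g : L2 L} (hx : HasWeakDeriv ex f fx)
    (hy : HasWeakDeriv ey f fy) (hg : HasHLaplacian f g) :
    ‖fx‖ ^ 2 + ‖fy‖ ^ 2 ≤ gam L * ‖g‖ ^ 2 := by
  refine hasSum_le (fun k => ?_) ((hasSum_norm_sq fx).add (hasSum_norm_sq fy))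
    ((hasSum_norm_sq g).mul_left (gam L))
  rw [hx.fc, hy.fc, norm_I_mul, norm_I_mul, ← add_mul, hg.fc]
  change hsym L k * _ ≤ _
  have e1 : ‖-(hsym L k : ℂ) * fc k f‖ ^ 2 = hsym L k ^ 2 * ‖fc k f‖ ^ 2 := by
    simp [mul_pow]
  rw [e1, sq (hsym L k), ← mul_assoc, ← mul_assoc]
  by_cases hk : hsym L k = 0
  · simp [hk]
  · exact mul_le_mul_of_nonneg_right
      (le_mul_of_one_le_left (hsym_nonneg k) (one_le_gam_mul_hsym hk)) (by positivity)

theorem HasWeakDeriv.inner {e : ℝ × ℝ × ℝ} {f f' g g' : L2 L} (hf : HasWeakDeriv e f f')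
    (hg : HasWeakDeriv e g g') : inner ℝ f' g = -inner ℝ f g' := by
  rw [← inner_neg_right]
  refine inner_eq_of_fc fun k => ?_
  rw [map_neg, hf.fc, hg.fc]
  simp
  ring

theorem HasWeakDeriv.comm {e d : ℝ × ℝ × ℝ} {f fe fd fed : L2 L} (he : HasWeakDeriv e f fe)
    (hd : HasWeakDeriv d f fd) (hed : HasWeakDeriv d fe fed) : HasWeakDeriv e fd fed :=
  hasWeakDeriv_iff_fc.2 fun k => by rw [hed.fc, he.fc, hd.fc]; ring

theorem HasWeakDeriv.neg {e : ℝ × ℝ × ℝ} {f g : L2 L} (h : HasWeakDeriv e f g) :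
    HasWeakDeriv e (-f) (-g) := by simpa using h.smul (-1)

theorem HasWeakDeriv.sub {e : ℝ × ℝ × ℝ} {f g f' g' : L2 L} (h : HasWeakDeriv e f g)
    (h' : HasWeakDeriv e f' g') : HasWeakDeriv e (f - f') (g - g') := by
  simpa [sub_eq_add_neg] using h.add h'.neg

theorem HasHLaplacian.eq_add {f g fx fy fxx fyy : L2 L} (h : HasHLaplacian f g)
    (hx : HasWeakDeriv ex f fx) (hy : HasWeakDeriv ey f fy) (hxx : HasWeakDeriv ex fx fxx)
    (hyy : HasWeakDeriv ey fy fyy) : g = fxx + fyy :=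
  ext_fc fun k => by
    rw [map_add, h.fc, hxx.fc, hyy.fc, hx.fc, hy.fc]
    simp only [hsym]
    push_cast
    linear_combination
      (-((sym L ex k : ℂ) ^ 2 + (sym L ey k : ℂ) ^ 2) * RotConv.fc k f) * Complex.I_sq

/-- The product of two horizontal symbols is at most the symbol of the Laplacian, so Δ_h f ∈ L²
yields every second horizontal derivative. -/
theorem HasHLaplacian.weaklyDiff {f g : L2 L} (h : HasHLaplacian f g) {e d : ℝ × ℝ × ℝ}
    (he : e = ex ∨ e = ey) (hd : d = ex ∨ d = ey) {fe : L2 L} (hfe : HasWeakDeriv e f fe) :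
    WeaklyDiff d fe := by
  refine weaklyDiff_of_le g fun k => ?_
  rw [hfe.fc, h.fc]
  have : |sym L d k| * |sym L e k| ≤ hsym L k := by
    unfold hsym
    rw [← sq_abs (sym L ex k), ← sq_abs (sym L ey k)]
    rcases he with rfl | rfl <;> rcases hd with rfl | rfl <;>
      nlinarith [sq_nonneg (|sym L ex k| - |sym L ey k|), abs_nonneg (sym L ex k),
        abs_nonneg (sym L ey k)]
  simp only [norm_mul, Complex.norm_I, Complex.norm_real, Real.norm_eq_abs, norm_neg, one_mul]
  rw [← mul_assoc, abs_of_nonneg (hsym_nonneg k)]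
  gcongr

theorem norm_hessian {f g fx fy fxx fxy fyy : L2 L} (h : HasHLaplacian f g)
    (hx : HasWeakDeriv ex f fx) (hy : HasWeakDeriv ey f fy) (hxx : HasWeakDeriv ex fx fxx)
    (hxy : HasWeakDeriv ey fx fxy) (hyy : HasWeakDeriv ey fy fyy) :
    ‖fxx‖ ^ 2 + 2 * ‖fxy‖ ^ 2 + ‖fyy‖ ^ 2 = ‖g‖ ^ 2 := by
  refine HasSum.unique (((hasSum_norm_sq fxx).add ((hasSum_norm_sq fxy).mul_left 2)).add
    (hasSum_norm_sq fyy)) ?_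
  convert! hasSum_norm_sq g using 2 with k
  rw [hxx.fc, hxy.fc, hyy.fc, hx.fc, hy.fc, h.fc]
  simp only [norm_I_mul]
  have e1 : ‖-(hsym L k : ℂ) * fc k f‖ ^ 2 = hsym L k ^ 2 * ‖fc k f‖ ^ 2 := by
    simp [mul_pow]
  rw [e1, hsym]
  ring

/-- The gradient of a divergence free field is controlled by its vorticity. -/
theorem norm_grad_eq_curl {u v ux uy vx vy : L2 L} (hux : HasWeakDeriv ex u ux)
    (huy : HasWeakDeriv ey u uy) (hvx : HasWeakDeriv ex v vx) (hvy : HasWeakDeriv ey v vy)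
    (hdiv : ux + vy = 0) :
    (‖ux‖ ^ 2 + ‖uy‖ ^ 2) + (‖vx‖ ^ 2 + ‖vy‖ ^ 2) = ‖vx - uy‖ ^ 2 := by
  have h1 := norm_sub_sq_real vx uy
  have h2 := norm_add_sq_real ux vy
  have h3 : inner ℝ vx uy = inner ℝ ux vy := by
    refine inner_eq_of_fc fun k => ?_
    rw [hux.fc, huy.fc, hvx.fc, hvy.fc]
    simp
    ring
  rw [hdiv, norm_zero] at h2
  rw [h1, h3]
  linarith

/-- For each mode the squared divergence and curl add up to |ξ|² times the squared velocity
coefficient. The hypotheses are put on coefficients because the lemma is applied to 𝐮_z, whose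
horizontal derivatives are not yet known to exist. -/
theorem weaklyDiff_of_curl {u v ω : L2 L} {e : ℝ × ℝ × ℝ} (he : e = ex ∨ e = ey)
    (hdiv : ∀ k, sym L ex k * fc k u + sym L ey k * fc k v = 0)
    (hcurl : ∀ k, fc k ω = Complex.I * (sym L ex k * fc k v - sym L ey k * fc k u)) :
    WeaklyDiff e u ∧ WeaklyDiff e v := by
  have key : ∀ k, hsym L k * (‖fc k u‖ ^ 2 + ‖fc k v‖ ^ 2) = ‖fc k ω‖ ^ 2 := by
    intro k
    have h1 := hdiv k
    rw [hcurl]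
    have h2 := congrArg Complex.re h1
    have h3 := congrArg Complex.im h1
    simp at h2 h3
    simp only [norm_mul, Complex.norm_I, one_mul, ← Complex.normSq_eq_norm_sq,
      Complex.normSq_apply, hsym]
    simp
    linear_combination (sym L ex k * (fc k u).re + sym L ey k * (fc k v).re) * h2
      + (sym L ex k * (fc k u).im + sym L ey k * (fc k v).im) * h3
  have hs : ∀ k, sym L e k ^ 2 ≤ hsym L k := by
    intro k
    unfold hsym
    rcases he with rfl | rfl <;> nlinarith [sq_nonneg (sym L ex k), sq_nonneg (sym L ey k)]
  constructor <;> refine weaklyDiff_of_le ω fun k => ?_ <;>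
    refine le_of_sq_le_sq ?_ (norm_nonneg _) <;> rw [← key k, norm_mul, mul_pow] <;>
    simp only [Complex.norm_real, Real.norm_eq_abs, sq_abs] <;>
    refine mul_le_mul (hs k) ?_ (by positivity) (hsym_nonneg k)
  · exact le_add_of_nonneg_right (by positivity)
  · exact le_add_of_nonneg_left (by positivity)

/-- A divergence free field with vanishing horizontal mean is the perpendicular gradient of the
stream function of its vorticity. -/
theorem hasWeakDeriv_stream {u v φ ux uy vx vy : L2 L} (hux : HasWeakDeriv ex u ux)
    (huy : HasWeakDeriv ey u uy) (hvx : HasWeakDeriv ex v vx) (hvy : HasWeakDeriv ey v vy)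
    (hdiv : ux + vy = 0) (hu : NoMean u) (hv : NoMean v)
    (hφ : HasHLaplacian φ (-(vx - uy))) : HasWeakDeriv ex φ (-v) ∧ HasWeakDeriv ey φ u := by
  have key : ∀ k, sym L ex k * fc k u + sym L ey k * fc k v = 0 := by
    intro k
    have := congrArg (fc k) hdiv
    rw [map_add, hux.fc, hvy.fc, map_zero] at this
    have h2 : Complex.I * (sym L ex k * fc k u + sym L ey k * fc k v) = 0 := by
      rw [← this]; ring
    simpa using h2
  have hs : ∀ k, (hsym L k : ℂ) * fc k φ
      = Complex.I * (sym L ex k * fc k v - sym L ey k * fc k u) := by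
    intro k
    have := hφ.fc k
    rw [map_neg, map_sub, hvx.fc, huy.fc] at this
    linear_combination this
  refine ⟨hasWeakDeriv_iff_fc.2 fun k => ?_, hasWeakDeriv_iff_fc.2 fun k => ?_⟩
  -- The Laplacian carries no information on these modes; both sides vanish there because the
  -- velocity has no mean.
  · by_cases hk : hsym L k = 0
    · rw [map_neg, hv k hk, (sym_eq_zero_of_hsym hk).1]; simp
    · have hk' : (hsym L k : ℂ) ≠ 0 := by exact_mod_cast hk
      apply mul_left_cancel₀ hk'
      rw [map_neg]
      have e : (hsym L k : ℂ) = sym L ex k ^ 2 + sym L ey k ^ 2 := by simp [hsym]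
      have h1 := hs k
      have h2 := key k
      rw [e] at h1 ⊢
      linear_combination (-(Complex.I * sym L ex k)) * h1 - (sym L ey k : ℂ) * h2
        - ((sym L ex k : ℂ) * (sym L ex k * fc k v - sym L ey k * fc k u)) * Complex.I_sq
  · by_cases hk : hsym L k = 0
    · rw [hu k hk, (sym_eq_zero_of_hsym hk).2]; simp
    · have hk' : (hsym L k : ℂ) ≠ 0 := by exact_mod_cast hk
      apply mul_left_cancel₀ hk'
      have e : (hsym L k : ℂ) = sym L ex k ^ 2 + sym L ey k ^ 2 := by simp [hsym]
      have h1 := hs k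
      have h2 := key k
      rw [e] at h1 ⊢
      linear_combination (-(Complex.I * sym L ey k)) * h1 + (sym L ex k : ℂ) * h2
        - ((sym L ey k : ℂ) * (sym L ex k * fc k v - sym L ey k * fc k u)) * Complex.I_sq

/-- The curve is the pointwise limit of its truncations, which are finite sums of scalar
coefficients times fixed vectors. This serves for curves of products. -/
theorem aestronglyMeasurable_of_fc {μ : Measure ℝ} {f : ℝ → L2 L}
    (h : ∀ k, AEStronglyMeasurable (fun t => fc k (f t)) μ) : AEStronglyMeasurable f μ := by
  refine aestronglyMeasurable_of_tendsto_ae atTop (f := fun F t => trunc F (f t)) (fun F => ?_)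
    (Eventually.of_forall fun t => tendsto_trunc (f t))
  simp only [trunc_eq_rePart]
  refine (rePart L).continuous.comp_aestronglyMeasurable ?_
  exact Finset.aestronglyMeasurable_fun_sum F fun k _ => (h k).smul_const _

theorem exists_finset_seq : ∃ F : ℕ → Finset (ℤ × ℤ × ℤ), Tendsto F atTop atTop :=
  exists_seq_tendsto atTop

end Symbols

/-! ### Vertical translations and difference quotients. -/

section Translation

variable {L : ℝ} [Fact (0 < L)]

/-- The vertical shift by `h`. -/
def vshift (L : ℝ) (h : ℝ) : Torus L := proj L (h • ez)

theorem measurePreserving_shift (h : ℝ) :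
    MeasurePreserving (fun q : Torus L => q + vshift L h) volume volume :=
  measurePreserving_add_right volume (vshift L h)

/-- Vertical translation on `L²(Ω)`. -/
def tz (h : ℝ) : L2 L →L[ℝ] L2 L :=
  (Lp.compMeasurePreservingₗᵢ ℝ _ (measurePreserving_shift (L := L) h)).toContinuousLinearMap

theorem coeFn_tz (h : ℝ) (f : L2 L) : tz h f =ᵐ[volume] fun q => f (q + vshift L h) :=
  Lp.coeFn_compMeasurePreserving f (measurePreserving_shift h)

theorem fc_tz (h : ℝ) (f : L2 L) (k : ℤ × ℤ × ℤ) :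
    fc k (tz h f) = Complex.exp ((sym L ez k * h : ℝ) * Complex.I) * fc k f := by
  rw [fc_eq_integral, fc_eq_integral, ← chr_proj_smul]
  have h1 : ∫ q, ((tz h f) q : ℂ) * conj (chr L k q)
      = ∫ q, (fun q => (f q : ℂ) * conj (chr L k q) * chr L k (proj L (h • ez)))
          (q + vshift L h) := by
    refine integral_congr_ae ?_
    filter_upwards [coeFn_tz h f] with q hq
    have h2 : conj (chr L k (proj L (h • ez))) * chr L k (proj L (h • ez)) = 1 := by
      rw [← chr_neg, ← chr_add, neg_add_cancel, chr_zero]; rfl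
    simp only [hq, chr_map_add, map_mul, vshift]
    linear_combination (-((f (q + proj L (h • ez)) : ℂ) * conj (chr L k q))) * h2
  rw [h1, integral_add_right_eq_self
    (fun q => (f q : ℂ) * conj (chr L k q) * chr L k (proj L (h • ez))) (vshift L h),
    integral_mul_const]
  ring

theorem inner_tz (h : ℝ) (f g : L2 L) : inner ℝ (tz h f) (tz h g) = inner ℝ f g :=
  LinearIsometry.inner_map_map _ _ _

theorem tz_neg_tz (h : ℝ) (f : L2 L) : tz (-h) (tz h f) = f := ext_fc fun k => by
  rw [fc_tz, fc_tz, ← mul_assoc, ← Complex.exp_add]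
  simp

theorem HasWeakDeriv.tz {e : ℝ × ℝ × ℝ} {f g : L2 L} (hf : HasWeakDeriv e f g) (h : ℝ) :
    HasWeakDeriv e (tz h f) (tz h g) := hasWeakDeriv_iff_fc.2 fun k => by
  rw [fc_tz, fc_tz, hf.fc]; ring

/-- The vertical difference operator. -/
def dz (h : ℝ) : L2 L →L[ℝ] L2 L := tz h - ContinuousLinearMap.id ℝ (L2 L)

theorem dz_apply (h : ℝ) (f : L2 L) : dz h f = tz h f - f := rfl

theorem fc_dz (h : ℝ) (f : L2 L) (k : ℤ × ℤ × ℤ) :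
    fc k (dz h f) = (Complex.exp ((sym L ez k * h : ℝ) * Complex.I) - 1) * fc k f := by
  rw [dz_apply, map_sub, fc_tz]; ring

theorem HasWeakDeriv.dz {e : ℝ × ℝ × ℝ} {f g : L2 L} (hf : HasWeakDeriv e f g) (h : ℝ) :
    HasWeakDeriv e (dz h f) (dz h g) := hasWeakDeriv_iff_fc.2 fun k => by
  rw [fc_dz, fc_dz, hf.fc]; ring

theorem HasHLaplacian.dz {f g : L2 L} (hf : HasHLaplacian f g) (h : ℝ) :
    HasHLaplacian (dz h f) (dz h g) := hasHLaplacian_iff_fc.2 fun k => by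
  rw [fc_dz, fc_dz, hf.fc]; ring

theorem NoMean.dz {f : L2 L} (hf : NoMean f) (h : ℝ) : NoMean (dz h f) := fun k hk => by
  rw [fc_dz, hf k hk, mul_zero]

/-- Summation by parts: the shift is an isometry with inverse the opposite shift. -/
theorem inner_dz_right (h : ℝ) (f g : L2 L) : inner ℝ f (dz (-h) g) = inner ℝ (dz h f) g := by
  rw [dz_apply, dz_apply, inner_sub_left, inner_sub_right, ← inner_tz h f (tz (-h) g)]
  congr 2
  simpa using tz_neg_tz (-h) g

theorem norm_dz_le {f fz : L2 L} (hf : HasWeakDeriv ez f fz) (h : ℝ) :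
    ‖dz h f‖ ≤ |h| * ‖fz‖ := by
  refine le_of_sq_le_sq ?_ (by positivity)
  rw [mul_pow]
  refine hasSum_le (fun k => ?_) (hasSum_norm_sq (dz h f)) ((hasSum_norm_sq fz).mul_left (|h| ^ 2))
  rw [fc_dz, hf.fc, norm_I_mul, norm_mul, mul_pow, ← mul_assoc]
  gcongr
  rw [← mul_pow]
  have := Real.norm_exp_I_mul_ofReal_sub_one_le (x := sym L ez k * h)
  rw [mul_comm Complex.I] at this
  refine (pow_le_pow_left₀ (norm_nonneg _) this 2).trans (le_of_eq ?_)
  rw [Real.norm_eq_abs, sq_abs]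
  simp [mul_pow, mul_comm]

/-- Dominated convergence in the Fourier series, with |e^{is} - 1| ≤ |s| as the domination. It turns
estimates of differences into estimates of the vertical derivative. -/
theorem tendsto_norm_dz {f fz : L2 L} (hf : HasWeakDeriv ez f fz) :
    Tendsto (fun h : ℝ => ‖dz h f‖ ^ 2 / h ^ 2) (𝓝[≠] 0) (𝓝 (‖fz‖ ^ 2)) := by
  have h1 : ∀ h : ℝ, ‖dz h f‖ ^ 2 / h ^ 2 = ∑' k, ‖fc k (dz h f)‖ ^ 2 / h ^ 2 := fun h => by
    rw [tsum_div_const, (hasSum_norm_sq _).tsum_eq]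
  simp only [h1]
  rw [← (hasSum_norm_sq fz).tsum_eq]
  refine tendsto_tsum_of_dominated_convergence (hasSum_norm_sq fz).summable (fun k => ?_) ?_
  · have hd : HasDerivAt (fun h : ℝ => Complex.exp ((sym L ez k * h : ℝ) * Complex.I) * fc k f)
        (fc k fz) 0 := by
      have h1 : HasDerivAt (fun s : ℝ => ((sym L ez k * s : ℝ) * Complex.I : ℂ))
          (sym L ez k * Complex.I) 0 := by
        have := ((hasDerivAt_id (0 : ℝ)).const_mul (sym L ez k)).ofReal_comp.mul_const Complex.I
        simpa using this
      have := h1.cexp.mul_const (fc k f)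
      convert! this using 1
      rw [hf.fc, mul_zero, Complex.ofReal_zero, zero_mul, Complex.exp_zero]
      ring
    have h2 := hd.tendsto_slope_zero
    have h3 := (h2.norm.pow 2)
    refine h3.congr fun h => ?_
    rw [norm_smul, fc_dz, mul_pow, norm_inv, Real.norm_eq_abs, inv_pow, sq_abs, div_eq_inv_mul]
    simp only [zero_add, mul_zero, Complex.ofReal_zero, zero_mul, Complex.exp_zero, sub_mul]
  · filter_upwards [self_mem_nhdsWithin] with h hh k
    have hh' : h ≠ 0 := hh
    have hpos : 0 < h ^ 2 := by positivity
    rw [Real.norm_of_nonneg (by positivity), div_le_iff₀ hpos, fc_dz, hf.fc, norm_I_mul, norm_mul,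
      mul_pow]
    have := Real.norm_exp_I_mul_ofReal_sub_one_le (x := sym L ez k * h)
    rw [mul_comm Complex.I] at this
    have h4 := pow_le_pow_left₀ (norm_nonneg _) this 2
    rw [Real.norm_eq_abs, sq_abs] at h4
    nlinarith [sq_nonneg ‖fc k f‖]

end Translation

/-! ### One-dimensional Sobolev inequalities on a circle. -/

section Circle

variable {T : ℝ} [Fact (0 < T)]

theorem circle_integral_deriv {g g' : AddCircle T → ℝ}
    (hd : ∀ s : ℝ, HasDerivAt (fun s : ℝ => g (s : AddCircle T)) (g' s) s) (hg' : Continuous g') :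
    ∫ x, g' x = 0 := by
  rw [← AddCircle.intervalIntegral_preimage T 0]
  have hc : Continuous fun s : ℝ => g' (s : AddCircle T) :=
    hg'.comp (AddCircle.continuous_mk' T)
  rw [intervalIntegral.integral_eq_sub_of_hasDerivAt (fun s _ => hd s) (hc.intervalIntegrable _ _)]
  rw [zero_add, AddCircle.coe_period, AddCircle.coe_zero, sub_self]

/-- The value at a point exceeds any other value by at most ∫|g'| over the period starting there;
average over the other point. -/
theorem circle_le {g g' : AddCircle T → ℝ}
    (hd : ∀ s : ℝ, HasDerivAt (fun s : ℝ => g (s : AddCircle T)) (g' s) s) (hg' : Continuous g')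
    (x : AddCircle T) : g x ≤ T⁻¹ * (∫ y, g y) + ∫ y, |g' y| := by
  have hT : 0 < T := Fact.out
  obtain ⟨a, rfl⟩ := QuotientAddGroup.mk_surjective x
  have hc' : Continuous fun s : ℝ => g' (s : AddCircle T) :=
    hg'.comp (AddCircle.continuous_mk' T)
  have hc : Continuous fun s : ℝ => g (s : AddCircle T) :=
    continuous_iff_continuousAt.2 fun s => (hd s).continuousAt
  rw [← AddCircle.intervalIntegral_preimage T a, ← AddCircle.intervalIntegral_preimage T a]
  set M := ∫ s in a..a + T, |g' (s : AddCircle T)| with hM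
  have key : ∀ y ∈ Icc a (a + T), g (a : AddCircle T) ≤ g (y : AddCircle T) + M := by
    intro y hy
    have h1 : ∫ s in a..y, g' (s : AddCircle T) = g (y : AddCircle T) - g (a : AddCircle T) :=
      intervalIntegral.integral_eq_sub_of_hasDerivAt (fun s _ => hd s) (hc'.intervalIntegrable _ _)
    have h2 : |∫ s in a..y, g' (s : AddCircle T)| ≤ ∫ s in a..y, |g' (s : AddCircle T)| :=
      intervalIntegral.abs_integral_le_integral_abs hy.1
    have h3 : ∫ s in a..y, |g' (s : AddCircle T)| ≤ M :=
      intervalIntegral.integral_mono_interval le_rfl hy.1 hy.2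
        (Eventually.of_forall fun s => abs_nonneg _) (hc'.abs.intervalIntegrable _ _)
    have := neg_abs_le (∫ s in a..y, g' (s : AddCircle T))
    linarith
  have h4 : ∫ _ in a..a + T, g (a : AddCircle T) ≤ ∫ y in a..a + T, (g (y : AddCircle T) + M) :=
    intervalIntegral.integral_mono_on (by linarith) (by simp)
      ((hc.add continuous_const).intervalIntegrable _ _) key
  rw [intervalIntegral.integral_add (hc.intervalIntegrable _ _) (by simp)] at h4
  simp only [intervalIntegral.integral_const, add_sub_cancel_left, smul_eq_mul] at h4
  change g (a : AddCircle T) ≤ _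
  rw [inv_mul_eq_div, div_add' _ _ _ hT.ne', le_div_iff₀ hT]
  linarith

/-- `circle_le` for f², written with `lintegral` so that it can be multiplied and integrated in the
remaining variables by Tonelli. -/
theorem circle_sq_le {f f' : AddCircle T → ℝ}
    (hd : ∀ s : ℝ, HasDerivAt (fun s : ℝ => f (s : AddCircle T)) (f' s) s) (hf : Continuous f)
    (hf' : Continuous f') (x : AddCircle T) :
    ENNReal.ofReal (f x ^ 2) ≤ ∫⁻ y, ENNReal.ofReal (T⁻¹ * f y ^ 2 + 2 * |f y * f' y|) := by
  have hT : 0 < T := Fact.out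
  have hdot : ∀ {ψ : AddCircle T → ℝ}, Continuous ψ → Integrable ψ := fun h =>
    h.integrable_of_hasCompactSupport (HasCompactSupport.of_compactSpace _)
  have h1 := circle_le (g := fun x => f x ^ 2) (g' := fun x => 2 * (f x * f' x))
    (fun s => by
      have := (hd s).pow 2
      convert! this using 1
      simp; ring) (by fun_prop) x
  rw [← ofReal_integral_eq_lintegral_ofReal (hdot (by fun_prop))
    (Eventually.of_forall fun y => by positivity)]
  apply ENNReal.ofReal_le_ofReal
  refine h1.trans (le_of_eq ?_)
  rw [integral_add (hdot (by fun_prop)) (hdot (by fun_prop)), integral_const_mul]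
  simp only [abs_mul, Nat.abs_ofNat]

end Circle

/-! ### Anisotropic estimates for smooth functions. -/

section Slices

variable {L : ℝ}

/-- The constant of the product estimate. -/
def prodConst (L : ℝ) : ℝ := 2 * (L⁻¹ + 1) ^ 2

theorem prodConst_nonneg : 0 ≤ prodConst L := by
  unfold prodConst; positivity

theorem IsTest.hasDerivAt_x {ψ : Torus L → ℝ} (h : IsTest ψ) (y : AddCircle L) (z : UnitAddCircle)
    (s : ℝ) : HasDerivAt (fun s : ℝ => ψ ((s : AddCircle L), y, z))
      (RotConv.dirDeriv RotConv.ex ψ ((s : AddCircle L), y, z)) s := by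
  have := h.hasDerivAt RotConv.ex (0, y, z) s
  simpa [proj, RotConv.ex] using this

theorem IsTest.hasDerivAt_y {ψ : Torus L → ℝ} (h : IsTest ψ) (x : AddCircle L) (z : UnitAddCircle)
    (s : ℝ) : HasDerivAt (fun s : ℝ => ψ (x, (s : AddCircle L), z))
      (RotConv.dirDeriv RotConv.ey ψ (x, (s : AddCircle L), z)) s := by
  have := h.hasDerivAt RotConv.ey (x, 0, z) s
  simpa [proj, RotConv.ey] using this

theorem IsTest.hasDerivAt_z {ψ : Torus L → ℝ} (h : IsTest ψ) (x y : AddCircle L)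
    (s : ℝ) : HasDerivAt (fun s : ℝ => ψ (x, y, (s : UnitAddCircle)))
      (RotConv.dirDeriv RotConv.ez ψ (x, y, (s : UnitAddCircle))) s := by
  have := h.hasDerivAt RotConv.ez (x, y, 0) s
  simpa [proj, RotConv.ez] using this

theorem IsTest.sq_le_z {f : Torus L → ℝ} (h : IsTest f) (x y : AddCircle L) (z : UnitAddCircle) :
    ENNReal.ofReal (f (x, y, z) ^ 2) ≤ ∫⁻ z' : UnitAddCircle,
      ENNReal.ofReal ((1 : ℝ)⁻¹ * f (x, y, z') ^ 2
      + 2 * |f (x, y, z') * RotConv.dirDeriv RotConv.ez f (x, y, z')|) :=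
  circle_sq_le (T := 1) (f := fun z => f (x, y, z))
    (f' := fun z => RotConv.dirDeriv RotConv.ez f (x, y, z)) (fun s => h.hasDerivAt_z x y s)
    (by have := h.continuous; fun_prop) (by have := (h.dirDeriv RotConv.ez).continuous; fun_prop) z

theorem dirDeriv_comm {ψ : Torus L → ℝ} (h : IsTest ψ) (e d : ℝ × ℝ × ℝ) :
    dirDeriv e (dirDeriv d ψ) = dirDeriv d (dirDeriv e ψ) := by
  funext q
  obtain ⟨p, rfl⟩ := exists_proj_eq q
  rw [dirDeriv_proj e (h.dirDeriv d), dirDeriv_proj d (h.dirDeriv e)]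
  simp only [dirDeriv_proj _ h]
  have h2 : Differentiable ℝ (fderiv ℝ fun p : ℝ × ℝ × ℝ => ψ (proj L p)) :=
    (ContDiff.fderiv_right (m := (⊤ : ℕ∞)) h (by simp)).differentiable (by simp)
  have h3 : ∀ a b : ℝ × ℝ × ℝ, fderiv ℝ (fun p => fderiv ℝ (fun p => ψ (proj L p)) p a) p b
      = fderiv ℝ (fderiv ℝ fun p => ψ (proj L p)) p b a := by
    intro a b
    rw [fderiv_clm_apply (h2 p) (differentiableAt_const a)]
    simp
  rw [h3, h3]
  have := (ContDiff.contDiffAt (x := p) h).isSymmSndFDerivAt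
    (by simpa using WithTop.coe_le_coe.2 (le_top : (2 : ℕ∞) ≤ ⊤))
  exact this e d

variable [Fact (0 < L)]

theorem _root_.Continuous.integrable_hslice {ψ : AddCircle L × AddCircle L → ℝ}
    (h : Continuous ψ) : Integrable ψ :=
  h.integrable_of_hasCompactSupport (HasCompactSupport.of_compactSpace ψ)

theorem IsTest.hdot_dirDeriv_x {ψ : Torus L → ℝ} (h : IsTest ψ) (z : UnitAddCircle) :
    ∫ p : AddCircle L × AddCircle L, RotConv.dirDeriv RotConv.ex ψ (p.1, p.2, z) = 0 := by
  have hc := (h.dirDeriv RotConv.ex).continuous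
  rw [Measure.volume_eq_prod, integral_prod_symm _ (Continuous.integrable_hslice (by fun_prop))]
  refine integral_eq_zero_of_ae (Eventually.of_forall fun y => ?_)
  exact circle_integral_deriv (g := fun x => ψ (x, y, z)) (fun s => h.hasDerivAt_x y z s)
    (by fun_prop)

theorem IsTest.hdot_dirDeriv_y {ψ : Torus L → ℝ} (h : IsTest ψ) (z : UnitAddCircle) :
    ∫ p : AddCircle L × AddCircle L, RotConv.dirDeriv RotConv.ey ψ (p.1, p.2, z) = 0 := by
  have hc := (h.dirDeriv RotConv.ey).continuous
  rw [Measure.volume_eq_prod, integral_prod _ (Continuous.integrable_hslice (by fun_prop))]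
  refine integral_eq_zero_of_ae (Eventually.of_forall fun x => ?_)
  exact circle_integral_deriv (g := fun y => ψ (x, y, z)) (fun s => h.hasDerivAt_y x z s)
    (by fun_prop)

theorem IsTest.hasDerivAt_hdot {ψ : Torus L → ℝ} (h : IsTest ψ) (s : ℝ) :
    HasDerivAt (fun s : ℝ => ∫ p : AddCircle L × AddCircle L, ψ (p.1, p.2, (s : UnitAddCircle)))
      (∫ p : AddCircle L × AddCircle L, RotConv.dirDeriv RotConv.ez ψ (p.1, p.2, (s : UnitAddCircle)))
      s := by
  have hc := (h.dirDeriv RotConv.ez).continuous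
  have hc0 := h.continuous
  obtain ⟨C, hC⟩ := isCompact_univ.exists_bound_of_continuousOn hc.continuousOn
  refine (hasDerivAt_integral_of_dominated_loc_of_deriv_le
    (F := fun (s : ℝ) (p : AddCircle L × AddCircle L) => ψ (p.1, p.2, (s : UnitAddCircle)))
    (F' := fun (s : ℝ) (p : AddCircle L × AddCircle L) =>
      RotConv.dirDeriv RotConv.ez ψ (p.1, p.2, (s : UnitAddCircle)))
    (bound := fun _ => C) (s := univ) univ_mem
    (Eventually.of_forall fun s => Continuous.aestronglyMeasurable (by fun_prop))
    (Continuous.integrable_hslice (by fun_prop))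
    (Continuous.aestronglyMeasurable (by fun_prop))
    (Eventually.of_forall fun q s _ => hC _ (mem_univ _))
    (integrable_const _)
    (Eventually.of_forall fun q s _ => h.hasDerivAt_z q.1 q.2 s)).2

theorem continuous_hdot {ψ : Torus L → ℝ} (h : Continuous ψ) :
    Continuous fun z : UnitAddCircle => ∫ p : AddCircle L × AddCircle L, ψ (p.1, p.2, z) := by
  obtain ⟨C, hC⟩ := isCompact_univ.exists_bound_of_continuousOn h.continuousOn
  refine continuous_of_dominated (bound := fun _ => C)
    (fun z => Continuous.aestronglyMeasurable (by fun_prop))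
    (fun z => Eventually.of_forall fun q => hC _ (mem_univ _)) (integrable_const _)
    (Eventually.of_forall fun q => by fun_prop)

theorem IsTest.hdot_le {ψ : Torus L → ℝ} (h : IsTest ψ) (z : UnitAddCircle) :
    ∫ p : AddCircle L × AddCircle L, ψ (p.1, p.2, z) ≤ (∫ q, ψ q)
      + ∫ z : UnitAddCircle, |∫ p : AddCircle L × AddCircle L,
          RotConv.dirDeriv RotConv.ez ψ (p.1, p.2, z)| := by
  have := circle_le (T := 1)
    (g := fun z => ∫ p : AddCircle L × AddCircle L, ψ (p.1, p.2, z))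
    (g' := fun z => ∫ p : AddCircle L × AddCircle L, RotConv.dirDeriv RotConv.ez ψ (p.1, p.2, z))
    (fun s => h.hasDerivAt_hdot s) (continuous_hdot (h.dirDeriv _).continuous) z
  rw [integral_torus h.continuous.integrable_torus]
  simpa using this

theorem norm_contLp_sq {ψ : Torus L → ℝ} (h : Continuous ψ) :
    ‖contLp ψ h‖ ^ 2 = ∫ q, ψ q ^ 2 := by
  rw [← real_inner_self_eq_norm_sq, inner_contLp]
  refine integral_congr_ae ?_
  filter_upwards [coeFn_contLp h] with q hq
  rw [hq, sq]

theorem norm_contLp_abs {ψ : Torus L → ℝ} (h : Continuous ψ) :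
    ‖contLp (fun q => |ψ q|) h.abs‖ = ‖contLp ψ h‖ := by
  have : ‖contLp (fun q => |ψ q|) h.abs‖ ^ 2 = ‖contLp ψ h‖ ^ 2 := by
    rw [norm_contLp_sq, norm_contLp_sq]
    simp only [sq_abs]
  exact (sq_eq_sq₀ (norm_nonneg _) (norm_nonneg _)).1 this

theorem integral_abs_mul_le {f g : Torus L → ℝ} (hf : Continuous f) (hg : Continuous g) :
    ∫ q, |f q * g q| ≤ ‖contLp f hf‖ * ‖contLp g hg‖ := by
  have h1 := real_inner_le_norm (contLp (fun q => |f q|) hf.abs) (contLp (fun q => |g q|) hg.abs)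
  rw [norm_contLp_abs hf, norm_contLp_abs hg, inner_contLp] at h1
  refine le_trans (le_of_eq ?_) h1
  refine integral_congr_ae ?_
  filter_upwards [coeFn_contLp hf.abs] with q hq
  rw [hq, abs_mul]

theorem integral_abs_hdot_le {ψ : Torus L → ℝ} (h : Continuous ψ) :
    ∫ z : UnitAddCircle, |∫ p : AddCircle L × AddCircle L, ψ (p.1, p.2, z)| ≤ ∫ q, |ψ q| := by
  rw [integral_torus h.abs.integrable_torus]
  refine integral_mono (integrable_hdot h.integrable_torus).abs
    (integrable_hdot (F := fun q => |ψ q|) h.abs.integrable_torus) fun z => ?_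
  exact abs_integral_le_integral_abs

theorem hdot_sq_le {f : Torus L → ℝ} (hf : IsTest f) (z : UnitAddCircle) :
    ∫ p : AddCircle L × AddCircle L, f (p.1, p.2, z) ^ 2 ≤ ‖contLp f hf.continuous‖ ^ 2
      + 2 * ‖contLp f hf.continuous‖ * ‖contLp _ (hf.dirDeriv ez).continuous‖ := by
  have h1 := (hf.mul hf).hdot_le z
  have e1 : dirDeriv ez (fun q => f q * f q) = fun q => 2 * f q * dirDeriv ez f q := by
    funext q; rw [dirDeriv_mul hf hf]; ring
  rw [e1] at h1
  have hc := hf.continuous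
  have hcz := (hf.dirDeriv ez).continuous
  have h2 := integral_abs_hdot_le (L := L) (ψ := fun q => 2 * f q * dirDeriv ez f q)
    (by fun_prop)
  have h3 := integral_abs_mul_le (f := fun q => f q) (g := dirDeriv ez f) hc hcz
  have h4 : ∫ q, |2 * f q * dirDeriv ez f q| = 2 * ∫ q, |f q * dirDeriv ez f q| := by
    rw [← integral_const_mul]; simp [abs_mul, mul_assoc]
  rw [norm_contLp_sq]
  simp only [← sq] at h1
  linarith

/-- The z-derivative of the horizontal Dirichlet integral is 2∫∇_h g·∇_h g_z = -2∫(Δ_h g) g_z over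
the slice. Hence the supremum over z costs Δ_h g and g_z in L², but not the mixed derivatives. -/
theorem hdot_grad_sq_le {g : Torus L → ℝ} (hg : IsTest g) (z : UnitAddCircle)
    {l : Torus L → ℝ} (hl : Continuous l)
    (hlap : ∀ q, l q = dirDeriv ex (dirDeriv ex g) q + dirDeriv ey (dirDeriv ey g) q) :
    ∫ p : AddCircle L × AddCircle L,
      (dirDeriv ex g (p.1, p.2, z) ^ 2 + dirDeriv ey g (p.1, p.2, z) ^ 2)
      ≤ ‖contLp _ (hg.dirDeriv ex).continuous‖ ^ 2 + ‖contLp _ (hg.dirDeriv ey).continuous‖ ^ 2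
        + 2 * ‖contLp l hl‖ * ‖contLp _ (hg.dirDeriv ez).continuous‖ := by
  set gx := dirDeriv ex g with hgx
  set gy := dirDeriv ey g with hgy
  set gz := dirDeriv ez g with hgz
  have tx : IsTest gx := hg.dirDeriv ex
  have ty : IsTest gy := hg.dirDeriv ey
  have tz : IsTest gz := hg.dirDeriv ez
  have cx := tx.continuous
  have cy := ty.continuous
  have cz := tz.continuous
  have cxx := (tx.dirDeriv ex).continuous
  have cyy := (ty.dirDeriv ey).continuous
  have cxz := (tz.dirDeriv ex).continuous
  have cyz := (tz.dirDeriv ey).continuous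
  have h1 := ((tx.mul tx).add (ty.mul ty)).hdot_le z
  have e1 : dirDeriv ez (fun q => gx q * gx q + gy q * gy q)
      = fun q => 2 * (gx q * dirDeriv ex gz q + gy q * dirDeriv ey gz q) := by
    funext q
    rw [dirDeriv_add (tx.mul tx) (ty.mul ty), dirDeriv_mul tx tx, dirDeriv_mul ty ty, hgz,
      dirDeriv_comm hg ex ez, dirDeriv_comm hg ey ez]
    ring
  have e2 : ∀ z : UnitAddCircle, ∫ p : AddCircle L × AddCircle L,
      2 * (gx (p.1, p.2, z) * dirDeriv ex gz (p.1, p.2, z)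
        + gy (p.1, p.2, z) * dirDeriv ey gz (p.1, p.2, z))
      = ∫ p : AddCircle L × AddCircle L, -2 * l (p.1, p.2, z) * gz (p.1, p.2, z) := by
    intro z
    have i1 := (tx.mul tz).hdot_dirDeriv_x z
    have i2 := (ty.mul tz).hdot_dirDeriv_y z
    simp only [dirDeriv_mul tx tz] at i1
    simp only [dirDeriv_mul ty tz] at i2
    have h3 : ∫ p : AddCircle L × AddCircle L,
        (2 * (gx (p.1, p.2, z) * dirDeriv ex gz (p.1, p.2, z)
        + gy (p.1, p.2, z) * dirDeriv ey gz (p.1, p.2, z))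
        - -2 * l (p.1, p.2, z) * gz (p.1, p.2, z)) = 0 := by
      have h4 : ∀ p : AddCircle L × AddCircle L,
        (2 * (gx (p.1, p.2, z) * dirDeriv ex gz (p.1, p.2, z)
        + gy (p.1, p.2, z) * dirDeriv ey gz (p.1, p.2, z))
        - -2 * l (p.1, p.2, z) * gz (p.1, p.2, z)) =
        2 * (dirDeriv ex gx (p.1, p.2, z) * gz (p.1, p.2, z)
          + gx (p.1, p.2, z) * dirDeriv ex gz (p.1, p.2, z))
        + 2 * (dirDeriv ey gy (p.1, p.2, z) * gz (p.1, p.2, z)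
          + gy (p.1, p.2, z) * dirDeriv ey gz (p.1, p.2, z)) := by
        intro p; rw [hlap]; ring
      simp only [h4]
      rw [integral_add (Continuous.integrable_hslice (by fun_prop))
        (Continuous.integrable_hslice (by fun_prop)), integral_const_mul, integral_const_mul,
        i1, i2]
      simp
    rw [integral_sub (Continuous.integrable_hslice (by fun_prop))
        (Continuous.integrable_hslice (by fun_prop))] at h3
    linarith
  rw [e1] at h1
  simp only [e2] at h1
  have h2 := integral_abs_hdot_le (L := L) (ψ := fun q => -2 * l q * gz q) (by fun_prop)
  have h3 := integral_abs_mul_le hl cz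
  have h4 : ∫ q, |-2 * l q * gz q| = 2 * ∫ q, |l q * gz q| := by
    rw [← integral_const_mul]; simp [abs_mul, mul_assoc]
  have h5 : ∫ q, (gx q * gx q + gy q * gy q) = (∫ q, gx q ^ 2) + ∫ q, gy q ^ 2 := by
    simp only [← sq]
    exact integral_add (Continuous.integrable_torus (by fun_prop))
      (Continuous.integrable_torus (by fun_prop))
  rw [norm_contLp_sq, norm_contLp_sq]
  simp only [← sq] at h1 h5
  linarith

theorem lintegral_torus_iter {F : Torus L → ℝ≥0∞} (hF : Measurable F) :
    ∫⁻ q, F q = ∫⁻ x : AddCircle L, ∫⁻ y : AddCircle L, ∫⁻ z : UnitAddCircle, F (x, y, z) := by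
  rw [Measure.volume_eq_prod, lintegral_prod _ hF.aemeasurable]
  refine lintegral_congr fun x => ?_
  rw [Measure.volume_eq_prod, lintegral_prod _ (by fun_prop)]

/-- If `f² ≤ A(y)` and `g² ≤ B(x,z)`, then `‖fg‖²` is controlled by the integrals. -/
theorem lintegral_mul_le {f g : Torus L → ℝ≥0∞} (hf : Measurable f) (hg : Measurable g)
    {A : AddCircle L → ℝ≥0∞} {B : AddCircle L → UnitAddCircle → ℝ≥0∞}
    (hA : ∀ x y z, f (x, y, z) ≤ A y) (hB : ∀ x y z, g (x, y, z) ≤ B x z)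
    (hAm : Measurable A) (hBm : Measurable (Function.uncurry B)) :
    ∫⁻ q, f q * g q ≤ (∫⁻ y, A y) * ∫⁻ x, ∫⁻ z, B x z := by
  rw [lintegral_torus_iter (F := fun q => f q * g q) (hf.mul hg)]
  calc ∫⁻ x : AddCircle L, ∫⁻ y : AddCircle L, ∫⁻ z : UnitAddCircle, f (x, y, z) * g (x, y, z)
      ≤ ∫⁻ x : AddCircle L, ∫⁻ y : AddCircle L, ∫⁻ z : UnitAddCircle, A y * B x z := by
        gcongr <;> apply_assumption
    _ = (∫⁻ y, A y) * ∫⁻ x, ∫⁻ z, B x z := by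
        have hx : Measurable fun x => ∫⁻ z, B x z := hBm.lintegral_prod_right'
        rw [← lintegral_const_mul _ hx]
        refine lintegral_congr fun x => ?_
        rw [← lintegral_mul_const _ hAm]
        refine lintegral_congr fun y => ?_
        rw [lintegral_const_mul _ (by fun_prop)]

theorem IsTest.sq_le_x {f : Torus L → ℝ} (h : IsTest f) (x y : AddCircle L) (z : UnitAddCircle) :
    ENNReal.ofReal (f (x, y, z) ^ 2) ≤ ∫⁻ x' : AddCircle L, ENNReal.ofReal (L⁻¹ * f (x', y, z) ^ 2
      + 2 * |f (x', y, z) * RotConv.dirDeriv RotConv.ex f (x', y, z)|) :=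
  circle_sq_le (f := fun x => f (x, y, z)) (f' := fun x => RotConv.dirDeriv RotConv.ex f (x, y, z))
    (fun s => h.hasDerivAt_x y z s)
    (by have := h.continuous; fun_prop) (by have := (h.dirDeriv RotConv.ex).continuous; fun_prop) x

theorem IsTest.sq_le_y {f : Torus L → ℝ} (h : IsTest f) (x y : AddCircle L) (z : UnitAddCircle) :
    ENNReal.ofReal (f (x, y, z) ^ 2) ≤ ∫⁻ y' : AddCircle L, ENNReal.ofReal (L⁻¹ * f (x, y', z) ^ 2
      + 2 * |f (x, y', z) * RotConv.dirDeriv RotConv.ey f (x, y', z)|) :=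
  circle_sq_le (f := fun y => f (x, y, z)) (f' := fun y => RotConv.dirDeriv RotConv.ey f (x, y, z))
    (fun s => h.hasDerivAt_y x z s)
    (by have := h.continuous; fun_prop) (by have := (h.dirDeriv RotConv.ey).continuous; fun_prop) y

theorem ofReal_young (c a b : ℝ) (hc : 0 ≤ c) : ENNReal.ofReal (c * a ^ 2 + 2 * |a * b|) ≤
    ENNReal.ofReal (c + 1) * (ENNReal.ofReal (a ^ 2) + ENNReal.ofReal (b ^ 2)) := by
  rw [← ENNReal.ofReal_add (by positivity) (by positivity), ← ENNReal.ofReal_mul (by positivity)]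
  apply ENNReal.ofReal_le_ofReal
  rw [abs_mul]
  nlinarith [sq_nonneg (|a| - |b|), sq_abs a, sq_abs b, mul_nonneg hc (sq_nonneg b)]

/-- The suprema are distributed over the variables: f² is bounded by a function of y alone (supremum
in x and z), and g² by a function of (x, z) (supremum in y). The integral of the product then
factors. -/
theorem lintegral_prod_sq_le {f g : Torus L → ℝ} (hf : IsTest f) (hg : IsTest g) :
    ∫⁻ q, ENNReal.ofReal (f q ^ 2) * ENNReal.ofReal (g q ^ 2) ≤ ENNReal.ofReal (prodConst L) *
      (∫⁻ q, (ENNReal.ofReal (f q ^ 2) + ENNReal.ofReal (dirDeriv ez f q ^ 2)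
        + (ENNReal.ofReal (dirDeriv ex f q ^ 2)
          + ENNReal.ofReal (dirDeriv ez (dirDeriv ex f) q ^ 2)))) *
      ∫⁻ q, (ENNReal.ofReal (g q ^ 2) + ENNReal.ofReal (dirDeriv ey g q ^ 2)) := by
  have hL : 0 ≤ L⁻¹ := inv_nonneg.2 (L_pos (L := L)).le
  have c0 := hf.continuous
  have c1 := (hf.dirDeriv ez).continuous
  have c2 := (hf.dirDeriv ex).continuous
  have c3 := ((hf.dirDeriv ex).dirDeriv ez).continuous
  have c4 := hg.continuous
  have c5 := (hg.dirDeriv ey).continuous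
  set c := ENNReal.ofReal (L⁻¹ + 1) with hc
  set S : Torus L → ℝ≥0∞ := fun q => ENNReal.ofReal (f q ^ 2) + ENNReal.ofReal (dirDeriv ez f q ^ 2)
        + (ENNReal.ofReal (dirDeriv ex f q ^ 2)
          + ENNReal.ofReal (dirDeriv ez (dirDeriv ex f) q ^ 2)) with hS
  set R : Torus L → ℝ≥0∞ :=
    fun q => ENNReal.ofReal (g q ^ 2) + ENNReal.ofReal (dirDeriv ey g q ^ 2) with hR
  have mS : Measurable S := by fun_prop
  have mR : Measurable R := by fun_prop
  have hz : ∀ {ψ : Torus L → ℝ}, IsTest ψ → ∀ x y z, ENNReal.ofReal (ψ (x, y, z) ^ 2) ≤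
      2 * ∫⁻ z' : UnitAddCircle, (ENNReal.ofReal (ψ (x, y, z') ^ 2)
        + ENNReal.ofReal (dirDeriv ez ψ (x, y, z') ^ 2)) := by
    intro ψ hψ x y z
    refine (hψ.sq_le_z x y z).trans ?_
    have d0 := hψ.continuous
    have d1 := (hψ.dirDeriv ez).continuous
    rw [← lintegral_const_mul _ (by fun_prop)]
    refine lintegral_mono fun z' => ?_
    have := ofReal_young (1 : ℝ)⁻¹ (ψ (x, y, z')) (dirDeriv ez ψ (x, y, z')) (by norm_num)
    norm_num at this ⊢
    exact this
  have hA : ∀ x y z, ENNReal.ofReal (f (x, y, z) ^ 2) ≤ c * 2 * ∫⁻ x' : AddCircle L,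
      ∫⁻ z' : UnitAddCircle, S (x', y, z') := by
    intro x y z
    refine (hf.sq_le_x x y z).trans ?_
    have m0 : Measurable fun p : AddCircle L × UnitAddCircle => S (p.1, y, p.2) := by fun_prop
    rw [mul_assoc, ← lintegral_const_mul _ m0.lintegral_prod_right',
      ← lintegral_const_mul _ (m0.lintegral_prod_right'.const_mul _)]
    refine lintegral_mono fun x' => ?_
    refine (ofReal_young _ _ _ hL).trans ?_
    gcongr
    simp only [hS]
    rw [lintegral_add_left (by fun_prop), mul_add]
    exact add_le_add (hz hf x' y z) (hz (hf.dirDeriv ex) x' y z)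
  have hB : ∀ x y z, ENNReal.ofReal (g (x, y, z) ^ 2) ≤ c * ∫⁻ y' : AddCircle L, R (x, y', z) := by
    intro x y z
    refine (hg.sq_le_y x y z).trans ?_
    rw [← lintegral_const_mul _ (by fun_prop)]
    exact lintegral_mono fun y' => ofReal_young _ _ _ hL
  refine (lintegral_mul_le (f := fun q => ENNReal.ofReal (f q ^ 2))
    (g := fun q => ENNReal.ofReal (g q ^ 2)) (by fun_prop) (by fun_prop) hA hB
    ?_ ?_).trans ?_
  · refine Measurable.const_mul ?_ _
    have m1 : Measurable fun p : (AddCircle L × AddCircle L) × UnitAddCircle =>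
      S (p.1.2, p.1.1, p.2) := by fun_prop
    have m2 := m1.lintegral_prod_right' (ν := volume)
    exact m2.lintegral_prod_right' (ν := volume)
  · refine Measurable.const_mul ?_ _
    have m1 : Measurable fun p : (AddCircle L × UnitAddCircle) × AddCircle L =>
      R (p.1.1, p.2, p.1.2) := by fun_prop
    exact m1.lintegral_prod_right' (ν := volume)
  · have m1 : Measurable fun p : (AddCircle L × AddCircle L) × UnitAddCircle =>
      S (p.1.2, p.1.1, p.2) := by fun_prop
    have m2 := m1.lintegral_prod_right' (ν := volume)
    have m3 : Measurable fun p : (AddCircle L × UnitAddCircle) × AddCircle L =>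
      R (p.1.1, p.2, p.1.2) := by fun_prop
    have m4 := m3.lintegral_prod_right' (ν := volume)
    rw [lintegral_const_mul _ (m2.lintegral_prod_right' (ν := volume))]
    have e1 : ∫⁻ y : AddCircle L, ∫⁻ x : AddCircle L, ∫⁻ z : UnitAddCircle, S (x, y, z)
        = ∫⁻ q, S q := by
      rw [lintegral_torus_iter mS]
      exact lintegral_lintegral_swap m2.aemeasurable
    have e2 : ∫⁻ x : AddCircle L, ∫⁻ z : UnitAddCircle, c * ∫⁻ y : AddCircle L, R (x, y, z)
        = c * ∫⁻ q, R q := by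
      rw [lintegral_torus_iter mR, ← lintegral_const_mul]
      · refine lintegral_congr fun x => ?_
        rw [lintegral_const_mul]
        · congr 1
          have m5 : Measurable fun p : UnitAddCircle × AddCircle L => R (x, p.2, p.1) := by fun_prop
          exact lintegral_lintegral_swap m5.aemeasurable
        · exact m4.comp (by fun_prop : Measurable fun z : UnitAddCircle => (x, z))
      · have m6 : Measurable fun p : (AddCircle L × AddCircle L) × UnitAddCircle =>
          R (p.1.1, p.1.2, p.2) := by fun_prop
        exact m6.lintegral_prod_right'.lintegral_prod_right'
    rw [e1, e2]
    -- One factor c comes from each horizontal direction and the factor 2 from the vertical one,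
    -- where the period is 1.
    have e3 : ENNReal.ofReal (prodConst L) = c * 2 * c := by
      rw [hc, prodConst, ENNReal.ofReal_mul (by norm_num), sq, ENNReal.ofReal_mul (by positivity)]
      norm_num
      ring
    rw [e3]
    apply le_of_eq
    ring

end Slices

/-! ### The trilinear estimate. -/

section Trilinear

variable {L : ℝ} [Fact (0 < L)]

theorem lintegral_mul_le_sqrt {α : Type*} [MeasurableSpace α] {μ : Measure α} {f g : α → ℝ≥0∞}
    (hf : AEMeasurable f μ) (hg : AEMeasurable g μ) :
    ∫⁻ a, f a * g a ∂μ ≤ (∫⁻ a, f a ^ 2 ∂μ) ^ (1 / 2 : ℝ) * (∫⁻ a, g a ^ 2 ∂μ) ^ (1 / 2 : ℝ) := by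
  have := ENNReal.lintegral_mul_le_Lp_mul_Lq μ Real.HolderConjugate.two_two hf hg
  simpa using this

/-- On each slice Cauchy–Schwarz separates g from fh, and ∫f²h² splits by taking the supremum of f²
in x and of h² in y, as in Ladyzhenskaya's inequality. The factor of g is uniform in z, so a second
Cauchy–Schwarz in z finishes. -/
theorem lintegral_tri_le {f g h : Torus L → ℝ} (hf : IsTest f) (hg : Continuous g) (hh : IsTest h)
    {R : ℝ} (hR : ∀ z : UnitAddCircle, ∫ p : AddCircle L × AddCircle L, g (p.1, p.2, z) ^ 2 ≤ R) :
    ∫⁻ q, ENNReal.ofReal |f q * g q * h q| ≤ ENNReal.ofReal R ^ (1 / 2 : ℝ) *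
      ((∫⁻ q, ENNReal.ofReal (L⁻¹ * f q ^ 2 + 2 * |f q * dirDeriv ex f q|)) ^ (1 / 2 : ℝ) *
      (∫⁻ q, ENNReal.ofReal (L⁻¹ * h q ^ 2 + 2 * |h q * dirDeriv ey h q|)) ^ (1 / 2 : ℝ)) := by
  have c0 := hf.continuous
  have c1 := (hf.dirDeriv ex).continuous
  have c2 := hh.continuous
  have c3 := (hh.dirDeriv ey).continuous
  set A : Torus L → ℝ≥0∞ := fun q => ENNReal.ofReal (L⁻¹ * f q ^ 2 + 2 * |f q * dirDeriv ex f q|)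
    with hA
  set B : Torus L → ℝ≥0∞ := fun q => ENNReal.ofReal (L⁻¹ * h q ^ 2 + 2 * |h q * dirDeriv ey h q|)
    with hB
  have mA : Measurable A := by fun_prop
  have mB : Measurable B := by fun_prop
  set α : UnitAddCircle → ℝ≥0∞ := fun z => ∫⁻ p : AddCircle L × AddCircle L, A (p.1, p.2, z) with hα
  set β : UnitAddCircle → ℝ≥0∞ := fun z => ∫⁻ p : AddCircle L × AddCircle L, B (p.1, p.2, z) with hβ
  have mA' : Measurable fun p : UnitAddCircle × (AddCircle L × AddCircle L) =>
    A (p.2.1, p.2.2, p.1) := by fun_prop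
  have mB' : Measurable fun p : UnitAddCircle × (AddCircle L × AddCircle L) =>
    B (p.2.1, p.2.2, p.1) := by fun_prop
  have mα : Measurable α := mA'.lintegral_prod_right' (ν := volume)
  have mβ : Measurable β := mB'.lintegral_prod_right' (ν := volume)
  have hfh : ∀ z, ∫⁻ p : AddCircle L × AddCircle L,
      ENNReal.ofReal |f (p.1, p.2, z) * h (p.1, p.2, z)| ^ 2 ≤ α z * β z := by
    intro z
    have mAz : Measurable fun p : AddCircle L × AddCircle L => A (p.1, p.2, z) := by fun_prop
    have mAz' : Measurable fun p : AddCircle L × AddCircle L => A (p.2, p.1, z) := by fun_prop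
    have mBz : Measurable fun p : AddCircle L × AddCircle L => B (p.1, p.2, z) := by fun_prop
    have e1 : ∀ p : AddCircle L × AddCircle L,
        ENNReal.ofReal |f (p.1, p.2, z) * h (p.1, p.2, z)| ^ 2
        ≤ (∫⁻ x : AddCircle L, A (x, p.2, z)) * ∫⁻ y : AddCircle L, B (p.1, y, z) := by
      intro p
      rw [← ENNReal.ofReal_pow (abs_nonneg _), sq_abs, mul_pow, ENNReal.ofReal_mul (by positivity)]
      exact mul_le_mul' (hf.sq_le_x p.1 p.2 z) (hh.sq_le_y p.1 p.2 z)
    refine (lintegral_mono e1).trans (le_of_eq ?_)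
    have m1 := mAz'.lintegral_prod_right' (ν := volume)
    have m2 := mBz.lintegral_prod_right' (ν := volume)
    rw [Measure.volume_eq_prod, lintegral_prod (fun p : AddCircle L × AddCircle L =>
      (∫⁻ x : AddCircle L, A (x, p.2, z)) * ∫⁻ y : AddCircle L, B (p.1, y, z))
      ((m1.comp measurable_snd).mul (m2.comp measurable_fst)).aemeasurable]
    have e2 : α z = ∫⁻ y : AddCircle L, ∫⁻ x : AddCircle L, A (x, y, z) := by
      rw [hα]
      simp only
      rw [Measure.volume_eq_prod, lintegral_prod_symm _ mAz.aemeasurable]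
    have e3 : β z = ∫⁻ x : AddCircle L, ∫⁻ y : AddCircle L, B (x, y, z) := by
      rw [hβ]
      simp only
      rw [Measure.volume_eq_prod, lintegral_prod _ mBz.aemeasurable]
    rw [e2, e3, ← lintegral_const_mul _ m2]
    refine lintegral_congr fun x => ?_
    exact lintegral_mul_const (μ := volume) (∫⁻ y : AddCircle L, B (x, y, z)) m1
  have hz : ∀ z, ∫⁻ p : AddCircle L × AddCircle L,
      ENNReal.ofReal |f (p.1, p.2, z) * g (p.1, p.2, z) * h (p.1, p.2, z)|
      ≤ ENNReal.ofReal R ^ (1 / 2 : ℝ) * (α z ^ (1 / 2 : ℝ) * β z ^ (1 / 2 : ℝ)) := by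
    intro z
    have e1 : ∀ p : AddCircle L × AddCircle L,
        ENNReal.ofReal |f (p.1, p.2, z) * g (p.1, p.2, z) * h (p.1, p.2, z)|
        = ENNReal.ofReal |g (p.1, p.2, z)| * ENNReal.ofReal |f (p.1, p.2, z) * h (p.1, p.2, z)| := by
      intro p
      rw [← ENNReal.ofReal_mul (abs_nonneg _), ← abs_mul]
      congr 2
      ring
    simp only [e1]
    refine (lintegral_mul_le_sqrt (by fun_prop) (by fun_prop)).trans ?_
    rw [← ENNReal.mul_rpow_of_nonneg (α z) (β z) (by norm_num : (0 : ℝ) ≤ 1 / 2)]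
    gcongr
    · have e2 : ∀ p : AddCircle L × AddCircle L, ENNReal.ofReal |g (p.1, p.2, z)| ^ 2
          = ENNReal.ofReal (g (p.1, p.2, z) ^ 2) := by
        intro p
        rw [← ENNReal.ofReal_pow (abs_nonneg _), sq_abs]
      simp only [e2]
      rw [← ofReal_integral_eq_lintegral_ofReal (Continuous.integrable_hslice (by fun_prop))
        (Eventually.of_forall fun p => by positivity)]
      exact ENNReal.ofReal_le_ofReal (hR z)
    · exact hfh z
  rw [lintegral_torus (by fun_prop), lintegral_torus mA.aemeasurable, lintegral_torus mB.aemeasurable]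
  refine (lintegral_mono hz).trans ?_
  rw [lintegral_const_mul _ (by fun_prop)]
  gcongr
  refine (lintegral_mul_le_sqrt (by fun_prop) (by fun_prop)).trans (le_of_eq ?_)
  have : ∀ x : ℝ≥0∞, (x ^ (1 / 2 : ℝ)) ^ 2 = x := by
    intro x
    rw [← ENNReal.rpow_natCast, ← ENNReal.rpow_mul]
    norm_num
  simp only [this, hα, hβ]

end Trilinear

/-! ### Extension of the estimates to L² functions by Fatou's lemma. -/

section Approximation

variable {L : ℝ} [Fact (0 < L)]

theorem HasWeakDeriv.trunc {e : ℝ × ℝ × ℝ} {f g : L2 L} (h : HasWeakDeriv e f g)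
    (F : Finset (ℤ × ℤ × ℤ)) : HasWeakDeriv e (trunc F f) (trunc F g) := by
  have := (isTest_truncFun F f).hasWeakDeriv e
  simp only [dirDeriv_truncFun h F] at this
  exact this

theorem exists_subseq_ae (f : L2 L) {F : ℕ → Finset (ℤ × ℤ × ℤ)} (hF : Tendsto F atTop atTop) :
    ∃ n : ℕ → ℕ, StrictMono n ∧
      ∀ᵐ q, Tendsto (fun i => truncFun (F (n i)) f q) atTop (𝓝 (f q)) := by
  have h1 : Tendsto (fun i => trunc (F i) f) atTop (𝓝 f) := (tendsto_trunc f).comp hF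
  have h2 := tendstoInMeasure_of_tendsto_Lp h1
  obtain ⟨n, hn, h3⟩ := h2.exists_seq_tendsto_ae
  refine ⟨n, hn, ?_⟩
  filter_upwards [h3, ae_all_iff.2 fun i => coeFn_trunc (F (n i)) f] with q h4 h5
  simpa only [h5] using h4

theorem exists_seq_ae (f g h : L2 L) : ∃ F : ℕ → Finset (ℤ × ℤ × ℤ),
    ∀ᵐ q, Tendsto (fun i => truncFun (F i) f q) atTop (𝓝 (f q)) ∧
      Tendsto (fun i => truncFun (F i) g q) atTop (𝓝 (g q)) ∧
      Tendsto (fun i => truncFun (F i) h q) atTop (𝓝 (h q)) := by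
  obtain ⟨F, hF⟩ := exists_finset_seq
  obtain ⟨n, hn, h1⟩ := exists_subseq_ae f hF
  have hF1 := hF.comp hn.tendsto_atTop
  obtain ⟨m, hm, h2⟩ := exists_subseq_ae g hF1
  have hF2 := hF1.comp hm.tendsto_atTop
  obtain ⟨l, hl, h3⟩ := exists_subseq_ae h hF2
  refine ⟨fun i => F (n (m (l i))), ?_⟩
  filter_upwards [h1, h2, h3] with q h1 h2 h3
  exact ⟨(h1.comp hm.tendsto_atTop).comp hl.tendsto_atTop, h2.comp hl.tendsto_atTop, h3⟩

theorem lintegral_le_of_tendsto {α : Type*} [MeasurableSpace α] {μ : Measure α}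
    {f : ℕ → α → ℝ≥0∞} {g : α → ℝ≥0∞} {C : ℝ≥0∞} (hf : ∀ n, AEMeasurable (f n) μ)
    (hlim : ∀ᵐ a ∂μ, Tendsto (fun n => f n a) atTop (𝓝 (g a)))
    (hC : ∀ n, ∫⁻ a, f n a ∂μ ≤ C) : ∫⁻ a, g a ∂μ ≤ C := by
  have h1 : ∫⁻ a, g a ∂μ = ∫⁻ a, liminf (fun n => f n a) atTop ∂μ := by
    refine lintegral_congr_ae ?_
    filter_upwards [hlim] with a ha
    exact ha.liminf_eq.symm
  rw [h1]
  refine (lintegral_liminf_le' hf).trans ?_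
  exact liminf_le_of_frequently_le' (Eventually.of_forall hC).frequently

theorem norm_sq_trunc (F : Finset (ℤ × ℤ × ℤ)) (f : L2 L) :
    ∫⁻ q, ENNReal.ofReal (truncFun F f q ^ 2) ≤ ENNReal.ofReal (‖f‖ ^ 2) := by
  have hc := continuous_truncFun F f
  rw [← ofReal_integral_eq_lintegral_ofReal (Continuous.integrable_torus (by fun_prop))
    (Eventually.of_forall fun q => by positivity), ← norm_contLp_sq hc]
  apply ENNReal.ofReal_le_ofReal
  exact pow_le_pow_left₀ (norm_nonneg _) (norm_trunc_le F f) 2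

theorem lintegral_young_trunc {e : ℝ × ℝ × ℝ} {f fe : L2 L} (h : HasWeakDeriv e f fe)
    (F : Finset (ℤ × ℤ × ℤ)) :
    ∫⁻ q, ENNReal.ofReal (L⁻¹ * truncFun F f q ^ 2
      + 2 * |truncFun F f q * dirDeriv e (truncFun F f) q|)
      ≤ ENNReal.ofReal (L⁻¹ * ‖f‖ ^ 2 + 2 * ‖f‖ * ‖fe‖) := by
  have hL : 0 ≤ L⁻¹ := inv_nonneg.2 (L_pos (L := L)).le
  rw [dirDeriv_truncFun h]
  have hc := continuous_truncFun F f
  have hc' := continuous_truncFun F fe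
  rw [← ofReal_integral_eq_lintegral_ofReal (Continuous.integrable_torus (by fun_prop))
    (Eventually.of_forall fun q => by positivity)]
  apply ENNReal.ofReal_le_ofReal
  rw [integral_add (Continuous.integrable_torus (by fun_prop))
    (Continuous.integrable_torus (by fun_prop)), integral_const_mul, integral_const_mul,
    ← norm_contLp_sq hc]
  have h1 : ‖contLp _ hc‖ ≤ ‖f‖ := norm_trunc_le F f
  have h2 : ‖contLp _ hc'‖ ≤ ‖fe‖ := norm_trunc_le F fe
  have h3 := integral_abs_mul_le hc hc'
  rw [mul_assoc]
  gcongr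
  exact h3.trans (by gcongr)

theorem ofReal_sqrt_mul {a b c : ℝ} (ha : 0 ≤ a) (hb : 0 ≤ b) :
    ENNReal.ofReal a ^ (1 / 2 : ℝ) * (ENNReal.ofReal b ^ (1 / 2 : ℝ) * ENNReal.ofReal c ^ (1 / 2 : ℝ))
      = ENNReal.ofReal √(a * b * c) := by
  rw [← ENNReal.mul_rpow_of_nonneg _ _ (by norm_num : (0 : ℝ) ≤ 1 / 2),
    ← ENNReal.mul_rpow_of_nonneg _ _ (by norm_num : (0 : ℝ) ≤ 1 / 2),
    ← ENNReal.ofReal_mul hb, ← ENNReal.ofReal_mul ha, ← mul_assoc, Real.sqrt_eq_rpow]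
  by_cases hc : 0 ≤ c
  · rw [ENNReal.ofReal_rpow_of_nonneg (by positivity) (by norm_num)]
  · have h0 : a * b * c ≤ 0 := mul_nonpos_of_nonneg_of_nonpos (by positivity) (by linarith)
    rw [ENNReal.ofReal_of_nonpos h0, ← Real.sqrt_eq_rpow, Real.sqrt_eq_zero_of_nonpos h0]
    simp

/-- The supremum in the vertical variable of the horizontal Dirichlet integral is controlled by
this quantity. -/
def vsup (gx gy gz l : L2 L) : ℝ := ‖gx‖ ^ 2 + ‖gy‖ ^ 2 + 2 * ‖l‖ * ‖gz‖

theorem vsup_nonneg (gx gy gz l : L2 L) : 0 ≤ vsup gx gy gz l := by unfold vsup; positivity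

theorem hdot_truncFun_sq_le {g gx gy gz l : L2 L} (hx : HasWeakDeriv ex g gx)
    (hy : HasWeakDeriv ey g gy) (hz : HasWeakDeriv ez g gz) (hl : HasHLaplacian g l)
    (F : Finset (ℤ × ℤ × ℤ)) (z : UnitAddCircle) :
    ∫ p : AddCircle L × AddCircle L, (truncFun F gx (p.1, p.2, z) ^ 2
      + truncFun F gy (p.1, p.2, z) ^ 2) ≤ vsup gx gy gz l := by
  obtain ⟨gxx, hxx⟩ := hl.weaklyDiff (Or.inl rfl) (Or.inl rfl) hx
  obtain ⟨gyy, hyy⟩ := hl.weaklyDiff (Or.inr rfl) (Or.inr rfl) hy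
  have hlap : ∀ q, truncFun F l q = dirDeriv ex (dirDeriv ex (truncFun F g)) q
      + dirDeriv ey (dirDeriv ey (truncFun F g)) q := by
    intro q
    rw [dirDeriv_truncFun hx, dirDeriv_truncFun hy, dirDeriv_truncFun hxx, dirDeriv_truncFun hyy,
      hl.eq_add hx hy hxx hyy]
    simp only [truncFun, map_add, mul_add, add_mul, Complex.add_re, Finset.sum_add_distrib]
  have := hdot_grad_sq_le (isTest_truncFun F g) z (continuous_truncFun F l) hlap
  simp only [dirDeriv_truncFun hx, dirDeriv_truncFun hy, dirDeriv_truncFun hz] at this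
  refine this.trans ?_
  have h1 : ‖contLp _ (continuous_truncFun F gx)‖ ≤ ‖gx‖ := norm_trunc_le F gx
  have h2 : ‖contLp _ (continuous_truncFun F gy)‖ ≤ ‖gy‖ := norm_trunc_le F gy
  have h3 : ‖contLp _ (continuous_truncFun F gz)‖ ≤ ‖gz‖ := norm_trunc_le F gz
  have h4 : ‖contLp _ (continuous_truncFun F l)‖ ≤ ‖l‖ := norm_trunc_le F l
  unfold vsup
  gcongr

/-- The bound on `f` in one horizontal direction. -/
def hbound (f fe : L2 L) : ℝ := L⁻¹ * ‖f‖ ^ 2 + 2 * ‖f‖ * ‖fe‖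

theorem hbound_nonneg (f fe : L2 L) : 0 ≤ hbound f fe := by
  have hL : 0 ≤ L⁻¹ := inv_nonneg.2 (L_pos (L := L)).le
  unfold hbound; positivity

/-- The factor measured uniformly in z is a horizontal derivative of g. The bound does not involve
the index set, because truncation does not increase norms and commutes with derivatives. -/
theorem lintegral_tri_trunc_le {g gx gy gz l g' a ax b b' : L2 L} (hx : HasWeakDeriv ex g gx)
    (hy : HasWeakDeriv ey g gy) (hz : HasWeakDeriv ez g gz) (hl : HasHLaplacian g l)
    (hg' : g' = gx ∨ g' = gy) (ha : HasWeakDeriv ex a ax) (hb : HasWeakDeriv ey b b')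
    (F : Finset (ℤ × ℤ × ℤ)) :
    ∫⁻ q, ENNReal.ofReal |truncFun F a q * truncFun F g' q * truncFun F b q|
      ≤ ENNReal.ofReal √(vsup gx gy gz l * hbound a ax * hbound b b') := by
  have cx := continuous_truncFun F gx
  have cy := continuous_truncFun F gy
  have hR : ∀ z : UnitAddCircle, ∫ p : AddCircle L × AddCircle L, truncFun F g' (p.1, p.2, z) ^ 2
      ≤ vsup gx gy gz l := by
    intro z
    refine le_trans ?_ (hdot_truncFun_sq_le hx hy hz hl F z)
    refine integral_mono (Continuous.integrable_hslice ?_)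
      (Continuous.integrable_hslice (by fun_prop)) fun p => ?_
    · have := continuous_truncFun F g'
      fun_prop
    · rcases hg' with rfl | rfl
      · exact le_add_of_nonneg_right (sq_nonneg _)
      · exact le_add_of_nonneg_left (sq_nonneg _)
  refine (lintegral_tri_le (isTest_truncFun F a) (continuous_truncFun F g') (isTest_truncFun F b)
    hR).trans ?_
  rw [← ofReal_sqrt_mul (vsup_nonneg _ _ _ _) (hbound_nonneg a ax)]
  gcongr
  · exact lintegral_young_trunc ha F
  · exact lintegral_young_trunc hb F

theorem lintegral_tri_L2_le {g gx gy gz l g' a ax b b' : L2 L} (hx : HasWeakDeriv ex g gx)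
    (hy : HasWeakDeriv ey g gy) (hz : HasWeakDeriv ez g gz) (hl : HasHLaplacian g l)
    (hg' : g' = gx ∨ g' = gy) (ha : HasWeakDeriv ex a ax) (hb : HasWeakDeriv ey b b') :
    ∫⁻ q, ENNReal.ofReal |a q * g' q * b q|
      ≤ ENNReal.ofReal √(vsup gx gy gz l * hbound a ax * hbound b b') := by
  obtain ⟨F, hF⟩ := exists_seq_ae a g' b
  refine lintegral_le_of_tendsto (f := fun n q => ENNReal.ofReal
    |truncFun (F n) a q * truncFun (F n) g' q * truncFun (F n) b q|) (fun n => ?_) ?_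
    fun n => lintegral_tri_trunc_le hx hy hz hl hg' ha hb (F n)
  · have h1 := continuous_truncFun (F n) a
    have h2 := continuous_truncFun (F n) g'
    have h3 := continuous_truncFun (F n) b
    fun_prop
  · filter_upwards [hF] with q ⟨h1, h2, h3⟩
    exact (ENNReal.continuous_ofReal.tendsto _).comp ((h1.mul h2).mul h3).abs

/-- The regularity of the advecting velocity in the product estimate. -/
structure RegXZ (u : L2 L) : Prop where
  x : WeaklyDiff ex u
  z : WeaklyDiff ez u
  xz : WeaklyDiff ez (wderiv ex u)

/-- The norm of the advecting velocity in the product estimate. -/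
def nXZ (u : L2 L) : ℝ :=
  ‖u‖ ^ 2 + ‖wderiv ez u‖ ^ 2 + (‖wderiv ex u‖ ^ 2 + ‖wderiv ez (wderiv ex u)‖ ^ 2)

/-- The norm of the second factor in the product estimate. -/
def nY (g : L2 L) : ℝ := ‖g‖ ^ 2 + ‖wderiv ey g‖ ^ 2

/-- This puts u·g in L² at exactly the regularity available for a velocity component and a
horizontal derivative of a scalar. The same bound gives the continuity of the product used in every
passage to the limit. -/
theorem lintegral_prod_L2_le {u g : L2 L} (hu : RegXZ u) (hg : WeaklyDiff ey g) :
    ∫⁻ q, ENNReal.ofReal ((u q * g q) ^ 2) ≤ ENNReal.ofReal (prodConst L * nXZ u * nY g) := by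
  obtain ⟨F, hF⟩ := exists_seq_ae u g g
  refine lintegral_le_of_tendsto (f := fun n q => ENNReal.ofReal
    ((truncFun (F n) u q * truncFun (F n) g q) ^ 2)) (fun n => ?_) ?_ fun n => ?_
  · have h1 := continuous_truncFun (F n) u
    have h2 := continuous_truncFun (F n) g
    fun_prop
  · filter_upwards [hF] with q ⟨h1, h2, h3⟩
    exact (ENNReal.continuous_ofReal.tendsto _).comp ((h1.mul h2).pow 2)
  · simp only [mul_pow, ENNReal.ofReal_mul (sq_nonneg _)]
    refine (lintegral_prod_sq_le (isTest_truncFun (F n) u) (isTest_truncFun (F n) g)).trans ?_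
    have hx := hu.x.hasWeakDeriv
    have hz := hu.z.hasWeakDeriv
    have hxz := hu.xz.hasWeakDeriv
    have hy := hg.hasWeakDeriv
    simp only [dirDeriv_truncFun hx, dirDeriv_truncFun hz, dirDeriv_truncFun hxz,
      dirDeriv_truncFun hy]
    have c0 := continuous_truncFun (F n) u
    have c1 := continuous_truncFun (F n) (wderiv ex u)
    have c2 := continuous_truncFun (F n) (wderiv ez u)
    have c3 := continuous_truncFun (F n) (wderiv ez (wderiv ex u))
    have c4 := continuous_truncFun (F n) g
    have c5 := continuous_truncFun (F n) (wderiv ey g)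
    rw [lintegral_add_left (by fun_prop), lintegral_add_left (by fun_prop),
      lintegral_add_left (by fun_prop), lintegral_add_left (by fun_prop),
      ENNReal.ofReal_mul (mul_nonneg prodConst_nonneg (by unfold nXZ; positivity)),
      ENNReal.ofReal_mul prodConst_nonneg, nXZ, nY,
      ENNReal.ofReal_add (by positivity) (by positivity),
      ENNReal.ofReal_add (by positivity) (by positivity),
      ENNReal.ofReal_add (by positivity) (by positivity),
      ENNReal.ofReal_add (by positivity) (by positivity)]
    gcongr <;> exact norm_sq_trunc _ _

theorem memLp_mul {u g : L2 L} (hu : RegXZ u) (hg : WeaklyDiff ey g) :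
    MemLp (fun q => u q * g q) 2 (volume : Measure (Torus L)) := by
  refine (memLp_two_iff_integrable_sq ((Lp.aestronglyMeasurable u).mul
    (Lp.aestronglyMeasurable g))).2 ⟨?_, ?_⟩
  · exact ((Lp.aestronglyMeasurable u).mul (Lp.aestronglyMeasurable g)).pow 2
  · rw [hasFiniteIntegral_iff_ofReal (Eventually.of_forall fun q => sq_nonneg _)]
    exact (lintegral_prod_L2_le hu hg).trans_lt ENNReal.ofReal_lt_top

open Classical in
/-- The product of two functions, if it is square integrable. -/
def mulL (u g : L2 L) : L2 L :=
  if h : MemLp (fun q => u q * g q) 2 (volume : Measure (Torus L)) then h.toLp else 0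

theorem coeFn_mulL_of_memLp {u g : L2 L}
    (h : MemLp (fun q => u q * g q) 2 (volume : Measure (Torus L))) :
    mulL u g =ᵐ[volume] fun q => u q * g q := by
  rw [mulL, dif_pos h]
  exact h.coeFn_toLp

theorem coeFn_mulL {u g : L2 L} (hu : RegXZ u) (hg : WeaklyDiff ey g) :
    mulL u g =ᵐ[volume] fun q => u q * g q := coeFn_mulL_of_memLp (memLp_mul hu hg)

theorem norm_sq_eq_integral (f : L2 L) : ‖f‖ ^ 2 = ∫ q, f q ^ 2 := by
  rw [← real_inner_self_eq_norm_sq, inner_eq_integral]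
  simp only [sq]

theorem norm_mulL_sq_le {u g : L2 L} (hu : RegXZ u) (hg : WeaklyDiff ey g) :
    ‖mulL u g‖ ^ 2 ≤ prodConst L * nXZ u * nY g := by
  have h1 := lintegral_prod_L2_le hu hg
  have h2 : Integrable fun q => (u q * g q) ^ 2 := (memLp_two_iff_integrable_sq ((Lp.aestronglyMeasurable u).mul
    (Lp.aestronglyMeasurable g))).1 (memLp_mul hu hg)
  have h3 : ‖mulL u g‖ ^ 2 = ∫ q, (u q * g q) ^ 2 := by
    rw [norm_sq_eq_integral]
    refine integral_congr_ae ?_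
    filter_upwards [coeFn_mulL hu hg] with q hq
    rw [hq]
  rw [h3]
  rw [← ofReal_integral_eq_lintegral_ofReal h2 (Eventually.of_forall fun q => sq_nonneg _)] at h1
  refine (ENNReal.ofReal_le_ofReal_iff ?_).1 h1
  exact mul_nonneg (mul_nonneg prodConst_nonneg (by unfold nXZ; positivity))
    (by unfold nY; positivity)

end Approximation

/-! ### Products, skew symmetry of advection, and its pairing with the Laplacian. -/

section Products

variable {L : ℝ} [Fact (0 < L)]

theorem WeaklyDiff.sub {e : ℝ × ℝ × ℝ} {f g : L2 L} (hf : WeaklyDiff e f) (hg : WeaklyDiff e g) :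
    WeaklyDiff e (f - g) := ⟨_, hf.hasWeakDeriv.sub hg.hasWeakDeriv⟩

theorem wderiv_sub {e : ℝ × ℝ × ℝ} {f g : L2 L} (hf : WeaklyDiff e f) (hg : WeaklyDiff e g) :
    wderiv e (f - g) = wderiv e f - wderiv e g :=
  (hf.hasWeakDeriv.sub hg.hasWeakDeriv).wderiv_eq

theorem WeaklyDiff.trunc {e : ℝ × ℝ × ℝ} {f : L2 L} (hf : WeaklyDiff e f)
    (F : Finset (ℤ × ℤ × ℤ)) : WeaklyDiff e (trunc F f) := ⟨_, hf.hasWeakDeriv.trunc F⟩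

theorem wderiv_trunc {e : ℝ × ℝ × ℝ} {f : L2 L} (hf : WeaklyDiff e f)
    (F : Finset (ℤ × ℤ × ℤ)) : wderiv e (trunc F f) = trunc F (wderiv e f) :=
  (hf.hasWeakDeriv.trunc F).wderiv_eq

theorem RegXZ.sub {u v : L2 L} (hu : RegXZ u) (hv : RegXZ v) : RegXZ (u - v) where
  x := hu.x.sub hv.x
  z := hu.z.sub hv.z
  xz := by rw [wderiv_sub hu.x hv.x]; exact hu.xz.sub hv.xz

theorem RegXZ.trunc {u : L2 L} (hu : RegXZ u) (F : Finset (ℤ × ℤ × ℤ)) : RegXZ (trunc F u) where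
  x := hu.x.trunc F
  z := hu.z.trunc F
  xz := by rw [wderiv_trunc hu.x]; exact hu.xz.trunc F

theorem mulL_sub_left {u v g : L2 L} (hu : RegXZ u) (hv : RegXZ v) (hg : WeaklyDiff ey g) :
    mulL (u - v) g = mulL u g - mulL v g := by
  apply Lp.ext
  filter_upwards [coeFn_mulL (hu.sub hv) hg, coeFn_mulL hu hg, coeFn_mulL hv hg,
    Lp.coeFn_sub u v, Lp.coeFn_sub (mulL u g) (mulL v g)] with q h1 h2 h3 h4 h5
  rw [h1, h5, Pi.sub_apply, h2, h3, h4, Pi.sub_apply, sub_mul]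

theorem mulL_sub_right {u g h : L2 L} (hu : RegXZ u) (hg : WeaklyDiff ey g)
    (hh : WeaklyDiff ey h) : mulL u (g - h) = mulL u g - mulL u h := by
  apply Lp.ext
  filter_upwards [coeFn_mulL hu (hg.sub hh), coeFn_mulL hu hg, coeFn_mulL hu hh,
    Lp.coeFn_sub g h, Lp.coeFn_sub (mulL u g) (mulL u h)] with q h1 h2 h3 h4 h5
  rw [h1, h5, Pi.sub_apply, h2, h3, h4, Pi.sub_apply, mul_sub]

theorem tendsto_of_norm_sq_le {ι : Type*} {l : Filter ι} {f : ι → L2 L} {g : L2 L} {r : ι → ℝ}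
    (h : ∀ i, ‖f i - g‖ ^ 2 ≤ r i) (hr : Tendsto r l (𝓝 0)) : Tendsto f l (𝓝 g) := by
  rw [tendsto_iff_norm_sub_tendsto_zero]
  have h1 : Tendsto (fun i => ‖f i - g‖ ^ 2) l (𝓝 0) :=
    squeeze_zero (fun i => by positivity) h hr
  have := (Real.continuous_sqrt.tendsto 0).comp h1
  simpa [Function.comp_def, Real.sqrt_sq (norm_nonneg _)] using this

/-- Expand the product around the limit; each of the three error terms is controlled by
`norm_mulL_sq_le`. -/
theorem tendsto_mulL {ι : Type*} {l : Filter ι} {u g : L2 L} {ui gi : ι → L2 L} (hu : RegXZ u)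
    (hg : WeaklyDiff ey g) (hui : ∀ i, RegXZ (ui i)) (hgi : ∀ i, WeaklyDiff ey (gi i))
    (hnu : Tendsto (fun i => nXZ (ui i - u)) l (𝓝 0))
    (hng : Tendsto (fun i => nY (gi i - g)) l (𝓝 0)) :
    Tendsto (fun i => mulL (ui i) (gi i)) l (𝓝 (mulL u g)) := by
  have e : ∀ i, mulL (ui i) (gi i) = mulL (ui i - u) (gi i - g) + mulL (ui i - u) g
      + mulL u (gi i - g) + mulL u g := by
    intro i
    rw [mulL_sub_right ((hui i).sub hu) (hgi i) hg, mulL_sub_left (hui i) hu (hgi i),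
      mulL_sub_left (hui i) hu hg, mulL_sub_right hu (hgi i) hg]
    abel
  simp only [e]
  have h1 : Tendsto (fun i => mulL (ui i - u) (gi i - g)) l (𝓝 0) := by
    refine tendsto_of_norm_sq_le (fun i => ?_) (r := fun i =>
      prodConst L * nXZ (ui i - u) * nY (gi i - g)) ?_
    · rw [sub_zero]; exact norm_mulL_sq_le ((hui i).sub hu) ((hgi i).sub hg)
    · simpa using (hnu.const_mul (prodConst L)).mul hng
  have h2 : Tendsto (fun i => mulL (ui i - u) g) l (𝓝 0) := by
    refine tendsto_of_norm_sq_le (fun i => ?_) (r := fun i =>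
      prodConst L * nXZ (ui i - u) * nY g) ?_
    · rw [sub_zero]; exact norm_mulL_sq_le ((hui i).sub hu) hg
    · simpa using (hnu.const_mul (prodConst L)).mul_const (nY g)
  have h3 : Tendsto (fun i => mulL u (gi i - g)) l (𝓝 0) := by
    refine tendsto_of_norm_sq_le (fun i => ?_) (r := fun i =>
      prodConst L * nXZ u * nY (gi i - g)) ?_
    · rw [sub_zero]; exact norm_mulL_sq_le hu ((hgi i).sub hg)
    · simpa using hng.const_mul (prodConst L * nXZ u)
  simpa using ((h1.add h2).add h3).add_const (mulL u g)

theorem tendsto_norm_trunc_sub (f : L2 L) :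
    Tendsto (fun F => ‖trunc F f - f‖ ^ 2) atTop (𝓝 0) := by
  have := ((tendsto_iff_norm_sub_tendsto_zero.1 (tendsto_trunc f)).pow 2)
  simpa using this

theorem tendsto_nXZ_trunc {u : L2 L} (hu : RegXZ u) :
    Tendsto (fun F => nXZ (trunc F u - u)) atTop (𝓝 0) := by
  have e : ∀ F, nXZ (trunc F u - u) = ‖trunc F u - u‖ ^ 2
      + ‖trunc F (wderiv ez u) - wderiv ez u‖ ^ 2
      + (‖trunc F (wderiv ex u) - wderiv ex u‖ ^ 2
        + ‖trunc F (wderiv ez (wderiv ex u)) - wderiv ez (wderiv ex u)‖ ^ 2) := by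
    intro F
    rw [nXZ, wderiv_sub (hu.z.trunc F) hu.z, wderiv_sub (hu.x.trunc F) hu.x, wderiv_trunc hu.z,
      wderiv_trunc hu.x, wderiv_sub (hu.xz.trunc F) hu.xz, wderiv_trunc hu.xz]
  simp only [e]
  simpa using ((tendsto_norm_trunc_sub u).add (tendsto_norm_trunc_sub (wderiv ez u))).add
    ((tendsto_norm_trunc_sub (wderiv ex u)).add
      (tendsto_norm_trunc_sub (wderiv ez (wderiv ex u))))

theorem tendsto_nY_trunc {g : L2 L} (hg : WeaklyDiff ey g) :
    Tendsto (fun F => nY (trunc F g - g)) atTop (𝓝 0) := by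
  have e : ∀ F, nY (trunc F g - g) = ‖trunc F g - g‖ ^ 2
      + ‖trunc F (wderiv ey g) - wderiv ey g‖ ^ 2 := by
    intro F
    rw [nY, wderiv_sub (hg.trunc F) hg, wderiv_trunc hg]
  simp only [e]
  simpa using (tendsto_norm_trunc_sub g).add (tendsto_norm_trunc_sub (wderiv ey g))

theorem tendsto_mulL_trunc {u g : L2 L} (hu : RegXZ u) (hg : WeaklyDiff ey g) :
    Tendsto (fun F => mulL (trunc F u) (trunc F g)) atTop (𝓝 (mulL u g)) :=
  tendsto_mulL hu hg (fun F => hu.trunc F) (fun F => hg.trunc F) (tendsto_nXZ_trunc hu)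
    (tendsto_nY_trunc hg)

theorem tendsto_mulL_trunc_left {u g : L2 L} (hu : RegXZ u) (hg : WeaklyDiff ey g) :
    Tendsto (fun F => mulL (trunc F u) g) atTop (𝓝 (mulL u g)) :=
  tendsto_mulL hu hg (fun F => hu.trunc F) (fun _ => hg) (tendsto_nXZ_trunc hu)
    (by
      have : nY (0 : L2 L) = 0 := by simp [nY, (HasWeakDeriv.zero (L := L) ey).wderiv_eq]
      simp [this])

theorem mulL_trunc (F : Finset (ℤ × ℤ × ℤ)) (u g : L2 L) : mulL (trunc F u) (trunc F g) =
    contLp (fun q => truncFun F u q * truncFun F g q)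
      ((continuous_truncFun F u).mul (continuous_truncFun F g)) := by
  have hc := (continuous_truncFun F u).mul (continuous_truncFun F g)
  have hae : (fun q => trunc F u q * trunc F g q) =ᵐ[volume]
      fun q => truncFun F u q * truncFun F g q := by
    filter_upwards [coeFn_trunc F u, coeFn_trunc F g] with q h1 h2
    rw [h1, h2]
  have hm : MemLp (fun q => trunc F u q * trunc F g q) 2 (volume : Measure (Torus L)) :=
    (memLp_congr_ae hae).2 hc.memLp_torus
  apply Lp.ext
  exact (coeFn_mulL_of_memLp hm).trans (hae.trans (coeFn_contLp hc).symm)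

theorem inner_mulL_comm {u f g : L2 L} (hf : MemLp (fun q => u q * f q) 2 (volume : Measure (Torus L)))
    (hg : MemLp (fun q => u q * g q) 2 (volume : Measure (Torus L))) :
    inner ℝ f (mulL u g) = inner ℝ (mulL u f) g := by
  rw [inner_eq_integral, inner_eq_integral]
  refine integral_congr_ae ?_
  filter_upwards [coeFn_mulL_of_memLp hf, coeFn_mulL_of_memLp hg] with q h1 h2
  rw [h1, h2]; ring

theorem truncFun_add (F : Finset (ℤ × ℤ × ℤ)) (f g : L2 L) (q : Torus L) :
    truncFun F (f + g) q = truncFun F f q + truncFun F g q := by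
  simp only [truncFun, map_add, mul_add, add_mul, Complex.add_re, Finset.sum_add_distrib]

theorem truncFun_zero (F : Finset (ℤ × ℤ × ℤ)) (q : Torus L) : truncFun F (0 : L2 L) q = 0 := by
  simp [truncFun]

theorem inner_trunc (F : Finset (ℤ × ℤ × ℤ)) (f g : L2 L) :
    inner ℝ f (trunc F g) = ∫ q, f q * truncFun F g q :=
  inner_contLp f (continuous_truncFun F g)

/-- Advection by a divergence free field is skew symmetric. -/
theorem skew {u v f g : L2 L} (hu : RegXZ u) (hv : RegXZ v) (hvy : WeaklyDiff ey v)
    (hdiv : wderiv ex u + wderiv ey v = 0) (hfx : WeaklyDiff ex f) (hfy : WeaklyDiff ey f)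
    (hgx : WeaklyDiff ex g) (hgy : WeaklyDiff ey g) :
    inner ℝ (wderiv ex f) (mulL u g) + inner ℝ (wderiv ey f) (mulL v g)
      = -(inner ℝ (mulL u f) (wderiv ex g) + inner ℝ (mulL v f) (wderiv ey g)) := by
  -- The velocity and g are truncated, f stays rough. The products of truncations are test
  -- functions, so the weak derivatives of f apply to them, and the truncated velocity is still
  -- exactly divergence free.
  have l1 := ((tendsto_const_nhds (x := wderiv ex f)).inner (𝕜 := ℝ)
    (tendsto_mulL_trunc hu hgy)).add
    ((tendsto_const_nhds (x := wderiv ey f)).inner (𝕜 := ℝ) (tendsto_mulL_trunc hv hgy))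
  have l2 := ((((tendsto_mulL_trunc_left hu hfy).inner (𝕜 := ℝ) (tendsto_trunc (wderiv ex g))).add
    ((tendsto_mulL_trunc_left hv hfy).inner (𝕜 := ℝ) (tendsto_trunc (wderiv ey g))))).neg
  refine tendsto_nhds_unique l1 (l2.congr fun F => ?_)
  set U := truncFun F u
  set V := truncFun F v
  set G := truncFun F g
  have tU : IsTest U := isTest_truncFun F u
  have tV : IsTest V := isTest_truncFun F v
  have tG : IsTest G := isTest_truncFun F g
  have dU : dirDeriv ex U = truncFun F (wderiv ex u) := dirDeriv_truncFun hu.x.hasWeakDeriv F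
  have dV : dirDeriv ey V = truncFun F (wderiv ey v) := dirDeriv_truncFun hvy.hasWeakDeriv F
  have dGx : dirDeriv ex G = truncFun F (wderiv ex g) := dirDeriv_truncFun hgx.hasWeakDeriv F
  have dGy : dirDeriv ey G = truncFun F (wderiv ey g) := dirDeriv_truncFun hgy.hasWeakDeriv F
  have h1 := hfx.hasWeakDeriv _ (tU.mul tG)
  have h2 := hfy.hasWeakDeriv _ (tV.mul tG)
  simp only [dirDeriv_mul tU tG] at h1
  simp only [dirDeriv_mul tV tG] at h2
  rw [mulL_trunc, mulL_trunc, inner_contLp, inner_contLp]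
  have e1 : inner ℝ (mulL (trunc F u) f) (trunc F (wderiv ex g)) = ∫ q, f q * (U q * dirDeriv ex G q) := by
    rw [inner_trunc, dGx]
    refine integral_congr_ae ?_
    filter_upwards [coeFn_mulL (hu.trunc F) hfy, coeFn_trunc F u] with q h3 h4
    rw [h3, h4]; ring
  have e2 : inner ℝ (mulL (trunc F v) f) (trunc F (wderiv ey g)) = ∫ q, f q * (V q * dirDeriv ey G q) := by
    rw [inner_trunc, dGy]
    refine integral_congr_ae ?_
    filter_upwards [coeFn_mulL (hv.trunc F) hfy, coeFn_trunc F v] with q h3 h4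
    rw [h3, h4]; ring
  rw [e1, e2]
  have i1 := integrable_mul_test f (tU.mul (tG.dirDeriv ex))
  have i2 := integrable_mul_test f (tV.mul (tG.dirDeriv ey))
  have i3 := integrable_mul_test f ((tU.dirDeriv ex).mul tG)
  have i4 := integrable_mul_test f ((tV.dirDeriv ey).mul tG)
  have s1 : ∫ q, f q * (dirDeriv ex U q * G q + U q * dirDeriv ex G q)
      = (∫ q, f q * (dirDeriv ex U q * G q)) + ∫ q, f q * (U q * dirDeriv ex G q) := by
    rw [← integral_add i3 i1]; simp only [mul_add]
  have s2 : ∫ q, f q * (dirDeriv ey V q * G q + V q * dirDeriv ey G q)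
      = (∫ q, f q * (dirDeriv ey V q * G q)) + ∫ q, f q * (V q * dirDeriv ey G q) := by
    rw [← integral_add i4 i2]; simp only [mul_add]
  have s3 : (∫ q, f q * (dirDeriv ex U q * G q)) + (∫ q, f q * (dirDeriv ey V q * G q)) = 0 := by
    rw [← integral_add i3 i4]
    refine integral_eq_zero_of_ae (Eventually.of_forall fun q => ?_)
    have : dirDeriv ex U q + dirDeriv ey V q = 0 := by
      rw [dU, dV, ← truncFun_add, hdiv, truncFun_zero]
    simp only [Pi.zero_apply]
    linear_combination (f q * G q) * this
  rw [s1] at h1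
  rw [s2] at h2
  linarith

/-- The advection term `u f_x + v f_y`. -/
def adv (u v f : L2 L) : L2 L := mulL u (wderiv ex f) + mulL v (wderiv ey f)

/-- Two horizontal derivatives in `L²`. -/
structure Reg2 (f : L2 L) : Prop where
  x : WeaklyDiff ex f
  y : WeaklyDiff ey f
  xy : WeaklyDiff ey (wderiv ex f)
  yy : WeaklyDiff ey (wderiv ey f)

theorem HasHLaplacian.reg2 {f l : L2 L} (h : HasHLaplacian f l) (hx : WeaklyDiff ex f)
    (hy : WeaklyDiff ey f) : Reg2 f where
  x := hx
  y := hy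
  xy := h.weaklyDiff (Or.inl rfl) (Or.inr rfl) hx.hasWeakDeriv
  yy := h.weaklyDiff (Or.inr rfl) (Or.inr rfl) hy.hasWeakDeriv

theorem coeFn_adv {u v f : L2 L} (hu : RegXZ u) (hv : RegXZ v) (hf : Reg2 f) :
    adv u v f =ᵐ[volume] fun q => u q * wderiv ex f q + v q * wderiv ey f q := by
  filter_upwards [coeFn_mulL hu hf.xy, coeFn_mulL hv hf.yy,
    Lp.coeFn_add (mulL u (wderiv ex f)) (mulL v (wderiv ey f))] with q h1 h2 h3
  rw [adv, h3, Pi.add_apply, h1, h2]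

theorem tendsto_adv {u v f : L2 L} (hu : RegXZ u) (hv : RegXZ v) (hf : Reg2 f) :
    Tendsto (fun F => adv (trunc F u) (trunc F v) (trunc F f)) atTop (𝓝 (adv u v f)) := by
  simp only [adv, wderiv_trunc hf.x, wderiv_trunc hf.y]
  exact (tendsto_mulL_trunc hu hf.xy).add (tendsto_mulL_trunc hv hf.yy)

theorem continuous_advFun (F : Finset (ℤ × ℤ × ℤ)) (u v f g : L2 L) :
    Continuous fun q => truncFun F u q * truncFun F f q + truncFun F v q * truncFun F g q := by
  have h1 := continuous_truncFun F u
  have h2 := continuous_truncFun F v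
  have h3 := continuous_truncFun F f
  have h4 := continuous_truncFun F g
  fun_prop

theorem adv_trunc {f : L2 L} (u v : L2 L) (hf : Reg2 f) (F : Finset (ℤ × ℤ × ℤ)) :
    adv (trunc F u) (trunc F v) (trunc F f) = contLp (fun q => truncFun F u q *
      truncFun F (wderiv ex f) q + truncFun F v q * truncFun F (wderiv ey f) q)
      (continuous_advFun F u v _ _) := by
  rw [adv, wderiv_trunc hf.x, wderiv_trunc hf.y, mulL_trunc, mulL_trunc]
  rfl

theorem integral_abs_le_of_lintegral {f : Torus L → ℝ} (hf : Continuous f) {r : ℝ} (hr : 0 ≤ r)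
    (h : ∫⁻ q, ENNReal.ofReal |f q| ≤ ENNReal.ofReal r) : ∫ q, |f q| ≤ r := by
  rw [← ofReal_integral_eq_lintegral_ofReal hf.abs.integrable_torus
    (Eventually.of_forall fun q => abs_nonneg _)] at h
  exact (ENNReal.ofReal_le_ofReal_iff hr).1 h

/-- The quantity controlling stretching of gradients by the velocity field. -/
def qvel (u v lu lv : L2 L) : ℝ :=
  vsup (wderiv ex u) (wderiv ey u) (wderiv ez u) lu
    + vsup (wderiv ex v) (wderiv ey v) (wderiv ez v) lv

/-- Regularity of the velocity field. -/
structure RegVel (u v lu lv : L2 L) : Prop where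
  ru : RegXZ u
  rv : RegXZ v
  uy : WeaklyDiff ey u
  vy : WeaklyDiff ey v
  lapu : HasHLaplacian u lu
  lapv : HasHLaplacian v lv
  div : wderiv ex u + wderiv ey v = 0

/-- Integration by parts in `∫ (𝐮·∇w) Δw` for smooth functions. -/
theorem integral_adv_lap {U V W : Torus L → ℝ} (tU : IsTest U) (tV : IsTest V) (tW : IsTest W)
    (hdiv : ∀ q, dirDeriv ex U q + dirDeriv ey V q = 0) :
    ∫ q, (U q * dirDeriv ex W q + V q * dirDeriv ey W q)
      * (dirDeriv ex (dirDeriv ex W) q + dirDeriv ey (dirDeriv ey W) q)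
    = -∫ q, (dirDeriv ex W q * dirDeriv ex U q * dirDeriv ex W q
        + dirDeriv ex W q * dirDeriv ex V q * dirDeriv ey W q
        + dirDeriv ex W q * dirDeriv ey U q * dirDeriv ey W q
        + dirDeriv ey W q * dirDeriv ey V q * dirDeriv ey W q) := by
  set a := dirDeriv ex W with ha
  set b := dirDeriv ey W with hb
  have ta : IsTest a := tW.dirDeriv ex
  have tb : IsTest b := tW.dirDeriv ey
  have hab : dirDeriv ey a = dirDeriv ex b := dirDeriv_comm tW ey ex
  -- The field (𝐮·∇W)∇W - ½𝐮|∇W|² has divergence equal to (𝐮·∇W)ΔW plus the quadratic form of ∇𝐮 in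
  -- ∇W, because 𝐮 is divergence free. Its integral vanishes.
  have tP := ((((tU.mul ta).add (tV.mul tb)).mul ta).add
    ((tU.const_mul (-(1 / 2))).mul ((ta.mul ta).add (tb.mul tb))))
  have tQ := ((((tU.mul ta).add (tV.mul tb)).mul tb).add
    ((tV.const_mul (-(1 / 2))).mul ((ta.mul ta).add (tb.mul tb))))
  have hcm : ∀ (e : ℝ × ℝ × ℝ) {ψ : Torus L → ℝ} (_ : IsTest ψ) (q : Torus L),
      dirDeriv e (fun q => -(1 / 2) * ψ q) q = -(1 / 2) * dirDeriv e ψ q := by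
    intro e ψ hψ q
    have := (hψ.hasDerivAt e q 0).const_mul (-(1 / 2))
    rw [proj_zero_smul] at this
    exact dirDeriv_eq_of_hasDerivAt this
  have hP := tP.integral_dirDeriv ex
  have hQ := tQ.integral_dirDeriv ey
  have cU := tU.continuous
  have cV := tV.continuous
  have ca := ta.continuous
  have cb := tb.continuous
  have cax := (ta.dirDeriv ex).continuous
  have cby := (tb.dirDeriv ey).continuous
  have cUx := (tU.dirDeriv ex).continuous
  have cUy := (tU.dirDeriv ey).continuous
  have cVx := (tV.dirDeriv ex).continuous
  have cVy := (tV.dirDeriv ey).continuous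
  have key : ∀ q, (U q * a q + V q * b q) * (dirDeriv ex a q + dirDeriv ey b q)
      + (a q * dirDeriv ex U q * a q + a q * dirDeriv ex V q * b q
        + a q * dirDeriv ey U q * b q + b q * dirDeriv ey V q * b q)
      = dirDeriv ex (fun q => (U q * a q + V q * b q) * a q
          + -(1 / 2) * U q * (a q * a q + b q * b q)) q
        + dirDeriv ey (fun q => (U q * a q + V q * b q) * b q
          + -(1 / 2) * V q * (a q * a q + b q * b q)) q := by
    intro q
    have hab' := congrFun hab q
    rw [dirDeriv_add (((tU.mul ta).add (tV.mul tb)).mul ta)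
        ((tU.const_mul (-(1 / 2))).mul ((ta.mul ta).add (tb.mul tb))),
      dirDeriv_mul ((tU.mul ta).add (tV.mul tb)) ta, dirDeriv_add (tU.mul ta) (tV.mul tb),
      dirDeriv_mul tU ta, dirDeriv_mul tV tb,
      dirDeriv_mul (tU.const_mul (-(1 / 2))) ((ta.mul ta).add (tb.mul tb)),
      dirDeriv_add (ta.mul ta) (tb.mul tb), dirDeriv_mul ta ta, dirDeriv_mul tb tb, hcm ex tU,
      dirDeriv_add (((tU.mul ta).add (tV.mul tb)).mul tb)
        ((tV.const_mul (-(1 / 2))).mul ((ta.mul ta).add (tb.mul tb))),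
      dirDeriv_mul ((tU.mul ta).add (tV.mul tb)) tb, dirDeriv_add (tU.mul ta) (tV.mul tb),
      dirDeriv_mul tU ta, dirDeriv_mul tV tb,
      dirDeriv_mul (tV.const_mul (-(1 / 2))) ((ta.mul ta).add (tb.mul tb)),
      dirDeriv_add (ta.mul ta) (tb.mul tb), dirDeriv_mul ta ta, dirDeriv_mul tb tb, hcm ey tV]
    linear_combination (1 / 2 * (a q * a q + b q * b q)) * hdiv q
      + (V q * a q - U q * b q) * hab'
  have h3 : ∫ q, ((U q * a q + V q * b q) * (dirDeriv ex a q + dirDeriv ey b q)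
      + (a q * dirDeriv ex U q * a q + a q * dirDeriv ex V q * b q
        + a q * dirDeriv ey U q * b q + b q * dirDeriv ey V q * b q)) = 0 := by
    simp only [key]
    rw [integral_add (tP.dirDeriv ex).continuous.integrable_torus
      (tQ.dirDeriv ey).continuous.integrable_torus, hP, hQ, add_zero]
  rw [integral_add (Continuous.integrable_torus (by fun_prop))
    (Continuous.integrable_torus (by fun_prop))] at h3
  linarith

theorem hbound_le {f fe : L2 L} {G D : ℝ} (hf : ‖f‖ ≤ G) (hfe : ‖fe‖ ≤ D) :
    hbound f fe ≤ L⁻¹ * G ^ 2 + 2 * G * D := by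
  have hL : 0 ≤ L⁻¹ := inv_nonneg.2 (L_pos (L := L)).le
  have : 0 ≤ G := (norm_nonneg _).trans hf
  unfold hbound
  gcongr

/-- Since γ ≤ L², Poincaré gives G ≤ L·D, and the lower-order term L⁻¹G² is absorbed in G·D. -/
theorem young_poincare {G D : ℝ} (hG : 0 ≤ G) (hD : 0 ≤ D) (h : G ^ 2 ≤ gam L * D ^ 2) :
    L⁻¹ * G ^ 2 + 2 * G * D ≤ 3 * G * D := by
  have hL := L_pos (L := L)
  have h1 : G ≤ L * D := by
    refine le_of_sq_le_sq (h.trans ?_) (by positivity)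
    rw [mul_pow]
    gcongr
    rw [gam, div_le_iff₀ (by positivity)]
    have : 1 ≤ 4 * Real.pi ^ 2 := by nlinarith [Real.pi_gt_three]
    exact le_mul_of_one_le_right (sq_nonneg L) this
  have h2 : L⁻¹ * G ≤ D := by
    rw [inv_mul_le_iff₀ hL]; exact h1
  nlinarith

/-- After `integral_adv_lap` the velocity is differentiated and w is not differentiated twice under
the integral. In the four terms ∂𝐮 is taken uniformly in z and both factors ∇_h w in the horizontal
Ladyzhenskaya bound, with the Hessian controlled by the Laplacian. The constant is 4 terms times the
3 of `young_poincare`. -/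
theorem abs_inner_adv_lap_le {u v lu lv w l : L2 L} (h : RegVel u v lu lv)
    (hx : WeaklyDiff ex w) (hy : WeaklyDiff ey w) (hl : HasHLaplacian w l) :
    |inner ℝ (adv u v w) l| ≤ 12 * √(qvel u v lu lv)
      * √(‖wderiv ex w‖ ^ 2 + ‖wderiv ey w‖ ^ 2) * ‖l‖ := by
  have hx' := hx.hasWeakDeriv
  have hy' := hy.hasWeakDeriv
  have r2 := hl.reg2 hx hy
  have hxx := (hl.weaklyDiff (Or.inl rfl) (Or.inl rfl) hx').hasWeakDeriv
  have hxy := r2.xy.hasWeakDeriv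
  have hyy := r2.yy.hasWeakDeriv
  have hyx := hy'.comm hx' (hx'.comm hy' hxy)
  set G := √(‖wderiv ex w‖ ^ 2 + ‖wderiv ey w‖ ^ 2) with hG
  have hG0 : 0 ≤ G := Real.sqrt_nonneg _
  have hG2 : G ^ 2 = ‖wderiv ex w‖ ^ 2 + ‖wderiv ey w‖ ^ 2 := Real.sq_sqrt (by positivity)
  have nx : ‖wderiv ex w‖ ≤ G := Real.le_sqrt_of_sq_le (by nlinarith [sq_nonneg ‖wderiv ey w‖])
  have ny : ‖wderiv ey w‖ ≤ G := Real.le_sqrt_of_sq_le (by nlinarith [sq_nonneg ‖wderiv ex w‖])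
  have hess := norm_hessian hl hx' hy' hxx hxy hyy
  have nxx : ‖wderiv ex (wderiv ex w)‖ ≤ ‖l‖ := le_of_sq_le_sq
    (by nlinarith [sq_nonneg ‖wderiv ey (wderiv ex w)‖, sq_nonneg ‖wderiv ey (wderiv ey w)‖])
    (norm_nonneg _)
  have nxy : ‖wderiv ey (wderiv ex w)‖ ≤ ‖l‖ := le_of_sq_le_sq
    (by nlinarith [sq_nonneg ‖wderiv ex (wderiv ex w)‖, sq_nonneg ‖wderiv ey (wderiv ey w)‖,
      sq_nonneg ‖wderiv ey (wderiv ex w)‖])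
    (norm_nonneg _)
  have nyy : ‖wderiv ey (wderiv ey w)‖ ≤ ‖l‖ := le_of_sq_le_sq
    (by nlinarith [sq_nonneg ‖wderiv ey (wderiv ex w)‖, sq_nonneg ‖wderiv ex (wderiv ex w)‖])
    (norm_nonneg _)
  set M := L⁻¹ * G ^ 2 + 2 * G * ‖l‖ with hM
  have hL : 0 ≤ L⁻¹ := inv_nonneg.2 (L_pos (L := L)).le
  have hM0 : 0 ≤ M := by positivity
  set Q := √(qvel u v lu lv) with hQ
  have hQM : 0 ≤ Q * M := by positivity
  have bnd : ∀ {s A B : ℝ}, 0 ≤ s → s ≤ qvel u v lu lv → 0 ≤ A → 0 ≤ B → A ≤ M → B ≤ M →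
      √(s * A * B) ≤ Q * M := by
    intro s A B h0 h1 h2 h3 h4 h5
    rw [hQ, ← Real.sqrt_sq hM0, ← Real.sqrt_mul (h0.trans h1), sq, ← mul_assoc]
    have hq0 := h0.trans h1
    exact Real.sqrt_le_sqrt (mul_le_mul (mul_le_mul h1 h4 h2 hq0) h5 h3 (mul_nonneg hq0 hM0))
  have vu := vsup_nonneg (wderiv ex u) (wderiv ey u) (wderiv ez u) lu
  have vv := vsup_nonneg (wderiv ex v) (wderiv ey v) (wderiv ez v) lv
  have hMl : M ≤ 3 * G * ‖l‖ :=
    young_poincare hG0 (norm_nonneg _) (by rw [hG2]; exact grad_le_lap hx' hy' hl)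
  have key : ∀ F, |inner ℝ (adv (trunc F u) (trunc F v) (trunc F w)) (trunc F l)| ≤ 4 * (Q * M) := by
    intro F
    set U := truncFun F u
    set V := truncFun F v
    set W := truncFun F w
    have tU : IsTest U := isTest_truncFun F u
    have tV : IsTest V := isTest_truncFun F v
    have tW : IsTest W := isTest_truncFun F w
    have dUx : dirDeriv ex U = truncFun F (wderiv ex u) := dirDeriv_truncFun h.ru.x.hasWeakDeriv F
    have dUy : dirDeriv ey U = truncFun F (wderiv ey u) := dirDeriv_truncFun h.uy.hasWeakDeriv F
    have dVx : dirDeriv ex V = truncFun F (wderiv ex v) := dirDeriv_truncFun h.rv.x.hasWeakDeriv F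
    have dVy : dirDeriv ey V = truncFun F (wderiv ey v) := dirDeriv_truncFun h.vy.hasWeakDeriv F
    have dWx : dirDeriv ex W = truncFun F (wderiv ex w) := dirDeriv_truncFun hx' F
    have dWy : dirDeriv ey W = truncFun F (wderiv ey w) := dirDeriv_truncFun hy' F
    have hdiv : ∀ q, dirDeriv ex U q + dirDeriv ey V q = 0 := fun q => by
      rw [dUx, dVy, ← truncFun_add, h.div, truncFun_zero]
    have hi := integral_adv_lap tU tV tW hdiv
    have hlap : ∀ q, truncFun F l q = dirDeriv ex (dirDeriv ex W) q
        + dirDeriv ey (dirDeriv ey W) q := by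
      intro q
      rw [dWx, dWy, dirDeriv_truncFun hxx, dirDeriv_truncFun hyy, ← truncFun_add,
        hl.eq_add hx' hy' hxx hyy]
    have e1 : inner ℝ (adv (trunc F u) (trunc F v) (trunc F w)) (trunc F l)
        = ∫ q, (U q * dirDeriv ex W q + V q * dirDeriv ey W q)
      * (dirDeriv ex (dirDeriv ex W) q + dirDeriv ey (dirDeriv ey W) q) := by
      rw [adv_trunc u v r2 F, trunc, inner_contLp, dWx, dWy]
      refine integral_congr_ae ?_
      filter_upwards [coeFn_contLp (continuous_advFun F u v (wderiv ex w) (wderiv ey w))] with q hq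
      rw [hq, hlap, dWx, dWy]
    rw [e1, hi, abs_neg, dUx, dUy, dVx, dVy, dWx, dWy]
    have c1 := continuous_truncFun F (wderiv ex u)
    have c2 := continuous_truncFun F (wderiv ey u)
    have c3 := continuous_truncFun F (wderiv ex v)
    have c4 := continuous_truncFun F (wderiv ey v)
    have c5 := continuous_truncFun F (wderiv ex w)
    have c6 := continuous_truncFun F (wderiv ey w)
    have hlu := fun {g' a ax b b' : L2 L} (h1 : g' = wderiv ex u ∨ g' = wderiv ey u)
      (h2 : HasWeakDeriv ex a ax) (h3 : HasWeakDeriv ey b b') =>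
      lintegral_tri_trunc_le h.ru.x.hasWeakDeriv h.uy.hasWeakDeriv h.ru.z.hasWeakDeriv h.lapu
      h1 h2 h3 F
    have hlv := fun {g' a ax b b' : L2 L} (h1 : g' = wderiv ex v ∨ g' = wderiv ey v)
      (h2 : HasWeakDeriv ex a ax) (h3 : HasWeakDeriv ey b b') =>
      lintegral_tri_trunc_le h.rv.x.hasWeakDeriv h.vy.hasWeakDeriv h.rv.z.hasWeakDeriv h.lapv
      h1 h2 h3 F
    have lequ : vsup (wderiv ex u) (wderiv ey u) (wderiv ez u) lu ≤ qvel u v lu lv :=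
      le_add_of_nonneg_right vv
    have leqv : vsup (wderiv ex v) (wderiv ey v) (wderiv ez v) lv ≤ qvel u v lu lv :=
      le_add_of_nonneg_left vu
    have t1 := integral_abs_le_of_lintegral (by fun_prop) hQM
      ((hlu (Or.inl rfl) hxx hxy).trans (ENNReal.ofReal_le_ofReal
        (bnd vu lequ (hbound_nonneg _ _) (hbound_nonneg _ _) (hbound_le nx nxx)
          (hbound_le nx nxy))))
    have t2 := integral_abs_le_of_lintegral (by fun_prop) hQM
      ((hlv (Or.inl rfl) hxx hyy).trans (ENNReal.ofReal_le_ofReal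
        (bnd vv leqv (hbound_nonneg _ _) (hbound_nonneg _ _) (hbound_le nx nxx)
          (hbound_le ny nyy))))
    have t3 := integral_abs_le_of_lintegral (by fun_prop) hQM
      ((hlu (Or.inr rfl) hxx hyy).trans (ENNReal.ofReal_le_ofReal
        (bnd vu lequ (hbound_nonneg _ _) (hbound_nonneg _ _) (hbound_le nx nxx)
          (hbound_le ny nyy))))
    have t4 := integral_abs_le_of_lintegral (by fun_prop) hQM
      ((hlv (Or.inr rfl) (hx'.comm hy' hxy) hyy).trans (ENNReal.ofReal_le_ofReal
        (bnd vv leqv (hbound_nonneg _ _) (hbound_nonneg _ _) (hbound_le ny nxy)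
          (hbound_le ny nyy))))
    have j : ∀ {f : Torus L → ℝ}, Continuous f → |∫ q, f q| ≤ ∫ q, |f q| := fun _ =>
      abs_integral_le_integral_abs
    rw [integral_add (Continuous.integrable_torus (by fun_prop))
      (Continuous.integrable_torus (by fun_prop)),
      integral_add (Continuous.integrable_torus (by fun_prop))
      (Continuous.integrable_torus (by fun_prop)),
      integral_add (Continuous.integrable_torus (by fun_prop))
      (Continuous.integrable_torus (by fun_prop))]
    refine (abs_add_le _ _).trans ?_
    refine (add_le_add (abs_add_le _ _) le_rfl).trans ?_
    refine (add_le_add (add_le_add (abs_add_le _ _) le_rfl) le_rfl).trans ?_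
    have j1 := (j (by fun_prop)).trans t1
    have j2 := (j (by fun_prop)).trans t2
    have j3 := (j (by fun_prop)).trans t3
    have j4 := (j (by fun_prop)).trans t4
    linarith
  have lim := ((tendsto_adv h.ru h.rv r2).inner (𝕜 := ℝ) (tendsto_trunc l)).abs
  have h1 := le_of_tendsto lim (Eventually.of_forall key)
  refine h1.trans ?_
  have : Q * M ≤ Q * (3 * G * ‖l‖) := by gcongr
  linarith

end Products

/-! ### Weights in the vertical variable. -/

/-- Bounded measurable functions of the vertical variable. -/
structure Weight where
  toFun : UnitAddCircle → ℝ
  meas : Measurable toFun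
  bdd : ∃ c, ∀ z, |toFun z| ≤ c

namespace Weight

instance : CoeFun Weight fun _ => UnitAddCircle → ℝ := ⟨toFun⟩

/-- A bound of a weight. -/
def bound (χ : Weight) : ℝ := χ.bdd.choose

theorem abs_le (χ : Weight) (z : UnitAddCircle) : |χ z| ≤ χ.bound := χ.bdd.choose_spec z

theorem bound_nonneg (χ : Weight) : 0 ≤ χ.bound := (abs_nonneg _).trans (χ.abs_le 0)

/-- The constant weight. -/
def const (c : ℝ) : Weight := ⟨fun _ => c, measurable_const, |c|, fun _ => le_rfl⟩

/-- The product of two weights. -/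
def mul (χ η : Weight) : Weight := ⟨fun z => χ z * η z, χ.meas.mul η.meas, χ.bound * η.bound,
  fun z => by
    rw [abs_mul]
    exact mul_le_mul (χ.abs_le z) (η.abs_le z) (abs_nonneg _) χ.bound_nonneg⟩

open Classical in
/-- The characteristic function of a measurable set. -/
def ind {s : Set UnitAddCircle} (hs : MeasurableSet s) : Weight :=
  ⟨s.indicator 1, measurable_one.indicator hs, 1, fun z => by
    by_cases h : z ∈ s <;> simp [h]⟩

theorem integrable_mul (χ : Weight) {f : UnitAddCircle → ℝ} (hf : Integrable f) :
    Integrable fun z => χ z * f z :=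
  hf.bdd_mul χ.meas.aestronglyMeasurable (Eventually.of_forall χ.abs_le)

theorem integrable (χ : Weight) : Integrable χ := by
  simpa using χ.integrable_mul (integrable_const (1 : ℝ))

/-- Indicator functions are weights, so an inequality tested with all nonnegative weights holds at
almost every height. In this way weighted energy estimates become pointwise in z. -/
theorem ae_le {f g : UnitAddCircle → ℝ} (hf : Integrable f) (hg : Integrable g)
    (h : ∀ χ : Weight, (∀ z, 0 ≤ χ z) → ∫ z, χ z * f z ≤ ∫ z, χ z * g z) : f ≤ᵐ[volume] g := by
  refine ae_le_of_forall_setIntegral_le hf hg fun s hs _ => ?_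
  have := h (ind hs) fun z => by simp only [ind]; exact indicator_nonneg (by simp) z
  have e : ∀ f : UnitAddCircle → ℝ, ∫ z in s, f z = ∫ z, ind hs z * f z := by
    intro f
    rw [← integral_indicator hs]
    congr 1
    funext z
    by_cases hz : z ∈ s <;> simp [ind, hz]
  rw [e, e]
  exact this

theorem integral_mono (χ : Weight) (hχ : ∀ z, 0 ≤ χ z) {f g : UnitAddCircle → ℝ}
    (hf : Integrable f) (hg : Integrable g) (h : f ≤ᵐ[volume] g) :
    ∫ z, χ z * f z ≤ ∫ z, χ z * g z := by
  refine integral_mono_ae (χ.integrable_mul hf) (χ.integrable_mul hg) ?_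
  filter_upwards [h] with z hz
  exact mul_le_mul_of_nonneg_left hz (hχ z)

end Weight

/-! ### Weighted inner products; weights commute with horizontal operations. -/

section Weighted

variable {L : ℝ} [Fact (0 < L)]

theorem aestronglyMeasurable_weight (χ : Weight) :
    AEStronglyMeasurable (fun q : Torus L => χ q.2.2) volume :=
  (χ.meas.comp (measurable_snd.comp measurable_snd)).aestronglyMeasurable

theorem memLp_weight_mul (χ : Weight) (f : L2 L) :
    MemLp (fun q => χ q.2.2 * f q) 2 (volume : Measure (Torus L)) :=
  (Lp.memLp f).of_le_mul (c := χ.bound)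
    ((aestronglyMeasurable_weight χ).mul (Lp.aestronglyMeasurable f))
    (Eventually.of_forall fun q => by
      rw [norm_mul]
      exact mul_le_mul_of_nonneg_right (χ.abs_le q.2.2) (norm_nonneg _))

/-- Multiplication by a bounded function of the vertical variable. -/
def mz (χ : Weight) : L2 L →L[ℝ] L2 L :=
  LinearMap.mkContinuous
    { toFun := fun f => (memLp_weight_mul χ f).toLp
      map_add' := fun f g => by
        rw [← MemLp.toLp_add]
        apply MemLp.toLp_congr
        filter_upwards [Lp.coeFn_add f g] with q hq
        simp only [hq, Pi.add_apply, mul_add]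
      map_smul' := fun c f => by
        rw [RingHom.id_apply, ← MemLp.toLp_const_smul]
        apply MemLp.toLp_congr
        filter_upwards [Lp.coeFn_smul c f] with q hq
        simp only [hq, Pi.smul_apply, smul_eq_mul]
        ring }
    χ.bound fun f => by
      refine Lp.norm_le_mul_norm_of_ae_le_mul ?_
      filter_upwards [(memLp_weight_mul χ f).coeFn_toLp] with q hq
      simp only [LinearMap.coe_mk, AddHom.coe_mk]
      rw [hq, Real.norm_eq_abs, Real.norm_eq_abs, abs_mul]
      exact mul_le_mul_of_nonneg_right (χ.abs_le _) (abs_nonneg _)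

theorem coeFn_mz (χ : Weight) (f : L2 L) : mz χ f =ᵐ[volume] fun q => χ q.2.2 * f q :=
  (memLp_weight_mul χ f).coeFn_toLp

theorem integrable_mul_L2 (f g : L2 L) : Integrable fun q => f q * g q :=
  (Lp.memLp f).integrable_mul (Lp.memLp g)

/-- The horizontal integral of a product. -/
def hdot (f g : L2 L) (z : UnitAddCircle) : ℝ :=
  ∫ p : AddCircle L × AddCircle L, f (p.1, p.2, z) * g (p.1, p.2, z)

theorem integrable_hprod (f g : L2 L) : Integrable (hdot f g) := by
  unfold hdot
  exact integrable_hdot (F := fun q => f q * g q) (integrable_mul_L2 f g)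

theorem inner_mz_integral (χ : Weight) (f g : L2 L) :
    inner ℝ (mz χ f) g = ∫ q, χ q.2.2 * (f q * g q) := by
  rw [inner_eq_integral]
  refine integral_congr_ae ?_
  filter_upwards [coeFn_mz χ f] with q hq
  rw [hq, mul_assoc]

theorem inner_mz (χ : Weight) (f g : L2 L) :
    inner ℝ (mz χ f) g = ∫ z, χ z * hdot f g z := by
  rw [inner_mz_integral, integral_torus]
  · simp only [integral_const_mul]; rfl
  · exact (integrable_mul_L2 f g).bdd_mul (aestronglyMeasurable_weight χ)
      (Eventually.of_forall fun q => χ.abs_le q.2.2)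

theorem inner_mz_comm (χ : Weight) (f g : L2 L) : inner ℝ (mz χ f) g = inner ℝ f (mz χ g) := by
  rw [real_inner_comm (mz χ g) f, inner_mz_integral, inner_mz_integral]
  simp only [mul_comm]

theorem mz_one (f : L2 L) : mz (Weight.const 1) f = f := by
  apply Lp.ext
  filter_upwards [coeFn_mz (Weight.const 1) f] with q hq
  rw [hq]; simp [Weight.const]

theorem inner_mz_self_nonneg {χ : Weight} (hχ : ∀ z, 0 ≤ χ z) (f : L2 L) :
    0 ≤ inner ℝ (mz χ f) f := by
  rw [inner_mz_integral]
  exact integral_nonneg fun q => mul_nonneg (hχ _) (mul_self_nonneg _)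

theorem two_inner_mz_le {χ : Weight} (hχ : ∀ z, 0 ≤ χ z) (f g : L2 L) :
    2 * inner ℝ (mz χ f) g ≤ inner ℝ (mz χ f) f + inner ℝ (mz χ g) g := by
  have h := inner_mz_self_nonneg hχ (f - g)
  rw [map_sub, inner_sub_left, inner_sub_right, inner_sub_right, inner_mz_comm χ g f,
    real_inner_comm (mz χ f) g] at h
  linarith

theorem integral_eq_hdot_zero {χ : Weight} {G : Torus L → ℝ} (hG : Continuous G)
    (h : ∀ z : UnitAddCircle, ∫ p : AddCircle L × AddCircle L, G (p.1, p.2, z) = 0) :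
    ∫ q, χ q.2.2 * G q = 0 := by
  rw [integral_torus]
  · simp only [integral_const_mul, h, mul_zero, integral_zero]
  · exact hG.integrable_torus.bdd_mul (aestronglyMeasurable_weight χ)
      (Eventually.of_forall fun q => χ.abs_le q.2.2)

/-- The weight is not smooth, so χψ is not a test function. Instead f is truncated and the
integration by parts is done on each slice, where χ is constant. -/
theorem HasWeakDeriv.mz {e : ℝ × ℝ × ℝ} (he : e = ex ∨ e = ey) {f g : L2 L}
    (h : HasWeakDeriv e f g) (χ : Weight) : HasWeakDeriv e (RotConv.mz χ f) (RotConv.mz χ g) := by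
  rw [hasWeakDeriv_iff_inner]
  intro ψ hψ
  have cm := (RotConv.mz (L := L) χ).continuous
  have l1 := ((cm.tendsto f).comp (tendsto_trunc f)).inner (𝕜 := ℝ)
    (tendsto_const_nhds (x := contLp _ (hψ.dirDeriv e).continuous))
  have l2 := (((cm.tendsto g).comp (tendsto_trunc g)).inner (𝕜 := ℝ)
    (tendsto_const_nhds (x := contLp ψ hψ.continuous))).neg
  refine tendsto_nhds_unique l1 (l2.congr fun F => ?_)
  have tF := isTest_truncFun F f
  have dF := dirDeriv_truncFun h F
  have key : ∫ q, χ q.2.2 * RotConv.dirDeriv e (fun q => truncFun F f q * ψ q) q = 0 := by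
    refine integral_eq_hdot_zero ((tF.mul hψ).dirDeriv e).continuous fun z => ?_
    rcases he with rfl | rfl
    · exact (tF.mul hψ).hdot_dirDeriv_x z
    · exact (tF.mul hψ).hdot_dirDeriv_y z
  simp only [Function.comp_apply, inner_mz_integral]
  have e1 : ∫ q, χ q.2.2 * (RotConv.trunc F f q * contLp _ (hψ.dirDeriv e).continuous q)
      = ∫ q, χ q.2.2 * (truncFun F f q * RotConv.dirDeriv e ψ q) := by
    refine integral_congr_ae ?_
    filter_upwards [coeFn_trunc F f, coeFn_contLp (hψ.dirDeriv e).continuous] with q h1 h2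
    rw [h1, h2]
  have e2 : ∫ q, χ q.2.2 * (RotConv.trunc F g q * contLp _ hψ.continuous q)
      = ∫ q, χ q.2.2 * (truncFun F g q * ψ q) := by
    refine integral_congr_ae ?_
    filter_upwards [coeFn_trunc F g, coeFn_contLp hψ.continuous] with q h1 h2
    rw [h1, h2]
  rw [e1, e2]
  have i := fun {G : Torus L → ℝ} (hG : Continuous G) =>
    hG.integrable_torus.bdd_mul (aestronglyMeasurable_weight (L := L) χ)
      (Eventually.of_forall fun q => χ.abs_le q.2.2)
  simp only [dirDeriv_mul tF hψ, dF, mul_add] at key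
  rw [integral_add (i (G := fun q => truncFun F g q * ψ q)
      ((continuous_truncFun F g).mul hψ.continuous))
    (i (G := fun q => truncFun F f q * RotConv.dirDeriv e ψ q)
      ((continuous_truncFun F f).mul (hψ.dirDeriv e).continuous))] at key
  linarith

/-- The vertical trace bound, in weighted form. -/
theorem inner_mz_self_le {f fz : L2 L} (hz : HasWeakDeriv ez f fz) {χ : Weight}
    (hχ : ∀ z, 0 ≤ χ z) :
    inner ℝ (mz χ f) f ≤ (‖f‖ ^ 2 + 2 * ‖f‖ * ‖fz‖) * ∫ z, χ z := by
  have cm := (mz (L := L) χ).continuous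
  refine le_of_tendsto (((cm.tendsto f).comp (tendsto_trunc f)).inner (𝕜 := ℝ) (tendsto_trunc f))
    (Eventually.of_forall fun F => ?_)
  have tF := isTest_truncFun F f
  have cF := continuous_truncFun F f
  simp only [Function.comp_apply]
  have e : inner ℝ (mz χ (trunc F f)) (trunc F f) = ∫ q, χ q.2.2 * truncFun F f q ^ 2 := by
    rw [inner_mz_integral]
    refine integral_congr_ae ?_
    filter_upwards [coeFn_trunc F f] with q hq
    rw [hq, sq]
  have c2 : Continuous fun q => truncFun F f q ^ 2 := by fun_prop
  rw [e, integral_torus (c2.integrable_torus.bdd_mul (aestronglyMeasurable_weight χ)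
      (Eventually.of_forall fun q => χ.abs_le q.2.2))]
  simp only [integral_const_mul]
  rw [← integral_const_mul]
  refine integral_mono_of_nonneg (Eventually.of_forall fun z => mul_nonneg (hχ z)
    (integral_nonneg fun p => by positivity)) (χ.integrable.const_mul _)
    (Eventually.of_forall fun z => ?_)
  simp only
  rw [mul_comm _ (χ z)]
  refine mul_le_mul_of_nonneg_left ((hdot_sq_le tF z).trans ?_) (hχ z)
  have h1 : ‖contLp _ tF.continuous‖ ≤ ‖f‖ := norm_trunc_le F f
  have h2 : ‖contLp _ (tF.dirDeriv ez).continuous‖ ≤ ‖fz‖ := by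
    have : contLp _ (tF.dirDeriv ez).continuous = trunc F fz := by
      simp only [dirDeriv_truncFun hz F]; rfl
    rw [this]; exact norm_trunc_le F fz
  gcongr

theorem hdot_self_le {f fz : L2 L} (hz : HasWeakDeriv ez f fz) :
    ∀ᵐ z, hdot f f z ≤ ‖f‖ ^ 2 + 2 * ‖f‖ * ‖fz‖ := by
  refine Weight.ae_le (integrable_hprod f f) (integrable_const _) fun χ hχ => ?_
  rw [← inner_mz, integral_mul_const, mul_comm]
  exact inner_mz_self_le hz hχ

/-- Advection preserves weighted norms. -/
theorem inner_mz_adv {u v f : L2 L} (hu : RegXZ u) (hv : RegXZ v) (hvy : WeaklyDiff ey v)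
    (hdiv : wderiv ex u + wderiv ey v = 0) (hf : Reg2 f) (χ : Weight) :
    inner ℝ (mz χ f) (adv u v f) = 0 := by
  have hx := hf.x.hasWeakDeriv.mz (Or.inl rfl) χ
  have hy := hf.y.hasWeakDeriv.mz (Or.inr rfl) χ
  -- With χf as second function, both sides of the skew symmetry are the same weighted integral with
  -- opposite signs.
  have h := skew hu hv hvy hdiv hf.x hf.y ⟨_, hx⟩ ⟨_, hy⟩
  rw [hx.wderiv_eq, hy.wderiv_eq] at h
  have hxy := hf.xy.hasWeakDeriv.mz (Or.inr rfl) χ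
  have hyy := hf.yy.hasWeakDeriv.mz (Or.inr rfl) χ
  rw [inner_mulL_comm (memLp_mul hu hf.xy) (memLp_mul hu ⟨_, hy⟩),
    inner_mulL_comm (memLp_mul hv hf.yy) (memLp_mul hv ⟨_, hy⟩),
    ← inner_mulL_comm (memLp_mul hu hf.y) (memLp_mul hu ⟨_, hxy⟩),
    ← inner_mulL_comm (memLp_mul hv hf.y) (memLp_mul hv ⟨_, hyy⟩)] at h
  have c : ∀ {a g : L2 L}, RegXZ a → WeaklyDiff ey g → mulL a (mz χ g) = mz χ (mulL a g) := by
    intro a g ha hg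
    apply Lp.ext
    filter_upwards [coeFn_mulL ha (g := mz χ g) ⟨_, hg.hasWeakDeriv.mz (Or.inr rfl) χ⟩,
      coeFn_mulL ha hg, coeFn_mz χ g, coeFn_mz χ (mulL a g)] with q h1 h2 h3 h4
    rw [h1, h4, h2, h3]; ring
  rw [c hu hf.xy, c hv hf.yy, ← inner_mz_comm, ← inner_mz_comm] at h
  rw [adv, inner_add_right]
  have e1 := inner_mz_comm χ f (mulL u (wderiv ex f))
  have e2 := inner_mz_comm χ f (mulL v (wderiv ey f))
  have e3 := real_inner_comm f (mz χ (mulL u (wderiv ex f)))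
  have e4 := real_inner_comm f (mz χ (mulL v (wderiv ey f)))
  linarith

theorem inner_mz_lap {f l : L2 L} (hx : WeaklyDiff ex f) (hy : WeaklyDiff ey f)
    (hl : HasHLaplacian f l) (χ : Weight) :
    inner ℝ (mz χ f) l = -(inner ℝ (mz χ (wderiv ex f)) (wderiv ex f)
      + inner ℝ (mz χ (wderiv ey f)) (wderiv ey f)) := by
  have hxx := (hl.weaklyDiff (Or.inl rfl) (Or.inl rfl) hx.hasWeakDeriv).hasWeakDeriv
  have hyy := (hl.weaklyDiff (Or.inr rfl) (Or.inr rfl) hy.hasWeakDeriv).hasWeakDeriv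
  rw [hl.eq_add hx.hasWeakDeriv hy.hasWeakDeriv hxx hyy, inner_add_right,
    (hx.hasWeakDeriv.mz (Or.inl rfl) χ).inner hxx, (hy.hasWeakDeriv.mz (Or.inr rfl) χ).inner hyy]
  ring

end Weighted

/-! ### Absolutely continuous functions and Grönwall inequalities. -/

section Calculus

variable {E F : Type*} [NormedAddCommGroup E] [NormedSpace ℝ E] [NormedAddCommGroup F]
  [NormedSpace ℝ F] {a b : ℝ}

/-- `f` is absolutely continuous on `[a, b]` with integrable derivative `g`. -/
structure HasIntDeriv (a b : ℝ) (f g : ℝ → E) : Prop where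
  int : IntervalIntegrable g volume a b
  eq : ∀ x ∈ Icc a b, f x = f a + ∫ t in a..x, g t

namespace HasIntDeriv

theorem sub_eq {f g : ℝ → E} (h : HasIntDeriv a b f g) {x y : ℝ} (hx : x ∈ Icc a b)
    (hy : y ∈ Icc a b) : f y - f x = ∫ t in x..y, g t := by
  have hab : a ≤ b := hx.1.trans hx.2
  have i : ∀ {x}, x ∈ Icc a b → IntervalIntegrable g volume a x := fun hx =>
    h.int.mono_set (by rw [uIcc_of_le hx.1, uIcc_of_le hab]; exact Icc_subset_Icc_right hx.2)
  rw [h.eq x hx, h.eq y hy, ← intervalIntegral.integral_interval_sub_left (i hy) (i hx)]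
  abel

theorem mono {f g : ℝ → E} (h : HasIntDeriv a b f g) {c d : ℝ} (hc : c ∈ Icc a b)
    (hd : d ∈ Icc a b) (hcd : c ≤ d) : HasIntDeriv c d f g where
  int := h.int.mono_set (by
    rw [uIcc_of_le hcd, uIcc_of_le (hc.1.trans hc.2)]; exact Icc_subset_Icc hc.1 hd.2)
  eq := fun x hx => by
    rw [← h.sub_eq hc ⟨hc.1.trans hx.1, hx.2.trans hd.2⟩]; abel

theorem congr_deriv {f g g' : ℝ → E} (hab : a ≤ b) (h : HasIntDeriv a b f g)
    (hg : ∀ᵐ t ∂volume.restrict (Ioo a b), g t = g' t) : HasIntDeriv a b f g' := by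
  rw [Measure.restrict_congr_set Ioo_ae_eq_Ioc] at hg
  have hg' : ∀ᵐ t, t ∈ uIoc a b → g t = g' t := by
    rw [uIoc_of_le hab]; exact (ae_restrict_iff' measurableSet_Ioc).1 hg
  refine ⟨h.int.congr_ae (by rwa [uIoc_of_le hab]), fun x hx => ?_⟩
  rw [h.eq x hx]
  congr 1
  refine intervalIntegral.integral_congr_ae ?_
  filter_upwards [hg'] with t ht htx
  refine ht ?_
  rw [uIoc_of_le hx.1] at htx
  rw [uIoc_of_le hab]
  exact ⟨htx.1, htx.2.trans hx.2⟩

theorem clm [CompleteSpace E] [CompleteSpace F] {f g : ℝ → E} (hab : a ≤ b)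
    (h : HasIntDeriv a b f g) (A : E →L[ℝ] F) :
    HasIntDeriv a b (fun t => A (f t)) (fun t => A (g t)) := by
  refine ⟨⟨A.integrable_comp h.int.1, A.integrable_comp h.int.2⟩, fun x hx => ?_⟩
  rw [h.eq x hx, map_add, A.intervalIntegral_comp_comm]
  exact h.int.mono_set (by rw [uIcc_of_le hx.1, uIcc_of_le hab]; exact Icc_subset_Icc_right hx.2)

theorem intervalIntegrable {f g : ℝ → E} (h : HasIntDeriv a b f g) {x : ℝ} (hx : x ∈ Icc a b) :
    IntervalIntegrable g volume a x :=
  h.int.mono_set (by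
    rw [uIcc_of_le hx.1, uIcc_of_le (hx.1.trans hx.2)]; exact Icc_subset_Icc_right hx.2)

theorem add {f g f' g' : ℝ → E} (h : HasIntDeriv a b f g) (h' : HasIntDeriv a b f' g') :
    HasIntDeriv a b (fun t => f t + f' t) (fun t => g t + g' t) := by
  refine ⟨h.int.add h'.int, fun x hx => ?_⟩
  rw [intervalIntegral.integral_add (h.intervalIntegrable hx) (h'.intervalIntegrable hx), h.eq x hx,
    h'.eq x hx]
  abel

theorem sum {ι : Type*} {f g : ι → ℝ → E} (s : Finset ι) (h : ∀ i ∈ s, HasIntDeriv a b (f i) (g i)) :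
    HasIntDeriv a b (fun t => ∑ i ∈ s, f i t) (fun t => ∑ i ∈ s, g i t) := by
  classical
  induction s using Finset.induction_on with
  | empty => exact ⟨by simp, fun x _ => by simp⟩
  | insert i s hi ih =>
    simp only [Finset.sum_insert hi]
    exact (h i (Finset.mem_insert_self _ _)).add
      (ih fun j hj => h j (Finset.mem_insert_of_mem hj))

theorem ae_hasDerivAt [CompleteSpace E] {f g : ℝ → E} (hab : a ≤ b) (h : HasIntDeriv a b f g) :
    ∀ᵐ x, x ∈ Ioo a b → HasDerivAt f (g x) x := by
  filter_upwards [h.int.ae_hasDerivAt_integral] with x hx hxab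
  rw [uIcc_of_le hab] at hx
  have h1 := (hx (Ioo_subset_Icc_self hxab) a ⟨le_rfl, hab⟩).const_add (f a)
  refine h1.congr_of_eventuallyEq ?_
  filter_upwards [Ioo_mem_nhds hxab.1 hxab.2] with y hy
  exact h.eq y (Ioo_subset_Icc_self hy)

end HasIntDeriv

/-- Absolute continuity is inherited by functions with dominated increments. -/
theorem absolutelyContinuousOnInterval_of_dist_le {X Y Z : Type*} [PseudoMetricSpace X]
    [PseudoMetricSpace Y] [PseudoMetricSpace Z] {f : ℝ → X} {g : ℝ → Y} {h : ℝ → Z} {C : ℝ}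
    (hg : AbsolutelyContinuousOnInterval g a b) (hh : AbsolutelyContinuousOnInterval h a b)
    (H : ∀ x ∈ uIcc a b, ∀ y ∈ uIcc a b,
      dist (f x) (f y) ≤ C * (dist (g x) (g y) + dist (h x) (h y))) :
    AbsolutelyContinuousOnInterval f a b := by
  unfold AbsolutelyContinuousOnInterval at *
  have hs := (Tendsto.add hg hh).const_mul C
  rw [add_zero, mul_zero] at hs
  refine squeeze_zero' (Eventually.of_forall fun _ => Finset.sum_nonneg fun _ _ => dist_nonneg)
    ?_ hs
  filter_upwards [mem_inf_of_right (mem_principal_self _)] with e he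
  rw [← Finset.sum_add_distrib, Finset.mul_sum]
  exact Finset.sum_le_sum fun i hi => H _ (he.1 i hi).1 _ (he.1 i hi).2

namespace HasIntDeriv

theorem ac {f g : ℝ → E} (hab : a ≤ b) (h : HasIntDeriv a b f g) :
    AbsolutelyContinuousOnInterval f a b := by
  have h1 := h.int.norm.absolutelyContinuousOnInterval_intervalIntegral
    (c := a) left_mem_uIcc
  refine absolutelyContinuousOnInterval_of_dist_le (C := 1) h1 h1 fun x hx y hy => ?_
  rw [uIcc_of_le hab] at hx hy
  rw [dist_comm, dist_eq_norm, h.sub_eq hx hy]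
  have e : dist (∫ v in a..x, ‖g v‖) (∫ v in a..y, ‖g v‖) = |∫ v in x..y, ‖g v‖| := by
    rw [dist_comm, Real.dist_eq, intervalIntegral.integral_interval_sub_left
      (h.intervalIntegrable hy).norm (h.intervalIntegrable hx).norm]
  rw [e]
  have := intervalIntegral.norm_integral_le_abs_integral_norm (f := g) (a := x) (b := y)
    (μ := volume)
  have h0 := abs_nonneg (∫ v in x..y, ‖g v‖)
  linarith

theorem of_ac {f g : ℝ → ℝ} (hab : a ≤ b) (hf : AbsolutelyContinuousOnInterval f a b)
    (hg : ∀ᵐ x, x ∈ Ioo a b → HasDerivAt f (g x) x) : HasIntDeriv a b f g := by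
  have h1 : HasIntDeriv a b f (deriv f) := by
    refine ⟨hf.intervalIntegrable_deriv, fun x hx => ?_⟩
    have := (hf.mono (c := a) (d := x) (by
      rw [uIcc_of_le hx.1, uIcc_of_le hab]; exact Icc_subset_Icc_right hx.2)).integral_deriv_eq_sub
    rw [this]; ring
  refine h1.congr_deriv hab ((ae_restrict_iff' measurableSet_Ioo).2 ?_)
  filter_upwards [hg] with x hx hxab
  exact (hx hxab).deriv

theorem continuousOn {f g : ℝ → E} (hab : a ≤ b) (h : HasIntDeriv a b f g) :
    ContinuousOn f (Icc a b) := by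
  have := (h.ac hab).continuousOn
  rwa [uIcc_of_le hab] at this

/-- The product rule. -/
theorem bilin [CompleteSpace E] [CompleteSpace F] {f f' : ℝ → E} {g g' : ℝ → F} (hab : a ≤ b)
    (hf : HasIntDeriv a b f f') (hg : HasIntDeriv a b g g') (B : E →L[ℝ] F →L[ℝ] ℝ) :
    HasIntDeriv a b (fun t => B (f t) (g t)) (fun t => B (f t) (g' t) + B (f' t) (g t)) := by
  obtain ⟨Cf, hCf⟩ := (hf.ac hab).exists_bound
  obtain ⟨Cg, hCg⟩ := (hg.ac hab).exists_bound
  refine of_ac hab ?_ ?_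
  · refine absolutelyContinuousOnInterval_of_dist_le (C := ‖B‖ * (|Cf| + |Cg|)) (hf.ac hab)
      (hg.ac hab) fun x hx y hy => ?_
    have e : B (f x) (g x) - B (f y) (g y) = B (f x - f y) (g x) + B (f y) (g x - g y) := by
      simp
    rw [Real.dist_eq, e, dist_eq_norm, dist_eq_norm]
    have h1 := B.le_opNorm₂ (f x - f y) (g x)
    have h2 := B.le_opNorm₂ (f y) (g x - g y)
    have h3 := (hCf y hy).trans (le_abs_self _)
    have h4 := (hCg x hx).trans (le_abs_self _)
    refine (abs_add_le _ _).trans ((add_le_add h1 h2).trans ?_)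
    have h5 : ‖B‖ * ‖f x - f y‖ * ‖g x‖ ≤ ‖B‖ * ‖f x - f y‖ * |Cg| := by gcongr
    have h6 : ‖B‖ * ‖f y‖ * ‖g x - g y‖ ≤ ‖B‖ * |Cf| * ‖g x - g y‖ := by gcongr
    have h7 : 0 ≤ ‖B‖ * ‖f x - f y‖ * |Cf| := by positivity
    have h8 : 0 ≤ ‖B‖ * ‖g x - g y‖ * |Cg| := by positivity
    linarith
  · filter_upwards [hf.ae_hasDerivAt hab, hg.ae_hasDerivAt hab] with x h1 h2 hx
    exact B.hasDerivAt_of_bilinear (fun _ => h1 hx) (fun _ => h2 hx)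

theorem mul {f f' g g' : ℝ → ℝ} (hab : a ≤ b) (hf : HasIntDeriv a b f f')
    (hg : HasIntDeriv a b g g') :
    HasIntDeriv a b (fun t => f t * g t) (fun t => f t * g' t + f' t * g t) :=
  hf.bilin hab hg (ContinuousLinearMap.mul ℝ ℝ)

theorem of_contDiff {f : ℝ → ℝ} (hab : a ≤ b) (hf : ContDiff ℝ 1 f) :
    HasIntDeriv a b f (deriv f) :=
  of_ac hab hf.contDiffOn.absolutelyContinuousOnInterval
    (Eventually.of_forall fun x _ => (hf.differentiable (by simp) x).hasDerivAt)

theorem integral {g : ℝ → E} (c : E) (h : IntervalIntegrable g volume a b) :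
    HasIntDeriv a b (fun t => c + ∫ s in a..t, g s) g :=
  ⟨h, fun x _ => by simp⟩

theorem le {f g h : ℝ → ℝ} (hab : a ≤ b) (hf : HasIntDeriv a b f g)
    (hh : IntervalIntegrable h volume a b) (hle : ∀ᵐ t ∂volume.restrict (Ioo a b), g t ≤ h t) :
    f b ≤ f a + ∫ t in a..b, h t := by
  rw [hf.eq b ⟨hab, le_rfl⟩]
  gcongr
  refine intervalIntegral.integral_mono_ae_restrict hab hf.int hh ?_
  rwa [Measure.restrict_congr_set Ioo_ae_eq_Icc] at hle

/-- Since c ≥ 0 the exponent stays nonpositive, where the exponential is 1-Lipschitz; absolute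
continuity passes from the integral to its exponential. -/
theorem exp_neg {c : ℝ → ℝ} (hab : a ≤ b) (hc : IntervalIntegrable c volume a b)
    (h0 : ∀ᵐ t ∂volume.restrict (Ioo a b), 0 ≤ c t) :
    HasIntDeriv a b (fun t => Real.exp (-∫ s in a..t, c s))
      (fun t => Real.exp (-∫ s in a..t, c s) * -c t) := by
  have hI : HasIntDeriv a b (fun t => ∫ s in a..t, c s) c := by
    simpa using HasIntDeriv.integral (0 : ℝ) hc
  have hpos : ∀ x ∈ Icc a b, 0 ≤ ∫ s in a..x, c s := by
    intro x hx
    refine intervalIntegral.integral_nonneg_of_ae_restrict hx.1 ?_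
    rw [Measure.restrict_congr_set Ioo_ae_eq_Icc] at h0
    exact ae_restrict_of_ae_restrict_of_subset (Icc_subset_Icc_right hx.2) h0
  refine of_ac hab ?_ ?_
  · refine absolutelyContinuousOnInterval_of_dist_le (C := 1) (hI.ac hab) (hI.ac hab)
      fun x hx y hy => ?_
    rw [uIcc_of_le hab] at hx hy
    set p := ∫ s in a..x, c s
    set r := ∫ s in a..y, c s
    have hp := hpos x hx
    have hr := hpos y hy
    have key : ∀ {p r : ℝ}, 0 ≤ p → 0 ≤ r → Real.exp (-p) - Real.exp (-r) ≤ |p - r| := by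
      intro p r hp hr
      have h1 := Real.add_one_le_exp (-(r - p))
      have h2 : Real.exp (-r) = Real.exp (-p) * Real.exp (-(r - p)) := by
        rw [← Real.exp_add]; ring_nf
      have h3 : Real.exp (-p) ≤ 1 := Real.exp_le_one_iff.2 (by linarith)
      have h4 := Real.exp_pos (-p)
      rcases le_total p r with h | h
      · rw [abs_sub_comm, abs_of_nonneg (sub_nonneg.2 h)]
        nlinarith
      · have : Real.exp (-p) ≤ Real.exp (-r) := Real.exp_le_exp.2 (by linarith)
        have := abs_nonneg (p - r)
        linarith
    have k1 := key hp hr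
    have k2 := key hr hp
    have : |Real.exp (-p) - Real.exp (-r)| ≤ |p - r| := by
      rw [abs_le]; rw [abs_sub_comm r p] at k2; constructor <;> linarith
    rw [Real.dist_eq, Real.dist_eq]
    have := abs_nonneg (p - r)
    linarith
  · filter_upwards [hI.ae_hasDerivAt hab] with x hx hxab
    exact (hx hxab).neg.exp

end HasIntDeriv

/-- **Grönwall's inequality** with an integrable coefficient. -/
theorem gronwall {y y' c d : ℝ → ℝ} (hab : a ≤ b) (hy : HasIntDeriv a b y y')
    (hc : IntervalIntegrable c volume a b) (hd : IntervalIntegrable d volume a b)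
    (hc0 : ∀ᵐ t ∂volume.restrict (Ioo a b), 0 ≤ c t)
    (hd0 : ∀ᵐ t ∂volume.restrict (Ioo a b), 0 ≤ d t)
    (hle : ∀ᵐ t ∂volume.restrict (Ioo a b), y' t ≤ c t * y t + d t) :
    y b ≤ Real.exp (∫ t in a..b, c t) * (y a + ∫ t in a..b, d t) := by
  -- The integrating factor is at most 1, so it can be dropped in front of d ≥ 0. No sign of y is
  -- involved.
  have h1 := (HasIntDeriv.exp_neg hab hc hc0).mul hab hy
  have h2 := h1.le hab hd (by
    filter_upwards [hd0, hle, ae_restrict_mem measurableSet_Ioo,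
      (ae_restrict_iff' measurableSet_Ioo).2 (Eventually.of_forall fun t (ht : t ∈ Ioo a b) => ht)]
      with t k1 k2 k3 _
    have hp : 0 ≤ ∫ s in a..t, c s := by
      refine intervalIntegral.integral_nonneg_of_ae_restrict k3.1.le ?_
      have := hc0
      rw [Measure.restrict_congr_set Ioo_ae_eq_Icc] at this
      exact ae_restrict_of_ae_restrict_of_subset (Icc_subset_Icc_right k3.2.le) this
    have h3 : Real.exp (-∫ s in a..t, c s) ≤ 1 := Real.exp_le_one_iff.2 (by linarith)
    have h4 := Real.exp_pos (-∫ s in a..t, c s)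
    nlinarith)
  simp only [intervalIntegral.integral_same, neg_zero, Real.exp_zero, one_mul] at h2
  rw [Real.exp_neg, inv_mul_le_iff₀ (Real.exp_pos _)] at h2
  exact h2

/-- The differential form is applied to the right-hand side of the integral inequality, which is
absolutely continuous even when y is not. -/
theorem gronwall_integral {y c : ℝ → ℝ} {A : ℝ} (hab : a ≤ b)
    (hc : IntervalIntegrable c volume a b)
    (hcy : IntervalIntegrable (fun t => c t * y t) volume a b)
    (hc0 : ∀ᵐ t ∂volume.restrict (Ioo a b), 0 ≤ c t)
    (hle : ∀ t ∈ Icc a b, y t ≤ A + ∫ s in a..t, c s * y s) :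
    y b ≤ Real.exp (∫ t in a..b, c t) * A := by
  have h := gronwall hab (HasIntDeriv.integral A hcy) hc
    (intervalIntegrable_const (c := (0 : ℝ))) hc0 (by simp) (by
      filter_upwards [hc0, ae_restrict_mem measurableSet_Ioo] with t h1 h2
      rw [add_zero]
      exact mul_le_mul_of_nonneg_left (hle t (Ioo_subset_Icc_self h2)) h1)
  refine (hle b ⟨hab, le_rfl⟩).trans ?_
  simpa using h

/-- Grönwall is run from every starting time s in the unit window and averaged over s. The initial
value is thereby replaced by the integral of y, which the dissipation controls. -/
theorem gronwall_uniform {y y' c d : ℝ → ℝ} {b : ℝ} (hy : HasIntDeriv (b - 1) b y y')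
    (hc : IntervalIntegrable c volume (b - 1) b) (hd : IntervalIntegrable d volume (b - 1) b)
    (hc0 : ∀ᵐ t ∂volume.restrict (Ioo (b - 1) b), 0 ≤ c t)
    (hd0 : ∀ᵐ t ∂volume.restrict (Ioo (b - 1) b), 0 ≤ d t)
    (hy0 : ∀ t ∈ Icc (b - 1) b, 0 ≤ y t)
    (hle : ∀ᵐ t ∂volume.restrict (Ioo (b - 1) b), y' t ≤ c t * y t + d t) :
    y b ≤ Real.exp (∫ t in (b - 1)..b, c t) * ((∫ t in (b - 1)..b, y t) + ∫ t in (b - 1)..b, d t) := by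
  have hb : b - 1 ≤ b := by linarith
  have key : ∀ s ∈ Icc (b - 1) b, y b ≤ Real.exp (∫ t in (b - 1)..b, c t)
      * (y s + ∫ t in (b - 1)..b, d t) := by
    intro s hs
    have sub : Ioo s b ⊆ Ioo (b - 1) b := Ioo_subset_Ioo_left hs.1
    have i : ∀ {f : ℝ → ℝ}, IntervalIntegrable f volume (b - 1) b →
        IntervalIntegrable f volume s b := fun hf => hf.mono_set (by
      rw [uIcc_of_le hs.2, uIcc_of_le hb]; exact Icc_subset_Icc_left hs.1)
    have i' : ∀ {f : ℝ → ℝ}, IntervalIntegrable f volume (b - 1) b →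
        (∀ᵐ t ∂volume.restrict (Ioo (b - 1) b), 0 ≤ f t) →
        ∫ t in s..b, f t ≤ ∫ t in (b - 1)..b, f t := by
      intro f hf hf0
      refine intervalIntegral.integral_mono_interval hs.1 hs.2 le_rfl ?_ hf
      rwa [Measure.restrict_congr_set Ioo_ae_eq_Ioc] at hf0
    have h := gronwall hs.2 (hy.mono hs ⟨hb, le_rfl⟩ hs.2) (i hc) (i hd)
      (ae_restrict_of_ae_restrict_of_subset sub hc0)
      (ae_restrict_of_ae_restrict_of_subset sub hd0)
      (ae_restrict_of_ae_restrict_of_subset sub hle)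
    refine h.trans ?_
    have hd1 : 0 ≤ ∫ t in s..b, d t := by
      refine intervalIntegral.integral_nonneg_of_ae_restrict hs.2 ?_
      rw [← Measure.restrict_congr_set Ioo_ae_eq_Icc]
      exact ae_restrict_of_ae_restrict_of_subset sub hd0
    have := hy0 s hs
    have h1 := i' hc hc0
    have h2 := i' hd hd0
    gcongr
  have hyc := hy.continuousOn hb
  have hyi : IntervalIntegrable y volume (b - 1) b := by
    refine ContinuousOn.intervalIntegrable ?_
    rwa [uIcc_of_le hb]
  have h1 := intervalIntegral.integral_mono_on hb (intervalIntegrable_const (c := y b))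
    ((hyi.add (intervalIntegrable_const (c := ∫ t in (b - 1)..b, d t))).const_mul
      (Real.exp (∫ t in (b - 1)..b, c t))) key
  rw [intervalIntegral.integral_const_mul, intervalIntegral.integral_add hyi
    intervalIntegrable_const] at h1
  simpa using h1

/-- Decay with an exponentially decaying forcing. -/
theorem gronwall_exp {y y' : ℝ → ℝ} {α β c T : ℝ} (hT : 0 ≤ T) (hαβ : α ≠ β)
    (hy : HasIntDeriv 0 T y y')
    (hle : ∀ᵐ t ∂volume.restrict (Ioo 0 T), y' t ≤ -α * y t + c * Real.exp (-β * t)) :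
    y T ≤ Real.exp (-α * T) * y 0
      + c / (α - β) * (Real.exp (-β * T) - Real.exp (-α * T)) := by
  have hab : α - β ≠ 0 := sub_ne_zero.2 hαβ
  -- Multiplying by e^{αt} leaves the forcing c e^{(α-β)t}, whose primitive is explicit because α ≠
  -- β.
  have he : ContDiff ℝ 1 fun t : ℝ => Real.exp (α * t) := by fun_prop
  have hde : ∀ (r t : ℝ), HasDerivAt (fun t : ℝ => Real.exp (r * t)) (Real.exp (r * t) * r) t :=
    fun r t => by simpa using ((hasDerivAt_id t).const_mul r).exp
  have hd : deriv (fun t : ℝ => Real.exp (α * t)) = fun t => Real.exp (α * t) * α :=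
    funext fun t => (hde α t).deriv
  have h1 := (HasIntDeriv.of_contDiff hT he).mul hT hy
  rw [hd] at h1
  have h2 := h1.le (h := fun t => c * Real.exp ((α - β) * t)) hT
    (Continuous.intervalIntegrable (by fun_prop) _ _) (by
      filter_upwards [hle] with t ht
      have e : Real.exp ((α - β) * t) = Real.exp (α * t) * Real.exp (-β * t) := by
        rw [← Real.exp_add]; ring_nf
      rw [e]
      nlinarith [Real.exp_pos (α * t), mul_le_mul_of_nonneg_left ht (Real.exp_pos (α * t)).le])
  have hi : ∫ t in (0 : ℝ)..T, c * Real.exp ((α - β) * t)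
      = c / (α - β) * (Real.exp ((α - β) * T) - 1) := by
    have := intervalIntegral.integral_eq_sub_of_hasDerivAt (a := 0) (b := T)
      (f := fun t => c / (α - β) * Real.exp ((α - β) * t))
      (f' := fun t => c * Real.exp ((α - β) * t)) (fun t _ => by
        have h := (hde (α - β) t).const_mul (c / (α - β))
        have e : c / (α - β) * (Real.exp ((α - β) * t) * (α - β)) = c * Real.exp ((α - β) * t) := by
          rw [mul_comm (Real.exp _), ← mul_assoc, div_mul_cancel₀ _ hab]
        rwa [e] at h) (Continuous.intervalIntegrable (by fun_prop) _ _)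
    rw [this]; simp; ring
  rw [hi] at h2
  simp only [mul_zero, Real.exp_zero, one_mul] at h2
  have e1 : Real.exp (-α * T) * Real.exp (α * T) = 1 := by
    rw [← Real.exp_add]; simp
  have e2 : Real.exp (-α * T) * Real.exp ((α - β) * T) = Real.exp (-β * T) := by
    rw [← Real.exp_add]; ring_nf
  have h3 := mul_le_mul_of_nonneg_left h2 (Real.exp_pos (-α * T)).le
  rw [← mul_assoc, e1, one_mul] at h3
  refine h3.trans (le_of_eq ?_)
  rw [← e2]
  ring

end Calculus

/-! ### Weak time derivatives and absolute continuity. -/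

section WeakTime

variable {E : Type*} [NormedAddCommGroup E] {T : ℝ}

theorem InLp.integrable {f : ℝ → E} {p : ℝ≥0∞} (hp : 1 ≤ p) (h : InLp p T f) :
    Integrable f (volume.restrict (Ioo 0 T)) := MemLp.integrable hp h

theorem locallyIntegrableOn_Ioo {f : ℝ → E} (h : Integrable f (volume.restrict (Ioo 0 T))) :
    LocallyIntegrableOn f (Ioo 0 T) volume :=
  IntegrableOn.locallyIntegrableOn h

variable [NormedSpace ℝ E]

theorem setIntegral_Ioo_eq {f : ℝ → E} (hf : ∀ t, t ∉ Ioo 0 T → f t = 0) :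
    ∫ t in Ioo 0 T, f t = ∫ t, f t :=
  setIntegral_eq_integral_of_forall_compl_eq_zero hf

theorem eq_zero_of_tsupport {η : ℝ → ℝ} (h : tsupport η ⊆ Ioo 0 T) {t : ℝ} (ht : t ∉ Ioo 0 T) :
    η t = 0 := image_eq_zero_of_notMem_tsupport fun h' => ht (h h')

theorem integrable_test_smul {η : ℝ → ℝ} (hη : Continuous η) (hc : HasCompactSupport η)
    {f : ℝ → E} (hf : Integrable f (volume.restrict (Ioo 0 T))) :
    Integrable (fun t => η t • f t) (volume.restrict (Ioo 0 T)) := by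
  obtain ⟨C, hC⟩ := hc.exists_bound_of_continuous hη
  exact hf.bdd_smul C hη.aestronglyMeasurable (Eventually.of_forall hC)

/-- Weak time derivatives are unique. -/
theorem HasTimeDeriv.unique [CompleteSpace E] {f g g' : ℝ → E} (h : HasTimeDeriv T f g)
    (h' : HasTimeDeriv T f g') (hg : InLp 2 T g) (hg' : InLp 2 T g') :
    ∀ᵐ t ∂volume.restrict (Ioo 0 T), g t = g' t := by
  have ig := hg.integrable one_le_two
  have ig' := hg'.integrable one_le_two
  have := isOpen_Ioo.ae_eq_zero_of_integral_contDiff_smul_eq_zero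
    (locallyIntegrableOn_Ioo (ig.sub ig')) (fun η h1 h2 h3 => by
      have e := (h η h1 h2 h3).symm.trans (h' η h1 h2 h3)
      rw [← setIntegral_Ioo_eq (T := T) fun t ht => by rw [eq_zero_of_tsupport h3 ht, zero_smul]]
      have i1 := integrable_test_smul h1.continuous h2 ig
      have i2 := integrable_test_smul h1.continuous h2 ig'
      simp only [Pi.sub_apply, smul_sub]
      rw [integral_sub i1 i2, neg_inj.1 e, sub_self])
  refine (ae_restrict_iff' measurableSet_Ioo).2 ?_
  filter_upwards [this] with t ht h0
  exact sub_eq_zero.1 (ht h0)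

theorem exists_test_integral_one (hT : 0 < T) : ∃ η : ℝ → ℝ, ContDiff ℝ (⊤ : ℕ∞) η ∧
    HasCompactSupport η ∧ tsupport η ⊆ Ioo 0 T ∧ ∫ t, η t = 1 := by
  let B : ContDiffBump (T / 2) := ⟨T / 8, T / 4, by linarith, by linarith⟩
  refine ⟨B.normed volume, B.contDiff_normed, B.hasCompactSupport_normed, ?_,
    B.integral_normed⟩
  rw [B.tsupport_normed_eq]
  intro t ht
  simp only [B, Metric.mem_closedBall, Real.dist_eq] at ht
  have := abs_le.1 ht
  constructor <;> linarith

/-- A test function with zero mean is the derivative of a test function. -/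
theorem exists_primitive_test {η : ℝ → ℝ} (h1 : ContDiff ℝ (⊤ : ℕ∞) η)
    (h2 : HasCompactSupport η) (h3 : tsupport η ⊆ Ioo 0 T) (h4 : ∫ t, η t = 0) :
    ∃ ξ : ℝ → ℝ, ContDiff ℝ (⊤ : ℕ∞) ξ ∧ HasCompactSupport ξ ∧ tsupport ξ ⊆ Ioo 0 T ∧
      deriv ξ = η := by
  rcases (tsupport η).eq_empty_or_nonempty with he | hne
  · have : η = 0 := by
      funext t; exact image_eq_zero_of_notMem_tsupport (by rw [he]; exact notMem_empty t)
    refine ⟨0, contDiff_const, HasCompactSupport.zero, ?_, ?_⟩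
    · rw [tsupport_eq_empty_iff.2 rfl]; exact empty_subset _
    · rw [this]; funext t; exact deriv_const t 0
  have hK : IsCompact (tsupport η) := h2
  set α := sInf (tsupport η)
  set β := sSup (tsupport η)
  have hα : α ∈ Ioo 0 T := h3 (hK.sInf_mem hne)
  have hβ : β ∈ Ioo 0 T := h3 (hK.sSup_mem hne)
  have zα : ∀ t, t < α → η t = 0 := fun t ht => image_eq_zero_of_notMem_tsupport fun h =>
    absurd (csInf_le hK.bddBelow h) (not_le.2 ht)
  have zβ : ∀ t, β < t → η t = 0 := fun t ht => image_eq_zero_of_notMem_tsupport fun h =>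
    absurd (le_csSup hK.bddAbove h) (not_le.2 ht)
  have hc := h1.continuous
  have hd : ∀ t, HasDerivAt (fun t => ∫ s in (0 : ℝ)..t, η s) (η t) t := fun t =>
    intervalIntegral.integral_hasDerivAt_right (hc.intervalIntegrable _ _)
      (hc.stronglyMeasurableAtFilter _ _) hc.continuousAt
  have hderiv : deriv (fun t => ∫ s in (0 : ℝ)..t, η s) = η := funext fun t => (hd t).deriv
  have hsupp : Function.support (fun t => ∫ s in (0 : ℝ)..t, η s) ⊆ Icc α β := by
    intro t ht
    by_contra hn
    apply ht
    rcases lt_or_ge t α with h | h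
    · refine intervalIntegral.integral_zero_ae (Eventually.of_forall fun s hs => zα s ?_)
      have := hs.2
      rcases le_total 0 t with h0 | h0
      · rw [max_eq_right h0] at this; exact this.trans_lt h
      · rw [max_eq_left h0] at this; exact this.trans_lt hα.1
    · have htβ : β < t := by
        by_contra h'; exact hn ⟨h, not_lt.1 h'⟩
      have h0t : 0 ≤ t := hβ.1.le.trans htβ.le
      show ∫ s in (0 : ℝ)..t, η s = 0
      rw [intervalIntegral.integral_of_le h0t, setIntegral_eq_integral_of_forall_compl_eq_zero, h4]
      intro s hs
      rw [mem_Ioc, not_and_or, not_lt, not_le] at hs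
      rcases hs with hs | hs
      · exact zα s (hs.trans_lt hα.1)
      · exact zβ s (htβ.trans hs)
  refine ⟨fun t => ∫ s in (0 : ℝ)..t, η s, ?_, ?_, ?_, hderiv⟩
  · exact contDiff_infty_iff_deriv.2 ⟨fun t => (hd t).differentiableAt, by rw [hderiv]; exact h1⟩
  · exact HasCompactSupport.of_support_subset_isCompact isCompact_Icc hsupp
  · refine (closure_minimal hsupp isClosed_Icc).trans ?_
    exact Icc_subset_Ioo hα.1 hβ.2

/-- Du Bois-Reymond: f minus the primitive of g annihilates derivatives of test functions, hence is
almost everywhere constant, and by continuity constant on the closed interval. -/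
theorem hasIntDeriv_of_weak_real {f g : ℝ → ℝ} (hT : 0 < T) (hf : ContinuousOn f (Icc 0 T))
    (hg : Integrable g (volume.restrict (Ioo 0 T))) (h : HasTimeDeriv T f g) :
    HasIntDeriv 0 T f g := by
  have ig : IntervalIntegrable g volume 0 T :=
    (intervalIntegrable_iff_integrableOn_Ioo_of_le hT.le).2 hg
  have hG : HasIntDeriv 0 T (fun t => ∫ s in (0 : ℝ)..t, g s) g := by
    simpa using HasIntDeriv.integral (0 : ℝ) ig
  set G : ℝ → ℝ := fun t => ∫ s in (0 : ℝ)..t, g s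
  have cG : ContinuousOn G (Icc 0 T) := hG.continuousOn hT.le
  have cF : ContinuousOn (fun t => f t - G t) (Icc 0 T) := hf.sub cG
  have intC : ∀ {k : ℝ → ℝ}, ContinuousOn k (Icc 0 T) →
      Integrable k (volume.restrict (Ioo 0 T)) := fun hk =>
    (hk.integrableOn_compact isCompact_Icc).mono_set Ioo_subset_Icc_self
  have key : ∀ η : ℝ → ℝ, ContDiff ℝ (⊤ : ℕ∞) η → HasCompactSupport η → tsupport η ⊆ Ioo 0 T →
      ∫ t in Ioo 0 T, deriv η t * (f t - G t) = 0 := by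
    intro η h1 h2 h3
    have hη1 : ContDiff ℝ 1 η := h1.of_le (by exact_mod_cast le_top)
    have hp := (HasIntDeriv.of_contDiff hT.le hη1).mul hT.le hG
    have he := hp.eq T ⟨hT.le, le_rfl⟩
    have z0 : η 0 = 0 := eq_zero_of_tsupport h3 (by simp)
    have zT : η T = 0 := eq_zero_of_tsupport h3 (by simp)
    have cd : Continuous (deriv η) := hη1.continuous_deriv (by simp)
    have i1 := integrable_test_smul cd h2.deriv (intC hf)
    have i2 := integrable_test_smul cd h2.deriv (intC cG)
    have i3 := integrable_test_smul h1.continuous h2 hg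
    simp only [z0, zT, zero_mul, zero_add] at he
    rw [intervalIntegral.integral_of_le hT.le, integral_Ioc_eq_integral_Ioo] at he
    simp only [smul_eq_mul] at i1 i2 i3
    rw [integral_add i3 i2] at he
    have hw := h η h1 h2 h3
    simp only [smul_eq_mul] at hw
    simp only [mul_sub]
    rw [integral_sub i1 i2, hw]
    linarith
  obtain ⟨η₀, a1, a2, a3, a4⟩ := exists_test_integral_one hT
  set c := ∫ t in Ioo 0 T, η₀ t * (f t - G t) with hc
  have hae := isOpen_Ioo.ae_eq_zero_of_integral_contDiff_smul_eq_zero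
    (locallyIntegrableOn_Ioo (intC (cF.sub (continuousOn_const (c := c))))) (fun η h1 h2 h3 => by
      rw [← setIntegral_Ioo_eq (T := T) fun t ht => by rw [eq_zero_of_tsupport h3 ht, zero_smul]]
      set r := ∫ t, η t with hr
      have iη := h1.continuous.integrable_of_hasCompactSupport h2 (μ := volume)
      have iη₀ := a1.continuous.integrable_of_hasCompactSupport a2 (μ := volume)
      -- Subtracting the mean of η times the fixed bump η₀ makes the integral zero, so the
      -- difference is the derivative of a test function.
      obtain ⟨ξ, b1, b2, b3, b4⟩ := exists_primitive_test (T := T)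
        (η := fun t => η t - r * η₀ t) (h1.sub (contDiff_const.mul a1)) (h2.sub a2.mul_left)
        (by
          refine (closure_mono (Function.support_sub η fun t => r * η₀ t)).trans ?_
          rw [closure_union]
          refine union_subset h3 ((closure_mono ?_).trans a3)
          exact Function.support_mul_subset_right _ _) (by
          rw [integral_sub iη (iη₀.const_mul r), integral_const_mul, a4]; simp [hr])
      have hk := key ξ b1 b2 b3
      rw [b4] at hk
      have i1 := integrable_test_smul h1.continuous h2 (intC cF)
      have i2 := integrable_test_smul a1.continuous a2 (intC cF)
      simp only [smul_eq_mul] at i1 i2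
      simp only [sub_mul, mul_assoc] at hk
      rw [integral_sub i1 (i2.const_mul r), integral_const_mul, ← hc] at hk
      have e : ∫ t in Ioo 0 T, η t = r := setIntegral_Ioo_eq fun t ht => eq_zero_of_tsupport h3 ht
      have : ∀ t, η t • (f t - G t - c) = η t * (f t - G t) - η t * c := fun t => by
        rw [smul_eq_mul, mul_sub]
      simp only [Pi.sub_apply, this]
      rw [integral_sub i1 (iη.integrableOn.mul_const c), integral_mul_const, e]
      linarith)
  have hEq : EqOn (fun t => f t - G t) (fun _ => c) (Icc 0 T) := by
    refine Measure.eqOn_Icc_of_ae_eq (μ := volume) hT.ne ?_ cF continuousOn_const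
    rw [← Measure.restrict_congr_set Ioo_ae_eq_Icc]
    refine (ae_restrict_iff' measurableSet_Ioo).2 ?_
    filter_upwards [hae] with t ht h0
    exact sub_eq_zero.1 (ht h0)
  refine ⟨ig, fun x hx => ?_⟩
  have e1 := hEq hx
  have e2 := hEq (x := 0) ⟨le_rfl, hT.le⟩
  simp only [G, intervalIntegral.integral_same] at e1 e2
  linarith

theorem HasTimeDeriv.clm {F : Type*} [NormedAddCommGroup F] [NormedSpace ℝ F] [CompleteSpace E]
    [CompleteSpace F] {f g : ℝ → E} (h : HasTimeDeriv T f g)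
    (hf : Integrable f (volume.restrict (Ioo 0 T))) (hg : Integrable g (volume.restrict (Ioo 0 T)))
    (A : E →L[ℝ] F) : HasTimeDeriv T (fun t => A (f t)) (fun t => A (g t)) := by
  intro η h1 h2 h3
  have hη1 : ContDiff ℝ 1 η := h1.of_le (by exact_mod_cast le_top)
  have cd : Continuous (deriv η) := hη1.continuous_deriv (by simp)
  have e := congrArg A (h η h1 h2 h3)
  rw [map_neg, ← A.integral_comp_comm (integrable_test_smul cd h2.deriv hf),
    ← A.integral_comp_comm (integrable_test_smul h1.continuous h2 hg)] at e
  simpa only [map_smul] using e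

end WeakTime

/-! ### Absolute continuity in a Hilbert space, through scalar pairings. -/

section WeakTimeHilbert

variable {E : Type*} [NormedAddCommGroup E] [InnerProductSpace ℝ E] [CompleteSpace E] {T : ℝ}

/-- A continuous function with an integrable weak time derivative is absolutely continuous. -/
theorem hasIntDeriv_of_weak {f g : ℝ → E} (hT : 0 < T) (hf : ContinuousOn f (Icc 0 T))
    (hg : Integrable g (volume.restrict (Ioo 0 T))) (h : HasTimeDeriv T f g) :
    HasIntDeriv 0 T f g := by
  have ig : IntervalIntegrable g volume 0 T :=
    (intervalIntegrable_iff_integrableOn_Ioo_of_le hT.le).2 hg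
  have hfi : Integrable f (volume.restrict (Ioo 0 T)) :=
    (hf.integrableOn_compact isCompact_Icc).mono_set Ioo_subset_Icc_self
  refine ⟨ig, fun x hx => ext_inner_left ℝ fun k => ?_⟩
  have h1 := hasIntDeriv_of_weak_real (f := fun t => innerSL ℝ k (f t))
    (g := fun t => innerSL ℝ k (g t)) hT ((innerSL ℝ k).continuous.comp_continuousOn hf)
    ((innerSL ℝ k).integrable_comp hg) (h.clm hfi hg _)
  have h2 := h1.eq x hx
  rw [ContinuousLinearMap.intervalIntegral_comp_comm _ (ig.mono_set (by
    rw [uIcc_of_le hx.1, uIcc_of_le hT.le]; exact Icc_subset_Icc_right hx.2)), ← map_add] at h2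
  exact h2

end WeakTimeHilbert

/-! ### Time evolution of norms and of the horizontal Dirichlet integral. -/

section GradientEnergy

variable {L : ℝ} [Fact (0 < L)] {a b : ℝ}

theorem integrable_inner_L2 {μ : Measure ℝ} {f g : ℝ → L2 L} (hf : MemLp f 2 μ)
    (hg : MemLp g 2 μ) : Integrable (fun t => inner ℝ (f t) (g t)) μ :=
  (hf.norm.integrable_mul hg.norm).mono' (hf.1.inner hg.1)
    (Eventually.of_forall fun t => norm_inner_le_norm (f t) (g t))

theorem integrable_norm_mul {μ : Measure ℝ} {f g : ℝ → L2 L} (hf : MemLp f 2 μ)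
    (hg : MemLp g 2 μ) : Integrable (fun t => ‖f t‖ * ‖g t‖) μ :=
  hf.norm.integrable_mul hg.norm

/-- The evolution of weighted energies. -/
theorem HasIntDeriv.inner_clm {f f' : ℝ → L2 L} (hab : a ≤ b) (h : HasIntDeriv a b f f')
    (A : L2 L →L[ℝ] L2 L) (hA : ∀ f g, inner ℝ (A f) g = inner ℝ f (A g)) :
    HasIntDeriv a b (fun t => inner ℝ (A (f t)) (f t)) (fun t => 2 * inner ℝ (A (f t)) (f' t)) := by
  have h1 := h.bilin hab h ((innerSL ℝ).comp A)
  refine h1.congr_deriv hab (Eventually.of_forall fun t => ?_)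
  simp only [ContinuousLinearMap.comp_apply, innerSL_apply_apply]
  rw [hA (f' t), real_inner_comm (A (f t)) (f' t)]
  ring

theorem HasIntDeriv.norm_sq {f f' : ℝ → L2 L} (hab : a ≤ b) (h : HasIntDeriv a b f f') :
    HasIntDeriv a b (fun t => ‖f t‖ ^ 2) (fun t => 2 * inner ℝ (f t) (f' t)) := by
  have h1 := h.inner_clm hab (ContinuousLinearMap.id ℝ (L2 L)) fun _ _ => rfl
  simpa only [ContinuousLinearMap.id_apply, real_inner_self_eq_norm_sq] using h1

theorem abs_sum_inner_le (F : Finset (ℤ × ℤ × ℤ)) (f g : L2 L) :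
    |∑ k ∈ F, (conj (fc k f) * fc k g).re| ≤ ‖f‖ * ‖g‖ := by
  have h1 : ∀ k, |(conj (fc k f) * fc k g).re| ≤ ‖fc k f‖ * ‖fc k g‖ := fun k => by
    refine (Complex.abs_re_le_norm _).trans ?_
    rw [norm_mul, RCLike.norm_conj]
  refine (Finset.abs_sum_le_sum_abs _ _).trans ((Finset.sum_le_sum fun k _ => h1 k).trans ?_)
  refine (Real.sum_mul_le_sqrt_mul_sqrt F _ _).trans ?_
  refine mul_le_mul ?_ ?_ (Real.sqrt_nonneg _) (norm_nonneg _)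
  · exact Real.sqrt_le_iff.2 ⟨norm_nonneg _, sum_le_hasSum F (fun k _ => by positivity)
      (hasSum_norm_sq f)⟩
  · exact Real.sqrt_le_iff.2 ⟨norm_nonneg _, sum_le_hasSum F (fun k _ => by positivity)
      (hasSum_norm_sq g)⟩

/-- The evolution of the horizontal gradient. -/
theorem HasIntDeriv.grad {f f' l : ℝ → L2 L} (hab : a ≤ b) (h : HasIntDeriv a b f f')
    (hx : ∀ t ∈ Icc a b, WeaklyDiff ex (f t)) (hy : ∀ t ∈ Icc a b, WeaklyDiff ey (f t))
    (hl : ∀ᵐ t ∂volume.restrict (Ioo a b), HasHLaplacian (f t) (l t))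
    (h2 : MemLp f' 2 (volume.restrict (Ioo a b))) (hl2 : MemLp l 2 (volume.restrict (Ioo a b))) :
    HasIntDeriv a b (fun t => ‖wderiv ex (f t)‖ ^ 2 + ‖wderiv ey (f t)‖ ^ 2)
      (fun t => -(2 * inner ℝ (l t) (f' t))) := by
  have hin : IntervalIntegrable (fun t => -(2 * inner ℝ (l t) (f' t))) volume a b :=
    (intervalIntegrable_iff_integrableOn_Ioo_of_le hab).2
      ((integrable_inner_L2 hl2 h2).const_mul 2).neg
  refine ⟨hin, fun x hxab => ?_⟩
  obtain ⟨F, hF⟩ := exists_finset_seq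
  have hs : ∀ t ∈ Icc a b, HasSum (fun k => hsym L k * ‖fc k (f t)‖ ^ 2)
      (‖wderiv ex (f t)‖ ^ 2 + ‖wderiv ey (f t)‖ ^ 2) := by
    intro t ht
    have := (hasSum_norm_sq (wderiv ex (f t))).add (hasSum_norm_sq (wderiv ey (f t)))
    refine this.congr_fun fun k => ?_
    rw [(hx t ht).hasWeakDeriv.fc, (hy t ht).hasWeakDeriv.fc, norm_I_mul, norm_I_mul, hsym]
    ring
  have l1 : ∀ t ∈ Icc a b, Tendsto (fun n => ∑ k ∈ F n, hsym L k * ‖fc k (f t)‖ ^ 2) atTop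
      (𝓝 (‖wderiv ex (f t)‖ ^ 2 + ‖wderiv ey (f t)‖ ^ 2)) := fun t ht => (hs t ht).comp hF
  -- The time derivative is only in L², so ∇_h f' is not available. Each Fourier mode is absolutely
  -- continuous, and the finite sums of their derivatives are dominated by 2‖l‖‖f'‖ through
  -- `abs_sum_inner_le`.
  have hmode : ∀ k, HasIntDeriv a b (fun t => hsym L k * ‖fc k (f t)‖ ^ 2)
      (fun t => -(2 * (conj (fc k (l t)) * fc k (f' t)).re)) := by
    intro k
    have hk := h.clm hab (fc k)
    have h3 := ((hk.bilin hab hk (innerSL ℝ)).clm hab (ContinuousLinearMap.mul ℝ ℝ (hsym L k)))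
    have e : ∀ x y : ℂ, innerSL ℝ x y = inner ℝ x y := fun _ _ => rfl
    simp only [e, real_inner_self_eq_norm_sq, ContinuousLinearMap.mul_apply'] at h3
    refine h3.congr_deriv hab ?_
    filter_upwards [hl] with t ht
    rw [real_inner_comm (fc k (f t)) (fc k (f' t)), ht.fc, Complex.inner]
    simp [Complex.mul_re]
    ring
  have h3 : ∀ n, ∑ k ∈ F n, hsym L k * ‖fc k (f x)‖ ^ 2
      = (∑ k ∈ F n, hsym L k * ‖fc k (f a)‖ ^ 2)
        + ∫ t in a..x, ∑ k ∈ F n, -(2 * (conj (fc k (l t)) * fc k (f' t)).re) := fun n =>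
    (HasIntDeriv.sum (F n) fun k _ => hmode k).eq x hxab
  have sub : Ioc a x ⊆ Ioc a b := Ioc_subset_Ioc_right hxab.2
  have iB : IntervalIntegrable (fun t => 2 * (‖l t‖ * ‖f' t‖)) volume a x :=
    ((intervalIntegrable_iff_integrableOn_Ioo_of_le hab).2
      ((integrable_norm_mul hl2 h2).const_mul 2)).mono_set (by
        rw [uIcc_of_le hxab.1, uIcc_of_le hab]; exact Icc_subset_Icc_right hxab.2)
  have l2 : Tendsto (fun n => ∫ t in a..x, ∑ k ∈ F n, -(2 * (conj (fc k (l t)) * fc k (f' t)).re))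
      atTop (𝓝 (∫ t in a..x, -(2 * inner ℝ (l t) (f' t)))) := by
    refine intervalIntegral.tendsto_integral_filter_of_dominated_convergence
      (fun t => 2 * (‖l t‖ * ‖f' t‖)) (Eventually.of_forall fun n => ?_)
      (Eventually.of_forall fun n => Eventually.of_forall fun t _ => ?_) iB
      (Eventually.of_forall fun t _ => ?_)
    · have := (HasIntDeriv.sum (F n) fun k _ => hmode k).intervalIntegrable hxab
      exact this.aestronglyMeasurable_restrict_uIoc
    · rw [Finset.sum_neg_distrib, ← Finset.mul_sum, norm_neg, norm_mul]
      simpa using abs_sum_inner_le (F n) (l t) (f' t)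
    · simp only [Finset.sum_neg_distrib, ← Finset.mul_sum]
      exact (((hasSum_inner (l t) (f' t)).comp hF).const_mul 2).neg
  have l3 := (l1 a ⟨le_rfl, hab⟩).add l2
  simp only [← h3] at l3
  exact tendsto_nhds_unique (l1 x hxab) l3

end GradientEnergy

/-! ### Integrable functions of z and their pairing with weights. -/

/-- Integrable functions of the vertical variable. -/
abbrev Z1 : Type := Lp ℝ 1 (volume : Measure UnitAddCircle)

theorem Z1.integrable (a : Z1) : Integrable a := L1.integrable_coeFn a

/-- Integration against a weight. -/
def Weight.pair (χ : Weight) : Z1 →L[ℝ] ℝ :=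
  LinearMap.mkContinuous
    { toFun := fun a => ∫ z, χ z * a z
      map_add' := fun a b => by
        rw [← integral_add (χ.integrable_mul a.integrable) (χ.integrable_mul b.integrable)]
        refine integral_congr_ae ?_
        filter_upwards [Lp.coeFn_add a b] with z hz
        rw [hz, Pi.add_apply, mul_add]
      map_smul' := fun c a => by
        rw [RingHom.id_apply, smul_eq_mul, ← integral_const_mul]
        refine integral_congr_ae ?_
        filter_upwards [Lp.coeFn_smul c a] with z hz
        rw [hz, Pi.smul_apply, smul_eq_mul]
        ring }
    χ.bound fun a => by
      simp only [LinearMap.coe_mk, AddHom.coe_mk]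
      rw [L1.norm_eq_integral_norm, ← integral_const_mul]
      refine (norm_integral_le_integral_norm _).trans ?_
      refine integral_mono_of_nonneg (Eventually.of_forall fun z => norm_nonneg _)
        (a.integrable.norm.const_mul _) (Eventually.of_forall fun z => ?_)
      simp only [norm_mul]
      exact mul_le_mul_of_nonneg_right (χ.abs_le z) (norm_nonneg _)

theorem Weight.pair_apply (χ : Weight) (a : Z1) : χ.pair a = ∫ z, χ z * a z := rfl

theorem Weight.pair_le_norm {χ : Weight} (h1 : ∀ z, |χ z| ≤ 1) (a : Z1) : χ.pair a ≤ ‖a‖ := by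
  rw [pair_apply, L1.norm_eq_integral_norm]
  refine MeasureTheory.integral_mono (χ.integrable_mul a.integrable) a.integrable.norm fun z => ?_
  refine (le_abs_self _).trans ?_
  rw [abs_mul, Real.norm_eq_abs]
  exact mul_le_of_le_one_left (abs_nonneg _) (h1 z)

theorem Weight.ae_eq {f g : UnitAddCircle → ℝ} (hf : Integrable f) (hg : Integrable g)
    (h : ∀ χ : Weight, ∫ z, χ z * f z = ∫ z, χ z * g z) : f =ᵐ[volume] g := by
  filter_upwards [Weight.ae_le hf hg fun χ _ => (h χ).le,
    Weight.ae_le hg hf fun χ _ => (h χ).ge] with z h1 h2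
  exact le_antisymm h1 h2

/-! ### Horizontal integrals of products and the nonlocal term. -/

section Hint

variable {L : ℝ} [Fact (0 < L)]

theorem hdot_add_left (f g k : L2 L) :
    hdot (f + g) k =ᵐ[volume] fun z => hdot f k z + hdot g k z := by
  refine Weight.ae_eq (integrable_hprod _ _) ((integrable_hprod _ _).add (integrable_hprod _ _))
    fun χ => ?_
  simp only [mul_add]
  rw [integral_add (χ.integrable_mul (integrable_hprod _ _))
    (χ.integrable_mul (integrable_hprod _ _)), ← inner_mz, ← inner_mz, ← inner_mz, map_add,
    inner_add_left]

theorem hdot_smul_left (c : ℝ) (f k : L2 L) :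
    hdot (c • f) k =ᵐ[volume] fun z => c * hdot f k z := by
  refine Weight.ae_eq (integrable_hprod _ _) ((integrable_hprod _ _).const_mul c)
    fun χ => ?_
  simp only [mul_left_comm _ c]
  rw [integral_const_mul, ← inner_mz, ← inner_mz, map_smul, real_inner_smul_left]

theorem hdot_comm (f g : L2 L) : hdot f g = hdot g f := by
  funext z; simp only [hdot, mul_comm]

/-- The horizontal integral of a product as an element of `L¹`. -/
def hp (f g : L2 L) : Z1 := (integrable_hprod f g).toL1 (hdot f g)

theorem coeFn_hp (f g : L2 L) : hp f g =ᵐ[volume] hdot f g := Integrable.coeFn_toL1 _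

theorem hp_comm (f g : L2 L) : hp f g = hp g f := by
  apply Lp.ext
  filter_upwards [coeFn_hp f g, coeFn_hp g f] with z h1 h2
  rw [h1, h2, hdot_comm]

theorem norm_hp_le_integral (f g : L2 L) : ‖hp f g‖ ≤ ∫ q, |f q * g q| := by
  rw [L1.norm_eq_integral_norm, integral_torus (integrable_mul_L2 f g).abs]
  refine integral_mono_ae (L1.integrable_coeFn _).norm
    (integrable_hdot (F := fun q => |f q * g q|) (integrable_mul_L2 f g).abs) ?_
  filter_upwards [coeFn_hp f g] with z hz
  rw [hz]
  exact norm_integral_le_integral_norm _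

theorem integral_abs_mul_le_norm (f g : L2 L) : ∫ q, |f q * g q| ≤ ‖f‖ * ‖g‖ := by
  have h := real_inner_le_norm |f| |g|
  rw [norm_abs_eq_norm, norm_abs_eq_norm, inner_eq_integral] at h
  refine le_trans (le_of_eq ?_) h
  refine integral_congr_ae ?_
  filter_upwards [Lp.coeFn_abs f, Lp.coeFn_abs g] with q h1 h2
  rw [h1, h2, abs_mul]

theorem norm_hp_le (f g : L2 L) : ‖hp f g‖ ≤ ‖f‖ * ‖g‖ :=
  (norm_hp_le_integral f g).trans (integral_abs_mul_le_norm f g)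

theorem hp_add_left (f g k : L2 L) : hp (f + g) k = hp f k + hp g k := by
  apply Lp.ext
  filter_upwards [coeFn_hp (f + g) k, coeFn_hp f k, coeFn_hp g k, hdot_add_left f g k,
    Lp.coeFn_add (hp f k) (hp g k)] with z h1 h2 h3 h4 h5
  rw [h1, h4, h5, Pi.add_apply, h2, h3]

theorem hp_smul_left (c : ℝ) (f k : L2 L) : hp (c • f) k = c • hp f k := by
  apply Lp.ext
  filter_upwards [coeFn_hp (c • f) k, coeFn_hp f k, hdot_smul_left c f k,
    Lp.coeFn_smul c (hp f k)] with z h1 h2 h3 h4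
  rw [h1, h3, h4, Pi.smul_apply, h2, smul_eq_mul]

/-- The horizontal integral of a product as a continuous bilinear map. -/
def hpL (L : ℝ) [Fact (0 < L)] : L2 L →L[ℝ] L2 L →L[ℝ] Z1 :=
  LinearMap.mkContinuous₂ (LinearMap.mk₂ ℝ hp hp_add_left hp_smul_left
    (fun f g k => by rw [hp_comm, hp_add_left, hp_comm g, hp_comm k])
    (fun c f g => by rw [hp_comm, hp_smul_left, hp_comm g])) 1 fun f g => by
      rw [one_mul]; exact norm_hp_le f g

/-- Weighted energies are thus pairings of one L¹(z)-valued curve, whose time integral serves all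
weights simultaneously. -/
theorem pair_hp (χ : Weight) (f g : L2 L) : χ.pair (hp f g) = inner ℝ (mz χ f) g := by
  rw [χ.pair_apply, inner_mz]
  refine integral_congr_ae ?_
  filter_upwards [coeFn_hp f g] with z hz
  rw [hz]

theorem aestronglyMeasurable_hp {μ : Measure ℝ} {f g : ℝ → L2 L} (hf : AEStronglyMeasurable f μ)
    (hg : AEStronglyMeasurable g μ) : AEStronglyMeasurable (fun t => hp (f t) (g t)) μ :=
  (hpL L).aestronglyMeasurable_comp₂ hf hg

theorem integrable_hp {μ : Measure ℝ} {f g : ℝ → L2 L} (hf : MemLp f 2 μ) (hg : MemLp g 2 μ) :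
    Integrable (fun t => hp (f t) (g t)) μ :=
  (integrable_norm_mul hf hg).mono' (aestronglyMeasurable_hp hf.1 hg.1)
    (Eventually.of_forall fun t => norm_hp_le (f t) (g t))

theorem hdot_sub_left (f g k : L2 L) :
    hdot (f - g) k =ᵐ[volume] fun z => hdot f k z - hdot g k z := by
  have h := hdot_add_left (f - g) g k
  rw [sub_add_cancel] at h
  filter_upwards [h] with z hz
  rw [hz]; ring

theorem hdot_sub_right (f g k : L2 L) :
    hdot k (f - g) =ᵐ[volume] fun z => hdot k f z - hdot k g z := by
  rw [hdot_comm]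
  filter_upwards [hdot_sub_left f g k] with z hz
  rw [hz, hdot_comm f, hdot_comm g]

theorem hdot_self_nonneg (f : L2 L) (z : UnitAddCircle) : 0 ≤ hdot f f z :=
  integral_nonneg fun p => mul_self_nonneg (f (p.1, p.2, z))

/-- Cauchy–Schwarz on almost every slice, via the discriminant of ∫(tf + g)² in t. -/
theorem hdot_sq_le_mul (f g : L2 L) : ∀ᵐ z, hdot f g z ^ 2 ≤ hdot f f z * hdot g g z := by
  filter_upwards [integrable_slice (integrable_mul_L2 f f), integrable_slice (integrable_mul_L2 f g),
    integrable_slice (integrable_mul_L2 g g)] with z h1 h2 h3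
  have key : ∀ t : ℝ, 0 ≤ hdot f f z * (t * t) + 2 * hdot f g z * t + hdot g g z := by
    intro t
    have : hdot f f z * (t * t) + 2 * hdot f g z * t + hdot g g z
        = ∫ p : AddCircle L × AddCircle L, (t * f (p.1, p.2, z) + g (p.1, p.2, z)) ^ 2 := by
      have e : ∀ p : AddCircle L × AddCircle L, (t * f (p.1, p.2, z) + g (p.1, p.2, z)) ^ 2
          = t * t * (f (p.1, p.2, z) * f (p.1, p.2, z)) + 2 * t * (f (p.1, p.2, z) * g (p.1, p.2, z))
            + g (p.1, p.2, z) * g (p.1, p.2, z) := fun p => by ring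
      simp only [e]
      rw [integral_add (f := fun p : AddCircle L × AddCircle L =>
          t * t * (f (p.1, p.2, z) * f (p.1, p.2, z)) + 2 * t * (f (p.1, p.2, z) * g (p.1, p.2, z)))
          ((h1.const_mul _).add (h2.const_mul _)) h3, integral_add (h1.const_mul _) (h2.const_mul _), integral_const_mul, integral_const_mul]
      simp only [hdot]
      ring
    rw [this]
    exact integral_nonneg fun p => sq_nonneg _
  have := discrim_le_zero key
  unfold discrim at this
  nlinarith

theorem measurePreserving_vert (h : ℝ) :
    MeasurePreserving (fun z : UnitAddCircle => z + (h : UnitAddCircle)) volume volume :=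
  measurePreserving_add_right volume _

theorem hdot_tz (h : ℝ) (f g : L2 L) :
    ∀ᵐ z, hdot (tz h f) (tz h g) z = hdot f g (z + (h : UnitAddCircle)) := by
  have e : ∀ (x y : AddCircle L) (z : UnitAddCircle),
      ((x, y, z) : Torus L) + vshift L h = (x, y, z + (h : UnitAddCircle)) := by
    intro x y z
    simp [vshift, proj, ez]
  filter_upwards [ae_slice (coeFn_tz h f), ae_slice (coeFn_tz h g)] with z h1 h2
  unfold hdot
  refine integral_congr_ae ?_
  filter_upwards [h1, h2] with p h3 h4
  rw [h3, h4, e]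

/-- The nonlocal term `w m` with `m` the mean of `w θ`. -/
def IsNonlocal (w θ r : L2 L) : Prop :=
  ∀ᵐ q, r q = w q * hmean (fun q' => w q' * θ q') q.2.2

theorem hmean_eq_hdot (w θ : L2 L) (z : UnitAddCircle) :
    hmean (fun q => w q * θ q) z = 1 / L ^ 2 * hdot w θ z := rfl

/-- The mean is constant on a slice, so pairing with θ produces it a second time. The nonlocal term
is therefore dissipative at every height. -/
theorem IsNonlocal.hdot_theta {w θ r : L2 L} (h : IsNonlocal w θ r) :
    ∀ᵐ z, hdot r θ z = L ^ 2 * hmean (fun q => w q * θ q) z ^ 2 := by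
  have hL := (L_pos (L := L)).ne'
  filter_upwards [ae_slice h] with z hz
  have : hdot r θ z = ∫ p : AddCircle L × AddCircle L,
      hmean (fun q => w q * θ q) z * (w (p.1, p.2, z) * θ (p.1, p.2, z)) := by
    refine integral_congr_ae ?_
    filter_upwards [hz] with p hp
    rw [hp]; ring
  rw [this, integral_const_mul]
  show hmean (fun q => w q * θ q) z * hdot w θ z = _
  rw [hmean_eq_hdot]
  field_simp

theorem IsNonlocal.hdot_self {w θ r : L2 L} (h : IsNonlocal w θ r) :
    ∀ᵐ z, hdot r r z = hmean (fun q => w q * θ q) z ^ 2 * hdot w w z := by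
  filter_upwards [ae_slice h] with z hz
  have : hdot r r z = ∫ p : AddCircle L × AddCircle L,
      hmean (fun q => w q * θ q) z ^ 2 * (w (p.1, p.2, z) * w (p.1, p.2, z)) := by
    refine integral_congr_ae ?_
    filter_upwards [hz] with p hp
    rw [hp]; ring
  rw [this, integral_const_mul]
  rfl

theorem IsNonlocal.inner_nonneg {w θ r : L2 L} (h : IsNonlocal w θ r) {χ : Weight}
    (hχ : ∀ z, 0 ≤ χ z) : 0 ≤ inner ℝ (mz χ r) θ := by
  rw [inner_mz]
  refine integral_nonneg_of_ae ?_
  filter_upwards [h.hdot_theta] with z hz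
  rw [hz]
  exact mul_nonneg (hχ z) (by positivity)

/-- On a slice ∫r² is the squared mean times ∫w², and the squared mean is, up to L², the dissipation
∫rθ of the θ-balance. A bound N for the profile of w² converts one into the other. -/
theorem IsNonlocal.norm_sq_le {w θ r : L2 L} (h : IsNonlocal w θ r) {N : Weight}
    (hN : ∀ᵐ z, hdot w w z ≤ N z) : ‖r‖ ^ 2 ≤ 1 / L ^ 2 * inner ℝ (mz N r) θ := by
  have hL := L_pos (L := L)
  rw [← real_inner_self_eq_norm_sq, ← mz_one r, inner_mz, mz_one, inner_mz, ← integral_const_mul]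
  refine integral_mono_ae ((Weight.const 1).integrable_mul (integrable_hprod r r))
    ((N.integrable_mul (integrable_hprod r θ)).const_mul _) ?_
  filter_upwards [hN, h.hdot_theta, h.hdot_self] with z h1 h2 h3
  simp only [Weight.const, one_mul]
  rw [h2, h3]
  have : 1 / L ^ 2 * (N z * (L ^ 2 * hmean (fun q => w q * θ q) z ^ 2))
      = hmean (fun q => w q * θ q) z ^ 2 * N z := by field_simp
  rw [this]
  exact mul_le_mul_of_nonneg_left h1 (sq_nonneg _)

/-- Discrete product rule, used twice: for w times the mean, and for the product wθ inside the mean.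
The shift is placed so that ∫(τw)(δθ), with τ the shift and δ the difference, occurs squared. -/
theorem IsNonlocal.hdot_dz {w θ r : L2 L} (hr : IsNonlocal w θ r) (h : ℝ) :
    ∀ᵐ z, hdot (dz h θ) (dz h r) z = hmean (fun q => w q * θ q) z * hdot (dz h θ) (dz h w) z
      + 1 / L ^ 2 * (hdot (dz h w) θ z + hdot (tz h w) (dz h θ) z) * hdot (dz h θ) (tz h w) z := by
  have hq : ∀ᵐ q, dz h r q = dz h w q * hmean (fun q => w q * θ q) q.2.2
      + tz h w q * (hmean (fun q => w q * θ q) (q.2.2 + (h : UnitAddCircle))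
        - hmean (fun q => w q * θ q) q.2.2) := by
    have hr' := (measurePreserving_shift (L := L) h).quasiMeasurePreserving.ae hr
    rw [dz_apply, dz_apply]
    filter_upwards [hr, hr', coeFn_tz h w, coeFn_tz h r, Lp.coeFn_sub (tz h w) w,
      Lp.coeFn_sub (tz h r) r] with q h1 h2 h3 h4 h5 h6
    have e : (q + vshift L h).2.2 = q.2.2 + (h : UnitAddCircle) := by simp [vshift, proj, ez]
    rw [h6, h5, Pi.sub_apply, Pi.sub_apply, h4, h3, h2, h1, e]
    ring
  filter_upwards [ae_slice hq, integrable_slice (integrable_mul_L2 (dz h θ) (dz h w)),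
    integrable_slice (integrable_mul_L2 (dz h θ) (tz h w)), hdot_tz h w θ,
    hdot_sub_left (tz h w) w θ, hdot_sub_right (tz h θ) θ (tz h w)] with z h1 h2 h3 h4 h5 h6
  have e : hdot (dz h θ) (dz h r) z = ∫ p : AddCircle L × AddCircle L,
      (hmean (fun q => w q * θ q) z * (dz h θ (p.1, p.2, z) * dz h w (p.1, p.2, z))
      + (hmean (fun q => w q * θ q) (z + (h : UnitAddCircle)) - hmean (fun q => w q * θ q) z)
        * (dz h θ (p.1, p.2, z) * tz h w (p.1, p.2, z))) := by
    refine integral_congr_ae ?_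
    filter_upwards [h1] with p hp
    rw [hp]; ring
  rw [e, integral_add (h2.const_mul _) (h3.const_mul _), integral_const_mul, integral_const_mul]
  show _ * hdot (dz h θ) (dz h w) z + _ * hdot (dz h θ) (tz h w) z = _
  have e2 : hdot (dz h w) θ z + hdot (tz h w) (dz h θ) z
      = hdot w θ (z + (h : UnitAddCircle)) - hdot w θ z := by
    rw [dz_apply, dz_apply, h5, h6, h4]; ring
  rw [e2, hmean_eq_hdot, hmean_eq_hdot]
  ring

/-- The nonlocal term in the equation for vertical differences. -/
theorem IsNonlocal.inner_dz_le {w θ r : L2 L} (hr : IsNonlocal w θ r) (h : ℝ) {χ N : Weight}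
    (hχ : ∀ z, 0 ≤ χ z) (hN : ∀ᵐ z, hdot (dz h θ) (dz h θ) z ≤ N z) {S B : ℝ} (hB : 0 < B)
    (hS : ∀ᵐ z, hdot θ θ z ≤ S) :
    -(2 * inner ℝ (mz χ (dz h θ)) (dz h r)) ≤ B / L ^ 2 * inner ℝ (mz (χ.mul N) r) θ
      + (1 / B + S / (2 * L ^ 2)) * inner ℝ (mz χ (dz h w)) (dz h w) := by
  have hL := L_pos (L := L)
  rw [inner_mz, inner_mz, inner_mz, ← integral_const_mul, ← integral_const_mul,
    ← integral_const_mul, ← integral_neg, ← integral_add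
    (((χ.mul N).integrable_mul (integrable_hprod _ _)).const_mul _)
    ((χ.integrable_mul (integrable_hprod _ _)).const_mul _)]
  refine integral_mono_ae ((χ.integrable_mul (integrable_hprod _ _)).const_mul _).neg
    ((((χ.mul N).integrable_mul (integrable_hprod _ _)).const_mul _).add
    ((χ.integrable_mul (integrable_hprod _ _)).const_mul _)) ?_
  filter_upwards [hN, hS, hr.hdot_dz h, hr.hdot_theta, hdot_sq_le_mul (dz h θ) (dz h w),
    hdot_sq_le_mul (dz h w) θ] with z h1 h2 h3 h4 h5 h6
  rw [h3, h4, hdot_comm (dz h θ) (tz h w)]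
  set m := hmean (fun q => w q * θ q) z
  set k := hdot (dz h θ) (dz h w) z
  set y := hdot (dz h w) θ z
  set x := hdot (tz h w) (dz h θ) z
  set W := hdot (dz h w) (dz h w) z with hW
  set A := hdot (dz h θ) (dz h θ) z
  have hW0 : 0 ≤ W := hdot_self_nonneg _ _
  -- Cauchy–Schwarz and the bound N for the profile of the difference of θ, then Young with
  -- parameter B. The term m²N is the θ-dissipation with weight N.
  have i1 : -(2 * (m * k)) ≤ B * m ^ 2 * N z + 1 / B * W := by
    have a1 : k ^ 2 ≤ N z * W := h5.trans (mul_le_mul_of_nonneg_right h1 hW0)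
    have a2 : (m * k) ^ 2 ≤ (B * m ^ 2 * N z) * (1 / B * W) := by
      have : (B * m ^ 2 * N z) * (1 / B * W) = m ^ 2 * (N z * W) := by field_simp
      rw [this, mul_pow]
      exact mul_le_mul_of_nonneg_left a1 (sq_nonneg _)
    have b1 : 0 ≤ B * m ^ 2 * N z := by
      have : 0 ≤ N z := (hdot_self_nonneg _ _).trans h1
      positivity
    have b2 : 0 ≤ 1 / B * W := by positivity
    nlinarith [sq_nonneg (B * m ^ 2 * N z - 1 / B * W),
      abs_le_of_sq_le_sq' (show (2 * (m * k)) ^ 2 ≤ (B * m ^ 2 * N z + 1 / B * W) ^ 2 by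
        nlinarith [sq_nonneg (B * m ^ 2 * N z - 1 / B * W)]) (by linarith)]
  -- Completing the square: -2x² - 2xy ≤ y²/2. The good sign of x² removes any dependence on the
  -- size of w.
  have i2 : -(2 * (1 / L ^ 2 * (y + x) * x)) ≤ S / (2 * L ^ 2) * W := by
    have a1 : y ^ 2 ≤ W * S := h6.trans (mul_le_mul_of_nonneg_left h2 hW0)
    have : S / (2 * L ^ 2) * W = 1 / L ^ 2 * (W * S / 2) := by field_simp
    rw [this, show -(2 * (1 / L ^ 2 * (y + x) * x)) = 1 / L ^ 2 * (-(2 * (y + x) * x)) by ring]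
    refine mul_le_mul_of_nonneg_left ?_ (by positivity)
    nlinarith [sq_nonneg (2 * x + y)]
  have e : B / L ^ 2 * ((χ.mul N) z * (L ^ 2 * m ^ 2)) = χ z * (B * m ^ 2 * N z) := by
    simp only [Weight.mul]
    field_simp
  rw [e]
  have := mul_le_mul_of_nonneg_left (add_le_add i1 i2) (hχ z)
  linarith

end Hint

/-- A pointwise Grönwall argument in the vertical variable: an inequality that loses half of any
a priori bound can be iterated. -/
theorem halving {T c : ℝ} {a : ℝ → UnitAddCircle → ℝ} {D : Weight → ℝ → ℝ} {X : Z1} (hc : 0 ≤ c)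
    (ha : ∀ τ ∈ Icc 0 T, Integrable (a τ)) (hac : ∀ τ ∈ Icc 0 T, ∀ᵐ z, a τ z ≤ c)
    (hX : ∀ᵐ z, 0 ≤ X z)
    (hD : ∀ χ : Weight, (∀ z, 0 ≤ χ z) → ∀ s ∈ Icc 0 T, 0 ≤ D χ s)
    (hE : ∀ N : Weight, (∀ z, 0 ≤ N z) → (∀ τ ∈ Icc 0 T, ∀ᵐ z, a τ z ≤ N z) →
      ∀ χ : Weight, (∀ z, 0 ≤ χ z) → ∀ s ∈ Icc 0 T,
        (∫ z, χ z * a s z) + D χ s ≤ (∫ z, χ z * X z) + 1 / 2 * ∫ z, χ z * N z)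
    {s : ℝ} (hs : s ∈ Icc 0 T) : (∫ z, a s z) + D (Weight.const 1) s ≤ 2 * ∫ z, X z := by
  have hXm : Measurable X := (Lp.stronglyMeasurable X).measurable
  -- The successive bounds 2X + c·2⁻ᵏ, capped at c so that they are bounded, and made nonnegative
  -- everywhere because X ≥ 0 is known only almost everywhere.
  let N : ℕ → Weight := fun k => ⟨fun z => max 0 (min c (2 * X z + c * (1 / 2) ^ k)),
    measurable_const.max (measurable_const.min ((hXm.const_mul 2).add_const _)), c, fun z => by
      rw [abs_of_nonneg (le_max_left _ _)]; exact max_le hc (min_le_left _ _)⟩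
  have hN0 : ∀ k z, 0 ≤ N k z := fun k z => le_max_left _ _
  have iN : ∀ k, Integrable (N k) := fun k => (N k).integrable
  have key : ∀ k, ∀ τ ∈ Icc 0 T, ∀ᵐ z, a τ z ≤ N k z := by
    intro k
    induction k with
    | zero =>
      intro τ hτ
      filter_upwards [hac τ hτ, hX] with z h1 h2
      refine le_max_of_le_right (le_min h1 ?_)
      simp only [pow_zero, mul_one]
      linarith
    | succ k ih =>
      intro τ hτ
      have h1 : a τ ≤ᵐ[volume] fun z => X z + 1 / 2 * N k z := by
        refine Weight.ae_le (ha τ hτ) (X.integrable.add ((iN k).const_mul _)) fun χ hχ => ?_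
        have := hE (N k) (hN0 k) ih χ hχ τ hτ
        simp only [mul_add, mul_left_comm _ (1 / 2 : ℝ)]
        rw [integral_add (χ.integrable_mul X.integrable)
          ((χ.integrable_mul (iN k)).const_mul _), integral_const_mul]
        have := hD χ hχ τ hτ
        linarith
      filter_upwards [h1, hac τ hτ, hX] with z h2 h3 h4
      refine le_max_of_le_right (le_min h3 (h2.trans ?_))
      -- The recursion closes since X + ½(2X + c·2⁻ᵏ) = 2X + c·2⁻⁽ᵏ⁺¹⁾.
      have h5 : N k z ≤ 2 * X z + c * (1 / 2) ^ k := max_le (by positivity) (min_le_right _ _)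
      rw [pow_succ]
      linarith
  have hb : ∀ k : ℕ, (∫ z, a s z) + D (Weight.const 1) s
      ≤ 2 * (∫ z, X z) + c / 2 * (1 / 2) ^ k := by
    intro k
    have h1 := hE (N k) (hN0 k) (key k) (Weight.const 1) (fun z => zero_le_one) s hs
    simp only [Weight.const, one_mul] at h1
    have h2 : ∫ z, N k z ≤ ∫ z, (2 * X z + c * (1 / 2) ^ k) := by
      refine integral_mono_ae (iN k) ((X.integrable.const_mul 2).add (integrable_const _)) ?_
      filter_upwards [hX] with z hz
      exact max_le (by positivity) (min_le_right _ _)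
    rw [integral_add (X.integrable.const_mul 2) (integrable_const _), integral_const_mul] at h2
    have hv : volume.real (univ : Set UnitAddCircle) = 1 := by
      simp [Measure.real, AddCircle.measure_univ]
    simp [hv] at h2
    simp only [Weight.const]
    rw [show (1 / 2 : ℝ) ^ k = (2 ^ k)⁻¹ by rw [one_div, inv_pow]]
    linarith
  have lim : Tendsto (fun k : ℕ => 2 * (∫ z, X z) + c / 2 * (1 / 2 : ℝ) ^ k) atTop
      (𝓝 (2 * (∫ z, X z) + c / 2 * 0)) :=
    ((tendsto_pow_atTop_nhds_zero_of_lt_one (by norm_num) (by norm_num)).const_mul _).const_add _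
  have := ge_of_tendsto' lim hb
  simpa using this

/-! ### Identities and inequalities at a fixed time. -/

section SliceSec

variable {L : ℝ} [Fact (0 < L)]

/-- The squared norm of the horizontal gradient. -/
def gradSq (f : L2 L) : ℝ := ‖wderiv ex f‖ ^ 2 + ‖wderiv ey f‖ ^ 2

theorem gradSq_nonneg (f : L2 L) : 0 ≤ gradSq f := by unfold gradSq; positivity

/-- The regularity of a transported scalar. -/
structure RegScalar (f l : L2 L) : Prop where
  x : WeaklyDiff ex f
  y : WeaklyDiff ey f
  z : WeaklyDiff ez f
  lap : HasHLaplacian f l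
  noMean : NoMean f

theorem RegScalar.reg2 {f l : L2 L} (h : RegScalar f l) : Reg2 f := h.lap.reg2 h.x h.y

/-- The state of a solution at a fixed time, with its time derivatives and equations. -/
structure Slice (Re Pe Γ ε : ℝ) (u v w θ ω φ ut vt wt θt r : L2 L) : Prop where
  vel : RegVel u v (-(wderiv ey ω)) (wderiv ex ω)
  noMean_u : NoMean u
  noMean_v : NoMean v
  stream_x : HasWeakDeriv ex φ (-v)
  stream_y : HasWeakDeriv ey φ u
  lap_stream : HasHLaplacian φ (-ω)
  curl : ω = wderiv ex v - wderiv ey u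
  ω_x : WeaklyDiff ex ω
  ω_y : WeaklyDiff ey ω
  ω_z : WeaklyDiff ez ω
  reg_w : RegScalar w (lapH w)
  reg_θ : RegScalar θ (lapH θ)
  φ_z : WeaklyDiff ez φ
  φ_zz : WeaklyDiff ez (wderiv ez φ)
  nonlocal : IsNonlocal w θ r
  eq_w : wt = -adv u v w + wderiv ez φ + Γ • θ + (1 / Re) • lapH w
  eq_θ : θt = -adv u v θ - r + (1 / Pe) • lapH θ
  eq_ω : ∀ ψ ψx ψy : L2 L, HasWeakDeriv ex ψ ψx → HasWeakDeriv ey ψ ψy →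
    -inner ℝ vt ψx + inner ℝ ut ψy = inner ℝ (mulL u ω) ψx + inner ℝ (mulL v ω) ψy
      + inner ℝ (wderiv ez w) ψ - (1 / Re) * (inner ℝ (wderiv ex ω) ψx + inner ℝ (wderiv ey ω) ψy)
      + ε ^ 2 * inner ℝ (wderiv ez (wderiv ez φ)) ψ

theorem inner_mulL_swap {u v f : L2 L} (hu : RegXZ u) (hv : RegXZ v) (hf : WeaklyDiff ey f) :
    inner ℝ (mulL u f) v = inner ℝ (mulL v f) u := by
  rw [inner_eq_integral, inner_eq_integral]
  refine integral_congr_ae ?_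
  filter_upwards [coeFn_mulL hu hf, coeFn_mulL hv hf] with q h1 h2
  rw [h1, h2]; ring

theorem inner_adv_self {u v f : L2 L} (hu : RegXZ u) (hv : RegXZ v) (hvy : WeaklyDiff ey v)
    (hdiv : wderiv ex u + wderiv ey v = 0) (hf : Reg2 f) : inner ℝ f (adv u v f) = 0 := by
  have := inner_mz_adv hu hv hvy hdiv hf (Weight.const 1)
  rwa [mz_one] at this

theorem inner_lap_self {f l : L2 L} (hx : WeaklyDiff ex f) (hy : WeaklyDiff ey f)
    (hl : HasHLaplacian f l) : inner ℝ f l = -gradSq f := by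
  have := inner_mz_lap hx hy hl (Weight.const 1)
  simp only [mz_one, real_inner_self_eq_norm_sq] at this
  exact this

theorem young {a b c : ℝ} (hc : 0 < c) : 2 * a * b ≤ c * a ^ 2 + 1 / c * b ^ 2 := by
  have h : c * a ^ 2 + 1 / c * b ^ 2 - 2 * a * b = c * (a - 1 / c * b) ^ 2 := by
    field_simp
    ring
  nlinarith [mul_nonneg hc.le (sq_nonneg (a - 1 / c * b))]

theorem two_inner_le (f g : L2 L) {c : ℝ} (hc : 0 < c) :
    2 * inner ℝ f g ≤ c * ‖f‖ ^ 2 + 1 / c * ‖g‖ ^ 2 := by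
  have h1 := real_inner_le_norm f g
  have h2 := young (a := ‖f‖) (b := ‖g‖) hc
  linarith

namespace Slice

variable {Re Pe Γ ε : ℝ} {u v w θ ω φ ut vt wt θt r : L2 L}

theorem gradSq_vel (h : Slice Re Pe Γ ε u v w θ ω φ ut vt wt θt r) :
    gradSq u + gradSq v = ‖ω‖ ^ 2 := by
  rw [h.curl]
  exact norm_grad_eq_curl h.vel.ru.x.hasWeakDeriv h.vel.uy.hasWeakDeriv h.vel.rv.x.hasWeakDeriv
    h.vel.vy.hasWeakDeriv h.vel.div

/-- For a divergence-free field Δ_h u = -ω_y and Δ_h v = ω_x, so the products of Laplacian and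
vertical derivative in `vsup` split by Young into ‖∇_h ω‖² and ‖𝐮_z‖². -/
theorem qvel_le (h : Slice Re Pe Γ ε u v w θ ω φ ut vt wt θt r) :
    qvel u v (-(wderiv ey ω)) (wderiv ex ω) ≤ ‖ω‖ ^ 2 + gradSq ω
      + (‖wderiv ez u‖ ^ 2 + ‖wderiv ez v‖ ^ 2) := by
  have h1 := h.gradSq_vel
  unfold qvel vsup
  unfold gradSq at *
  rw [norm_neg]
  nlinarith [sq_nonneg (‖wderiv ey ω‖ - ‖wderiv ez u‖), sq_nonneg (‖wderiv ex ω‖ - ‖wderiv ez v‖)]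

/-- No vertical derivative occurs in the θ-equation, so the balance holds with an arbitrary weight
and there is no flux between heights. -/
theorem theta_weighted (h : Slice Re Pe Γ ε u v w θ ω φ ut vt wt θt r) (χ : Weight) :
    inner ℝ (mz χ θ) θt = -inner ℝ (mz χ r) θ - 1 / Pe *
      (inner ℝ (mz χ (wderiv ex θ)) (wderiv ex θ) + inner ℝ (mz χ (wderiv ey θ)) (wderiv ey θ)) := by
  rw [h.eq_θ, inner_add_right, inner_sub_right, inner_neg_right, real_inner_smul_right,
    inner_mz_adv h.vel.ru h.vel.rv h.vel.vy h.vel.div h.reg_θ.reg2,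
    inner_mz_lap h.reg_θ.x h.reg_θ.y h.reg_θ.lap, inner_mz_comm χ θ r, real_inner_comm θ (mz χ r)]
  ring

theorem theta_le (h : Slice Re Pe Γ ε u v w θ ω φ ut vt wt θt r) :
    2 * inner ℝ θ θt ≤ -(2 / Pe * gradSq θ) := by
  have h1 := h.theta_weighted (Weight.const 1)
  have h2 := h.nonlocal.inner_nonneg (χ := Weight.const 1) fun _ => zero_le_one
  simp only [mz_one, real_inner_self_eq_norm_sq] at h1 h2
  have : 2 / Pe * gradSq θ = 2 * (1 / Pe * (‖wderiv ex θ‖ ^ 2 + ‖wderiv ey θ‖ ^ 2)) := by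
    unfold gradSq; ring
  linarith

theorem w_weighted_le (h : Slice Re Pe Γ ε u v w θ ω φ ut vt wt θt r) (hRe : 0 < Re) {χ : Weight}
    (hχ : ∀ z, 0 ≤ χ z) :
    2 * inner ℝ (mz χ w) wt ≤ inner ℝ (mz χ (wderiv ez φ)) (wderiv ez φ)
      + Γ ^ 2 * inner ℝ (mz χ θ) θ + 2 * inner ℝ (mz χ w) w := by
  rw [h.eq_w, inner_add_right, inner_add_right, inner_add_right, inner_neg_right,
    real_inner_smul_right, real_inner_smul_right,
    inner_mz_adv h.vel.ru h.vel.rv h.vel.vy h.vel.div h.reg_w.reg2,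
    inner_mz_lap h.reg_w.x h.reg_w.y h.reg_w.lap]
  have h1 := two_inner_mz_le hχ w (wderiv ez φ)
  have h2 := two_inner_mz_le hχ w (Γ • θ)
  simp only [map_smul, real_inner_smul_left, real_inner_smul_right] at h2
  have h3 : 0 ≤ 1 / Re * (inner ℝ (mz χ (wderiv ex w)) (wderiv ex w)
      + inner ℝ (mz χ (wderiv ey w)) (wderiv ey w)) :=
    mul_nonneg (by positivity) (add_nonneg (inner_mz_self_nonneg hχ _) (inner_mz_self_nonneg hχ _))
  have h4 : Γ * (Γ * inner ℝ (mz χ θ) θ) = Γ ^ 2 * inner ℝ (mz χ θ) θ := by ring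
  linarith

/-- The energy balance. -/
theorem energy (h : Slice Re Pe Γ ε u v w θ ω φ ut vt wt θt r) :
    inner ℝ u ut + inner ℝ v vt + inner ℝ w wt = -(1 / Re * (‖ω‖ ^ 2 + gradSq w))
      - ε ^ 2 * ‖wderiv ez φ‖ ^ 2 + Γ * inner ℝ w θ := by
  -- Tested with the stream function, whose gradient is (-v, u), the left side is the pairing of
  -- velocity and acceleration and the two transport terms cancel.
  have h1 := h.eq_ω φ (-v) u h.stream_x h.stream_y
  simp only [inner_neg_right] at h1
  rw [inner_mulL_swap h.vel.ru h.vel.rv h.ω_y, h.ω_x.hasWeakDeriv.inner h.vel.rv.x.hasWeakDeriv,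
    h.ω_y.hasWeakDeriv.inner h.vel.uy.hasWeakDeriv,
    h.reg_w.z.hasWeakDeriv.inner h.φ_z.hasWeakDeriv,
    h.φ_zz.hasWeakDeriv.inner h.φ_z.hasWeakDeriv, real_inner_self_eq_norm_sq] at h1
  have h2 : inner ℝ ω (wderiv ex v) - inner ℝ ω (wderiv ey u) = ‖ω‖ ^ 2 := by
    rw [← inner_sub_right, ← h.curl, real_inner_self_eq_norm_sq]
  have h3 : inner ℝ w wt = inner ℝ w (wderiv ez φ) + Γ * inner ℝ w θ - 1 / Re * gradSq w := by
    rw [h.eq_w, inner_add_right, inner_add_right, inner_add_right, inner_neg_right,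
      real_inner_smul_right, real_inner_smul_right,
      inner_adv_self h.vel.ru h.vel.rv h.vel.vy h.vel.div h.reg_w.reg2,
      inner_lap_self h.reg_w.x h.reg_w.y h.reg_w.lap]
    ring
  rw [real_inner_comm ut u, real_inner_comm vt v, h3, ← h2]
  linarith

/-- The mixed derivatives of the velocity. -/
theorem vel_z (h : Slice Re Pe Γ ε u v w θ ω φ ut vt wt θt r) :
    HasWeakDeriv ex (wderiv ez v) (wderiv ez (wderiv ex v)) ∧
      ∃ uyz, HasWeakDeriv ey (wderiv ez u) uyz ∧ HasWeakDeriv ez (wderiv ey u) uyz ∧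
        wderiv ez ω = wderiv ez (wderiv ex v) - uyz := by
  have h1 := h.vel.rv.x.hasWeakDeriv.comm h.vel.rv.z.hasWeakDeriv h.vel.rv.xz.hasWeakDeriv
  have e : wderiv ey u = wderiv ex v - ω := by rw [h.curl]; abel
  have h2 : HasWeakDeriv ez (wderiv ey u) (wderiv ez (wderiv ex v) - wderiv ez ω) := by
    rw [e]; exact h.vel.rv.xz.hasWeakDeriv.sub h.ω_z.hasWeakDeriv
  refine ⟨h1, _, h.vel.uy.hasWeakDeriv.comm h.vel.ru.z.hasWeakDeriv h2, h2, by abel⟩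

theorem stream_z (h : Slice Re Pe Γ ε u v w θ ω φ ut vt wt θt r) :
    HasWeakDeriv ex (wderiv ez φ) (-wderiv ez v) ∧ HasWeakDeriv ey (wderiv ez φ) (wderiv ez u) :=
  ⟨h.stream_x.comm h.φ_z.hasWeakDeriv h.vel.rv.z.hasWeakDeriv.neg,
    h.stream_y.comm h.φ_z.hasWeakDeriv h.vel.ru.z.hasWeakDeriv⟩

/-- One integration by parts in z and one horizontally, using ∇_h φ_z = (-v_z, u_z). This is the
damping of 𝐮_z on which the gradient estimates rest. -/
theorem inner_stream_zz (h : Slice Re Pe Γ ε u v w θ ω φ ut vt wt θt r) :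
    inner ℝ (wderiv ez (wderiv ez φ)) ω = -(‖wderiv ez u‖ ^ 2 + ‖wderiv ez v‖ ^ 2) := by
  obtain ⟨h1, uyz, h2, h3, h4⟩ := h.vel_z
  obtain ⟨h5, h6⟩ := h.stream_z
  rw [h.φ_zz.hasWeakDeriv.inner h.ω_z.hasWeakDeriv, h4, inner_sub_right]
  have e1 := h5.inner h1
  have e2 := h6.inner h2
  rw [inner_neg_left, real_inner_self_eq_norm_sq] at e1
  rw [real_inner_self_eq_norm_sq] at e2
  linarith

/-- The vertical derivative is moved from w onto the velocity, where the damping of 𝐮_z absorbs it;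
only ∇_h w is left. -/
theorem inner_wz_vorticity (h : Slice Re Pe Γ ε u v w θ ω φ ut vt wt θt r) :
    inner ℝ (wderiv ez w) ω = inner ℝ (wderiv ex w) (wderiv ez v)
      - inner ℝ (wderiv ey w) (wderiv ez u) := by
  obtain ⟨h1, uyz, h2, h3, h4⟩ := h.vel_z
  rw [h.reg_w.z.hasWeakDeriv.inner h.ω_z.hasWeakDeriv, h4, inner_sub_right,
    h.reg_w.x.hasWeakDeriv.inner h1, h.reg_w.y.hasWeakDeriv.inner h2]
  ring

/-- The enstrophy inequality. -/
theorem enstrophy_le (h : Slice Re Pe Γ ε u v w θ ω φ ut vt wt θt r) (hε : ε ≠ 0) :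
    -(2 * inner ℝ (-(wderiv ey ω)) ut) + -(2 * inner ℝ (wderiv ex ω) vt)
      ≤ -(2 / Re * gradSq ω) - ε ^ 2 * (‖wderiv ez u‖ ^ 2 + ‖wderiv ez v‖ ^ 2)
        + 1 / ε ^ 2 * gradSq w := by
  have h1 := h.eq_ω ω _ _ h.ω_x.hasWeakDeriv h.ω_y.hasWeakDeriv
  -- Skew symmetry with both functions equal to ω makes the transport term vanish.
  have h2 := skew h.vel.ru h.vel.rv h.vel.vy h.vel.div h.ω_x h.ω_y h.ω_x h.ω_y
  rw [real_inner_comm (mulL u ω) (wderiv ex ω), real_inner_comm (mulL v ω) (wderiv ey ω)] at h2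
  rw [real_inner_self_eq_norm_sq, real_inner_self_eq_norm_sq, h.inner_stream_zz,
    h.inner_wz_vorticity] at h1
  have hε2 : 0 < ε ^ 2 := by positivity
  have y1 := two_inner_le (wderiv ez v) (wderiv ex w) hε2
  have y2 := two_inner_le (wderiv ez u) (-wderiv ey w) hε2
  rw [inner_neg_right, norm_neg] at y2
  rw [real_inner_comm (wderiv ex w)] at y1
  rw [real_inner_comm (wderiv ey w)] at y2
  rw [inner_neg_left, real_inner_comm ut, real_inner_comm vt]
  have e1 : 2 / Re * gradSq ω = 2 * (1 / Re * (‖wderiv ex ω‖ ^ 2 + ‖wderiv ey ω‖ ^ 2)) := by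
    unfold gradSq; ring
  have e2 : 1 / ε ^ 2 * gradSq w
      = 1 / ε ^ 2 * ‖wderiv ex w‖ ^ 2 + 1 / ε ^ 2 * ‖wderiv ey w‖ ^ 2 := by unfold gradSq; ring
  rw [e1, e2]
  linarith

/-- Young's inequality on `abs_inner_adv_lap_le`; 144 is the square of the constant 12 there. -/
theorem adv_lap_le {u v lu lv f l : L2 L} (h : RegVel u v lu lv) (hf : RegScalar f l)
    {c : ℝ} (hc : 0 < c) :
    2 * inner ℝ l (adv u v f) ≤ c * ‖l‖ ^ 2 + 144 / c * (qvel u v lu lv * gradSq f) := by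
  have h1 := abs_inner_adv_lap_le h hf.x hf.y hf.lap
  have h2 := (le_abs_self _).trans h1
  rw [real_inner_comm] at h2
  have hq : 0 ≤ qvel u v lu lv := add_nonneg (vsup_nonneg _ _ _ _) (vsup_nonneg _ _ _ _)
  have hg := gradSq_nonneg f
  have y := young (a := ‖l‖) (b := 12 * √(qvel u v lu lv) * √(gradSq f)) hc
  have e : (12 * √(qvel u v lu lv) * √(gradSq f)) ^ 2 = 144 * (qvel u v lu lv * gradSq f) := by
    rw [mul_pow, mul_pow, Real.sq_sqrt hq, Real.sq_sqrt hg]; ring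
  rw [e] at y
  unfold gradSq at *
  have : 144 / c * (qvel u v lu lv * (‖wderiv ex f‖ ^ 2 + ‖wderiv ey f‖ ^ 2))
    = 1 / c * (144 * (qvel u v lu lv * (‖wderiv ex f‖ ^ 2 + ‖wderiv ey f‖ ^ 2))) := by ring
  linarith

/-- The terms from advection, φ_z and buoyancy may each use a third of (1/Re)‖Δ_h w‖², leaving half
of the dissipation. -/
theorem grad_w_le (h : Slice Re Pe Γ ε u v w θ ω φ ut vt wt θt r) (hRe : 0 < Re) :
    -(2 * inner ℝ (lapH w) wt) ≤ -(1 / Re * ‖lapH w‖ ^ 2) + 3 * Re * ‖wderiv ez φ‖ ^ 2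
      + 3 * Re * Γ ^ 2 * ‖θ‖ ^ 2
      + 432 * Re * (qvel u v (-(wderiv ey ω)) (wderiv ex ω) * gradSq w) := by
  have hc : 0 < 1 / (3 * Re) := by positivity
  have h1 := adv_lap_le h.vel h.reg_w hc
  have h2 := two_inner_le (lapH w) (-wderiv ez φ) hc
  have h3 := two_inner_le (lapH w) (-(Γ • θ)) hc
  rw [norm_neg, inner_neg_right] at h2 h3
  rw [norm_smul, real_inner_smul_right, mul_pow, Real.norm_eq_abs, sq_abs] at h3
  rw [h.eq_w, inner_add_right, inner_add_right, inner_add_right, inner_neg_right,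
    real_inner_smul_right, real_inner_smul_right, real_inner_self_eq_norm_sq]
  have e1 : 1 / (1 / (3 * Re)) = 3 * Re := by field_simp
  have e2 : 144 / (1 / (3 * Re)) = 432 * Re := by field_simp; norm_num
  have e3 : 1 / (3 * Re) * ‖lapH w‖ ^ 2 = 1 / 3 * (1 / Re * ‖lapH w‖ ^ 2) := by field_simp
  rw [e1] at h2 h3
  rw [e2] at h1
  rw [e3] at h1 h2 h3
  linarith

theorem grad_theta_le (h : Slice Re Pe Γ ε u v w θ ω φ ut vt wt θt r) (hPe : 0 < Pe) :
    -(2 * inner ℝ (lapH θ) θt) ≤ -(1 / Pe * ‖lapH θ‖ ^ 2) + 2 * Pe * ‖r‖ ^ 2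
      + 288 * Pe * (qvel u v (-(wderiv ey ω)) (wderiv ex ω) * gradSq θ) := by
  have hc : 0 < 1 / (2 * Pe) := by positivity
  have h1 := adv_lap_le h.vel h.reg_θ hc
  have h2 := two_inner_le (lapH θ) r hc
  rw [h.eq_θ, inner_add_right, inner_sub_right, inner_neg_right, real_inner_smul_right,
    real_inner_self_eq_norm_sq]
  have e1 : 1 / (1 / (2 * Pe)) = 2 * Pe := by field_simp
  have e2 : 144 / (1 / (2 * Pe)) = 288 * Pe := by field_simp; norm_num
  have e3 : 1 / (2 * Pe) * ‖lapH θ‖ ^ 2 = 1 / 2 * (1 / Pe * ‖lapH θ‖ ^ 2) := by field_simp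
  rw [e1] at h2
  rw [e2] at h1
  rw [e3] at h1 h2
  linarith

end Slice

end SliceSec

/-! ### Vertical differences at a fixed time. -/

section Differences

variable {L : ℝ} [Fact (0 < L)]

theorem WeaklyDiff.tz {e : ℝ × ℝ × ℝ} {f : L2 L} (hf : WeaklyDiff e f) (h : ℝ) :
    WeaklyDiff e (tz h f) := ⟨_, hf.hasWeakDeriv.tz h⟩

theorem WeaklyDiff.dz {e : ℝ × ℝ × ℝ} {f : L2 L} (hf : WeaklyDiff e f) (h : ℝ) :
    WeaklyDiff e (dz h f) := ⟨_, hf.hasWeakDeriv.dz h⟩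

theorem wderiv_tz {e : ℝ × ℝ × ℝ} {f : L2 L} (hf : WeaklyDiff e f) (h : ℝ) :
    wderiv e (tz h f) = tz h (wderiv e f) := (hf.hasWeakDeriv.tz h).wderiv_eq

theorem wderiv_dz {e : ℝ × ℝ × ℝ} {f : L2 L} (hf : WeaklyDiff e f) (h : ℝ) :
    wderiv e (dz h f) = dz h (wderiv e f) := (hf.hasWeakDeriv.dz h).wderiv_eq

theorem RegXZ.tz {u : L2 L} (hu : RegXZ u) (h : ℝ) : RegXZ (tz h u) where
  x := hu.x.tz h
  z := hu.z.tz h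
  xz := by rw [wderiv_tz hu.x]; exact hu.xz.tz h

theorem RegXZ.dz {u : L2 L} (hu : RegXZ u) (h : ℝ) : RegXZ (dz h u) := (hu.tz h).sub hu

theorem Reg2.dz {f : L2 L} (hf : Reg2 f) (h : ℝ) : Reg2 (dz h f) where
  x := hf.x.dz h
  y := hf.y.dz h
  xy := by rw [wderiv_dz hf.x]; exact hf.xy.dz h
  yy := by rw [wderiv_dz hf.y]; exact hf.yy.dz h

theorem tz_mulL {f g : L2 L} (hf : RegXZ f) (hg : WeaklyDiff ey g) (h : ℝ) :
    tz h (mulL f g) = mulL (tz h f) (tz h g) := by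
  have h1 := (measurePreserving_shift (L := L) h).quasiMeasurePreserving.ae (coeFn_mulL hf hg)
  apply Lp.ext
  filter_upwards [h1, coeFn_tz h f, coeFn_tz h g, coeFn_tz h (mulL f g),
    coeFn_mulL (hf.tz h) (hg.tz h)] with q h2 h3 h4 h5 h6
  rw [h5, h6, h3, h4, h2]

theorem dz_mulL {f g : L2 L} (hf : RegXZ f) (hg : WeaklyDiff ey g) (h : ℝ) :
    dz h (mulL f g) = mulL f (dz h g) + mulL (dz h f) (tz h g) := by
  rw [dz_apply, tz_mulL hf hg, dz_apply, dz_apply, mulL_sub_right hf (hg.tz h) hg,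
    mulL_sub_left (hf.tz h) hf (hg.tz h)]
  abel

theorem dz_mulL' {f g : L2 L} (hf : RegXZ f) (hg : WeaklyDiff ey g) (h : ℝ) :
    dz h (mulL f g) = mulL (dz h f) g + mulL (tz h f) (dz h g) := by
  rw [dz_apply, tz_mulL hf hg, dz_apply, dz_apply, mulL_sub_right (hf.tz h) (hg.tz h) hg,
    mulL_sub_left (hf.tz h) hf hg]
  abel

theorem mulL_neg_right {f g : L2 L} (hf : RegXZ f) (hg : WeaklyDiff ey g) :
    mulL f (-g) = -mulL f g := by
  have h0 : WeaklyDiff ey (0 : L2 L) := ⟨0, HasWeakDeriv.zero ey⟩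
  have z : mulL f (0 : L2 L) = 0 := by
    have := mulL_sub_right hf h0 h0
    simpa using this
  have := mulL_sub_right hf h0 hg
  rw [zero_sub, z, zero_sub] at this
  exact this

theorem dz_adv {u v f : L2 L} (hu : RegXZ u) (hv : RegXZ v) (hf : Reg2 f) (h : ℝ) :
    dz h (adv u v f) = adv (dz h u) (dz h v) f + adv (tz h u) (tz h v) (dz h f) := by
  rw [adv, map_add, dz_mulL' hu hf.xy, dz_mulL' hv hf.yy, adv, adv, wderiv_dz hf.x, wderiv_dz hf.y]
  abel

/-- In `dz_adv` the shift falls on the velocity in front of the differenced scalar. That part is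
transport by a divergence-free field and drops out for every weight. -/
theorem inner_mz_dz_adv {u v f : L2 L} (hu : RegXZ u) (hv : RegXZ v) (hvy : WeaklyDiff ey v)
    (hdiv : wderiv ex u + wderiv ey v = 0) (hf : Reg2 f) (h : ℝ) (χ : Weight) :
    inner ℝ (mz χ (dz h f)) (dz h (adv u v f))
      = inner ℝ (mz χ (dz h f)) (adv (dz h u) (dz h v) f) := by
  rw [dz_adv hu hv hf, inner_add_right, inner_mz_adv (hu.tz h) (hv.tz h) (hvy.tz h) ?_ (hf.dz h),
    add_zero]
  rw [wderiv_tz hu.x, wderiv_tz hvy, ← map_add, hdiv, map_zero]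

theorem hbound_poincare {f : L2 L} (hf : NoMean f) (hx : WeaklyDiff ex f) (hy : WeaklyDiff ey f) :
    hbound f (wderiv ex f) ≤ 3 * ‖f‖ * √(gradSq f) ∧
      hbound f (wderiv ey f) ≤ 3 * ‖f‖ * √(gradSq f) := by
  have hp := poincare hf hx.hasWeakDeriv hy.hasWeakDeriv
  have hD : 0 ≤ √(gradSq f) := Real.sqrt_nonneg _
  have hD2 : √(gradSq f) ^ 2 = gradSq f := Real.sq_sqrt (gradSq_nonneg f)
  have h1 := young_poincare (L := L) (norm_nonneg f) hD (by rw [hD2]; exact hp)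
  have nx : ‖wderiv ex f‖ ≤ √(gradSq f) := Real.le_sqrt_of_sq_le (by unfold gradSq; nlinarith [sq_nonneg ‖wderiv ey f‖])
  have ny : ‖wderiv ey f‖ ≤ √(gradSq f) := Real.le_sqrt_of_sq_le (by unfold gradSq; nlinarith [sq_nonneg ‖wderiv ex f‖])
  exact ⟨(hbound_le le_rfl nx).trans h1, (hbound_le le_rfl ny).trans h1⟩

theorem integral_abs_le_of_lintegral' {f : Torus L → ℝ} (hf : AEStronglyMeasurable f volume)
    {r : ℝ} (hr : 0 ≤ r) (h : ∫⁻ q, ENNReal.ofReal |f q| ≤ ENNReal.ofReal r) :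
    Integrable f ∧ ∫ q, |f q| ≤ r := by
  have hi : Integrable f := ⟨hf, by
    rw [hasFiniteIntegral_iff_norm]
    exact h.trans_lt ENNReal.ofReal_lt_top⟩
  refine ⟨hi, ?_⟩
  rw [← ofReal_integral_eq_lintegral_ofReal hi.abs
    (Eventually.of_forall fun q => abs_nonneg _)] at h
  exact (ENNReal.ofReal_le_ofReal_iff hr).1 h

/-- Each horizontal factor is bounded by 3‖·‖ times its gradient norm by Poincaré, and Young
separates gradients from norms: the square root of 4·η·9/(4η) is the product of the two constants 3
up to square root. -/
theorem integral_abs_tri_le {g l g' a b : L2 L} (hg : RegScalar g l)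
    (hg' : g' = wderiv ex g ∨ g' = wderiv ey g) (na : NoMean a) (ax : WeaklyDiff ex a)
    (ay : WeaklyDiff ey a) (nb : NoMean b) (bx : WeaklyDiff ex b) (hby : WeaklyDiff ey b)
    {η : ℝ} (hη : 0 < η) :
    Integrable (fun q => a q * g' q * b q) ∧ ∫ q, |a q * g' q * b q| ≤ η / 2 * (gradSq a + gradSq b)
      + 9 / (4 * η) * (vsup (wderiv ex g) (wderiv ey g) (wderiv ez g) l * ‖a‖ * ‖b‖) := by
  have h1 := lintegral_tri_L2_le hg.x.hasWeakDeriv hg.y.hasWeakDeriv hg.z.hasWeakDeriv hg.lap hg'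
    ax.hasWeakDeriv hby.hasWeakDeriv
  obtain ⟨hi, h2⟩ := integral_abs_le_of_lintegral'
    (((Lp.aestronglyMeasurable a).mul (Lp.aestronglyMeasurable g')).mul
      (Lp.aestronglyMeasurable b)) (Real.sqrt_nonneg _) h1
  refine ⟨hi, h2.trans ?_⟩
  set V := vsup (wderiv ex g) (wderiv ey g) (wderiv ez g) l
  have hV : 0 ≤ V := vsup_nonneg _ _ _ _
  have ha := (hbound_poincare na ax ay).1
  have hb := (hbound_poincare nb bx hby).2
  set A := √(gradSq a) with hA
  set B := √(gradSq b) with hB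
  have hA0 : 0 ≤ A := Real.sqrt_nonneg _
  have hB0 : 0 ≤ B := Real.sqrt_nonneg _
  have hA2 : A ^ 2 = gradSq a := Real.sq_sqrt (gradSq_nonneg a)
  have hB2 : B ^ 2 = gradSq b := Real.sq_sqrt (gradSq_nonneg b)
  have n1 := norm_nonneg a
  have n2 := norm_nonneg b
  have h3 : V * hbound a (wderiv ex a) * hbound b (wderiv ey b)
      ≤ (η * (A * B) + 9 / (4 * η) * (V * ‖a‖ * ‖b‖)) ^ 2 := by
    have h4 : V * hbound a (wderiv ex a) * hbound b (wderiv ey b)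
        ≤ V * (3 * ‖a‖ * A) * (3 * ‖b‖ * B) := by
      have p1 := hbound_nonneg a (wderiv ex a)
      have p2 := hbound_nonneg b (wderiv ey b)
      gcongr
    refine h4.trans ?_
    have e : V * (3 * ‖a‖ * A) * (3 * ‖b‖ * B)
        = 4 * ((η * (A * B)) * (9 / (4 * η) * (V * ‖a‖ * ‖b‖))) := by field_simp; ring
    rw [e]
    nlinarith [sq_nonneg (η * (A * B) - 9 / (4 * η) * (V * ‖a‖ * ‖b‖))]
  have h5 : √(V * hbound a (wderiv ex a) * hbound b (wderiv ey b))
      ≤ η * (A * B) + 9 / (4 * η) * (V * ‖a‖ * ‖b‖) := Real.sqrt_le_iff.2 ⟨by positivity, h3⟩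
  refine h5.trans ?_
  rw [← hA2, ← hB2]
  nlinarith [mul_nonneg hη.le (sq_nonneg (A - B))]

theorem abs_add_mul_le {p q r : ℝ} : |(p + q) * r| ≤ |p * r| + |q * r| := by
  rw [add_mul]; exact abs_add_le _ _

theorem integral_abs_adv_le {g l a a' b : L2 L} (hg : RegScalar g l) (ha : RegXZ a) (ha' : RegXZ a')
    (na : NoMean a) (ay : WeaklyDiff ey a) (na' : NoMean a') (ay' : WeaklyDiff ey a')
    (nb : NoMean b) (bx : WeaklyDiff ex b) (hby : WeaklyDiff ey b) {η : ℝ} (hη : 0 < η) :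
    ∫ q, |adv a a' g q * b q| ≤ η * (gradSq a + gradSq a' + gradSq b)
      + 9 / (4 * η) * (vsup (wderiv ex g) (wderiv ey g) (wderiv ez g) l * (‖a‖ + ‖a'‖) * ‖b‖) := by
  obtain ⟨i1, h1⟩ := integral_abs_tri_le hg (Or.inl rfl) na ha.x ay nb bx hby hη
  obtain ⟨i2, h2⟩ := integral_abs_tri_le hg (Or.inr rfl) na' ha'.x ay' nb bx hby hη
  have h3 : ∫ q, |adv a a' g q * b q|
      ≤ ∫ q, (|a q * wderiv ex g q * b q| + |a' q * wderiv ey g q * b q|) := by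
    refine integral_mono_ae (integrable_mul_L2 _ _).abs (i1.abs.add i2.abs) ?_
    filter_upwards [coeFn_adv ha ha' hg.reg2] with q hq
    rw [hq]
    exact abs_add_mul_le
  rw [integral_add i1.abs i2.abs] at h3
  have p1 := mul_nonneg hη.le (gradSq_nonneg a)
  have p2 := mul_nonneg hη.le (gradSq_nonneg a')
  have p3 := mul_nonneg hη.le (gradSq_nonneg b)
  linarith

namespace Slice

variable {Re Pe Γ ε : ℝ} {u v w θ ω φ ut vt wt θt r : L2 L}

/-- The coefficient with which a transported scalar enters the estimate for vertical derivatives. -/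
def coef (u v g l : L2 L) : ℝ := gradSq g + 2 * ‖l‖ * (‖wderiv ez u‖ + ‖wderiv ez v‖)

theorem coef_nonneg (u v g l : L2 L) : 0 ≤ coef u v g l := by
  have := gradSq_nonneg g
  unfold coef; positivity

/-- The squared norm of the vertical derivatives. -/
def vertSq (u v w θ : L2 L) : ℝ :=
  ‖wderiv ez u‖ ^ 2 + ‖wderiv ez v‖ ^ 2 + ‖wderiv ez w‖ ^ 2 + ‖wderiv ez θ‖ ^ 2

theorem vertSq_nonneg (u v w θ : L2 L) : 0 ≤ vertSq u v w θ := by unfold vertSq; positivity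

theorem gradSq_dz_vel (h : Slice Re Pe Γ ε u v w θ ω φ ut vt wt θt r) (k : ℝ) :
    gradSq (dz k u) + gradSq (dz k v) = ‖dz k ω‖ ^ 2 := by
  have e : dz k ω = wderiv ex (dz k v) - wderiv ey (dz k u) := by
    rw [wderiv_dz h.vel.rv.x, wderiv_dz h.vel.uy, ← map_sub, ← h.curl]
  rw [e]
  refine norm_grad_eq_curl (h.vel.ru.x.dz k).hasWeakDeriv (h.vel.uy.dz k).hasWeakDeriv
    (h.vel.rv.x.dz k).hasWeakDeriv (h.vel.vy.dz k).hasWeakDeriv ?_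
  rw [wderiv_dz h.vel.ru.x, wderiv_dz h.vel.vy, ← map_add, h.vel.div, map_zero]

/-- The factor ‖g_z‖ hidden in `vsup` is combined with the one from the difference of g and counted
in `vertSq`. The remaining coefficient contains only u_z and v_z as vertical derivatives, and these
are square integrable in time with a bound from the data. -/
theorem integral_dz_adv_le (h : Slice Re Pe Γ ε u v w θ ω φ ut vt wt θt r) {g l : L2 L}
    (hg : RegScalar g l) (hY : ‖wderiv ez u‖ ^ 2 + ‖wderiv ez v‖ ^ 2 + ‖wderiv ez g‖ ^ 2
      ≤ vertSq u v w θ) (k : ℝ) {η : ℝ} (hη : 0 < η) :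
    ∫ q, |adv (dz k u) (dz k v) g q * dz k g q| ≤ η * (‖dz k ω‖ ^ 2 + gradSq (dz k g))
      + 9 / (4 * η) * (k ^ 2 * (coef u v g l * vertSq u v w θ)) := by
  have h1 := integral_abs_adv_le hg (h.vel.ru.dz k) (h.vel.rv.dz k) (h.noMean_u.dz k)
    (h.vel.uy.dz k) (h.noMean_v.dz k) (h.vel.vy.dz k) (hg.noMean.dz k) (hg.x.dz k) (hg.y.dz k) hη
  rw [h.gradSq_dz_vel k] at h1
  refine h1.trans ?_
  have n1 := norm_dz_le h.vel.ru.z.hasWeakDeriv k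
  have n2 := norm_dz_le h.vel.rv.z.hasWeakDeriv k
  have n3 := norm_dz_le hg.z.hasWeakDeriv k
  set U := ‖wderiv ez u‖
  set V := ‖wderiv ez v‖
  set G := ‖wderiv ez g‖
  have pU : 0 ≤ U := norm_nonneg _
  have pV : 0 ≤ V := norm_nonneg _
  have pG : 0 ≤ G := norm_nonneg _
  set A := vsup (wderiv ex g) (wderiv ey g) (wderiv ez g) l with hA
  have pA : 0 ≤ A := vsup_nonneg _ _ _ _
  have h2 : A * (‖dz k u‖ + ‖dz k v‖) * ‖dz k g‖ ≤ k ^ 2 * (coef u v g l * vertSq u v w θ) := by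
    have h3 : A * (‖dz k u‖ + ‖dz k v‖) * ‖dz k g‖ ≤ A * (|k| * U + |k| * V) * (|k| * G) := by
      gcongr
    refine h3.trans ?_
    have e : A * (|k| * U + |k| * V) * (|k| * G) = |k| ^ 2 * (A * ((U + V) * G)) := by ring
    rw [e, sq_abs]
    refine mul_le_mul_of_nonneg_left ?_ (sq_nonneg k)
    have eA : A = gradSq g + 2 * ‖l‖ * G := rfl
    have b1 : (U + V) * G ≤ vertSq u v w θ := by
      refine le_trans ?_ hY
      nlinarith [sq_nonneg (U - G), sq_nonneg (V - G), sq_nonneg U, sq_nonneg V]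
    have b2 : G ^ 2 ≤ vertSq u v w θ := by nlinarith [sq_nonneg U, sq_nonneg V]
    have c1 : gradSq g * ((U + V) * G) ≤ gradSq g * vertSq u v w θ :=
      mul_le_mul_of_nonneg_left b1 (gradSq_nonneg g)
    have c2 : 2 * ‖l‖ * (U + V) * G ^ 2 ≤ 2 * ‖l‖ * (U + V) * vertSq u v w θ :=
      mul_le_mul_of_nonneg_left b2 (by positivity)
    have e2 : coef u v g l = gradSq g + 2 * ‖l‖ * (U + V) := rfl
    rw [eA, e2]
    linarith
  have : 9 / (4 * η) * (A * (‖dz k u‖ + ‖dz k v‖) * ‖dz k g‖)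
      ≤ 9 / (4 * η) * (k ^ 2 * (coef u v g l * vertSq u v w θ)) :=
    mul_le_mul_of_nonneg_left h2 (by positivity)
  linarith

theorem norm_hp_adv_le (h : Slice Re Pe Γ ε u v w θ ω φ ut vt wt θt r) (k : ℝ) {η : ℝ}
    (hη : 0 < η) :
    ‖hp (adv (dz k u) (dz k v) θ) (dz k θ)‖ ≤ η * (‖dz k ω‖ ^ 2 + gradSq (dz k θ))
      + 9 / (4 * η) * (k ^ 2 * (coef u v θ (lapH θ) * vertSq u v w θ)) :=
  (norm_hp_le_integral _ _).trans (h.integral_dz_adv_le h.reg_θ (by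
    unfold vertSq; linarith [sq_nonneg ‖wderiv ez w‖]) k hη)

/-- The vorticity equation is tested with the forward and then backward difference of φ. The
surviving nonlinear term is rewritten as transport of the difference of φ paired with the difference
of ω. -/
theorem dz_velocity (h : Slice Re Pe Γ ε u v w θ ω φ ut vt wt θt r) (k : ℝ) :
    inner ℝ (dz k u) (dz k ut) + inner ℝ (dz k v) (dz k vt)
      = inner ℝ (dz k ω) (adv u v (dz k φ)) - inner ℝ (dz k w) (dz k (wderiv ez φ))
        - 1 / Re * ‖dz k ω‖ ^ 2 - ε ^ 2 * ‖dz k (wderiv ez φ)‖ ^ 2 := by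
  have h1 := h.eq_ω _ _ _ ((h.stream_x.dz k).dz (-k)) ((h.stream_y.dz k).dz (-k))
  simp only [inner_dz_right, map_neg, inner_neg_right] at h1
  have ωdx := (h.ω_x.hasWeakDeriv.dz k).inner (h.vel.rv.x.hasWeakDeriv.dz k)
  have ωdy := (h.ω_y.hasWeakDeriv.dz k).inner (h.vel.uy.hasWeakDeriv.dz k)
  have wz := (h.reg_w.z.hasWeakDeriv.dz k).inner (h.φ_z.hasWeakDeriv.dz k)
  have φzz := (h.φ_zz.hasWeakDeriv.dz k).inner (h.φ_z.hasWeakDeriv.dz k)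
  rw [real_inner_self_eq_norm_sq] at φzz
  rw [ωdx, ωdy, wz, φzz, dz_mulL h.vel.ru h.ω_y, dz_mulL h.vel.rv h.ω_y, inner_add_left,
    inner_add_left, inner_mulL_swap (h.vel.ru.dz k) (h.vel.rv.dz k) (h.ω_y.tz k)] at h1
  have e1 : inner ℝ (dz k ω) (dz k (wderiv ex v)) - inner ℝ (dz k ω) (dz k (wderiv ey u))
      = ‖dz k ω‖ ^ 2 := by
    rw [← inner_sub_right, ← map_sub, ← h.curl, real_inner_self_eq_norm_sq]
  have dv := h.vel.vy.dz k
  have du := h.vel.uy.dz k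
  have e2 : inner ℝ (dz k ω) (adv u v (dz k φ))
      = -inner ℝ (mulL u (dz k ω)) (dz k v) + inner ℝ (mulL v (dz k ω)) (dz k u) := by
    rw [adv, (h.stream_x.dz k).wderiv_eq, (h.stream_y.dz k).wderiv_eq, map_neg,
      mulL_neg_right h.vel.ru dv, inner_add_right, inner_neg_right,
      inner_mulL_comm (memLp_mul h.vel.ru (h.ω_y.dz k)) (memLp_mul h.vel.ru dv),
      inner_mulL_comm (memLp_mul h.vel.rv (h.ω_y.dz k)) (memLp_mul h.vel.rv du)]
  rw [real_inner_comm (dz k ut), real_inner_comm (dz k vt), e2, ← e1]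
  linarith

theorem dz_w (h : Slice Re Pe Γ ε u v w θ ω φ ut vt wt θt r) (k : ℝ) :
    inner ℝ (dz k w) (dz k wt) = -inner ℝ (dz k w) (adv (dz k u) (dz k v) w)
      + inner ℝ (dz k w) (dz k (wderiv ez φ)) + Γ * inner ℝ (dz k w) (dz k θ)
      - 1 / Re * gradSq (dz k w) := by
  have h1 := inner_mz_dz_adv h.vel.ru h.vel.rv h.vel.vy h.vel.div h.reg_w.reg2 k (Weight.const 1)
  rw [mz_one] at h1
  rw [h.eq_w, map_add, map_add, map_add, map_neg, map_smul, map_smul, inner_add_right,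
    inner_add_right, inner_add_right, inner_neg_right, real_inner_smul_right, real_inner_smul_right,
    h1, inner_lap_self (h.reg_w.x.dz k) (h.reg_w.y.dz k) (h.reg_w.lap.dz k)]
  ring

theorem dz_theta_weighted (h : Slice Re Pe Γ ε u v w θ ω φ ut vt wt θt r) (k : ℝ) (χ : Weight) :
    inner ℝ (mz χ (dz k θ)) (dz k θt) = -inner ℝ (mz χ (dz k θ)) (adv (dz k u) (dz k v) θ)
      - inner ℝ (mz χ (dz k θ)) (dz k r)
      - 1 / Pe * (inner ℝ (mz χ (dz k (wderiv ex θ))) (dz k (wderiv ex θ))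
        + inner ℝ (mz χ (dz k (wderiv ey θ))) (dz k (wderiv ey θ))) := by
  have h1 := inner_mz_dz_adv h.vel.ru h.vel.rv h.vel.vy h.vel.div h.reg_θ.reg2 k χ
  rw [h.eq_θ, map_add, map_sub, map_neg, map_smul, inner_add_right, inner_sub_right,
    inner_neg_right, real_inner_smul_right, h1,
    inner_mz_lap (h.reg_θ.x.dz k) (h.reg_θ.y.dz k) (h.reg_θ.lap.dz k), wderiv_dz h.reg_θ.x,
    wderiv_dz h.reg_θ.y]
  ring

/-- The evolution of vertical differences of the velocity. -/
theorem dz_energy_le (h : Slice Re Pe Γ ε u v w θ ω φ ut vt wt θt r) (hRe : 0 < Re) (k : ℝ) :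
    2 * inner ℝ (dz k u) (dz k ut) + 2 * inner ℝ (dz k v) (dz k vt)
      + 2 * inner ℝ (dz k w) (dz k wt)
      ≤ -(1 / Re * ‖dz k ω‖ ^ 2) + k ^ 2 * ((|Γ| + 288 * Re *
        qvel u v (-(wderiv ey ω)) (wderiv ex ω) + 18 * Re * coef u v w (lapH w))
        * vertSq u v w θ) := by
  have h1 := h.dz_velocity k
  have h2 := h.dz_w k
  set q := qvel u v (-(wderiv ey ω)) (wderiv ex ω)
  have hq : 0 ≤ q := add_nonneg (vsup_nonneg _ _ _ _) (vsup_nonneg _ _ _ _)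
  -- Each of the two nonlinear terms may use 1/(2Re) of the squared difference of ω, which leaves
  -- 1/Re out of 2/Re.
  have hR : 0 < 1 / (2 * Re) := by positivity
  have hη : 0 < 1 / (4 * Re) := by positivity
  have n1 := norm_dz_le h.vel.ru.z.hasWeakDeriv k
  have n2 := norm_dz_le h.vel.rv.z.hasWeakDeriv k
  have n3 := norm_dz_le h.reg_w.z.hasWeakDeriv k
  have n4 := norm_dz_le h.reg_θ.z.hasWeakDeriv k
  have s1 := pow_le_pow_left₀ (norm_nonneg _) n1 2
  have s2 := pow_le_pow_left₀ (norm_nonneg _) n2 2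
  have s3 := pow_le_pow_left₀ (norm_nonneg _) n3 2
  have s4 := pow_le_pow_left₀ (norm_nonneg _) n4 2
  simp only [mul_pow, sq_abs] at s1 s2 s3 s4
  -- the vorticity term
  have t1 : 2 * inner ℝ (dz k ω) (adv u v (dz k φ)) ≤ 1 / (2 * Re) * ‖dz k ω‖ ^ 2
      + 288 * Re * (k ^ 2 * (q * vertSq u v w θ)) := by
    have hx := h.stream_x.dz k
    have hy := h.stream_y.dz k
    -- The estimate for transported scalars is applied to the difference of φ: its Laplacian is
    -- minus the difference of ω and its gradient is the rotated difference of the velocity.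
    have a1 := abs_inner_adv_lap_le h.vel ⟨_, hx⟩ ⟨_, hy⟩ (h.lap_stream.dz k)
    rw [map_neg, inner_neg_right, abs_neg, norm_neg, hx.wderiv_eq, hy.wderiv_eq, map_neg,
      norm_neg] at a1
    have a2 := (le_abs_self _).trans a1
    rw [real_inner_comm] at a2
    have y := young (a := ‖dz k ω‖) (b := 12 * √q * √(‖dz k v‖ ^ 2 + ‖dz k u‖ ^ 2)) hR
    have e : (12 * √q * √(‖dz k v‖ ^ 2 + ‖dz k u‖ ^ 2)) ^ 2
        = 144 * (q * (‖dz k v‖ ^ 2 + ‖dz k u‖ ^ 2)) := by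
      rw [mul_pow, mul_pow, Real.sq_sqrt hq, Real.sq_sqrt (by positivity)]; ring
    have e1 : 1 / (1 / (2 * Re)) = 2 * Re := by field_simp
    rw [e, e1] at y
    have b1 : ‖dz k v‖ ^ 2 + ‖dz k u‖ ^ 2 ≤ k ^ 2 * vertSq u v w θ := by
      unfold vertSq
      nlinarith [sq_nonneg k, mul_nonneg (sq_nonneg k) (sq_nonneg ‖wderiv ez w‖),
        mul_nonneg (sq_nonneg k) (sq_nonneg ‖wderiv ez θ‖)]
    have b2 : 2 * Re * (144 * (q * (‖dz k v‖ ^ 2 + ‖dz k u‖ ^ 2)))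
        ≤ 2 * Re * (144 * (q * (k ^ 2 * vertSq u v w θ))) := by gcongr
    linarith
  -- the advection of `w`
  have t2 : -(2 * inner ℝ (dz k w) (adv (dz k u) (dz k v) w)) ≤ 1 / (2 * Re) * (‖dz k ω‖ ^ 2
      + gradSq (dz k w)) + 18 * Re * (k ^ 2 * (coef u v w (lapH w) * vertSq u v w θ)) := by
    have a1 := h.integral_dz_adv_le h.reg_w (by
      unfold vertSq; linarith [sq_nonneg ‖wderiv ez θ‖]) k hη
    have a2 : |inner ℝ (dz k w) (adv (dz k u) (dz k v) w)|
        ≤ ∫ q, |adv (dz k u) (dz k v) w q * dz k w q| := by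
      rw [real_inner_comm, inner_eq_integral]
      exact abs_integral_le_integral_abs
    have a3 := neg_abs_le (inner ℝ (dz k w) (adv (dz k u) (dz k v) w))
    have e1 : 9 / (4 * (1 / (4 * Re))) = 9 * Re := by field_simp
    have e2 : 1 / (4 * Re) * (‖dz k ω‖ ^ 2 + gradSq (dz k w))
        = 1 / 2 * (1 / (2 * Re) * (‖dz k ω‖ ^ 2 + gradSq (dz k w))) := by field_simp; ring
    rw [e1, e2] at a1
    linarith
  have t3 : 2 * (Γ * inner ℝ (dz k w) (dz k θ)) ≤ k ^ 2 * (|Γ| * vertSq u v w θ) := by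
    have a1 := abs_real_inner_le_norm (dz k w) (dz k θ)
    have a2 : 2 * (‖dz k w‖ * ‖dz k θ‖) ≤ k ^ 2 * vertSq u v w θ := by
      unfold vertSq
      nlinarith [sq_nonneg (‖dz k w‖ - ‖dz k θ‖), mul_nonneg (sq_nonneg k) (sq_nonneg ‖wderiv ez u‖),
        mul_nonneg (sq_nonneg k) (sq_nonneg ‖wderiv ez v‖)]
    have a3 : Γ * inner ℝ (dz k w) (dz k θ) ≤ |Γ| * |inner ℝ (dz k w) (dz k θ)| := by
      rw [← abs_mul]; exact le_abs_self _
    have a4 := mul_le_mul_of_nonneg_left a1 (abs_nonneg Γ)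
    have a5 := mul_le_mul_of_nonneg_left a2 (abs_nonneg Γ)
    linarith
  have p1 : 0 ≤ 1 / Re * gradSq (dz k w) := mul_nonneg (by positivity) (gradSq_nonneg _)
  have p2 : 0 ≤ ε ^ 2 * ‖dz k (wderiv ez φ)‖ ^ 2 := by positivity
  have e3 : 1 / (2 * Re) * (‖dz k ω‖ ^ 2 + gradSq (dz k w))
      = 1 / 2 * (1 / Re * ‖dz k ω‖ ^ 2) + 1 / 2 * (1 / Re * gradSq (dz k w)) := by
    field_simp
  have e4 : 1 / (2 * Re) * ‖dz k ω‖ ^ 2 = 1 / 2 * (1 / Re * ‖dz k ω‖ ^ 2) := by field_simp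
  rw [e3] at t2
  rw [e4] at t1
  linarith

end Slice

end Differences

theorem norm_chr {L : ℝ} (k : ℤ × ℤ × ℤ) (q : Torus L) : ‖chr L k q‖ = 1 := by
  simp only [chr_apply, fourier_apply, norm_mul, Circle.norm_coe, mul_one]

/-! ### Measurability in time of products. -/

section ProductMeasurable

variable {L : ℝ} [Fact (0 < L)]

/-- The Fourier coefficient of a product. -/
def mulCoeff (k : ℤ × ℤ × ℤ) (f g : L2 L) : ℂ := ∫ q, ((f q * g q : ℝ) : ℂ) * conj (chr L k q)

theorem integrable_mulCoeff (k : ℤ × ℤ × ℤ) (f g : L2 L) :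
    Integrable fun q => ((f q * g q : ℝ) : ℂ) * conj (chr L k q) :=
  (integrable_mul_L2 f g).ofReal.mul_bdd (c := 1)
    (Complex.continuous_conj.comp (chr L k).continuous).aestronglyMeasurable
    (Eventually.of_forall fun q => by
      rw [RCLike.norm_conj, norm_chr])

theorem mulCoeff_comm (k : ℤ × ℤ × ℤ) (f g : L2 L) : mulCoeff k f g = mulCoeff k g f := by
  simp only [mulCoeff, mul_comm]

theorem mulCoeff_add (k : ℤ × ℤ × ℤ) (f f' g : L2 L) :
    mulCoeff k (f + f') g = mulCoeff k f g + mulCoeff k f' g := by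
  rw [mulCoeff, mulCoeff, mulCoeff,
    ← integral_add (integrable_mulCoeff k f g) (integrable_mulCoeff k f' g)]
  refine integral_congr_ae ?_
  filter_upwards [Lp.coeFn_add f f'] with q hq
  rw [hq, Pi.add_apply]; push_cast; ring

theorem mulCoeff_smul (k : ℤ × ℤ × ℤ) (c : ℝ) (f g : L2 L) :
    mulCoeff k (c • f) g = c • mulCoeff k f g := by
  rw [mulCoeff, mulCoeff, ← integral_smul]
  refine integral_congr_ae ?_
  filter_upwards [Lp.coeFn_smul c f] with q hq
  rw [hq, Pi.smul_apply]; simp; ring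

theorem norm_mulCoeff_le (k : ℤ × ℤ × ℤ) (f g : L2 L) : ‖mulCoeff k f g‖ ≤ ‖f‖ * ‖g‖ := by
  refine (norm_integral_le_integral_norm _).trans ((le_of_eq ?_).trans
    (integral_abs_mul_le_norm f g))
  refine integral_congr_ae (Eventually.of_forall fun q => ?_)
  simp only [norm_mul, RCLike.norm_conj, norm_chr, mul_one, Complex.norm_real, Real.norm_eq_abs,
    abs_mul]

/-- The Fourier coefficient of a product, as a continuous bilinear map. -/
def mulCoeffL (L : ℝ) [Fact (0 < L)] (k : ℤ × ℤ × ℤ) : L2 L →L[ℝ] L2 L →L[ℝ] ℂ :=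
  LinearMap.mkContinuous₂ (LinearMap.mk₂ ℝ (mulCoeff k) (mulCoeff_add k) (mulCoeff_smul k)
    (fun f g h => by
      rw [mulCoeff_comm, mulCoeff_add, mulCoeff_comm k g, mulCoeff_comm k h])
    (fun c f g => by rw [mulCoeff_comm, mulCoeff_smul, mulCoeff_comm k g])) 1 fun f g => by
      rw [one_mul]; exact norm_mulCoeff_le k f g

theorem mulCoeffL_apply (k : ℤ × ℤ × ℤ) (f g : L2 L) : mulCoeffL L k f g = mulCoeff k f g := rfl

theorem fc_mulL {f g : L2 L} (h : MemLp (fun q => f q * g q) 2 (volume : Measure (Torus L)))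
    (k : ℤ × ℤ × ℤ) : fc k (mulL f g) = (L : ℂ)⁻¹ * mulCoeff k f g := by
  rw [fc_eq_integral, mulCoeff]
  congr 1
  refine integral_congr_ae ?_
  filter_upwards [coeFn_mulL_of_memLp h] with q hq
  rw [hq]

/-- Multiplication does not map L² × L² into L², but every Fourier coefficient of the product is a
continuous bilinear function of the factors. -/
theorem aestronglyMeasurable_mulL {μ : Measure ℝ} {f g : ℝ → L2 L} (hf : AEStronglyMeasurable f μ)
    (hg : AEStronglyMeasurable g μ)
    (h : ∀ᵐ t ∂μ, MemLp (fun q => f t q * g t q) 2 (volume : Measure (Torus L))) :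
    AEStronglyMeasurable (fun t => mulL (f t) (g t)) μ := by
  refine aestronglyMeasurable_of_fc fun k => ?_
  have h1 : AEStronglyMeasurable (fun t => (L : ℂ)⁻¹ * mulCoeffL L k (f t) (g t)) μ :=
    ((mulCoeffL L k).aestronglyMeasurable_comp₂ hf hg).const_mul _
  refine h1.congr ?_
  filter_upwards [h] with t ht
  rw [fc_mulL ht, mulCoeffL_apply]

theorem aestronglyMeasurable_adv {μ : Measure ℝ} {u v f : ℝ → L2 L}
    (hu : AEStronglyMeasurable u μ) (hv : AEStronglyMeasurable v μ)
    (hx : AEStronglyMeasurable (fun t => wderiv ex (f t)) μ)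
    (hy : AEStronglyMeasurable (fun t => wderiv ey (f t)) μ)
    (h : ∀ᵐ t ∂μ, RegXZ (u t) ∧ RegXZ (v t) ∧ Reg2 (f t)) :
    AEStronglyMeasurable (fun t => adv (u t) (v t) (f t)) μ := by
  refine (aestronglyMeasurable_mulL hu hx ?_).add (aestronglyMeasurable_mulL hv hy ?_)
  · filter_upwards [h] with t ht
    exact memLp_mul ht.1 ht.2.2.xy
  · filter_upwards [h] with t ht
    exact memLp_mul ht.2.1 ht.2.2.yy

end ProductMeasurable

/-! ### Weak time derivatives under bounded linear maps. -/

section TimeDeriv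

variable {E : Type*} [NormedAddCommGroup E] [NormedSpace ℝ E] {T : ℝ}

theorem HasTimeDeriv.add {f g f' g' : ℝ → E} (h : HasTimeDeriv T f g) (h' : HasTimeDeriv T f' g')
    (hf : Integrable f (volume.restrict (Ioo 0 T))) (hg : Integrable g (volume.restrict (Ioo 0 T)))
    (hf' : Integrable f' (volume.restrict (Ioo 0 T)))
    (hg' : Integrable g' (volume.restrict (Ioo 0 T))) :
    HasTimeDeriv T (fun t => f t + f' t) (fun t => g t + g' t) := by
  intro η h1 h2 h3
  have hd : Continuous (deriv η) := h1.continuous_deriv (by simp)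
  simp only [smul_add]
  rw [integral_add (integrable_test_smul hd h2.deriv hf) (integrable_test_smul hd h2.deriv hf'),
    integral_add (integrable_test_smul h1.continuous h2 hg)
      (integrable_test_smul h1.continuous h2 hg'), h η h1 h2 h3, h' η h1 h2 h3]
  abel

theorem HasTimeDeriv.congr {f f' g : ℝ → E} (h : HasTimeDeriv T f g)
    (hf : ∀ t ∈ Ioo 0 T, f t = f' t) : HasTimeDeriv T f' g := by
  intro η h1 h2 h3
  rw [← h η h1 h2 h3]
  refine setIntegral_congr_fun measurableSet_Ioo fun t ht => ?_
  simp only [hf t ht]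

/-- The weak time derivative of a function that is a bounded linear image of two others. -/
theorem HasTimeDeriv.ae_eq_clm_add {F : Type*} [NormedAddCommGroup F] [NormedSpace ℝ F]
    [CompleteSpace E] [CompleteSpace F] {f g f' g' : ℝ → E} {k k' : ℝ → F} (A B : E →L[ℝ] F)
    (hk : HasTimeDeriv T k k') (h : HasTimeDeriv T f g) (h' : HasTimeDeriv T f' g')
    (hf : InLp 2 T f) (hg : InLp 2 T g) (hf' : InLp 2 T f') (hg' : InLp 2 T g')
    (hk' : InLp 2 T k') (he : ∀ t ∈ Ioo 0 T, A (f t) + B (f' t) = k t) :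
    ∀ᵐ t ∂volume.restrict (Ioo 0 T), k' t = A (g t) + B (g' t) := by
  have i1 := hf.integrable one_le_two
  have i2 := hg.integrable one_le_two
  have i3 := hf'.integrable one_le_two
  have i4 := hg'.integrable one_le_two
  have h1 := (h.clm i1 i2 A).add (h'.clm i3 i4 B) (A.integrable_comp i1) (A.integrable_comp i2)
    (B.integrable_comp i3) (B.integrable_comp i4)
  exact hk.unique (h1.congr he) hk' ((A.comp_memLp' hg).add (B.comp_memLp' hg'))

end TimeDeriv

/-! ### From a strong solution to the pointwise-in-time formulation. -/

section Extraction

variable {L : ℝ} [Fact (0 < L)]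

/-- The functional `ψ ↦ (f, ψ_i)` on `H¹_h`, linear in `f`. -/
def dualComp (L : ℝ) [Fact (0 < L)] (i : Fin 3) : L2 L →L[ℝ] H1hDual L :=
  LinearMap.mkContinuous
    { toFun := fun f =>
        (innerSL ℝ f).comp ((PiLp.proj 2 (fun _ : Fin 3 => L2 L) i).comp (H1h L).subtypeL)
      map_add' := fun f g => by rw [map_add, ContinuousLinearMap.add_comp]
      map_smul' := fun c f => by
        ext ψ
        exact real_inner_smul_left f (ψ.1 i) c }
    ‖(PiLp.proj 2 (fun _ : Fin 3 => L2 L) i).comp (H1h L).subtypeL‖ fun f => by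
      refine (ContinuousLinearMap.opNorm_comp_le _ _).trans (le_of_eq ?_)
      rw [innerSL_apply_norm, mul_comm]

/-- As a functional on H¹_h the vorticity is a bounded linear image of (u, v). Hence ω_t is the same
image of (u_t, v_t), and the vorticity equation can be tested with functions that depend on time
without differentiating ω. -/
theorem toDual_curlH {u v : L2 L} (hu : WeaklyDiff ey u) (hv : WeaklyDiff ex v) :
    toDual (curlH u v) = (-dualComp L 1) v + dualComp L 2 u := by
  ext ψ
  have e1 := hv.hasWeakDeriv.inner ψ.2.1
  have e2 := hu.hasWeakDeriv.inner ψ.2.2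
  change inner ℝ (curlH u v) (ψ.1 0) = -inner ℝ v (ψ.1 1) + inner ℝ u (ψ.1 2)
  rw [curlH, inner_sub_left]
  linarith

/-- A strong solution on `[0,T]`, with its time derivatives, in the form used for the estimates. -/
structure Flow (Re Pe Γ ε T : ℝ) (u v w θ ω φ ut vt wt θt r : ℝ → L2 L) : Prop where
  pos : 0 < T
  Re_pos : 0 < Re
  Pe_pos : 0 < Pe
  ε_ne : ε ≠ 0
  mem_V : ∀ t ∈ Icc 0 T, InV (u t) (v t) (w t) (θ t)
  slice : ∀ᵐ t ∂volume.restrict (Ioo 0 T), Slice Re Pe Γ ε (u t) (v t) (w t) (θ t) (ω t) (φ t)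
    (ut t) (vt t) (wt t) (θt t) (r t)
  du : HasIntDeriv 0 T u ut
  dv : HasIntDeriv 0 T v vt
  dw : HasIntDeriv 0 T w wt
  dθ : HasIntDeriv 0 T θ θt
  ut_L2 : InLp 2 T ut
  vt_L2 : InLp 2 T vt
  wt_L2 : InLp 2 T wt
  θt_L2 : InLp 2 T θt
  u_reg : LinftyH1ContL2 T u
  v_reg : LinftyH1ContL2 T v
  w_reg : LinftyH1ContL2 T w
  θ_reg : LinftyH1ContL2 T θ
  ω_bdd : InLp ∞ T ω
  ωx_L2 : InLp 2 T fun t => wderiv ex (ω t)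
  ωy_L2 : InLp 2 T fun t => wderiv ey (ω t)
  lap_w : InLp 2 T fun t => lapH (w t)
  lap_θ : InLp 2 T fun t => lapH (θ t)
  φz_L2 : InLp 2 T fun t => wderiv ez (φ t)

theorem InLp.of_top {f : ℝ → L2 L} {T : ℝ} (h : InLp ∞ T f) : InLp 2 T f :=
  MemLp.mono_exponent h le_top

/-- The vertical derivative of the velocity is divergence free with curl ω_z ∈ L², so its horizontal
derivatives exist by `weaklyDiff_of_curl`. -/
theorem regXZ_of_curl {u v ω : L2 L} (hux : WeaklyDiff ex u) (huy : WeaklyDiff ey u)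
    (hvx : WeaklyDiff ex v) (hvy : WeaklyDiff ey v) (huz : WeaklyDiff ez u) (hvz : WeaklyDiff ez v)
    (hdiv : wderiv ex u + wderiv ey v = 0) (hω : ω = wderiv ex v - wderiv ey u)
    (hz : WeaklyDiff ez ω) : RegXZ u ∧ RegXZ v := by
  have h1 := weaklyDiff_of_curl (u := wderiv ez u) (v := wderiv ez v) (ω := wderiv ez ω)
    (e := ex) (Or.inl rfl) (fun k => by
      have := congrArg (fc k) hdiv
      rw [map_add, map_zero, hux.hasWeakDeriv.fc, hvy.hasWeakDeriv.fc] at this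
      rw [huz.hasWeakDeriv.fc, hvz.hasWeakDeriv.fc]
      linear_combination (sym L ez k : ℂ) * this) (fun k => by
      have := congrArg (fc k) hω
      rw [map_sub, hvx.hasWeakDeriv.fc, huy.hasWeakDeriv.fc] at this
      rw [hz.hasWeakDeriv.fc, huz.hasWeakDeriv.fc, hvz.hasWeakDeriv.fc, this]
      ring)
  exact ⟨⟨hux, huz, _, huz.hasWeakDeriv.comm hux.hasWeakDeriv h1.1.hasWeakDeriv⟩,
    ⟨hvx, hvz, _, hvz.hasWeakDeriv.comm hvx.hasWeakDeriv h1.2.hasWeakDeriv⟩⟩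

theorem regVel_of_curl {u v ω : L2 L} (hux : WeaklyDiff ex u) (huy : WeaklyDiff ey u)
    (hvx : WeaklyDiff ex v) (hvy : WeaklyDiff ey v) (huz : WeaklyDiff ez u) (hvz : WeaklyDiff ez v)
    (hdiv : wderiv ex u + wderiv ey v = 0) (hω : ω = wderiv ex v - wderiv ey u)
    (hx : WeaklyDiff ex ω) (hy : WeaklyDiff ey ω) (hz : WeaklyDiff ez ω) :
    RegVel u v (-(wderiv ey ω)) (wderiv ex ω) := by
  obtain ⟨ru, rv⟩ := regXZ_of_curl hux huy hvx hvy huz hvz hdiv hω hz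
  have hs : ∀ k, (hsym L k : ℂ) = sym L ex k ^ 2 + sym L ey k ^ 2 := fun k => by simp [hsym]
  have key : ∀ k, fc k ω = Complex.I * (sym L ex k * fc k v - sym L ey k * fc k u) := fun k => by
    rw [hω, map_sub, hvx.hasWeakDeriv.fc, huy.hasWeakDeriv.fc]; ring
  have hd : ∀ k, Complex.I * (sym L ex k * fc k u + sym L ey k * fc k v) = 0 := fun k => by
    have := congrArg (fc k) hdiv
    rw [map_add, map_zero, hux.hasWeakDeriv.fc, hvy.hasWeakDeriv.fc] at this
    linear_combination this
  refine ⟨ru, rv, huy, hvy, hasHLaplacian_iff_fc.2 fun k => ?_, hasHLaplacian_iff_fc.2 fun k => ?_,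
    hdiv⟩
  · rw [map_neg, hy.hasWeakDeriv.fc, key, hs]
    have := hd k
    linear_combination (-(Complex.I * sym L ex k)) * this + ((sym L ex k : ℂ) ^ 2 * fc k u
      + (sym L ey k : ℂ) ^ 2 * fc k u) * Complex.I_sq
  · rw [hx.hasWeakDeriv.fc, key, hs]
    have := hd k
    linear_combination (-(Complex.I * sym L ey k)) * this + ((sym L ex k : ℂ) ^ 2 * fc k v
      + (sym L ey k : ℂ) ^ 2 * fc k v) * Complex.I_sq

/-- The derivative is moved from ω to ψ. In this form the two transport terms cancel when ψ is the
stream function. -/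
theorem integral_adv_mul {u v ω ψ ψx ψy : L2 L} (hu : RegXZ u) (hv : RegXZ v)
    (hvy : WeaklyDiff ey v) (hdiv : wderiv ex u + wderiv ey v = 0) (hx : WeaklyDiff ex ω)
    (hy : WeaklyDiff ey ω) (hψx : HasWeakDeriv ex ψ ψx) (hψy : HasWeakDeriv ey ψ ψy) :
    ∫ q, (u q * wderiv ex ω q + v q * wderiv ey ω q) * ψ q
      = -(inner ℝ (mulL u ω) ψx + inner ℝ (mulL v ω) ψy) := by
  have h1 := skew hu hv hvy hdiv hx hy ⟨_, hψx⟩ ⟨_, hψy⟩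
  rw [hψx.wderiv_eq, hψy.wderiv_eq] at h1
  rw [← h1, inner_eq_integral, inner_eq_integral,
    ← integral_add (integrable_mul_L2 _ _) (integrable_mul_L2 _ _)]
  refine integral_congr_ae ?_
  filter_upwards [coeFn_mulL hu ⟨_, hψy⟩, coeFn_mulL hv ⟨_, hψy⟩] with q h1 h2
  rw [h1, h2]; ring

theorem exists_ae_norm_le {f : ℝ → L2 L} {T : ℝ} (h : InLp ∞ T f) :
    ∃ c, ∀ᵐ t ∂volume.restrict (Ioo 0 T), ‖f t‖ ≤ c := by
  refine ⟨(eLpNormEssSup f (volume.restrict (Ioo 0 T))).toReal, ?_⟩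
  have hfin : eLpNormEssSup f (volume.restrict (Ioo 0 T)) < ∞ := by
    have := h.2
    rwa [eLpNorm_exponent_top] at this
  filter_upwards [ae_le_eLpNormEssSup (f := f) (μ := volume.restrict (Ioo 0 T))] with t ht
  rw [← toReal_enorm]
  exact ENNReal.toReal_mono hfin.ne ht

theorem ae_eq_dualComp {T : ℝ} {u v ut vt : ℝ → L2 L} {k k' : ℝ → H1hDual L}
    (hk : HasTimeDeriv T k k') (hv : HasTimeDeriv T v vt) (hu : HasTimeDeriv T u ut)
    (hk2 : InLp 2 T k') (hv2 : InLp 2 T v) (hvt2 : InLp 2 T vt) (hu2 : InLp 2 T u)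
    (hut2 : InLp 2 T ut) (he : ∀ t ∈ Ioo 0 T, k t = (-dualComp L 1) (v t) + dualComp L 2 (u t)) :
    ∀ᵐ t ∂volume.restrict (Ioo 0 T), k' t = (-dualComp L 1) (vt t) + dualComp L 2 (ut t) := by
  have h1 := HasTimeDeriv.ae_eq_clm_add (E := L2 L) (F := H1hDual L) (k := k) (k' := k')
    (-dualComp L 1) (dualComp L 2) hk hv hu
  have h2 := h1 hv2 hvt2 hu2 hut2 hk2
  exact h2 fun t ht => (he t ht).symm

theorem IsStrongSolutionAux.exists_flow {Re Pe Γ ε T : ℝ} {u v w θ ω φ : ℝ → L2 L}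
    {u₀ v₀ w₀ θ₀ : L2 L} (h : IsStrongSolutionAux Re Pe Γ ε T u v w θ ω φ u₀ v₀ w₀ θ₀)
    (hT : 0 < T) (hRe : 0 < Re) (hPe : 0 < Pe) (hε : ε ≠ 0) :
    ∃ ut vt wt θt r : ℝ → L2 L, Flow Re Pe Γ ε T u v w θ ω φ ut vt wt θt r := by
  obtain ⟨ut, hut, dut⟩ := h.u_t
  obtain ⟨vt, hvt, dvt⟩ := h.v_t
  obtain ⟨wt, hwt, dwt, ew⟩ := h.w_eq
  obtain ⟨θt, hθt, dθt, eθ⟩ := h.θ_eq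
  obtain ⟨ωt, hωt, dωt, eω⟩ := h.ω_eq
  have iut := hut.integrable one_le_two
  have ivt := hvt.integrable one_le_two
  have mem : ∀ᵐ t ∂volume.restrict (Ioo 0 T), t ∈ Icc 0 T :=
    (ae_restrict_mem measurableSet_Ioo).mono fun t ht => Ioo_subset_Icc_self ht
  -- the time derivative of the vorticity in terms of those of the velocity
  have hωt' : ∀ᵐ t ∂volume.restrict (Ioo 0 T),
      ωt t = (-dualComp L 1) (vt t) + dualComp L 2 (ut t) := by
    have h1 := ae_eq_dualComp (k := fun t => toDual (ω t)) dωt dvt dut hωt h.v_reg.bdd.of_top hvt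
      h.u_reg.bdd.of_top hut
    refine h1 fun t ht => ?_
    have hV := h.mem_V t (Ioo_subset_Icc_self ht)
    rw [h.vorticity t (Ioo_subset_Icc_self ht), toDual_curlH hV.u_H1.2.1 hV.v_H1.1]
  -- The nonlocal term is defined as what the θ-equation leaves, so that it is in L²(Ω) without an
  -- estimate of w times the mean.
  set r : ℝ → L2 L := fun t => -θt t - adv (u t) (v t) (θ t) + (1 / Pe) • lapH (θ t) with hr
  have slice : ∀ᵐ t ∂volume.restrict (Ioo 0 T), Slice Re Pe Γ ε (u t) (v t) (w t) (θ t) (ω t) (φ t)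
      (ut t) (vt t) (wt t) (θt t) (r t) := by
    filter_upwards [mem, hωt', eω, ew, eθ, h.ω_x.1, h.ω_y.1, h.ω_z.1, h.lap_w.1, h.lap_θ.1,
      h.φ_zz.1, h.φ_zz.2.1] with t ht e1 e2 e3 e4 ωx ωy ωz lw lθ φz φzz
    have hV := h.mem_V t ht
    have hω := h.vorticity t ht
    have vel := regVel_of_curl hV.u_H1.1 hV.u_H1.2.1 hV.v_H1.1 hV.v_H1.2.1 hV.u_H1.2.2 hV.v_H1.2.2
      hV.div_free hω ωx ωy ωz
    have st := h.stream t ht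
    have str := hasWeakDeriv_stream hV.u_H1.1.hasWeakDeriv hV.u_H1.2.1.hasWeakDeriv
      hV.v_H1.1.hasWeakDeriv hV.v_H1.2.1.hasWeakDeriv hV.div_free hV.u_mean.noMean hV.v_mean.noMean
      (by rw [hω] at st; exact st)
    have rw' : RegScalar (w t) (lapH (w t)) := ⟨hV.w_H1.1, hV.w_H1.2.1, hV.w_H1.2.2,
      hasHLaplacian_lapH lw, hV.w_mean.noMean⟩
    have rθ : RegScalar (θ t) (lapH (θ t)) := ⟨hV.θ_H1.1, hV.θ_H1.2.1, hV.θ_H1.2.2,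
      hasHLaplacian_lapH lθ, hV.θ_mean.noMean⟩
    have aw := coeFn_adv vel.ru vel.rv rw'.reg2
    have aθ := coeFn_adv vel.ru vel.rv rθ.reg2
    refine ⟨vel, hV.u_mean.noMean, hV.v_mean.noMean, str.1, str.2, st, hω, ωx, ωy, ωz, rw', rθ, φz,
      φzz, ?_, ?_, ?_, ?_⟩
    · unfold IsNonlocal
      filter_upwards [e4, aθ, Lp.coeFn_add (-θt t - adv (u t) (v t) (θ t)) ((1 / Pe) • lapH (θ t)),
        Lp.coeFn_sub (-θt t) (adv (u t) (v t) (θ t)), Lp.coeFn_neg (θt t),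
        Lp.coeFn_smul (1 / Pe) (lapH (θ t))] with q q1 q2 q3 q4 q5 q6
      rw [hr, q3, Pi.add_apply, q4, Pi.sub_apply, q5, Pi.neg_apply, q6, Pi.smul_apply, q2,
        smul_eq_mul, ← q1]
      ring
    · refine Lp.ext ?_
      filter_upwards [e3, aw,
        Lp.coeFn_add (-adv (u t) (v t) (w t) + wderiv ez (φ t) + Γ • θ t) ((1 / Re) • lapH (w t)),
        Lp.coeFn_add (-adv (u t) (v t) (w t) + wderiv ez (φ t)) (Γ • θ t),
        Lp.coeFn_add (-adv (u t) (v t) (w t)) (wderiv ez (φ t)), Lp.coeFn_neg (adv (u t) (v t) (w t)),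
        Lp.coeFn_smul Γ (θ t), Lp.coeFn_smul (1 / Re) (lapH (w t))] with q q1 q2 q3 q4 q5 q6 q7 q8
      rw [q3, Pi.add_apply, q4, Pi.add_apply, q5, Pi.add_apply, q6, Pi.neg_apply, q7, q8,
        Pi.smul_apply, Pi.smul_apply, q2, smul_eq_mul, smul_eq_mul]
      linarith
    · rw [hr]; simp only; abel
    · intro ψ ψx ψy hx hy
      have e5 := e2 ⟨WithLp.toLp 2 ![ψ, ψx, ψy], hx, hy⟩
      rw [e1] at e5
      have e6 := integral_adv_mul vel.ru vel.rv vel.vy vel.div ωx ωy hx hy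
      change -inner ℝ (vt t) ψx + inner ℝ (ut t) ψy
        + (∫ q, (u t q * wderiv ex (ω t) q + v t q * wderiv ey (ω t) q) * ψ q)
        - inner ℝ (wderiv ez (w t)) ψ = -(1 / Re) * (inner ℝ (wderiv ex (ω t)) ψx
          + inner ℝ (wderiv ey (ω t)) ψy) + ε ^ 2 * inner ℝ (wderiv ez (wderiv ez (φ t))) ψ at e5
      rw [e6] at e5
      linarith
  -- Measurability of φ_z in time is not part of the notion of solution; it is read off from the
  -- w-equation.
  have mφ : AEStronglyMeasurable (fun t => wderiv ez (φ t)) (volume.restrict (Ioo 0 T)) := by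
    have ma := aestronglyMeasurable_adv h.u_reg.bdd.1 h.v_reg.bdd.1 h.w_reg.bdd_x.1
      h.w_reg.bdd_y.1 (slice.mono fun t ht => ⟨ht.vel.ru, ht.vel.rv, ht.reg_w.reg2⟩)
    refine (((hwt.1.add ma).sub (h.θ_reg.bdd.1.const_smul Γ)).sub
      (h.lap_w.2.1.const_smul (1 / Re))).congr ?_
    filter_upwards [slice] with t ht
    simp only [Pi.add_apply, Pi.sub_apply, Pi.smul_apply]
    rw [ht.eq_w]; abel
  -- The horizontal gradient of φ_z is (-v_z, u_z), which is bounded in time, and φ_z has zero mean,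
  -- so Poincaré applies.
  have bφ : InLp ∞ T fun t => wderiv ez (φ t) := by
    obtain ⟨a, ha⟩ := exists_ae_norm_le h.u_reg.bdd_z
    obtain ⟨b, hb⟩ := exists_ae_norm_le h.v_reg.bdd_z
    refine memLp_top_of_bound mφ (√(gam L * (b ^ 2 + a ^ 2))) ?_
    filter_upwards [slice, ha, hb, mem] with t ht h1 h2 hm
    obtain ⟨s1, s2⟩ := ht.stream_z
    have nφ : NoMean (wderiv ez (φ t)) :=
      (h.stream_mean t hm).noMean.of_hasWeakDeriv ht.φ_z.hasWeakDeriv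
    have := poincare nφ s1 s2
    rw [norm_neg] at this
    refine Real.le_sqrt_of_sq_le (this.trans ?_)
    have := gam_pos (L := L)
    gcongr
  exact ⟨ut, vt, wt, θt, r, hT, hRe, hPe, hε, h.mem_V, slice, hasIntDeriv_of_weak hT h.u_reg.cont iut dut,
    hasIntDeriv_of_weak hT h.v_reg.cont ivt dvt,
    hasIntDeriv_of_weak hT h.w_reg.cont (hwt.integrable one_le_two) dwt,
    hasIntDeriv_of_weak hT h.θ_reg.cont (hθt.integrable one_le_two) dθt, hut, hvt, hwt, hθt,
    h.u_reg, h.v_reg, h.w_reg, h.θ_reg, h.ω_bdd, h.ω_x.2, h.ω_y.2, h.lap_w.2, h.lap_θ.2, bφ.of_top⟩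

end Extraction

/-! ### Integrals over time intervals. -/

section TimeIntegrals

variable {L : ℝ} [Fact (0 < L)] {T s t : ℝ}

theorem ae_restrict_Ioo {p : ℝ → Prop} (h : ∀ᵐ τ ∂volume.restrict (Ioo 0 T), p τ) (hs : 0 ≤ s)
    (ht : t ≤ T) : ∀ᵐ τ ∂volume.restrict (Ioo s t), p τ :=
  ae_mono (Measure.restrict_mono (Ioo_subset_Ioo hs ht) le_rfl) h

theorem intervalIntegrable_of_Ioo {E : Type*} [NormedAddCommGroup E] {f : ℝ → E}
    (h : Integrable f (volume.restrict (Ioo 0 T))) (hs : 0 ≤ s) (hst : s ≤ t) (ht : t ≤ T) :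
    IntervalIntegrable f volume s t :=
  (intervalIntegrable_iff_integrableOn_Ioo_of_le hst).2
    (IntegrableOn.mono_set h (Ioo_subset_Ioo hs ht))

theorem InLp.sq {f : ℝ → L2 L} (h : InLp 2 T f) :
    Integrable (fun t => ‖f t‖ ^ 2) (volume.restrict (Ioo 0 T)) :=
  MemLp.integrable_norm_pow h two_ne_zero

theorem InLp.clm {f : ℝ → L2 L} {p : ℝ≥0∞} (h : InLp p T f) (A : L2 L →L[ℝ] L2 L) :
    InLp p T fun t => A (f t) := A.comp_memLp' h

theorem intervalIntegral_mono_ae {f g : ℝ → ℝ} (hst : s ≤ t) (hf : IntervalIntegrable f volume s t)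
    (hg : IntervalIntegrable g volume s t)
    (h : ∀ᵐ τ ∂volume.restrict (Ioo s t), f τ ≤ g τ) : ∫ τ in s..t, f τ ≤ ∫ τ in s..t, g τ := by
  rw [intervalIntegral.integral_of_le hst, intervalIntegral.integral_of_le hst,
    integral_Ioc_eq_integral_Ioo, integral_Ioc_eq_integral_Ioo]
  exact integral_mono_ae ((intervalIntegrable_iff_integrableOn_Ioo_of_le hst).1 hf)
    ((intervalIntegrable_iff_integrableOn_Ioo_of_le hst).1 hg) h

theorem intervalIntegral_nonneg_ae {f : ℝ → ℝ} (hst : s ≤ t)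
    (h : ∀ᵐ τ ∂volume.restrict (Ioo s t), 0 ≤ f τ) : 0 ≤ ∫ τ in s..t, f τ := by
  rw [intervalIntegral.integral_of_le hst, integral_Ioc_eq_integral_Ioo]
  exact integral_nonneg_of_ae h

/-- The fundamental theorem of calculus for an inequality with a dissipative term. -/
theorem HasIntDeriv.add_integral_le {f g d k : ℝ → ℝ} (hst : s ≤ t) (hf : HasIntDeriv s t f g)
    (hd : IntervalIntegrable d volume s t) (hk : IntervalIntegrable k volume s t)
    (hle : ∀ᵐ τ ∂volume.restrict (Ioo s t), g τ ≤ -d τ + k τ) :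
    f t + ∫ τ in s..t, d τ ≤ f s + ∫ τ in s..t, k τ := by
  have h1 := hf.le hst (hd.neg.add hk) hle
  have e : ∫ τ in s..t, ((-d) τ + k τ) = -(∫ τ in s..t, d τ) + ∫ τ in s..t, k τ := by
    rw [← intervalIntegral.integral_neg]
    exact intervalIntegral.integral_add hd.neg hk
  rw [e] at h1
  linarith

end TimeIntegrals

/-! ### Energy estimates and decay. -/

section Energy

variable {L : ℝ} [Fact (0 < L)]

/-- The weight of `‖θ‖²` in the energy. -/
def lam (L Re Pe Γ : ℝ) : ℝ := gam L ^ 2 * Re * Pe * Γ ^ 2 + 1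

/-- The energy of a state. -/
def energyOf (Re Pe Γ : ℝ) (u v w θ : L2 L) : ℝ :=
  ‖u‖ ^ 2 + ‖v‖ ^ 2 + ‖w‖ ^ 2 + lam L Re Pe Γ * ‖θ‖ ^ 2

/-- The dissipation rate of the energy. -/
def dissip (Re Pe ε : ℝ) (w θ ω φ : L2 L) : ℝ :=
  1 / Re * (‖ω‖ ^ 2 + gradSq w) + 2 * ε ^ 2 * ‖wderiv ez φ‖ ^ 2 + 1 / Pe * gradSq θ

theorem RegScalar.poincare {f l : L2 L} (h : RegScalar f l) : ‖f‖ ^ 2 ≤ gam L * gradSq f :=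
  RotConv.poincare h.noMean h.x.hasWeakDeriv h.y.hasWeakDeriv

namespace Slice

variable {Re Pe Γ ε : ℝ} {u v w θ ω φ ut vt wt θt r : L2 L}

theorem poincare_vel (h : Slice Re Pe Γ ε u v w θ ω φ ut vt wt θt r) :
    ‖u‖ ^ 2 + ‖v‖ ^ 2 ≤ gam L * ‖ω‖ ^ 2 := by
  have h1 := poincare h.noMean_u h.vel.ru.x.hasWeakDeriv h.vel.uy.hasWeakDeriv
  have h2 := poincare h.noMean_v h.vel.rv.x.hasWeakDeriv h.vel.vy.hasWeakDeriv
  rw [← h.gradSq_vel]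
  unfold gradSq
  linarith

theorem theta_decay_le (h : Slice Re Pe Γ ε u v w θ ω φ ut vt wt θt r) (hPe : 0 < Pe) :
    2 * inner ℝ θ θt ≤ -(2 / (gam L * Pe)) * ‖θ‖ ^ 2 := by
  have h1 := h.theta_le
  have h2 := h.reg_θ.poincare
  have hγ := gam_pos (L := L)
  have e : 2 / Pe * gradSq θ = 2 / (gam L * Pe) * (gam L * gradSq θ) := by field_simp
  have h3 : 2 / (gam L * Pe) * ‖θ‖ ^ 2 ≤ 2 / (gam L * Pe) * (gam L * gradSq θ) :=
    mul_le_mul_of_nonneg_left h2 (by positivity)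
  linarith

/-- Young's parameter in the buoyancy term is chosen so that Poincaré turns the w-part into half of
the dissipation of w. -/
theorem energy_le (h : Slice Re Pe Γ ε u v w θ ω φ ut vt wt θt r) (hRe : 0 < Re) :
    2 * inner ℝ u ut + 2 * inner ℝ v vt + 2 * inner ℝ w wt ≤ -(1 / Re * (‖ω‖ ^ 2 + gradSq w))
      - 2 * ε ^ 2 * ‖wderiv ez φ‖ ^ 2 + gam L * Re * Γ ^ 2 * ‖θ‖ ^ 2 := by
  have hγ := gam_pos (L := L)
  have h1 := h.energy
  have h2 := two_inner_le w (Γ • θ) (c := 1 / (gam L * Re)) (by positivity)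
  rw [real_inner_smul_right, norm_smul, mul_pow, Real.norm_eq_abs, sq_abs, one_div_one_div] at h2
  have h3 := mul_le_mul_of_nonneg_left h.reg_w.poincare
    (show 0 ≤ 1 / (gam L * Re) by positivity)
  have e : 1 / (gam L * Re) * (gam L * gradSq w) = 1 / Re * gradSq w := by field_simp
  have h4 : 0 ≤ 1 / Re * ‖ω‖ ^ 2 := by positivity
  linarith

/-- Half of the dissipation is still available and gives the rate 1/(γRe). Taking κ > 1 only lowers
it, which allows the rate of θ to be avoided. -/
theorem energy_decay_le (h : Slice Re Pe Γ ε u v w θ ω φ ut vt wt θt r) (hRe : 0 < Re) {κ : ℝ}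
    (hκ : 1 ≤ κ) :
    2 * inner ℝ u ut + 2 * inner ℝ v vt + 2 * inner ℝ w wt
      ≤ -(1 / (κ * gam L * Re)) * (‖u‖ ^ 2 + ‖v‖ ^ 2 + ‖w‖ ^ 2)
        + gam L * Re * Γ ^ 2 * ‖θ‖ ^ 2 := by
  have hγ := gam_pos (L := L)
  have h1 := h.energy_le hRe
  have h2 := h.poincare_vel
  have h3 := h.reg_w.poincare
  have h4 : 1 / (κ * gam L * Re) * (‖u‖ ^ 2 + ‖v‖ ^ 2 + ‖w‖ ^ 2)
      ≤ 1 / (gam L * Re) * (gam L * (‖ω‖ ^ 2 + gradSq w)) := by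
    have k1 : 1 / (κ * gam L * Re) ≤ 1 / (gam L * Re) := by
      apply one_div_le_one_div_of_le (by positivity)
      rw [mul_assoc]
      exact le_mul_of_one_le_left (by positivity) hκ
    have k2 : 0 ≤ 1 / (κ * gam L * Re) := by positivity
    exact mul_le_mul k1 (by linarith) (by positivity) (by positivity)
  have e : 1 / (gam L * Re) * (gam L * (‖ω‖ ^ 2 + gradSq w)) = 1 / Re * (‖ω‖ ^ 2 + gradSq w) := by
    field_simp
  have p : 0 ≤ 2 * ε ^ 2 * ‖wderiv ez φ‖ ^ 2 := by positivity
  linarith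

/-- The weight `lam` is large enough for the dissipation of θ to absorb buoyancy; its summand 1
leaves (1/Pe)‖∇_h θ‖² over. -/
theorem energyOf_le (h : Slice Re Pe Γ ε u v w θ ω φ ut vt wt θt r) (hRe : 0 < Re) (hPe : 0 < Pe) :
    2 * inner ℝ u ut + 2 * inner ℝ v vt + 2 * inner ℝ w wt + lam L Re Pe Γ * (2 * inner ℝ θ θt)
      ≤ -dissip Re Pe ε w θ ω φ := by
  have hγ := gam_pos (L := L)
  have h1 := h.energy_le hRe
  have hl : 0 ≤ lam L Re Pe Γ := by unfold lam; positivity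
  have h2 := mul_le_mul_of_nonneg_left h.theta_le hl
  have h3 := mul_le_mul_of_nonneg_left h.reg_θ.poincare
    (show 0 ≤ gam L * Re * Γ ^ 2 by positivity)
  have e : lam L Re Pe Γ * -(2 / Pe * gradSq θ)
      = -(gam L * Re * Γ ^ 2 * (gam L * gradSq θ)) - (gam L ^ 2 * Re * Γ ^ 2 * gradSq θ)
        - 2 * (1 / Pe * gradSq θ) := by
    unfold lam; field_simp; ring
  have g0 := gradSq_nonneg θ
  have p1 : 0 ≤ gam L ^ 2 * Re * Γ ^ 2 * gradSq θ := by positivity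
  have p2 : 0 ≤ 1 / Pe * gradSq θ := by positivity
  unfold dissip
  linarith

end Slice

theorem dissip_nonneg {Re Pe : ℝ} (hRe : 0 < Re) (hPe : 0 < Pe) (ε : ℝ) (w θ ω φ : L2 L) :
    0 ≤ dissip Re Pe ε w θ ω φ := by
  have h1 := gradSq_nonneg w
  have h2 := gradSq_nonneg θ
  unfold dissip
  positivity

/-- The terms of the dissipation rate are bounded by it. -/
theorem le_dissip {Re Pe ε : ℝ} (hRe : 0 < Re) (hPe : 0 < Pe) (hε : ε ≠ 0) (w θ ω φ : L2 L) :
    ‖ω‖ ^ 2 + gradSq w ≤ Re * dissip Re Pe ε w θ ω φ ∧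
      ‖wderiv ez φ‖ ^ 2 ≤ 1 / ε ^ 2 * dissip Re Pe ε w θ ω φ ∧
      gradSq θ ≤ Pe * dissip Re Pe ε w θ ω φ := by
  have h1 := gradSq_nonneg w
  have h2 := gradSq_nonneg θ
  have hε2 : 0 < ε ^ 2 := by positivity
  have p1 : 0 ≤ 1 / Re * (‖ω‖ ^ 2 + gradSq w) := by positivity
  have p2 : 0 ≤ ε ^ 2 * ‖wderiv ez φ‖ ^ 2 := by positivity
  have p3 : 0 ≤ 1 / Pe * gradSq θ := by positivity
  refine ⟨?_, ?_, ?_⟩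
  · rw [← div_le_iff₀' hRe, div_eq_mul_one_div, mul_comm]
    unfold dissip; linarith
  · rw [one_div, ← div_eq_inv_mul, le_div_iff₀' hε2]
    unfold dissip; linarith
  · rw [← div_le_iff₀' hPe, div_eq_mul_one_div, mul_comm]
    unfold dissip; linarith

theorem energyOf_nonneg {Re Pe : ℝ} (hRe : 0 < Re) (hPe : 0 < Pe) (Γ : ℝ) (u v w θ : L2 L) :
    0 ≤ energyOf Re Pe Γ u v w θ := by
  have hγ := gam_pos (L := L)
  unfold energyOf lam
  positivity

/-- The bound for the horizontal means of `θ²`. -/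
def thetaSup (a b : ℝ) : ℝ := a ^ 2 + 2 * a * b

namespace Flow

variable {Re Pe Γ ε T : ℝ} {u v w θ ω φ ut vt wt θt r : ℝ → L2 L}

theorem zero_mem (h : Flow Re Pe Γ ε T u v w θ ω φ ut vt wt θt r) : (0 : ℝ) ∈ Icc 0 T :=
  ⟨le_rfl, h.pos.le⟩

theorem theta_decay (h : Flow Re Pe Γ ε T u v w θ ω φ ut vt wt θt r) {t : ℝ} (ht : t ∈ Icc 0 T) :
    ‖θ t‖ ^ 2 ≤ Real.exp (-(2 / (gam L * Pe)) * t) * ‖θ 0‖ ^ 2 := by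
  have h1 := (h.dθ.mono h.zero_mem ht ht.1).norm_sq ht.1
  -- There is no forcing here, so any β different from α will do.
  have h2 := gronwall_exp (α := 2 / (gam L * Pe)) (β := 2 / (gam L * Pe) + 1) (c := 0) ht.1
    (by linarith) h1 (by
      filter_upwards [ae_restrict_Ioo h.slice le_rfl ht.2] with τ hτ
      have := hτ.theta_decay_le h.Pe_pos
      linarith)
  simpa using h2

/-- Square integrability of the nonlocal term in time is not assumed; the weighted balance expresses
this pairing through integrable quantities. -/
theorem flux_integrable (h : Flow Re Pe Γ ε T u v w θ ω φ ut vt wt θt r) (χ : Weight) :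
    Integrable (fun t => inner ℝ (mz χ (r t)) (θ t)) (volume.restrict (Ioo 0 T)) := by
  have i1 := integrable_inner_L2 (h.θ_reg.bdd.of_top.clm (mz χ)) h.θt_L2
  have i2 := integrable_inner_L2 (h.θ_reg.bdd_x.of_top.clm (mz χ)) h.θ_reg.bdd_x.of_top
  have i3 := integrable_inner_L2 (h.θ_reg.bdd_y.of_top.clm (mz χ)) h.θ_reg.bdd_y.of_top
  refine ((i1.neg).sub ((i2.add i3).const_mul (1 / Pe))).congr ?_
  filter_upwards [h.slice] with t ht
  have := ht.theta_weighted χ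
  simp only [Pi.sub_apply, Pi.neg_apply, Pi.add_apply]
  linarith

theorem flux_nonneg (h : Flow Re Pe Γ ε T u v w θ ω φ ut vt wt θt r) {χ : Weight}
    (hχ : ∀ z, 0 ≤ χ z) :
    ∀ᵐ t ∂volume.restrict (Ioo 0 T), 0 ≤ inner ℝ (mz χ (r t)) (θ t) :=
  h.slice.mono fun _ ht => ht.nonlocal.inner_nonneg hχ

/-- The balance at each height, started from the trace bound for θ₀. It yields both the bound for
the profile of θ² (`hdot_theta_le`) and the one for the squared mean of wθ integrated in time
(`flux_le`). -/
theorem theta_weighted_le (h : Flow Re Pe Γ ε T u v w θ ω φ ut vt wt θt r) {χ : Weight}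
    (hχ : ∀ z, 0 ≤ χ z) {t : ℝ} (ht : t ∈ Icc 0 T) :
    inner ℝ (mz χ (θ t)) (θ t) + 2 * ∫ τ in (0 : ℝ)..t, inner ℝ (mz χ (r τ)) (θ τ)
      ≤ thetaSup ‖θ 0‖ ‖wderiv ez (θ 0)‖ * ∫ z, χ z := by
  have h1 := (h.dθ.mono h.zero_mem ht ht.1).inner_clm ht.1 (mz χ) (inner_mz_comm χ)
  have hi := intervalIntegrable_of_Ioo (h.flux_integrable χ) le_rfl ht.1 ht.2
  have h2 := h1.add_integral_le ht.1 (hi.const_mul 2) (k := fun _ => 0)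
    intervalIntegrable_const (by
      filter_upwards [ae_restrict_Ioo h.slice le_rfl ht.2] with τ hτ
      have e := hτ.theta_weighted χ
      have p : 0 ≤ 1 / Pe * (inner ℝ (mz χ (wderiv ex (θ τ))) (wderiv ex (θ τ))
          + inner ℝ (mz χ (wderiv ey (θ τ))) (wderiv ey (θ τ))) :=
        mul_nonneg (one_div_nonneg.2 h.Pe_pos.le)
          (add_nonneg (inner_mz_self_nonneg hχ _) (inner_mz_self_nonneg hχ _))
      linarith)
  rw [intervalIntegral.integral_const_mul] at h2
  simp only [intervalIntegral.integral_zero, add_zero] at h2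
  exact h2.trans (inner_mz_self_le (h.mem_V 0 h.zero_mem).θ_H1.2.2.hasWeakDeriv hχ)

theorem flux_le (h : Flow Re Pe Γ ε T u v w θ ω φ ut vt wt θt r) {χ : Weight}
    (hχ : ∀ z, 0 ≤ χ z) {s t : ℝ} (hs : 0 ≤ s) (hst : s ≤ t) (ht : t ≤ T) :
    2 * ∫ τ in s..t, inner ℝ (mz χ (r τ)) (θ τ)
      ≤ thetaSup ‖θ 0‖ ‖wderiv ez (θ 0)‖ * ∫ z, χ z := by
  have h1 := h.theta_weighted_le hχ (t := t) ⟨hs.trans hst, ht⟩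
  have h2 := inner_mz_self_nonneg hχ (θ t)
  have h3 := intervalIntegral_nonneg_ae hs
    (ae_restrict_Ioo (h.flux_nonneg hχ) le_rfl (hst.trans ht))
  have h4 := intervalIntegral.integral_add_adjacent_intervals
    (intervalIntegrable_of_Ioo (h.flux_integrable χ) le_rfl hs (hst.trans ht))
    (intervalIntegrable_of_Ioo (h.flux_integrable χ) hs hst ht)
  linarith

theorem hdot_theta_le (h : Flow Re Pe Γ ε T u v w θ ω φ ut vt wt θt r) {t : ℝ} (ht : t ∈ Icc 0 T) :
    ∀ᵐ z, hdot (θ t) (θ t) z ≤ thetaSup ‖θ 0‖ ‖wderiv ez (θ 0)‖ := by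
  refine Weight.ae_le (integrable_hprod _ _) (integrable_const _) fun χ hχ => ?_
  rw [← inner_mz, integral_mul_const, mul_comm]
  have h1 := h.theta_weighted_le hχ ht
  have h2 := intervalIntegral_nonneg_ae ht.1 (ae_restrict_Ioo (h.flux_nonneg hχ) le_rfl ht.2)
  linarith

theorem kinetic (h : Flow Re Pe Γ ε T u v w θ ω φ ut vt wt θt r) :
    HasIntDeriv 0 T (fun t => ‖u t‖ ^ 2 + ‖v t‖ ^ 2 + ‖w t‖ ^ 2) fun t =>
      2 * inner ℝ (u t) (ut t) + 2 * inner ℝ (v t) (vt t) + 2 * inner ℝ (w t) (wt t) :=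
  ((h.du.norm_sq h.pos.le).add (h.dv.norm_sq h.pos.le)).add (h.dw.norm_sq h.pos.le)

theorem kinetic_decay (h : Flow Re Pe Γ ε T u v w θ ω φ ut vt wt θt r) {κ : ℝ} (hκ : 1 ≤ κ)
    (hne : Pe ≠ 2 * κ * Re) {t : ℝ} (ht : t ∈ Icc 0 T) :
    ‖u t‖ ^ 2 + ‖v t‖ ^ 2 + ‖w t‖ ^ 2
      ≤ Real.exp (-(1 / (κ * gam L * Re)) * t) * (‖u 0‖ ^ 2 + ‖v 0‖ ^ 2 + ‖w 0‖ ^ 2)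
        + gam L * Re * Γ ^ 2 / |1 / (κ * gam L * Re) - 2 / (gam L * Pe)|
          * (Real.exp (-(2 / (gam L * Pe)) * t) + Real.exp (-(1 / (κ * gam L * Re)) * t))
          * ‖θ 0‖ ^ 2 := by
  have hγ := gam_pos (L := L)
  have hRe := h.Re_pos
  have hPe := h.Pe_pos
  set α := 1 / (κ * gam L * Re) with hα
  set β := 2 / (gam L * Pe) with hβ
  -- The rates coincide exactly when Pe = 2κRe, the resonant case in which a factor t would appear.
  have hαβ : α ≠ β := by
    intro e
    have hκ0 : 0 < κ := by linarith
    rw [hα, hβ] at e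
    field_simp at e
    exact hne (by linarith)
  have h1 := gronwall_exp (α := α) (β := β) (c := gam L * Re * Γ ^ 2 * ‖θ 0‖ ^ 2) ht.1 hαβ
    (h.kinetic.mono h.zero_mem ht ht.1) (by
      filter_upwards [ae_restrict_Ioo h.slice le_rfl ht.2, ae_restrict_mem measurableSet_Ioo]
        with τ hτ hm
      refine (hτ.energy_decay_le hRe hκ).trans ?_
      have h2 := mul_le_mul_of_nonneg_left (h.theta_decay (t := τ) ⟨hm.1.le, hm.2.le.trans ht.2⟩)
        (show 0 ≤ gam L * Re * Γ ^ 2 by positivity)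
      linarith)
  refine h1.trans (add_le_add le_rfl ?_)
  have hc : 0 ≤ gam L * Re * Γ ^ 2 * ‖θ 0‖ ^ 2 := by positivity
  refine (le_abs_self _).trans ?_
  rw [abs_mul, abs_div, abs_of_nonneg hc]
  have h3 : |Real.exp (-β * t) - Real.exp (-α * t)| ≤ Real.exp (-β * t) + Real.exp (-α * t) := by
    have p1 := Real.exp_pos (-β * t)
    have p2 := Real.exp_pos (-α * t)
    rw [abs_le]
    constructor <;> linarith
  refine (mul_le_mul_of_nonneg_left h3 (by positivity)).trans (le_of_eq ?_)
  ring

theorem dissip_integrable (h : Flow Re Pe Γ ε T u v w θ ω φ ut vt wt θt r) :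
    Integrable (fun t => dissip Re Pe ε (w t) (θ t) (ω t) (φ t)) (volume.restrict (Ioo 0 T)) :=
  (((h.ω_bdd.of_top.sq.add (h.w_reg.bdd_x.of_top.sq.add h.w_reg.bdd_y.of_top.sq)).const_mul _).add
    (h.φz_L2.sq.const_mul _)).add
      ((h.θ_reg.bdd_x.of_top.sq.add h.θ_reg.bdd_y.of_top.sq).const_mul _)

theorem energyOf_add_le (h : Flow Re Pe Γ ε T u v w θ ω φ ut vt wt θt r) {s t : ℝ} (hs : 0 ≤ s)
    (hst : s ≤ t) (ht : t ≤ T) :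
    energyOf Re Pe Γ (u t) (v t) (w t) (θ t)
      + ∫ τ in s..t, dissip Re Pe ε (w τ) (θ τ) (ω τ) (φ τ)
      ≤ energyOf Re Pe Γ (u s) (v s) (w s) (θ s) := by
  have h1 := h.kinetic.add ((h.dθ.norm_sq h.pos.le).clm h.pos.le
    (ContinuousLinearMap.mul ℝ ℝ (lam L Re Pe Γ)))
  have h2 := (h1.mono ⟨hs, hst.trans ht⟩ ⟨hs.trans hst, ht⟩ hst).add_integral_le hst
    (intervalIntegrable_of_Ioo h.dissip_integrable hs hst ht) (k := fun _ => 0)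
    intervalIntegrable_const (by
      filter_upwards [ae_restrict_Ioo h.slice hs ht] with τ hτ
      have := hτ.energyOf_le h.Re_pos h.Pe_pos
      simp only [ContinuousLinearMap.mul_apply']
      linarith)
  simp only [intervalIntegral.integral_zero, add_zero, ContinuousLinearMap.mul_apply'] at h2
  exact h2

theorem energyOf_le (h : Flow Re Pe Γ ε T u v w θ ω φ ut vt wt θt r) {s t : ℝ} (hs : 0 ≤ s)
    (hst : s ≤ t) (ht : t ≤ T) :
    energyOf Re Pe Γ (u t) (v t) (w t) (θ t) ≤ energyOf Re Pe Γ (u s) (v s) (w s) (θ s) := by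
  have h1 := h.energyOf_add_le hs hst ht
  have h2 := intervalIntegral_nonneg_ae (s := s) (t := t) hst (Eventually.of_forall fun τ =>
    dissip_nonneg h.Re_pos h.Pe_pos ε (w τ) (θ τ) (ω τ) (φ τ))
  linarith

theorem integral_dissip_le (h : Flow Re Pe Γ ε T u v w θ ω φ ut vt wt θt r) {s t : ℝ} (hs : 0 ≤ s)
    (hst : s ≤ t) (ht : t ≤ T) :
    ∫ τ in s..t, dissip Re Pe ε (w τ) (θ τ) (ω τ) (φ τ)
      ≤ energyOf Re Pe Γ (u s) (v s) (w s) (θ s) := by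
  have h1 := h.energyOf_add_le hs hst ht
  have h2 := energyOf_nonneg h.Re_pos h.Pe_pos Γ (u t) (v t) (w t) (θ t)
  linarith

end Flow

end Energy

/-! ### The vertical profile of w² and the nonlocal term. -/

section Nonlocal

variable {L : ℝ} [Fact (0 < L)]

/-- The constant in the bound for the vertical profile of `‖w‖²`. -/
def profConst (L Re Pe Γ ε : ℝ) : ℝ := 1 + 1 / ε ^ 2 + Γ ^ 2 * gam L * Pe + 2 * gam L * Re

namespace Flow

variable {Re Pe Γ ε T : ℝ} {u v w θ ω φ ut vt wt θt r : ℝ → L2 L}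

/-- The horizontal integrals of `w²` are bounded, on a time interval, by a fixed function of `z`. -/
theorem exists_weight (h : Flow Re Pe Γ ε T u v w θ ω φ ut vt wt θt r) {s t : ℝ} (hs : 0 ≤ s)
    (hst : s ≤ t) (ht : t ≤ T) :
    ∃ N : Weight, (∀ z, 0 ≤ N z) ∧
      (∀ᵐ τ ∂volume.restrict (Ioo s t), ∀ᵐ z, hdot (w τ) (w τ) z ≤ N z) ∧
      ∫ z, N z ≤ profConst L Re Pe Γ ε * energyOf Re Pe Γ (u s) (v s) (w s) (θ s) := by
  have hγ := gam_pos (L := L)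
  have hRe := h.Re_pos
  have hPe := h.Pe_pos
  -- The w-equation has no vertical transport of w either: by `w_weighted_le` the profile of w²
  -- grows at most at the rate F, height by height.
  set F : ℝ → Z1 := fun τ => hp (wderiv ez (φ τ)) (wderiv ez (φ τ)) + Γ ^ 2 • hp (θ τ) (θ τ)
    + (2 : ℝ) • hp (w τ) (w τ) with hF
  have iF : Integrable F (volume.restrict (Ioo 0 T)) :=
    ((integrable_hp h.φz_L2 h.φz_L2).add ((integrable_hp h.θ_reg.bdd.of_top
      h.θ_reg.bdd.of_top).smul (Γ ^ 2))).add ((integrable_hp h.w_reg.bdd.of_top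
      h.w_reg.bdd.of_top).smul (2 : ℝ))
  have pF : ∀ (χ : Weight) τ, χ.pair (F τ) = inner ℝ (mz χ (wderiv ez (φ τ))) (wderiv ez (φ τ))
      + Γ ^ 2 * inner ℝ (mz χ (θ τ)) (θ τ) + 2 * inner ℝ (mz χ (w τ)) (w τ) := fun χ τ => by
    rw [hF]; simp only [map_add, map_smul, pair_hp, smul_eq_mul]
  have pF0 : ∀ χ : Weight, (∀ z, 0 ≤ χ z) → ∀ τ, 0 ≤ χ.pair (F τ) := fun χ hχ τ => by
    have a1 := inner_mz_self_nonneg hχ (wderiv ez (φ τ))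
    have a2 := inner_mz_self_nonneg hχ (θ τ)
    have a3 := inner_mz_self_nonneg hχ (w τ)
    rw [pF]; positivity
  -- Integrating the nonnegative F over the whole interval gives one function of z that dominates
  -- the profile at all intermediate times.
  set B : Z1 := hp (w s) (w s) + ∫ τ in s..t, F τ with hB
  have pB : ∀ χ : Weight, χ.pair B = inner ℝ (mz χ (w s)) (w s) + ∫ τ in s..t, χ.pair (F τ) := by
    intro χ
    rw [hB, map_add, pair_hp, ContinuousLinearMap.intervalIntegral_comp_comm]
    exact intervalIntegrable_of_Ioo iF hs hst ht
  have ip : ∀ χ : Weight, Integrable (fun τ => χ.pair (F τ)) (volume.restrict (Ioo 0 T)) :=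
    fun χ => χ.pair.integrable_comp iF
  have hdot_le : ∀ τ ∈ Icc s t, ∀ᵐ z, hdot (w τ) (w τ) z ≤ B z := by
    intro τ hτ
    refine Weight.ae_le (integrable_hprod _ _) B.integrable fun χ hχ => ?_
    rw [← inner_mz, ← Weight.pair_apply, pB]
    have h0 : (0 : ℝ) ≤ τ := hs.trans hτ.1
    have h1 := (h.dw.mono ⟨hs, hst.trans ht⟩ ⟨h0, hτ.2.trans ht⟩ hτ.1).inner_clm hτ.1 (mz χ)
      (inner_mz_comm χ)
    have h2 := h1.le hτ.1 (intervalIntegrable_of_Ioo (ip χ) hs hτ.1 (hτ.2.trans ht)) (by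
      filter_upwards [ae_restrict_Ioo h.slice hs (hτ.2.trans ht)] with x hx
      rw [pF]
      exact hx.w_weighted_le hRe hχ)
    have h3 := intervalIntegral.integral_add_adjacent_intervals
      (intervalIntegrable_of_Ioo (ip χ) hs hτ.1 (hτ.2.trans ht))
      (intervalIntegrable_of_Ioo (ip χ) h0 hτ.2 ht)
    have h4 := intervalIntegral_nonneg_ae (s := τ) (t := t) hτ.2
      (Eventually.of_forall fun x => pF0 χ hχ x)
    linarith
  have B0 : ∀ᵐ z, 0 ≤ B z := (hdot_le s ⟨le_rfl, hst⟩).mono fun z hz =>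
    (hdot_self_nonneg (w s) z).trans hz
  obtain ⟨a, ha⟩ := exists_ae_norm_le h.w_reg.bdd
  obtain ⟨b, hb⟩ := exists_ae_norm_le h.w_reg.bdd_z
  -- The cap c, from the trace bound, only serves to make the profile bound a bounded weight; it
  -- does not enter the final estimate.
  set c := |a| ^ 2 + 2 * |a| * |b| with hc
  have c0 : 0 ≤ c := by positivity
  refine ⟨⟨fun z => max 0 (min c (B z)), measurable_const.max (measurable_const.min
    (Lp.stronglyMeasurable B).measurable), c, fun z => ?_⟩, fun z => le_max_left _ _, ?_, ?_⟩
  · rw [abs_of_nonneg (le_max_left _ _)]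
    exact max_le c0 (min_le_left _ _)
  · filter_upwards [ae_restrict_Ioo ha hs ht, ae_restrict_Ioo hb hs ht,
      ae_restrict_mem measurableSet_Ioo, ae_restrict_Ioo h.slice hs ht] with τ h1 h2 hm hτ
    filter_upwards [hdot_le τ ⟨hm.1.le, hm.2.le⟩, hdot_self_le hτ.reg_w.z.hasWeakDeriv] with z z1 z2
    refine le_max_of_le_right (le_min (z2.trans ?_) z1)
    have h1' := h1.trans (le_abs_self a)
    have h2' := h2.trans (le_abs_self b)
    rw [hc]
    gcongr
  · have h1 : ∫ z, max 0 (min c (B z)) ≤ ∫ z, B z := by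
      refine integral_mono_of_nonneg (Eventually.of_forall fun z => le_max_left _ _) B.integrable ?_
      filter_upwards [B0] with z hz
      exact max_le hz (min_le_right _ _)
    refine h1.trans ?_
    have h2 := pB (Weight.const 1)
    have h3 : (Weight.const 1).pair B = ∫ z, B z := by
      rw [Weight.pair_apply]
      exact integral_congr_ae (Eventually.of_forall fun z => one_mul _)
    rw [← h3, h2, mz_one, real_inner_self_eq_norm_sq]
    -- The total mass of F is controlled by the energy dissipation, since θ and w obey Poincaré.
    have h4 : ∫ τ in s..t, (Weight.const 1).pair (F τ)
        ≤ ∫ τ in s..t, (1 / ε ^ 2 + Γ ^ 2 * gam L * Pe + 2 * gam L * Re)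
          * dissip Re Pe ε (w τ) (θ τ) (ω τ) (φ τ) := by
      refine intervalIntegral_mono_ae hst (intervalIntegrable_of_Ioo (ip _) hs hst ht)
        (intervalIntegrable_of_Ioo (h.dissip_integrable.const_mul _) hs hst ht) ?_
      filter_upwards [ae_restrict_Ioo h.slice hs ht] with τ hτ
      rw [pF]
      simp only [mz_one, real_inner_self_eq_norm_sq]
      obtain ⟨d1, d2, d3⟩ := le_dissip hRe hPe h.ε_ne (w τ) (θ τ) (ω τ) (φ τ)
      have p1 := hτ.reg_θ.poincare
      have p2 := hτ.reg_w.poincare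
      have p3 : Γ ^ 2 * ‖θ τ‖ ^ 2 ≤ Γ ^ 2 * (gam L * (Pe * dissip Re Pe ε (w τ) (θ τ) (ω τ) (φ τ))) :=
        mul_le_mul_of_nonneg_left (p1.trans (mul_le_mul_of_nonneg_left d3 hγ.le)) (sq_nonneg _)
      have d1' : gradSq (w τ) ≤ Re * dissip Re Pe ε (w τ) (θ τ) (ω τ) (φ τ) := by
        linarith [sq_nonneg ‖ω τ‖]
      have p4 := p2.trans (mul_le_mul_of_nonneg_left d1' hγ.le)
      linarith
    rw [intervalIntegral.integral_const_mul] at h4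
    have h5 := mul_le_mul_of_nonneg_left (h.integral_dissip_le hs hst ht)
      (show 0 ≤ 1 / ε ^ 2 + Γ ^ 2 * gam L * Pe + 2 * gam L * Re by positivity)
    have h6 : ‖w s‖ ^ 2 ≤ energyOf Re Pe Γ (u s) (v s) (w s) (θ s) := by
      have : 0 ≤ lam L Re Pe Γ * ‖θ s‖ ^ 2 := by unfold lam; positivity
      unfold energyOf
      linarith [sq_nonneg ‖u s‖, sq_nonneg ‖v s‖]
    unfold profConst
    linarith

/-- The nonlocal term is square integrable in time, with a bound by the energy. -/
theorem exists_nonlocal_bound (h : Flow Re Pe Γ ε T u v w θ ω φ ut vt wt θt r) {s t : ℝ}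
    (hs : 0 ≤ s) (hst : s ≤ t) (ht : t ≤ T) :
    ∃ F : ℝ → ℝ, IntervalIntegrable F volume s t ∧
      (∀ᵐ τ ∂volume.restrict (Ioo s t), ‖r τ‖ ^ 2 ≤ F τ) ∧
      ∫ τ in s..t, F τ ≤ 1 / (2 * L ^ 2) * thetaSup ‖θ 0‖ ‖wderiv ez (θ 0)‖
        * (profConst L Re Pe Γ ε * energyOf Re Pe Γ (u s) (v s) (w s) (θ s)) := by
  obtain ⟨N, hN0, hN, hNi⟩ := h.exists_weight hs hst ht
  -- The majorant is the θ-dissipation with weight N, so its time integral is at most half of S∫N,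
  -- up to L².
  refine ⟨fun τ => 1 / L ^ 2 * inner ℝ (mz N (r τ)) (θ τ),
    intervalIntegrable_of_Ioo ((h.flux_integrable N).const_mul _) hs hst ht, ?_, ?_⟩
  · filter_upwards [hN, ae_restrict_Ioo h.slice hs ht] with τ h1 h2
    exact h2.nonlocal.norm_sq_le h1
  · rw [intervalIntegral.integral_const_mul]
    have h1 := h.flux_le hN0 hs hst ht
    have hS : 0 ≤ thetaSup ‖θ 0‖ ‖wderiv ez (θ 0)‖ := by unfold thetaSup; positivity
    have h2 := h1.trans (mul_le_mul_of_nonneg_left hNi hS)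
    have h3 := mul_le_mul_of_nonneg_left h2 (show 0 ≤ 1 / (2 * L ^ 2) by positivity)
    have e : 1 / (2 * L ^ 2) * (2 * ∫ τ in s..t, inner ℝ (mz N (r τ)) (θ τ))
        = 1 / L ^ 2 * ∫ τ in s..t, inner ℝ (mz N (r τ)) (θ τ) := by ring
    rw [e] at h3
    linarith

end Flow

end Nonlocal

/-! ### Differential inequalities for the horizontal gradients. -/

section Gradients

variable {L : ℝ} [Fact (0 < L)]

/-- The square of the norm of the vertical derivative of the velocity. -/
def vertVel (u v : L2 L) : ℝ := ‖wderiv ez u‖ ^ 2 + ‖wderiv ez v‖ ^ 2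

/-- The coefficient of the growth of gradients. -/
def growth (u v ω : L2 L) : ℝ := ‖ω‖ ^ 2 + gradSq ω + vertVel u v

/-- The squared norm of the horizontal gradients. -/
def gradOf (u v w θ : L2 L) : ℝ := gradSq u + gradSq v + gradSq w + gradSq θ

/-- The dissipation rate of the horizontal gradients. -/
def gradDissip (Re Pe ε : ℝ) (u v w θ ω : L2 L) : ℝ :=
  2 / Re * gradSq ω + ε ^ 2 * vertVel u v + 1 / Re * ‖lapH w‖ ^ 2 + 1 / Pe * ‖lapH θ‖ ^ 2

theorem vertVel_nonneg (u v : L2 L) : 0 ≤ vertVel u v := by unfold vertVel; positivity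

theorem growth_nonneg (u v ω : L2 L) : 0 ≤ growth u v ω := by
  have h1 := gradSq_nonneg ω
  have h2 := vertVel_nonneg u v
  unfold growth; positivity

theorem gradOf_nonneg (u v w θ : L2 L) : 0 ≤ gradOf u v w θ := by
  have h1 := gradSq_nonneg u
  have h2 := gradSq_nonneg v
  have h3 := gradSq_nonneg w
  have h4 := gradSq_nonneg θ
  unfold gradOf; positivity

theorem gradDissip_nonneg {Re Pe : ℝ} (hRe : 0 < Re) (hPe : 0 < Pe) (ε : ℝ) (u v w θ ω : L2 L) :
    0 ≤ gradDissip Re Pe ε u v w θ ω := by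
  have h1 := gradSq_nonneg ω
  have h2 := vertVel_nonneg u v
  unfold gradDissip; positivity

/-- The constant in the bound for the growth coefficient. -/
def growthConst (Re ε : ℝ) : ℝ := Re + (Re / 2 + 1 / ε ^ 2) * (1 + Re / ε ^ 2)

/-- The constant in front of the dissipation in the gradient estimate. -/
def sourceConst (L Re Pe Γ ε : ℝ) : ℝ := 4 * Re / ε ^ 2 + 3 * Re * Γ ^ 2 * gam L * Pe

/-- The constant in front of the growth coefficient in the gradient estimate. -/
def rateConst (Re Pe : ℝ) : ℝ := 432 * Re + 288 * Pe

namespace Slice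

variable {Re Pe Γ ε : ℝ} {u v w θ ω φ ut vt wt θt r : L2 L}

/-- Every linear source is charged to the energy dissipation, advection to `growth` times the
gradients, and the nonlocal term is kept for its separate estimate. -/
theorem gradOf_le (h : Slice Re Pe Γ ε u v w θ ω φ ut vt wt θt r) (hRe : 0 < Re) (hPe : 0 < Pe)
    (hε : ε ≠ 0) :
    -(2 * inner ℝ (-(wderiv ey ω)) ut) + -(2 * inner ℝ (wderiv ex ω) vt)
      + -(2 * inner ℝ (lapH w) wt) + -(2 * inner ℝ (lapH θ) θt)
      ≤ -gradDissip Re Pe ε u v w θ ω + (rateConst Re Pe * growth u v ω * gradOf u v w θ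
        + (sourceConst L Re Pe Γ ε * dissip Re Pe ε w θ ω φ + 2 * Pe * ‖r‖ ^ 2)) := by
  have hγ := gam_pos (L := L)
  have h1 := h.enstrophy_le hε
  have h2 := h.grad_w_le hRe
  have h3 := h.grad_theta_le hPe
  have hq := h.qvel_le
  set q := qvel u v (-(wderiv ey ω)) (wderiv ex ω)
  have q0 : 0 ≤ q := add_nonneg (vsup_nonneg _ _ _ _) (vsup_nonneg _ _ _ _)
  obtain ⟨d1, d2, d3⟩ := le_dissip hRe hPe hε w θ ω φ
  set D := dissip Re Pe ε w θ ω φ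
  have gu := gradSq_nonneg u
  have gv := gradSq_nonneg v
  have gw := gradSq_nonneg w
  have gθ := gradSq_nonneg θ
  have e1 : q ≤ growth u v ω := hq
  have a1 : q * gradSq w ≤ growth u v ω * gradOf u v w θ :=
    mul_le_mul e1 (by unfold gradOf; linarith) gw (q0.trans e1)
  have a2 : q * gradSq θ ≤ growth u v ω * gradOf u v w θ :=
    mul_le_mul e1 (by unfold gradOf; linarith) gθ (q0.trans e1)
  have a3 := mul_le_mul_of_nonneg_left a1 (show 0 ≤ 432 * Re by positivity)
  have a4 := mul_le_mul_of_nonneg_left a2 (show 0 ≤ 288 * Pe by positivity)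
  have b1 : 1 / ε ^ 2 * gradSq w ≤ 1 / ε ^ 2 * (Re * D) :=
    mul_le_mul_of_nonneg_left (by linarith [sq_nonneg ‖ω‖]) (by positivity)
  have b2 : 3 * Re * ‖wderiv ez φ‖ ^ 2 ≤ 3 * Re * (1 / ε ^ 2 * D) :=
    mul_le_mul_of_nonneg_left d2 (by positivity)
  have b3 : 3 * Re * Γ ^ 2 * ‖θ‖ ^ 2 ≤ 3 * Re * Γ ^ 2 * (gam L * (Pe * D)) :=
    mul_le_mul_of_nonneg_left (h.reg_θ.poincare.trans (mul_le_mul_of_nonneg_left d3 hγ.le))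
      (by positivity)
  have e2 : sourceConst L Re Pe Γ ε * D = 1 / ε ^ 2 * (Re * D) + 3 * Re * (1 / ε ^ 2 * D)
      + 3 * Re * Γ ^ 2 * (gam L * (Pe * D)) := by unfold sourceConst; ring
  have e3 : ε ^ 2 * vertVel u v = ε ^ 2 * (‖wderiv ez u‖ ^ 2 + ‖wderiv ez v‖ ^ 2) := rfl
  unfold gradDissip rateConst
  linarith

end Slice

namespace Flow

variable {Re Pe Γ ε T : ℝ} {u v w θ ω φ ut vt wt θt r : ℝ → L2 L}

theorem growthConst_nonneg {Re : ℝ} (hRe : 0 < Re) (ε : ℝ) : 0 ≤ growthConst Re ε := by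
  unfold growthConst; positivity

theorem ωgrad_integrable (h : Flow Re Pe Γ ε T u v w θ ω φ ut vt wt θt r) :
    Integrable (fun t => gradSq (ω t)) (volume.restrict (Ioo 0 T)) := h.ωx_L2.sq.add h.ωy_L2.sq

theorem vertVel_integrable (h : Flow Re Pe Γ ε T u v w θ ω φ ut vt wt θt r) :
    Integrable (fun t => vertVel (u t) (v t)) (volume.restrict (Ioo 0 T)) :=
  h.u_reg.bdd_z.of_top.sq.add h.v_reg.bdd_z.of_top.sq

theorem growth_integrable (h : Flow Re Pe Γ ε T u v w θ ω φ ut vt wt θt r) :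
    Integrable (fun t => growth (u t) (v t) (ω t)) (volume.restrict (Ioo 0 T)) :=
  (h.ω_bdd.of_top.sq.add h.ωgrad_integrable).add h.vertVel_integrable

theorem gradDissip_integrable (h : Flow Re Pe Γ ε T u v w θ ω φ ut vt wt θt r) :
    Integrable (fun t => gradDissip Re Pe ε (u t) (v t) (w t) (θ t) (ω t))
      (volume.restrict (Ioo 0 T)) :=
  (((h.ωgrad_integrable.const_mul _).add (h.vertVel_integrable.const_mul _)).add
    (h.lap_w.sq.const_mul _)).add (h.lap_θ.sq.const_mul _)

theorem enstrophy (h : Flow Re Pe Γ ε T u v w θ ω φ ut vt wt θt r) :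
    HasIntDeriv 0 T (fun t => gradSq (u t) + gradSq (v t)) fun t =>
      -(2 * inner ℝ (-(wderiv ey (ω t))) (ut t)) + -(2 * inner ℝ (wderiv ex (ω t)) (vt t)) :=
  (h.du.grad h.pos.le (fun t ht => (h.mem_V t ht).u_H1.1) (fun t ht => (h.mem_V t ht).u_H1.2.1)
    (h.slice.mono fun _ ht => ht.vel.lapu) h.ut_L2 (MemLp.neg h.ωy_L2)).add
  (h.dv.grad h.pos.le (fun t ht => (h.mem_V t ht).v_H1.1) (fun t ht => (h.mem_V t ht).v_H1.2.1)
    (h.slice.mono fun _ ht => ht.vel.lapv) h.vt_L2 h.ωx_L2)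

theorem gradients (h : Flow Re Pe Γ ε T u v w θ ω φ ut vt wt θt r) :
    HasIntDeriv 0 T (fun t => gradOf (u t) (v t) (w t) (θ t)) fun t =>
      -(2 * inner ℝ (-(wderiv ey (ω t))) (ut t)) + -(2 * inner ℝ (wderiv ex (ω t)) (vt t))
      + -(2 * inner ℝ (lapH (w t)) (wt t)) + -(2 * inner ℝ (lapH (θ t)) (θt t)) :=
  (h.enstrophy.add (h.dw.grad h.pos.le (fun t ht => (h.mem_V t ht).w_H1.1)
    (fun t ht => (h.mem_V t ht).w_H1.2.1) (h.slice.mono fun _ ht => ht.reg_w.lap) h.wt_L2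
    h.lap_w)).add (h.dθ.grad h.pos.le (fun t ht => (h.mem_V t ht).θ_H1.1)
    (fun t ht => (h.mem_V t ht).θ_H1.2.1) (h.slice.mono fun _ ht => ht.reg_θ.lap) h.θt_L2 h.lap_θ)

/-- The enstrophy inequality has no nonlinear term, and its source ‖∇_h w‖² is part of the energy
dissipation. No Grönwall factor is needed, so the bound is uniform in t. -/
theorem enstrophy_add_le (h : Flow Re Pe Γ ε T u v w θ ω φ ut vt wt θt r) {s t : ℝ} (hs : 0 ≤ s)
    (hst : s ≤ t) (ht : t ≤ T) :
    gradSq (u t) + gradSq (v t)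
      + ∫ τ in s..t, (2 / Re * gradSq (ω τ) + ε ^ 2 * vertVel (u τ) (v τ))
      ≤ gradSq (u s) + gradSq (v s)
        + Re / ε ^ 2 * energyOf Re Pe Γ (u s) (v s) (w s) (θ s) := by
  have i1 := (h.ωgrad_integrable.const_mul (2 / Re)).add (h.vertVel_integrable.const_mul (ε ^ 2))
  have h1 := (h.enstrophy.mono ⟨hs, hst.trans ht⟩ ⟨hs.trans hst, ht⟩ hst).add_integral_le hst
    (intervalIntegrable_of_Ioo i1 hs hst ht)
    (intervalIntegrable_of_Ioo (h.dissip_integrable.const_mul (Re / ε ^ 2)) hs hst ht) (by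
      filter_upwards [ae_restrict_Ioo h.slice hs ht] with τ hτ
      have e := hτ.enstrophy_le h.ε_ne
      have d := (le_dissip h.Re_pos h.Pe_pos h.ε_ne (w τ) (θ τ) (ω τ) (φ τ)).1
      have b1 : 1 / ε ^ 2 * gradSq (w τ)
          ≤ 1 / ε ^ 2 * (Re * dissip Re Pe ε (w τ) (θ τ) (ω τ) (φ τ)) :=
        mul_le_mul_of_nonneg_left (by linarith [sq_nonneg ‖ω τ‖]) (by positivity)
      have e2 : Re / ε ^ 2 * dissip Re Pe ε (w τ) (θ τ) (ω τ) (φ τ)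
          = 1 / ε ^ 2 * (Re * dissip Re Pe ε (w τ) (θ τ) (ω τ) (φ τ)) := by ring
      have e3 : ε ^ 2 * vertVel (u τ) (v τ)
        = ε ^ 2 * (‖wderiv ez (u τ)‖ ^ 2 + ‖wderiv ez (v τ)‖ ^ 2) := rfl
      simp only [Pi.add_apply]
      rw [e2, e3]
      linarith)
  rw [intervalIntegral.integral_const_mul] at h1
  have := h.Re_pos
  have h2 := mul_le_mul_of_nonneg_left (h.integral_dissip_le hs hst ht)
    (show 0 ≤ Re / ε ^ 2 by positivity)
  refine le_trans ?_ (h1.trans (add_le_add le_rfl h2))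
  exact le_rfl

theorem integral_growth_le (h : Flow Re Pe Γ ε T u v w θ ω φ ut vt wt θt r) {s t : ℝ} (hs : 0 ≤ s)
    (hst : s ≤ t) (ht : t ≤ T) :
    ∫ τ in s..t, growth (u τ) (v τ) (ω τ) ≤ growthConst Re ε * (gradSq (u s) + gradSq (v s)
      + energyOf Re Pe Γ (u s) (v s) (w s) (θ s)) := by
  have hRe := h.Re_pos
  have hε := h.ε_ne
  have i1 := intervalIntegrable_of_Ioo (h.dissip_integrable.const_mul Re) hs hst ht
  have i2 := intervalIntegrable_of_Ioo (((h.ωgrad_integrable.const_mul (2 / Re)).add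
    (h.vertVel_integrable.const_mul (ε ^ 2))).const_mul (Re / 2 + 1 / ε ^ 2)) hs hst ht
  have h1 := intervalIntegral_mono_ae hst
    (intervalIntegrable_of_Ioo h.growth_integrable hs hst ht) (i1.add i2) (by
      refine Eventually.of_forall fun τ => ?_
      have d := (le_dissip h.Re_pos h.Pe_pos h.ε_ne (w τ) (θ τ) (ω τ) (φ τ)).1
      have g1 := gradSq_nonneg (w τ)
      have g2 := gradSq_nonneg (ω τ)
      have g3 := vertVel_nonneg (u τ) (v τ)
      simp only [Pi.add_apply]
      -- The sum of the two reciprocal coefficients dominates both terms at once; the cross terms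
      -- are nonnegative and discarded.
      have e : (Re / 2 + 1 / ε ^ 2) * (2 / Re * gradSq (ω τ) + ε ^ 2 * vertVel (u τ) (v τ))
          = gradSq (ω τ) + vertVel (u τ) (v τ) + (Re / 2 * ε ^ 2 * vertVel (u τ) (v τ)
            + 1 / ε ^ 2 * (2 / Re) * gradSq (ω τ)) := by field_simp; ring
      have p : 0 ≤ Re / 2 * ε ^ 2 * vertVel (u τ) (v τ)
            + 1 / ε ^ 2 * (2 / Re) * gradSq (ω τ) := by positivity
      rw [e]
      unfold growth
      linarith)
  have e1 := intervalIntegral.integral_add i1 i2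
  rw [intervalIntegral.integral_const_mul, intervalIntegral.integral_const_mul] at e1
  have h2 := h1.trans (le_of_eq e1)
  have h3 := mul_le_mul_of_nonneg_left (h.integral_dissip_le hs hst ht) hRe.le
  have h4 := h.enstrophy_add_le hs hst ht
  have p1 := gradSq_nonneg (u t)
  have p2 := gradSq_nonneg (v t)
  have p3 := gradSq_nonneg (u s)
  have p4 := gradSq_nonneg (v s)
  have p5 := energyOf_nonneg hRe h.Pe_pos Γ (u s) (v s) (w s) (θ s)
  set P := energyOf Re Pe Γ (u s) (v s) (w s) (θ s)
  set W := gradSq (u s) + gradSq (v s) with hW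
  have W0 : 0 ≤ W := by positivity
  have h5 : ∫ τ in s..t, (2 / Re * gradSq (ω τ) + ε ^ 2 * vertVel (u τ) (v τ))
      ≤ (1 + Re / ε ^ 2) * (W + P) := by
    have : 0 ≤ Re / ε ^ 2 * W := by positivity
    linarith
  have h6 := mul_le_mul_of_nonneg_left h5 (show 0 ≤ Re / 2 + 1 / ε ^ 2 by positivity)
  have h7 : Re * P ≤ Re * (W + P) := mul_le_mul_of_nonneg_left (by linarith) hRe.le
  have h8 : ∫ τ in s..t, growth (u τ) (v τ) (ω τ)
      ≤ Re * P + (Re / 2 + 1 / ε ^ 2) * ((1 + Re / ε ^ 2) * (W + P)) :=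
    h2.trans (add_le_add h3 h6)
  unfold growthConst
  linarith

end Flow

end Gradients

/-! ### Bounds for the horizontal gradients, at large times and on [0, t]. -/

section GradientBounds

variable {L : ℝ} [Fact (0 < L)]

/-- The constant in the bound for the sources of the gradients, in terms of a bound `S` for the
horizontal means of `θ²`. -/
def sourceTotal (L Re Pe Γ ε S : ℝ) : ℝ :=
  sourceConst L Re Pe Γ ε + Pe / L ^ 2 * S * profConst L Re Pe Γ ε

theorem sourceTotal_nonneg {Re Pe S : ℝ} (hRe : 0 < Re) (hPe : 0 < Pe) (Γ ε : ℝ) (hS : 0 ≤ S) :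
    0 ≤ sourceTotal L Re Pe Γ ε S := by
  have hγ := gam_pos (L := L)
  unfold sourceTotal sourceConst profConst
  positivity

theorem thetaSup_nonneg {a b : ℝ} (ha : 0 ≤ a) (hb : 0 ≤ b) : 0 ≤ thetaSup a b := by
  unfold thetaSup; positivity

/-- The bound for the gradients at large times. -/
def uniformBound (L Re Pe Γ ε p S : ℝ) : ℝ :=
  Real.exp (rateConst Re Pe * (growthConst Re ε * ((Re + Re / ε ^ 2 + 1) * p)))
    * (Re + Pe + sourceTotal L Re Pe Γ ε S)

/-- The bound for the integral of the growth coefficient. -/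
def growthBound (Re Pe ε p y : ℝ) : ℝ := rateConst Re Pe * (growthConst Re ε * (y + p))

/-- The bound for the gradients on finite time intervals. -/
def gradBound (L Re Pe Γ ε p y S : ℝ) : ℝ :=
  Real.exp (growthBound Re Pe ε p y) * (y + sourceTotal L Re Pe Γ ε S * p)

/-- The bound for the dissipation of the gradients. -/
def dissipBound (L Re Pe Γ ε p y S : ℝ) : ℝ :=
  y + (growthBound Re Pe ε p y * gradBound L Re Pe Γ ε p y S + sourceTotal L Re Pe Γ ε S * p)

namespace Flow

variable {Re Pe Γ ε T : ℝ} {u v w θ ω φ ut vt wt θt r : ℝ → L2 L}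

/-- The source uses the majorant of the nonlocal term, which depends on the time interval. Its
integral is proportional to the energy at the start of the interval, and this is what later
transfers the decay. -/
theorem exists_source (h : Flow Re Pe Γ ε T u v w θ ω φ ut vt wt θt r) {s t : ℝ} (hs : 0 ≤ s)
    (hst : s ≤ t) (ht : t ≤ T) :
    ∃ d : ℝ → ℝ, IntervalIntegrable d volume s t ∧
      (∀ᵐ τ ∂volume.restrict (Ioo s t), 0 ≤ d τ) ∧
      (∀ᵐ τ ∂volume.restrict (Ioo s t),
        -(2 * inner ℝ (-(wderiv ey (ω τ))) (ut τ)) + -(2 * inner ℝ (wderiv ex (ω τ)) (vt τ))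
        + -(2 * inner ℝ (lapH (w τ)) (wt τ)) + -(2 * inner ℝ (lapH (θ τ)) (θt τ))
        ≤ -gradDissip Re Pe ε (u τ) (v τ) (w τ) (θ τ) (ω τ)
          + (rateConst Re Pe * growth (u τ) (v τ) (ω τ) * gradOf (u τ) (v τ) (w τ) (θ τ) + d τ)) ∧
      ∫ τ in s..t, d τ ≤ sourceTotal L Re Pe Γ ε (thetaSup ‖θ 0‖ ‖wderiv ez (θ 0)‖)
        * energyOf Re Pe Γ (u s) (v s) (w s) (θ s) := by
  have hγ := gam_pos (L := L)
  have hRe := h.Re_pos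
  have hPe := h.Pe_pos
  obtain ⟨F, hF, hr, hi⟩ := h.exists_nonlocal_bound hs hst ht
  have i1 := intervalIntegrable_of_Ioo (h.dissip_integrable.const_mul (sourceConst L Re Pe Γ ε))
    hs hst ht
  have i2 := hF.const_mul (2 * Pe)
  have c0 : 0 ≤ sourceConst L Re Pe Γ ε := by unfold sourceConst; positivity
  refine ⟨fun τ => sourceConst L Re Pe Γ ε * dissip Re Pe ε (w τ) (θ τ) (ω τ) (φ τ) + 2 * Pe * F τ,
    i1.add i2, ?_, ?_, ?_⟩
  · filter_upwards [hr] with τ hτ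
    have := dissip_nonneg hRe hPe ε (w τ) (θ τ) (ω τ) (φ τ)
    have := (sq_nonneg _).trans hτ
    positivity
  · filter_upwards [hr, ae_restrict_Ioo h.slice hs ht] with τ h1 h2
    have h3 := h2.gradOf_le hRe hPe h.ε_ne
    have h4 := mul_le_mul_of_nonneg_left h1 (show 0 ≤ 2 * Pe by positivity)
    linarith
  · rw [intervalIntegral.integral_add i1 i2, intervalIntegral.integral_const_mul,
      intervalIntegral.integral_const_mul]
    have h1 := mul_le_mul_of_nonneg_left (h.integral_dissip_le hs hst ht) c0
    have h2 := mul_le_mul_of_nonneg_left hi (show 0 ≤ 2 * Pe by positivity)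
    refine (add_le_add h1 h2).trans (le_of_eq ?_)
    unfold sourceTotal
    ring

theorem rateConst_nonneg {Re Pe : ℝ} (hRe : 0 < Re) (hPe : 0 < Pe) : 0 ≤ rateConst Re Pe := by
  unfold rateConst; positivity

/-- The bound for the horizontal gradients at times `t ≥ 2`. -/
theorem gradOf_uniform (h : Flow Re Pe Γ ε T u v w θ ω φ ut vt wt θt r) {t : ℝ} (h2 : 2 ≤ t)
    (ht : t ≤ T) :
    gradOf (u t) (v t) (w t) (θ t) ≤ uniformBound L Re Pe Γ ε
      (energyOf Re Pe Γ (u 0) (v 0) (w 0) (θ 0)) (thetaSup ‖θ 0‖ ‖wderiv ez (θ 0)‖)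
      * energyOf Re Pe Γ (u (t - 2)) (v (t - 2)) (w (t - 2)) (θ (t - 2)) := by
  have hγ := gam_pos (L := L)
  have hRe := h.Re_pos
  have hPe := h.Pe_pos
  have hε := h.ε_ne
  have hS := thetaSup_nonneg (norm_nonneg (θ 0)) (norm_nonneg (wderiv ez (θ 0)))
  set S := thetaSup ‖θ 0‖ ‖wderiv ez (θ 0)‖
  have e01 := h.energyOf_le le_rfl (show 0 ≤ t - 2 by linarith) (by linarith)
  have e12 := h.energyOf_le (show 0 ≤ t - 2 by linarith) (show t - 2 ≤ t - 1 by linarith)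
    (by linarith)
  have E0 := energyOf_nonneg hRe hPe Γ (u (t - 2)) (v (t - 2)) (w (t - 2)) (θ (t - 2))
  have J1 := h.integral_dissip_le (show 0 ≤ t - 2 by linarith) (show t - 2 ≤ t - 1 by linarith)
    (by linarith)
  have J2 := h.integral_dissip_le (show 0 ≤ t - 1 by linarith) (show t - 1 ≤ t by linarith) ht
  have G := h.integral_growth_le (show 0 ≤ t - 1 by linarith) (show t - 1 ≤ t by linarith) ht
  obtain ⟨d, di, d0, dle, dint⟩ := h.exists_source (show 0 ≤ t - 1 by linarith)
    (show t - 1 ≤ t by linarith) ht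
  set P0 := energyOf Re Pe Γ (u 0) (v 0) (w 0) (θ 0)
  set P1 := energyOf Re Pe Γ (u (t - 2)) (v (t - 2)) (w (t - 2)) (θ (t - 2))
  set P2 := energyOf Re Pe Γ (u (t - 1)) (v (t - 1)) (w (t - 1)) (θ (t - 1))
  -- the enstrophy at time `t - 1`
  have hW : gradSq (u (t - 1)) + gradSq (v (t - 1)) ≤ (Re + Re / ε ^ 2) * P1 := by
    have ee : t - 1 - 1 = t - 2 := by ring
    have hy : HasIntDeriv (t - 1 - 1) (t - 1) (fun t => gradSq (u t) + gradSq (v t)) fun t =>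
        -(2 * inner ℝ (-(wderiv ey (ω t))) (ut t)) + -(2 * inner ℝ (wderiv ex (ω t)) (vt t)) :=
      h.enstrophy.mono ⟨by linarith, by linarith⟩ ⟨by linarith, by linarith⟩ (by linarith)
    have i1 := intervalIntegrable_of_Ioo (h.dissip_integrable.const_mul (Re / ε ^ 2))
      (show 0 ≤ t - 1 - 1 by linarith) (show t - 1 - 1 ≤ t - 1 by linarith) (by linarith)
    have i2 := intervalIntegrable_of_Ioo (h.dissip_integrable.const_mul Re)
      (show 0 ≤ t - 1 - 1 by linarith) (show t - 1 - 1 ≤ t - 1 by linarith) (by linarith)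
    have sl := ae_restrict_Ioo h.slice (show 0 ≤ t - 1 - 1 by linarith)
      (show t - 1 ≤ T by linarith)
    -- On the window [t - 2, t - 1] the enstrophy at its end is bounded by dissipated energy alone,
    -- since there is no growth coefficient.
    have := gronwall_uniform (c := fun _ => 0) hy intervalIntegrable_const i1
      (Eventually.of_forall fun _ => le_rfl) (Eventually.of_forall fun τ => by
        have := dissip_nonneg hRe hPe ε (w τ) (θ τ) (ω τ) (φ τ)
        positivity)
      (fun τ _ => add_nonneg (gradSq_nonneg _) (gradSq_nonneg _)) (by
        filter_upwards [sl] with τ hτ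
        have e := hτ.enstrophy_le hε
        have d := (le_dissip hRe hPe hε (w τ) (θ τ) (ω τ) (φ τ)).1
        have b1 : 1 / ε ^ 2 * gradSq (w τ)
            ≤ 1 / ε ^ 2 * (Re * dissip Re Pe ε (w τ) (θ τ) (ω τ) (φ τ)) :=
          mul_le_mul_of_nonneg_left (by linarith [sq_nonneg ‖ω τ‖]) (by positivity)
        have e2 : Re / ε ^ 2 * dissip Re Pe ε (w τ) (θ τ) (ω τ) (φ τ)
            = 1 / ε ^ 2 * (Re * dissip Re Pe ε (w τ) (θ τ) (ω τ) (φ τ)) := by ring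
        have g1 := gradSq_nonneg (ω τ)
        have p1 : 0 ≤ 2 / Re * gradSq (ω τ) := by positivity
        have p2 : 0 ≤ ε ^ 2 * (‖wderiv ez (u τ)‖ ^ 2 + ‖wderiv ez (v τ)‖ ^ 2) := by positivity
        linarith)
    simp only [intervalIntegral.integral_zero, Real.exp_zero, one_mul] at this
    have hdot : ∫ τ in (t - 1 - 1)..(t - 1), (gradSq (u τ) + gradSq (v τ))
        ≤ ∫ τ in (t - 1 - 1)..(t - 1), Re * dissip Re Pe ε (w τ) (θ τ) (ω τ) (φ τ) := by
      refine intervalIntegral_mono_ae (by linarith)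
        ((hy.continuousOn (by linarith)).intervalIntegrable_of_Icc (by linarith)) i2 ?_
      filter_upwards [sl] with τ hτ
      have d := (le_dissip hRe hPe hε (w τ) (θ τ) (ω τ) (φ τ)).1
      rw [hτ.gradSq_vel]
      linarith [gradSq_nonneg (w τ)]
    rw [intervalIntegral.integral_const_mul] at this hdot
    rw [ee] at this hdot
    have k1 := mul_le_mul_of_nonneg_left J1 hRe.le
    have k2 := mul_le_mul_of_nonneg_left J1 (show 0 ≤ Re / ε ^ 2 by positivity)
    linarith
  -- the gradients at time `t`
  have hy := h.gradients.mono (c := t - 1) (d := t) ⟨by linarith, by linarith⟩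
    ⟨by linarith, ht⟩ (by linarith)
  have sl := ae_restrict_Ioo h.slice (show 0 ≤ t - 1 by linarith) ht
  have K0 := rateConst_nonneg hRe hPe
  have ig := intervalIntegrable_of_Ioo (h.growth_integrable.const_mul (rateConst Re Pe))
    (show 0 ≤ t - 1 by linarith) (show t - 1 ≤ t by linarith) ht
  have main := gronwall_uniform hy ig di
    (Eventually.of_forall fun τ => mul_nonneg K0 (growth_nonneg _ _ _)) d0
    (fun τ _ => gradOf_nonneg _ _ _ _) (by
      filter_upwards [dle] with τ hτ
      have := gradDissip_nonneg hRe hPe ε (u τ) (v τ) (w τ) (θ τ) (ω τ)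
      linarith)
  have hyi : ∫ τ in (t - 1)..t, gradOf (u τ) (v τ) (w τ) (θ τ)
      ≤ ∫ τ in (t - 1)..t, (Re + Pe) * dissip Re Pe ε (w τ) (θ τ) (ω τ) (φ τ) := by
    refine intervalIntegral_mono_ae (by linarith)
      ((hy.continuousOn (by linarith)).intervalIntegrable_of_Icc (by linarith))
      (intervalIntegrable_of_Ioo (h.dissip_integrable.const_mul _) (by linarith) (by linarith) ht) ?_
    filter_upwards [sl] with τ hτ
    obtain ⟨d1, -, d3⟩ := le_dissip hRe hPe hε (w τ) (θ τ) (ω τ) (φ τ)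
    unfold gradOf
    rw [hτ.gradSq_vel]
    linarith
  rw [intervalIntegral.integral_const_mul] at hyi main
  have c0 := growthConst_nonneg hRe ε
  have s0 := sourceTotal_nonneg (L := L) hRe hPe Γ ε hS
  -- In the exponent the energy may be replaced by its initial value; in the prefactor the energy at
  -- t - 2 is kept, because it decays.
  have k1 : rateConst Re Pe * ∫ τ in (t - 1)..t, growth (u τ) (v τ) (ω τ)
      ≤ rateConst Re Pe * (growthConst Re ε * ((Re + Re / ε ^ 2 + 1) * P0)) := by
    refine mul_le_mul_of_nonneg_left (G.trans (mul_le_mul_of_nonneg_left ?_ c0)) K0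
    have : (Re + Re / ε ^ 2 + 1) * P1 ≤ (Re + Re / ε ^ 2 + 1) * P0 :=
      mul_le_mul_of_nonneg_left e01 (by positivity)
    linarith
  have k2 : (∫ τ in (t - 1)..t, gradOf (u τ) (v τ) (w τ) (θ τ)) + ∫ τ in (t - 1)..t, d τ
      ≤ (Re + Pe + sourceTotal L Re Pe Γ ε S) * P1 := by
    have a1 := mul_le_mul_of_nonneg_left (J2.trans e12) (show 0 ≤ Re + Pe by positivity)
    have a2 := mul_le_mul_of_nonneg_left e12 s0
    linarith
  have k3 : 0 ≤ (Re + Pe + sourceTotal L Re Pe Γ ε S) * P1 := by positivity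
  refine main.trans ?_
  unfold uniformBound
  rw [mul_assoc]
  refine (mul_le_mul_of_nonneg_left k2 (Real.exp_pos _).le).trans
    (mul_le_mul_of_nonneg_right (Real.exp_le_exp.2 k1) k3)

/-- Neither bound depends on t, because the integrals of `growth` and of the sources are bounded
uniformly in time. -/
theorem gradOf_le (h : Flow Re Pe Γ ε T u v w θ ω φ ut vt wt θt r) {t : ℝ} (ht : t ∈ Icc 0 T) :
    gradOf (u t) (v t) (w t) (θ t) ≤ gradBound L Re Pe Γ ε
      (energyOf Re Pe Γ (u 0) (v 0) (w 0) (θ 0)) (gradOf (u 0) (v 0) (w 0) (θ 0))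
      (thetaSup ‖θ 0‖ ‖wderiv ez (θ 0)‖) ∧
    ∫ τ in (0 : ℝ)..t, rateConst Re Pe * growth (u τ) (v τ) (ω τ) ≤ growthBound Re Pe ε
      (energyOf Re Pe Γ (u 0) (v 0) (w 0) (θ 0)) (gradOf (u 0) (v 0) (w 0) (θ 0)) := by
  have hRe := h.Re_pos
  have hPe := h.Pe_pos
  have K0 := rateConst_nonneg hRe hPe
  have c0 := growthConst_nonneg hRe ε
  obtain ⟨d, di, d0, dle, dint⟩ := h.exists_source le_rfl ht.1 ht.2
  have G := h.integral_growth_le le_rfl ht.1 ht.2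
  have ig := intervalIntegrable_of_Ioo (h.growth_integrable.const_mul (rateConst Re Pe))
    le_rfl ht.1 ht.2
  have main := gronwall ht.1 (h.gradients.mono h.zero_mem ht ht.1) ig di
    (Eventually.of_forall fun τ => mul_nonneg K0 (growth_nonneg _ _ _)) d0 (by
      filter_upwards [dle] with τ hτ
      have := gradDissip_nonneg hRe hPe ε (u τ) (v τ) (w τ) (θ τ) (ω τ)
      linarith)
  have k1 : ∫ τ in (0 : ℝ)..t, rateConst Re Pe * growth (u τ) (v τ) (ω τ) ≤ growthBound Re Pe ε
      (energyOf Re Pe Γ (u 0) (v 0) (w 0) (θ 0)) (gradOf (u 0) (v 0) (w 0) (θ 0)) := by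
    rw [intervalIntegral.integral_const_mul]
    refine mul_le_mul_of_nonneg_left (G.trans (mul_le_mul_of_nonneg_left ?_ c0)) K0
    have := gradSq_nonneg (w 0)
    have := gradSq_nonneg (θ 0)
    unfold gradOf
    linarith
  refine ⟨main.trans ?_, k1⟩
  unfold gradBound
  have y0 := gradOf_nonneg (u 0) (v 0) (w 0) (θ 0)
  have d1 := intervalIntegral_nonneg_ae ht.1 d0
  exact mul_le_mul (Real.exp_le_exp.2 k1) (by linarith) (by linarith) (Real.exp_pos _).le

theorem integral_gradDissip_le (h : Flow Re Pe Γ ε T u v w θ ω φ ut vt wt θt r) {t : ℝ}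
    (ht : t ∈ Icc 0 T) :
    ∫ τ in (0 : ℝ)..t, gradDissip Re Pe ε (u τ) (v τ) (w τ) (θ τ) (ω τ) ≤ dissipBound L Re Pe Γ ε
      (energyOf Re Pe Γ (u 0) (v 0) (w 0) (θ 0)) (gradOf (u 0) (v 0) (w 0) (θ 0))
      (thetaSup ‖θ 0‖ ‖wderiv ez (θ 0)‖) := by
  have hRe := h.Re_pos
  have hPe := h.Pe_pos
  have K0 := rateConst_nonneg hRe hPe
  obtain ⟨d, di, d0, dle, dint⟩ := h.exists_source le_rfl ht.1 ht.2
  set M := gradBound L Re Pe Γ ε (energyOf Re Pe Γ (u 0) (v 0) (w 0) (θ 0))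
    (gradOf (u 0) (v 0) (w 0) (θ 0)) (thetaSup ‖θ 0‖ ‖wderiv ez (θ 0)‖) with hM
  have ig := (intervalIntegrable_of_Ioo (h.growth_integrable.const_mul (rateConst Re Pe))
    le_rfl ht.1 ht.2).mul_const M
  have h1 := (h.gradients.mono h.zero_mem ht ht.1).add_integral_le ht.1
    (intervalIntegrable_of_Ioo h.gradDissip_integrable le_rfl ht.1 ht.2) (ig.add di) (by
      filter_upwards [dle, ae_restrict_mem measurableSet_Ioo] with τ hτ hm
      have b := (h.gradOf_le (t := τ) ⟨hm.1.le, hm.2.le.trans ht.2⟩).1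
      have c := mul_le_mul_of_nonneg_left b
        (mul_nonneg K0 (growth_nonneg (u τ) (v τ) (ω τ)))
      refine hτ.trans (add_le_add le_rfl (add_le_add c le_rfl)))
  have e := intervalIntegral.integral_add ig di
  rw [intervalIntegral.integral_mul_const] at e
  have k1 := (h.gradOf_le ht).2
  have M0 : 0 ≤ M := (gradOf_nonneg _ _ _ _).trans (h.gradOf_le ht).1
  have k2 := mul_le_mul_of_nonneg_right k1 M0
  have yt := gradOf_nonneg (u t) (v t) (w t) (θ t)
  have h2 := h1.trans (add_le_add le_rfl (le_of_eq e))
  unfold dissipBound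
  rw [← hM]
  linarith

end Flow

end GradientBounds

/-! ### Weighted vertical differences of θ at a fixed time. -/

section VerticalSlice

variable {L : ℝ} [Fact (0 < L)]

theorem aestronglyMeasurable_abs_Z1 {μ : Measure ℝ} {F : ℝ → Z1} (h : AEStronglyMeasurable F μ) :
    AEStronglyMeasurable (fun t => |F t|) μ :=
  (continuous_id.sup continuous_neg : Continuous fun a : Z1 => a ⊔ -a).comp_aestronglyMeasurable h

theorem Weight.neg_pair_le {χ : Weight} (hχ : ∀ z, 0 ≤ χ z) (a : Z1) : -χ.pair a ≤ χ.pair |a| := by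
  rw [← map_neg, Weight.pair_apply, Weight.pair_apply]
  refine χ.integral_mono hχ (Z1.integrable _) (Z1.integrable _) ?_
  filter_upwards [Lp.coeFn_neg a, Lp.coeFn_abs a] with z h1 h2
  rw [h1, h2, Pi.neg_apply]
  exact neg_le_abs _

theorem Weight.pair_abs_nonneg {χ : Weight} (hχ : ∀ z, 0 ≤ χ z) (a : Z1) : 0 ≤ χ.pair |a| := by
  rw [Weight.pair_apply]
  refine integral_nonneg_of_ae ?_
  filter_upwards [Lp.coeFn_abs a] with z h1
  rw [h1]
  exact mul_nonneg (hχ z) (abs_nonneg _)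

theorem Weight.pair_one_abs_le (a : Z1) : (Weight.const 1).pair |a| ≤ ‖a‖ := by
  rw [← norm_abs_eq_norm a]
  exact Weight.pair_le_norm (fun _ => by simp [Weight.const]) _

/-- The rate of growth of the vertical derivatives. -/
def vertGrowth (u v w θ ω : L2 L) : ℝ :=
  growth u v ω + gradSq w + gradSq θ + 2 * ‖lapH w‖ ^ 2 + 2 * ‖lapH θ‖ ^ 2 + 2 * vertVel u v

theorem vertGrowth_nonneg (u v w θ ω : L2 L) : 0 ≤ vertGrowth u v w θ ω := by
  have h1 := growth_nonneg u v ω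
  have h2 := gradSq_nonneg w
  have h3 := gradSq_nonneg θ
  have h4 := vertVel_nonneg u v
  unfold vertGrowth; positivity

theorem coef_add_coef_le (u v w θ : L2 L) :
    Slice.coef u v w (lapH w) + Slice.coef u v θ (lapH θ)
      ≤ gradSq w + gradSq θ + 2 * ‖lapH w‖ ^ 2 + 2 * ‖lapH θ‖ ^ 2 + 2 * vertVel u v := by
  unfold Slice.coef vertVel
  nlinarith [sq_nonneg (‖lapH w‖ - ‖wderiv ez u‖), sq_nonneg (‖lapH w‖ - ‖wderiv ez v‖),
    sq_nonneg (‖lapH θ‖ - ‖wderiv ez u‖), sq_nonneg (‖lapH θ‖ - ‖wderiv ez v‖)]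

/-- A crude bound with no smallness in the step. Its only purpose is to start the iteration in
`halving`, whose conclusion does not depend on it. -/
theorem hdot_dz_self_le {f : L2 L} {S : ℝ} (h : ∀ᵐ z, hdot f f z ≤ S) (k : ℝ) :
    ∀ᵐ z, hdot (dz k f) (dz k f) z ≤ 4 * S := by
  refine Weight.ae_le (integrable_hprod _ _) (integrable_const _) fun χ hχ => ?_
  have h0 : ∀ᵐ z, hdot (tz k f) (tz k f) z ≤ S := by
    filter_upwards [hdot_tz k f f, (measurePreserving_vert k).quasiMeasurePreserving.ae h] with z h1 h2
    rw [h1]; exact h2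
  have h1 := χ.integral_mono hχ (integrable_hprod _ _) (integrable_const S) h
  have h2 := χ.integral_mono hχ (integrable_hprod _ _) (integrable_const S) h0
  rw [← inner_mz, integral_mul_const] at *
  have h3 := two_inner_mz_le hχ (tz k f) (-f)
  simp only [map_neg, inner_neg_left, inner_neg_right, neg_neg] at h3
  have e : inner ℝ (mz χ (dz k f)) (dz k f) = inner ℝ (mz χ (tz k f)) (tz k f)
      + inner ℝ (mz χ f) f - 2 * inner ℝ (mz χ (tz k f)) f := by
    rw [dz_apply, map_sub, inner_sub_left, inner_sub_right, inner_sub_right, inner_mz_comm χ f,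
      real_inner_comm (mz χ (tz k f)) f]
    ring
  rw [e]
  linarith

namespace Slice

variable {Re Pe Γ ε : ℝ} {u v w θ ω φ ut vt wt θt r : L2 L}

theorem gradSq_dz_theta (h : Slice Re Pe Γ ε u v w θ ω φ ut vt wt θt r) (k : ℝ) :
    gradSq (dz k θ) = ‖dz k (wderiv ex θ)‖ ^ 2 + ‖dz k (wderiv ey θ)‖ ^ 2 := by
  rw [gradSq, wderiv_dz h.reg_θ.x, wderiv_dz h.reg_θ.y]

/-- The evolution of a weighted vertical difference of `θ`. -/
theorem dz_theta_le (h : Slice Re Pe Γ ε u v w θ ω φ ut vt wt θt r) (k : ℝ) {χ N : Weight}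
    (hχ : ∀ z, 0 ≤ χ z) (hN : ∀ᵐ z, hdot (dz k θ) (dz k θ) z ≤ N z) {S : ℝ} (hS0 : 0 ≤ S)
    (hS : ∀ᵐ z, hdot θ θ z ≤ S) :
    2 * inner ℝ (mz χ (dz k θ)) (dz k θt)
      ≤ -(2 / Pe * (inner ℝ (mz χ (dz k (wderiv ex θ))) (dz k (wderiv ex θ))
        + inner ℝ (mz χ (dz k (wderiv ey θ))) (dz k (wderiv ey θ))))
      + (χ.pair ((2 : ℝ) • |hp (adv (dz k u) (dz k v) θ) (dz k θ)|
          + ((S + 1) / L ^ 2 + S / (2 * L ^ 2)) • hp (dz k w) (dz k w))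
        + 1 / (S + 1) * inner ℝ (mz (χ.mul N) r) θ) := by
  have hL : 0 < L := L_pos
  have h1 := h.dz_theta_weighted k χ
  -- With this B the dissipation with weight χN carries the factor 1/(S + 1), and its time integral
  -- is at most (S/2)∫χN: less than half of ∫χN is lost.
  have h2 := h.nonlocal.inner_dz_le k hχ hN (B := L ^ 2 / (S + 1)) (by positivity) hS
  have h3 := Weight.neg_pair_le hχ (hp (adv (dz k u) (dz k v) θ) (dz k θ))
  rw [hp_comm, pair_hp] at h3
  rw [map_add, map_smul, map_smul, pair_hp, smul_eq_mul, smul_eq_mul]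
  rw [hp_comm] at h3
  have e1 : 1 / (L ^ 2 / (S + 1)) = (S + 1) / L ^ 2 := by rw [one_div_div]
  have e2 : L ^ 2 / (S + 1) / L ^ 2 = 1 / (S + 1) := by field_simp
  rw [e1, e2] at h2
  have e3 : 2 / Pe * (inner ℝ (mz χ (dz k (wderiv ex θ))) (dz k (wderiv ex θ))
        + inner ℝ (mz χ (dz k (wderiv ey θ))) (dz k (wderiv ey θ)))
      = 2 * (1 / Pe * (inner ℝ (mz χ (dz k (wderiv ex θ))) (dz k (wderiv ex θ))
        + inner ℝ (mz χ (dz k (wderiv ey θ))) (dz k (wderiv ey θ)))) := by ring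
  rw [e3]
  linarith

end Slice

end VerticalSlice

/-- The coefficient of the nonlocal term in the estimate for vertical differences of `θ`. -/
def nonlocalCoef (L S : ℝ) : ℝ := (S + 1) / L ^ 2 + S / (2 * L ^ 2)

theorem nonlocalCoef_nonneg {L S : ℝ} (hS : 0 ≤ S) : 0 ≤ nonlocalCoef L S := by
  unfold nonlocalCoef; positivity

/-! ### Time-integrated estimates of vertical differences. -/

section Vertical

variable {L : ℝ} [Fact (0 < L)]

/-- The growth rate of the vertical derivatives. -/
def vertRate (L Re Pe Γ S g : ℝ) : ℝ := |Γ| + 2 * nonlocalCoef L S + 288 * (Re + Pe) * g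

namespace Flow

variable {Re Pe Γ ε T : ℝ} {u v w θ ω φ ut vt wt θt r : ℝ → L2 L}

theorem vertGrowth_integrable (h : Flow Re Pe Γ ε T u v w θ ω φ ut vt wt θt r) :
    Integrable (fun t => vertGrowth (u t) (v t) (w t) (θ t) (ω t)) (volume.restrict (Ioo 0 T)) :=
  ((((h.growth_integrable.add (h.w_reg.bdd_x.of_top.sq.add h.w_reg.bdd_y.of_top.sq)).add
    (h.θ_reg.bdd_x.of_top.sq.add h.θ_reg.bdd_y.of_top.sq)).add (h.lap_w.sq.const_mul 2)).add
      (h.lap_θ.sq.const_mul 2)).add (h.vertVel_integrable.const_mul 2)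

theorem vertSq_bdd (h : Flow Re Pe Γ ε T u v w θ ω φ ut vt wt θt r) :
    AEStronglyMeasurable (fun t => Slice.vertSq (u t) (v t) (w t) (θ t)) (volume.restrict (Ioo 0 T))
      ∧ ∃ c, ∀ᵐ t ∂volume.restrict (Ioo 0 T), ‖Slice.vertSq (u t) (v t) (w t) (θ t)‖ ≤ c := by
  obtain ⟨a, ha⟩ := exists_ae_norm_le h.u_reg.bdd_z
  obtain ⟨b, hb⟩ := exists_ae_norm_le h.v_reg.bdd_z
  obtain ⟨c, hc⟩ := exists_ae_norm_le h.w_reg.bdd_z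
  obtain ⟨d, hd⟩ := exists_ae_norm_le h.θ_reg.bdd_z
  refine ⟨(((h.u_reg.bdd_z.of_top.sq.add h.v_reg.bdd_z.of_top.sq).add
    h.w_reg.bdd_z.of_top.sq).add h.θ_reg.bdd_z.of_top.sq).1,
    a ^ 2 + b ^ 2 + c ^ 2 + d ^ 2, ?_⟩
  filter_upwards [ha, hb, hc, hd] with t h1 h2 h3 h4
  rw [Real.norm_eq_abs, abs_of_nonneg (Slice.vertSq_nonneg _ _ _ _)]
  unfold Slice.vertSq
  gcongr

theorem rate_mul_vertSq_integrable (h : Flow Re Pe Γ ε T u v w θ ω φ ut vt wt θt r) {f : ℝ → ℝ}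
    (hf : Integrable f (volume.restrict (Ioo 0 T))) :
    Integrable (fun t => f t * Slice.vertSq (u t) (v t) (w t) (θ t))
      (volume.restrict (Ioo 0 T)) := by
  obtain ⟨h1, c, h2⟩ := h.vertSq_bdd
  exact hf.mul_bdd h1 h2

/-- Vertical differences of the velocity. -/
theorem dz_kinetic_le (h : Flow Re Pe Γ ε T u v w θ ω φ ut vt wt θt r) (k : ℝ) {t : ℝ}
    (ht : t ∈ Icc 0 T) :
    ‖dz k (u t)‖ ^ 2 + ‖dz k (v t)‖ ^ 2 + ‖dz k (w t)‖ ^ 2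
        + 1 / Re * ∫ τ in (0 : ℝ)..t, ‖dz k (ω τ)‖ ^ 2
      ≤ ‖dz k (u 0)‖ ^ 2 + ‖dz k (v 0)‖ ^ 2 + ‖dz k (w 0)‖ ^ 2
        + k ^ 2 * ∫ τ in (0 : ℝ)..t, (|Γ| + 288 * Re * growth (u τ) (v τ) (ω τ)
          + 18 * Re * (gradSq (w τ) + 2 * ‖lapH (w τ)‖ ^ 2 + vertVel (u τ) (v τ)))
          * Slice.vertSq (u τ) (v τ) (w τ) (θ τ) := by
  have hRe := h.Re_pos
  have d := ((((h.du.clm h.pos.le (dz k)).norm_sq h.pos.le).add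
    ((h.dv.clm h.pos.le (dz k)).norm_sq h.pos.le)).add
      ((h.dw.clm h.pos.le (dz k)).norm_sq h.pos.le)).mono h.zero_mem ht ht.1
  have ic : Integrable (fun τ => |Γ| + 288 * Re * growth (u τ) (v τ) (ω τ)
      + 18 * Re * (gradSq (w τ) + 2 * ‖lapH (w τ)‖ ^ 2 + vertVel (u τ) (v τ)))
      (volume.restrict (Ioo 0 T)) :=
    ((integrable_const |Γ|).add (h.growth_integrable.const_mul _)).add
      ((((h.w_reg.bdd_x.of_top.sq.add h.w_reg.bdd_y.of_top.sq).add (h.lap_w.sq.const_mul 2)).add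
        h.vertVel_integrable).const_mul _)
  have h1 := d.add_integral_le ht.1
    (intervalIntegrable_of_Ioo ((h.ω_bdd.of_top.clm (dz k)).sq.const_mul (1 / Re)) le_rfl ht.1 ht.2)
    (intervalIntegrable_of_Ioo ((h.rate_mul_vertSq_integrable ic).const_mul (k ^ 2)) le_rfl ht.1
      ht.2) (by
      filter_upwards [ae_restrict_Ioo h.slice le_rfl ht.2] with τ hτ
      refine (hτ.dz_energy_le hRe k).trans (add_le_add le_rfl ?_)
      refine mul_le_mul_of_nonneg_left (mul_le_mul_of_nonneg_right ?_
        (Slice.vertSq_nonneg _ _ _ _)) (sq_nonneg k)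
      have a1 := mul_le_mul_of_nonneg_left hτ.qvel_le (show 0 ≤ 288 * Re by positivity)
      have a2 : Slice.coef (u τ) (v τ) (w τ) (lapH (w τ))
          ≤ gradSq (w τ) + 2 * ‖lapH (w τ)‖ ^ 2 + vertVel (u τ) (v τ) := by
        unfold Slice.coef vertVel
        nlinarith [sq_nonneg (‖lapH (w τ)‖ - ‖wderiv ez (u τ)‖),
          sq_nonneg (‖lapH (w τ)‖ - ‖wderiv ez (v τ)‖)]
      have a3 := mul_le_mul_of_nonneg_left a2 (show 0 ≤ 18 * Re by positivity)
      exact add_le_add (add_le_add le_rfl a1) a3)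
  rwa [intervalIntegral.integral_const_mul, intervalIntegral.integral_const_mul] at h1

/-- The source in the estimate for vertical differences of `θ`, as a function of `z`. -/
def dzSource (S k : ℝ) (u v w θ : L2 L) : Z1 :=
  (2 : ℝ) • |hp (adv (dz k u) (dz k v) θ) (dz k θ)| + nonlocalCoef L S • hp (dz k w) (dz k w)

theorem dzSource_integrable (h : Flow Re Pe Γ ε T u v w θ ω φ ut vt wt θt r) (S k : ℝ) :
    Integrable (fun t => dzSource S k (u t) (v t) (w t) (θ t)) (volume.restrict (Ioo 0 T)) := by
  have mθ := h.θ_reg.bdd.of_top.clm (dz k)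
  have mw := h.w_reg.bdd.of_top.clm (dz k)
  have ma : AEStronglyMeasurable (fun t => adv (dz k (u t)) (dz k (v t)) (θ t))
      (volume.restrict (Ioo 0 T)) :=
    aestronglyMeasurable_adv (h.u_reg.bdd.of_top.clm (dz k)).1 (h.v_reg.bdd.of_top.clm (dz k)).1
      h.θ_reg.bdd_x.1 h.θ_reg.bdd_y.1
      (h.slice.mono fun t ht => ⟨ht.vel.ru.dz k, ht.vel.rv.dz k, ht.reg_θ.reg2⟩)
  refine Integrable.add (Integrable.smul (2 : ℝ) ?_) ((integrable_hp mw mw).smul (nonlocalCoef L S))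
  have ib := (((h.ω_bdd.of_top.clm (dz k)).sq.add ((h.θ_reg.bdd_x.of_top.clm (dz k)).sq.add
    (h.θ_reg.bdd_y.of_top.clm (dz k)).sq)).const_mul 1).add
    (((h.rate_mul_vertSq_integrable h.vertGrowth_integrable).const_mul (k ^ 2)).const_mul
      (9 / (4 * 1)))
  refine ib.mono' (aestronglyMeasurable_abs_Z1 (aestronglyMeasurable_hp ma mθ.1)) ?_
  filter_upwards [h.slice] with t ht
  rw [norm_abs_eq_norm]
  refine (ht.norm_hp_adv_le k one_pos).trans ?_
  rw [ht.gradSq_dz_theta k]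
  have h1 := coef_add_coef_le (u t) (v t) (w t) (θ t)
  have h2 := Slice.coef_nonneg (u t) (v t) (w t) (lapH (w t))
  have h3 := growth_nonneg (u t) (v t) (ω t)
  have h4 : Slice.coef (u t) (v t) (θ t) (lapH (θ t)) ≤ vertGrowth (u t) (v t) (w t) (θ t) (ω t) := by
    unfold vertGrowth; linarith
  refine add_le_add le_rfl (mul_le_mul_of_nonneg_left (mul_le_mul_of_nonneg_left
    (mul_le_mul_of_nonneg_right h4 (Slice.vertSq_nonneg _ _ _ _)) (sq_nonneg k)) (by norm_num))

theorem pair_dzSource_nonneg {S : ℝ} (hS : 0 ≤ S) (k : ℝ) {χ : Weight} (hχ : ∀ z, 0 ≤ χ z)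
    (u v w θ : L2 L) : 0 ≤ χ.pair (dzSource S k u v w θ) := by
  rw [dzSource, map_add, map_smul, map_smul, pair_hp, smul_eq_mul, smul_eq_mul]
  have h1 := Weight.pair_abs_nonneg hχ (hp (adv (dz k u) (dz k v) θ) (dz k θ))
  have h2 := inner_mz_self_nonneg hχ (dz k w)
  have h3 := nonlocalCoef_nonneg (L := L) hS
  positivity

/-- Vertical differences of the temperature. -/
theorem dz_theta_le (h : Flow Re Pe Γ ε T u v w θ ω φ ut vt wt θt r) (k : ℝ) {t : ℝ}
    (ht : t ∈ Icc 0 T) {S : ℝ} (hS : S = thetaSup ‖θ 0‖ ‖wderiv ez (θ 0)‖) :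
    ‖dz k (θ t)‖ ^ 2 + 2 / Pe * ∫ τ in (0 : ℝ)..t,
        (‖dz k (wderiv ex (θ τ))‖ ^ 2 + ‖dz k (wderiv ey (θ τ))‖ ^ 2)
      ≤ 2 * (‖dz k (θ 0)‖ ^ 2
        + ∫ τ in (0 : ℝ)..t, (Weight.const 1).pair (dzSource S k (u τ) (v τ) (w τ) (θ τ))) := by
  have hPe := h.Pe_pos
  have hS0 : 0 ≤ S := hS ▸ thetaSup_nonneg (norm_nonneg _) (norm_nonneg _)
  have hSle : ∀ τ ∈ Icc 0 t, ∀ᵐ z, hdot (θ τ) (θ τ) z ≤ S := fun τ hτ =>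
    hS ▸ h.hdot_theta_le ⟨hτ.1, hτ.2.trans ht.2⟩
  set Q : Weight → ℝ → ℝ := fun χ τ =>
    inner ℝ (mz χ (dz k (wderiv ex (θ τ)))) (dz k (wderiv ex (θ τ)))
      + inner ℝ (mz χ (dz k (wderiv ey (θ τ)))) (dz k (wderiv ey (θ τ))) with hQ
  have iQ : ∀ χ, Integrable (Q χ) (volume.restrict (Ioo 0 T)) := fun χ =>
    (integrable_inner_L2 ((h.θ_reg.bdd_x.of_top.clm (dz k)).clm (mz χ))
      (h.θ_reg.bdd_x.of_top.clm (dz k))).add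
    (integrable_inner_L2 ((h.θ_reg.bdd_y.of_top.clm (dz k)).clm (mz χ))
      (h.θ_reg.bdd_y.of_top.clm (dz k)))
  have iF := h.dzSource_integrable S k
  set F : ℝ → Z1 := fun τ => dzSource S k (u τ) (v τ) (w τ) (θ τ) with hF
  have ip : ∀ χ : Weight, Integrable (fun τ => χ.pair (F τ)) (volume.restrict (Ioo 0 T)) :=
    fun χ => χ.pair.integrable_comp iF
  -- The source is integrated over all of [0, t], so that one X serves every intermediate time; this
  -- is allowed because the source is nonnegative.
  set X : Z1 := hp (dz k (θ 0)) (dz k (θ 0)) + ∫ τ in (0 : ℝ)..t, F τ with hX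
  have pX : ∀ χ : Weight, ∫ z, χ z * X z = inner ℝ (mz χ (dz k (θ 0))) (dz k (θ 0))
      + ∫ τ in (0 : ℝ)..t, χ.pair (F τ) := by
    intro χ
    rw [← Weight.pair_apply, hX, map_add, pair_hp, ContinuousLinearMap.intervalIntegral_comp_comm]
    exact intervalIntegrable_of_Ioo iF le_rfl ht.1 ht.2
  have X0 : ∀ᵐ z, 0 ≤ X z := by
    refine Weight.ae_le (integrable_const 0) X.integrable fun χ hχ => ?_
    simp only [mul_zero, integral_zero]
    rw [pX]
    exact add_nonneg (inner_mz_self_nonneg hχ _) (intervalIntegral_nonneg_ae ht.1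
      (Eventually.of_forall fun τ => pair_dzSource_nonneg hS0 k hχ _ _ _ _))
  -- The hypothesis of the iteration is the weighted balance on [0, s], in which the nonlocal term
  -- is charged to an arbitrary bound N of the profile.
  have main := halving (T := t) (c := 4 * S) (a := fun τ => hdot (dz k (θ τ)) (dz k (θ τ)))
    (D := fun χ s => 2 / Pe * ∫ τ in (0 : ℝ)..s, Q χ τ) (X := X) (by positivity)
    (fun τ _ => integrable_hprod _ _) (fun τ hτ => hdot_dz_self_le (hSle τ hτ) k) X0
    (fun χ hχ s hs => mul_nonneg (by positivity) (intervalIntegral_nonneg_ae hs.1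
      (Eventually.of_forall fun τ => add_nonneg (inner_mz_self_nonneg hχ _)
        (inner_mz_self_nonneg hχ _)))) (fun N hN0 hN χ hχ s hs => by
      have hsT : s ≤ T := hs.2.trans ht.2
      have hmul : ∀ z, 0 ≤ (χ.mul N) z := fun z => mul_nonneg (hχ z) (hN0 z)
      have d := ((h.dθ.clm h.pos.le (dz k)).mono h.zero_mem ⟨hs.1, hsT⟩ hs.1).inner_clm hs.1 (mz χ)
        (inner_mz_comm χ)
      have i1 := intervalIntegrable_of_Ioo ((iQ χ).const_mul (2 / Pe)) le_rfl hs.1 hsT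
      have i2 := intervalIntegrable_of_Ioo (ip χ) le_rfl hs.1 hsT
      have i3 := intervalIntegrable_of_Ioo ((h.flux_integrable (χ.mul N)).const_mul (1 / (S + 1)))
        le_rfl hs.1 hsT
      have h1 := d.add_integral_le hs.1 i1 (i2.add i3) (by
        filter_upwards [ae_restrict_Ioo h.slice le_rfl hsT, ae_restrict_mem measurableSet_Ioo]
          with τ hτ hm
        have hm' : τ ∈ Icc 0 t := ⟨hm.1.le, hm.2.le.trans hs.2⟩
        exact hτ.dz_theta_le k hχ (hN τ hm') hS0 (hSle τ hm'))
      have e := intervalIntegral.integral_add i2 i3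
      have h2 := h1.trans (add_le_add le_rfl (le_of_eq e))
      rw [intervalIntegral.integral_const_mul, intervalIntegral.integral_const_mul] at h2
      have h3 := h.flux_le hmul le_rfl hs.1 hsT
      rw [← hS] at h3
      have h4 := intervalIntegral.integral_add_adjacent_intervals i2
        (intervalIntegrable_of_Ioo (ip χ) hs.1 hs.2 ht.2)
      have h5 := intervalIntegral_nonneg_ae (s := s) (t := t) hs.2 (Eventually.of_forall fun τ =>
        pair_dzSource_nonneg hS0 k hχ (u τ) (v τ) (w τ) (θ τ))
      have h6 : 1 / (S + 1) * ∫ τ in (0 : ℝ)..s, inner ℝ (mz (χ.mul N) (r τ)) (θ τ)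
          ≤ 1 / 2 * ∫ z, χ z * N z := by
        have n0 : 0 ≤ ∫ z, χ z * N z := integral_nonneg hmul
        have h7 : ∫ τ in (0 : ℝ)..s, inner ℝ (mz (χ.mul N) (r τ)) (θ τ)
            ≤ S / 2 * ∫ z, χ z * N z := by
          have : ∫ z, (χ.mul N) z = ∫ z, χ z * N z := rfl
          rw [this] at h3
          linarith
        refine (mul_le_mul_of_nonneg_left h7 (by positivity)).trans ?_
        rw [← mul_assoc]
        refine mul_le_mul_of_nonneg_right ?_ n0
        rw [one_div, ← div_eq_inv_mul, div_le_iff₀ (by positivity)]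
        linarith
      simp only [← inner_mz]
      rw [pX]
      linarith) (s := t) ⟨ht.1, le_rfl⟩
  have e1 : ∫ z, hdot (dz k (θ t)) (dz k (θ t)) z = ‖dz k (θ t)‖ ^ 2 := by
    rw [← real_inner_self_eq_norm_sq, ← mz_one (dz k (θ t)), inner_mz, mz_one]
    exact integral_congr_ae (Eventually.of_forall fun z => (one_mul _).symm)
  have e2 : ∫ z, X z = ‖dz k (θ 0)‖ ^ 2
      + ∫ τ in (0 : ℝ)..t, (Weight.const 1).pair (F τ) := by
    have := pX (Weight.const 1)
    rw [mz_one, real_inner_self_eq_norm_sq] at this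
    rw [← this]
    exact integral_congr_ae (Eventually.of_forall fun z => (one_mul _).symm)
  have e3 : ∀ τ, Q (Weight.const 1) τ
      = ‖dz k (wderiv ex (θ τ))‖ ^ 2 + ‖dz k (wderiv ey (θ τ))‖ ^ 2 := fun τ => by
    rw [hQ]; simp only [mz_one, real_inner_self_eq_norm_sq]
  simp only [e1, e2, e3] at main
  exact main

end Flow

end Vertical

/-! ### Closing the estimate of the vertical derivatives. -/

section VerticalBound

variable {L : ℝ} [Fact (0 < L)]

/-- The bound for the integral of the growth rate of the vertical derivatives. -/
def vertGrowthBound (L Re Pe Γ ε p y S : ℝ) : ℝ :=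
  growthConst Re ε * (y + p) + (Re + Pe) * p
    + (2 * Re + 2 * Pe + 2 / ε ^ 2) * dissipBound L Re Pe Γ ε p y S

namespace Flow

variable {Re Pe Γ ε T : ℝ} {u v w θ ω φ ut vt wt θt r : ℝ → L2 L}

/-- The advection term enters with factor 4, from the source and from `halving`. Young's parameter
1/(4(Re + Pe)) turns this into 1/(Re + Pe), small enough for the dissipation of ω and of θ to absorb
it. -/
theorem integral_pair_dzSource_le (h : Flow Re Pe Γ ε T u v w θ ω φ ut vt wt θt r) (k : ℝ) {t : ℝ}
    (ht : t ∈ Icc 0 T) {S : ℝ} (hS0 : 0 ≤ S) :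
    2 * ∫ τ in (0 : ℝ)..t, (Weight.const 1).pair (dzSource S k (u τ) (v τ) (w τ) (θ τ))
      ≤ 1 / (Re + Pe) * (∫ τ in (0 : ℝ)..t, ‖dz k (ω τ)‖ ^ 2)
        + 1 / (Re + Pe) * (∫ τ in (0 : ℝ)..t,
          (‖dz k (wderiv ex (θ τ))‖ ^ 2 + ‖dz k (wderiv ey (θ τ))‖ ^ 2))
        + k ^ 2 * ∫ τ in (0 : ℝ)..t, (36 * (Re + Pe) * (gradSq (θ τ) + 2 * ‖lapH (θ τ)‖ ^ 2
          + vertVel (u τ) (v τ)) + 2 * nonlocalCoef L S)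
          * Slice.vertSq (u τ) (v τ) (w τ) (θ τ) := by
  have hRe := h.Re_pos
  have hPe := h.Pe_pos
  have i1 := intervalIntegrable_of_Ioo ((h.ω_bdd.of_top.clm (dz k)).sq.const_mul (1 / (Re + Pe)))
    le_rfl ht.1 ht.2
  have i2 := intervalIntegrable_of_Ioo (((h.θ_reg.bdd_x.of_top.clm (dz k)).sq.add
    (h.θ_reg.bdd_y.of_top.clm (dz k)).sq).const_mul (1 / (Re + Pe))) le_rfl ht.1 ht.2
  have ic : Integrable (fun τ => 36 * (Re + Pe) * (gradSq (θ τ) + 2 * ‖lapH (θ τ)‖ ^ 2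
      + vertVel (u τ) (v τ)) + 2 * nonlocalCoef L S) (volume.restrict (Ioo 0 T)) :=
    ((((h.θ_reg.bdd_x.of_top.sq.add h.θ_reg.bdd_y.of_top.sq).add (h.lap_θ.sq.const_mul 2)).add
      h.vertVel_integrable).const_mul _).add (integrable_const _)
  have i3 := intervalIntegrable_of_Ioo ((h.rate_mul_vertSq_integrable ic).const_mul (k ^ 2))
    le_rfl ht.1 ht.2
  have ip : Integrable (fun τ => (Weight.const 1).pair (dzSource S k (u τ) (v τ) (w τ) (θ τ)))
      (volume.restrict (Ioo 0 T)) :=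
    (Weight.const 1).pair.integrable_comp (h.dzSource_integrable S k)
  have h1 := intervalIntegral_mono_ae ht.1
    (intervalIntegrable_of_Ioo (ip.const_mul 2) le_rfl ht.1 ht.2) ((i1.add i2).add i3) (by
      filter_upwards [ae_restrict_Ioo h.slice le_rfl ht.2] with τ hτ
      simp only [Pi.add_apply]
      rw [dzSource, map_add, map_smul, map_smul, pair_hp, mz_one, real_inner_self_eq_norm_sq,
        smul_eq_mul, smul_eq_mul]
      have a1 := Weight.pair_one_abs_le (hp (adv (dz k (u τ)) (dz k (v τ)) (θ τ)) (dz k (θ τ)))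
      have a2 := hτ.norm_hp_adv_le k (η := 1 / (4 * (Re + Pe))) (by positivity)
      rw [hτ.gradSq_dz_theta k] at a2
      have e1 : 9 / (4 * (1 / (4 * (Re + Pe)))) = 9 * (Re + Pe) := by field_simp
      have e2 : 1 / (4 * (Re + Pe)) * (‖dz k (ω τ)‖ ^ 2 + (‖dz k (wderiv ex (θ τ))‖ ^ 2
            + ‖dz k (wderiv ey (θ τ))‖ ^ 2))
          = 1 / 4 * (1 / (Re + Pe) * ‖dz k (ω τ)‖ ^ 2 + 1 / (Re + Pe)
            * (‖dz k (wderiv ex (θ τ))‖ ^ 2 + ‖dz k (wderiv ey (θ τ))‖ ^ 2)) := by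
        field_simp
      rw [e1, e2] at a2
      have a3 : Slice.coef (u τ) (v τ) (θ τ) (lapH (θ τ))
          ≤ gradSq (θ τ) + 2 * ‖lapH (θ τ)‖ ^ 2 + vertVel (u τ) (v τ) := by
        unfold Slice.coef vertVel
        nlinarith [sq_nonneg (‖lapH (θ τ)‖ - ‖wderiv ez (u τ)‖),
          sq_nonneg (‖lapH (θ τ)‖ - ‖wderiv ez (v τ)‖)]
      have Y0 := Slice.vertSq_nonneg (u τ) (v τ) (w τ) (θ τ)
      have a4 := mul_le_mul_of_nonneg_left (mul_le_mul_of_nonneg_left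
        (mul_le_mul_of_nonneg_right a3 Y0) (sq_nonneg k)) (show 0 ≤ 36 * (Re + Pe) by positivity)
      have n3 := norm_dz_le hτ.reg_w.z.hasWeakDeriv k
      have s3 := pow_le_pow_left₀ (norm_nonneg _) n3 2
      rw [mul_pow, sq_abs] at s3
      have a5 : ‖dz k (w τ)‖ ^ 2 ≤ k ^ 2 * Slice.vertSq (u τ) (v τ) (w τ) (θ τ) := by
        refine s3.trans (mul_le_mul_of_nonneg_left ?_ (sq_nonneg k))
        unfold Slice.vertSq
        linarith [sq_nonneg ‖wderiv ez (u τ)‖, sq_nonneg ‖wderiv ez (v τ)‖,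
          sq_nonneg ‖wderiv ez (θ τ)‖]
      have a6 := mul_le_mul_of_nonneg_left a5 (nonlocalCoef_nonneg (L := L) hS0)
      have q1 : 0 ≤ 1 / (Re + Pe) * ‖dz k (ω τ)‖ ^ 2 := by positivity
      linarith)
  have e1 := intervalIntegral.integral_add (i1.add i2) i3
  have e2 := intervalIntegral.integral_add i1 i2
  have e3 := intervalIntegral.integral_const_mul (μ := volume) (a := 0) (b := t) (2 : ℝ)
    (fun τ => (Weight.const 1).pair (dzSource S k (u τ) (v τ) (w τ) (θ τ)))
  rw [← e3]
  rw [intervalIntegral.integral_const_mul] at e1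
  rw [intervalIntegral.integral_const_mul, intervalIntegral.integral_const_mul] at e2
  refine h1.trans (e1.trans ?_).le
  exact congrArg₂ (· + ·) e2 rfl

theorem dz_total_le (h : Flow Re Pe Γ ε T u v w θ ω φ ut vt wt θt r) (k : ℝ) {t : ℝ}
    (ht : t ∈ Icc 0 T) {S : ℝ} (hS : S = thetaSup ‖θ 0‖ ‖wderiv ez (θ 0)‖) :
    ‖dz k (u t)‖ ^ 2 + ‖dz k (v t)‖ ^ 2 + ‖dz k (w t)‖ ^ 2 + ‖dz k (θ t)‖ ^ 2
      ≤ k ^ 2 * (2 * Slice.vertSq (u 0) (v 0) (w 0) (θ 0) + ∫ τ in (0 : ℝ)..t,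
        vertRate L Re Pe Γ S (vertGrowth (u τ) (v τ) (w τ) (θ τ) (ω τ))
          * Slice.vertSq (u τ) (v τ) (w τ) (θ τ)) := by
  have hRe := h.Re_pos
  have hPe := h.Pe_pos
  have hS0 : 0 ≤ S := hS ▸ thetaSup_nonneg (norm_nonneg _) (norm_nonneg _)
  have h1 := h.dz_kinetic_le k ht
  have h2 := h.dz_theta_le k ht hS
  have h3 := h.integral_pair_dzSource_le k ht hS0
  have J1 : 0 ≤ ∫ τ in (0 : ℝ)..t, ‖dz k (ω τ)‖ ^ 2 :=
    intervalIntegral.integral_nonneg ht.1 fun _ _ => by positivity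
  have J2 : 0 ≤ ∫ τ in (0 : ℝ)..t,
      (‖dz k (wderiv ex (θ τ))‖ ^ 2 + ‖dz k (wderiv ey (θ τ))‖ ^ 2) :=
    intervalIntegral.integral_nonneg ht.1 fun _ _ => by positivity
  -- The dissipation left in the velocity and temperature estimates absorbs the advection terms of
  -- the source.
  have c1 : 1 / (Re + Pe) ≤ 1 / Re := one_div_le_one_div_of_le hRe (by linarith)
  have c2 : 1 / (Re + Pe) ≤ 2 / Pe := by
    refine (one_div_le_one_div_of_le hPe (by linarith)).trans ?_
    exact div_le_div_of_nonneg_right (by norm_num) hPe.le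
  have k1 := mul_le_mul_of_nonneg_right c1 J1
  have k2 := mul_le_mul_of_nonneg_right c2 J2
  have hV := h.mem_V 0 h.zero_mem
  have z1 := pow_le_pow_left₀ (norm_nonneg _) (norm_dz_le hV.u_H1.2.2.hasWeakDeriv k) 2
  have z2 := pow_le_pow_left₀ (norm_nonneg _) (norm_dz_le hV.v_H1.2.2.hasWeakDeriv k) 2
  have z3 := pow_le_pow_left₀ (norm_nonneg _) (norm_dz_le hV.w_H1.2.2.hasWeakDeriv k) 2
  have z4 := pow_le_pow_left₀ (norm_nonneg _) (norm_dz_le hV.θ_H1.2.2.hasWeakDeriv k) 2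
  simp only [mul_pow, sq_abs] at z1 z2 z3 z4
  have ia : Integrable (fun τ => |Γ| + 288 * Re * growth (u τ) (v τ) (ω τ)
      + 18 * Re * (gradSq (w τ) + 2 * ‖lapH (w τ)‖ ^ 2 + vertVel (u τ) (v τ)))
      (volume.restrict (Ioo 0 T)) :=
    ((integrable_const |Γ|).add (h.growth_integrable.const_mul _)).add
      ((((h.w_reg.bdd_x.of_top.sq.add h.w_reg.bdd_y.of_top.sq).add (h.lap_w.sq.const_mul 2)).add
        h.vertVel_integrable).const_mul _)
  have ib : Integrable (fun τ => 36 * (Re + Pe) * (gradSq (θ τ) + 2 * ‖lapH (θ τ)‖ ^ 2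
      + vertVel (u τ) (v τ)) + 2 * nonlocalCoef L S) (volume.restrict (Ioo 0 T)) :=
    ((((h.θ_reg.bdd_x.of_top.sq.add h.θ_reg.bdd_y.of_top.sq).add (h.lap_θ.sq.const_mul 2)).add
      h.vertVel_integrable).const_mul _).add (integrable_const _)
  have ic : Integrable (fun τ => vertRate L Re Pe Γ S (vertGrowth (u τ) (v τ) (w τ) (θ τ) (ω τ)))
      (volume.restrict (Ioo 0 T)) :=
    (integrable_const (|Γ| + 2 * nonlocalCoef L S)).add (h.vertGrowth_integrable.const_mul _)
  have ja := intervalIntegrable_of_Ioo (h.rate_mul_vertSq_integrable ia) le_rfl ht.1 ht.2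
  have jb := intervalIntegrable_of_Ioo (h.rate_mul_vertSq_integrable ib) le_rfl ht.1 ht.2
  have jc := intervalIntegrable_of_Ioo (h.rate_mul_vertSq_integrable ic) le_rfl ht.1 ht.2
  have h4 := intervalIntegral_mono_ae ht.1 (ja.add jb) jc (Eventually.of_forall fun τ => by
    rw [← add_mul]
    refine mul_le_mul_of_nonneg_right ?_ (Slice.vertSq_nonneg _ _ _ _)
    have g1 := growth_nonneg (u τ) (v τ) (ω τ)
    have g2 := gradSq_nonneg (w τ)
    have g3 := gradSq_nonneg (θ τ)
    have g4 := vertVel_nonneg (u τ) (v τ)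
    set x := gradSq (w τ) + 2 * ‖lapH (w τ)‖ ^ 2 + vertVel (u τ) (v τ) with hx
    set y := gradSq (θ τ) + 2 * ‖lapH (θ τ)‖ ^ 2 + vertVel (u τ) (v τ) with hy
    have x0 : 0 ≤ x := by positivity
    have y0 : 0 ≤ y := by positivity
    have e : vertGrowth (u τ) (v τ) (w τ) (θ τ) (ω τ) = growth (u τ) (v τ) (ω τ) + x + y := by
      rw [hx, hy]; unfold vertGrowth; ring
    rw [e]
    unfold vertRate
    have p1 := mul_nonneg hRe.le x0
    have p2 := mul_nonneg hRe.le y0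
    have p3 := mul_nonneg hPe.le x0
    have p4 := mul_nonneg hPe.le y0
    have p5 := mul_nonneg hPe.le g1
    nlinarith)
  have h5 := (le_of_eq (intervalIntegral.integral_add ja jb).symm).trans h4
  have h6 := mul_le_mul_of_nonneg_left h5 (sq_nonneg k)
  have e0 : k ^ 2 * (2 * Slice.vertSq (u 0) (v 0) (w 0) (θ 0))
      = 2 * (k ^ 2 * ‖wderiv ez (u 0)‖ ^ 2 + k ^ 2 * ‖wderiv ez (v 0)‖ ^ 2
        + k ^ 2 * ‖wderiv ez (w 0)‖ ^ 2 + k ^ 2 * ‖wderiv ez (θ 0)‖ ^ 2) := by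
    unfold Slice.vertSq; ring
  have w1 := mul_nonneg (sq_nonneg k) (sq_nonneg ‖wderiv ez (u 0)‖)
  have w2 := mul_nonneg (sq_nonneg k) (sq_nonneg ‖wderiv ez (v 0)‖)
  have w3 := mul_nonneg (sq_nonneg k) (sq_nonneg ‖wderiv ez (w 0)‖)
  rw [mul_add (k ^ 2), e0]
  linarith

/-- After division by the squared step the right side of `dz_total_le` no longer depends on the
step, so only the left side has to pass to the limit. -/
theorem vertSq_integral_le (h : Flow Re Pe Γ ε T u v w θ ω φ ut vt wt θt r) {t : ℝ}
    (ht : t ∈ Icc 0 T) {S : ℝ} (hS : S = thetaSup ‖θ 0‖ ‖wderiv ez (θ 0)‖) :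
    Slice.vertSq (u t) (v t) (w t) (θ t)
      ≤ 2 * Slice.vertSq (u 0) (v 0) (w 0) (θ 0) + ∫ τ in (0 : ℝ)..t,
        vertRate L Re Pe Γ S (vertGrowth (u τ) (v τ) (w τ) (θ τ) (ω τ))
          * Slice.vertSq (u τ) (v τ) (w τ) (θ τ) := by
  have hV := h.mem_V t ht
  have h1 := (((tendsto_norm_dz hV.u_H1.2.2.hasWeakDeriv).add
    (tendsto_norm_dz hV.v_H1.2.2.hasWeakDeriv)).add
      (tendsto_norm_dz hV.w_H1.2.2.hasWeakDeriv)).add (tendsto_norm_dz hV.θ_H1.2.2.hasWeakDeriv)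
  refine le_of_tendsto h1 ?_
  filter_upwards [self_mem_nhdsWithin] with k hk
  have hk2 : 0 < k ^ 2 := lt_of_le_of_ne (sq_nonneg k) (Ne.symm (pow_ne_zero 2 hk))
  rw [← add_div, ← add_div, ← add_div, div_le_iff₀' hk2]
  exact h.dz_total_le k ht hS

/-- All terms of the rate are parts of one of three quantities with time integral bounded uniformly
in t: `growth`, the energy dissipation and the gradient dissipation. -/
theorem integral_vertGrowth_le (h : Flow Re Pe Γ ε T u v w θ ω φ ut vt wt θt r) {t : ℝ}
    (ht : t ∈ Icc 0 T) :
    ∫ τ in (0 : ℝ)..t, vertGrowth (u τ) (v τ) (w τ) (θ τ) (ω τ)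
      ≤ vertGrowthBound L Re Pe Γ ε (energyOf Re Pe Γ (u 0) (v 0) (w 0) (θ 0))
        (gradOf (u 0) (v 0) (w 0) (θ 0)) (thetaSup ‖θ 0‖ ‖wderiv ez (θ 0)‖) := by
  have hRe := h.Re_pos
  have hPe := h.Pe_pos
  have hε := h.ε_ne
  have hε2 : 0 < ε ^ 2 := by positivity
  have i1 := intervalIntegrable_of_Ioo h.growth_integrable le_rfl ht.1 ht.2
  have i2 := intervalIntegrable_of_Ioo (h.dissip_integrable.const_mul (Re + Pe)) le_rfl ht.1 ht.2
  have i3 := intervalIntegrable_of_Ioo (h.gradDissip_integrable.const_mul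
    (2 * Re + 2 * Pe + 2 / ε ^ 2)) le_rfl ht.1 ht.2
  have h1 := intervalIntegral_mono_ae ht.1
    (intervalIntegrable_of_Ioo h.vertGrowth_integrable le_rfl ht.1 ht.2) ((i1.add i2).add i3)
    (Eventually.of_forall fun τ => by
      obtain ⟨d1, -, d3⟩ := le_dissip hRe hPe hε (w τ) (θ τ) (ω τ) (φ τ)
      have g1 := gradSq_nonneg (ω τ)
      have g4 := vertVel_nonneg (u τ) (v τ)
      set G := gradDissip Re Pe ε (u τ) (v τ) (w τ) (θ τ) (ω τ) with hG
      have p1 : 0 ≤ 2 / Re * gradSq (ω τ) := by positivity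
      have p2 : 0 ≤ ε ^ 2 * vertVel (u τ) (v τ) := by positivity
      have p3 : 0 ≤ 1 / Re * ‖lapH (w τ)‖ ^ 2 := by positivity
      have p4 : 0 ≤ 1 / Pe * ‖lapH (θ τ)‖ ^ 2 := by positivity
      have q1 : ‖lapH (w τ)‖ ^ 2 ≤ Re * G := by
        rw [← div_le_iff₀' hRe, div_eq_mul_one_div, mul_comm, hG]
        unfold gradDissip; linarith
      have q2 : ‖lapH (θ τ)‖ ^ 2 ≤ Pe * G := by
        rw [← div_le_iff₀' hPe, div_eq_mul_one_div, mul_comm, hG]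
        unfold gradDissip; linarith
      have q3 : vertVel (u τ) (v τ) ≤ 1 / ε ^ 2 * G := by
        rw [one_div, ← div_eq_inv_mul, le_div_iff₀' hε2, hG]
        unfold gradDissip; linarith
      have e : (2 * Re + 2 * Pe + 2 / ε ^ 2) * G = 2 * (Re * G) + 2 * (Pe * G)
          + 2 * (1 / ε ^ 2 * G) := by ring
      rw [e]
      unfold vertGrowth
      linarith [sq_nonneg ‖ω τ‖])
  have e1 := intervalIntegral.integral_add (i1.add i2) i3
  have e2 := intervalIntegral.integral_add i1 i2
  rw [intervalIntegral.integral_const_mul] at e1 e2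
  have h2 := h.integral_growth_le le_rfl ht.1 ht.2
  have h3 := mul_le_mul_of_nonneg_left (h.integral_dissip_le le_rfl ht.1 ht.2)
    (show 0 ≤ Re + Pe by positivity)
  have h4 := mul_le_mul_of_nonneg_left (h.integral_gradDissip_le ht)
    (show 0 ≤ 2 * Re + 2 * Pe + 2 / ε ^ 2 by positivity)
  have h5 : gradSq (u 0) + gradSq (v 0) ≤ gradOf (u 0) (v 0) (w 0) (θ 0) := by
    unfold gradOf
    linarith [gradSq_nonneg (w 0), gradSq_nonneg (θ 0)]
  have h6 := mul_le_mul_of_nonneg_left (add_le_add_left h5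
    (energyOf Re Pe Γ (u 0) (v 0) (w 0) (θ 0))) (growthConst_nonneg hRe ε)
  refine h1.trans (e1.le.trans ?_)
  unfold vertGrowthBound
  refine add_le_add ?_ h4
  refine le_trans e2.le ?_
  exact add_le_add (h2.trans h6) h3

/-- The bound for the vertical derivatives. -/
theorem vertSq_le (h : Flow Re Pe Γ ε T u v w θ ω φ ut vt wt θt r) {t : ℝ}
    (ht : t ∈ Icc 0 T) :
    Slice.vertSq (u t) (v t) (w t) (θ t)
      ≤ Real.exp ((|Γ| + 2 * nonlocalCoef L (thetaSup ‖θ 0‖ ‖wderiv ez (θ 0)‖)) * t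
        + 288 * (Re + Pe) * vertGrowthBound L Re Pe Γ ε
          (energyOf Re Pe Γ (u 0) (v 0) (w 0) (θ 0)) (gradOf (u 0) (v 0) (w 0) (θ 0))
          (thetaSup ‖θ 0‖ ‖wderiv ez (θ 0)‖))
        * (2 * Slice.vertSq (u 0) (v 0) (w 0) (θ 0)) := by
  have hRe := h.Re_pos
  have hPe := h.Pe_pos
  have hS0 := thetaSup_nonneg (norm_nonneg (θ 0)) (norm_nonneg (wderiv ez (θ 0)))
  set S := thetaSup ‖θ 0‖ ‖wderiv ez (θ 0)‖ with hS
  have ic : Integrable (fun τ => vertRate L Re Pe Γ S (vertGrowth (u τ) (v τ) (w τ) (θ τ) (ω τ)))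
      (volume.restrict (Ioo 0 T)) :=
    (integrable_const (|Γ| + 2 * nonlocalCoef L S)).add (h.vertGrowth_integrable.const_mul _)
  have main := gronwall_integral ht.1 (intervalIntegrable_of_Ioo ic le_rfl ht.1 ht.2)
    (intervalIntegrable_of_Ioo (h.rate_mul_vertSq_integrable ic) le_rfl ht.1 ht.2)
    (Eventually.of_forall fun τ => by
      have := vertGrowth_nonneg (u τ) (v τ) (w τ) (θ τ) (ω τ)
      have := nonlocalCoef_nonneg (L := L) hS0
      unfold vertRate
      positivity)
    (fun τ hτ => h.vertSq_integral_le ⟨hτ.1, hτ.2.trans ht.2⟩ hS)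
  refine main.trans (mul_le_mul_of_nonneg_right (Real.exp_le_exp.2 ?_)
    (mul_nonneg zero_le_two (Slice.vertSq_nonneg _ _ _ _)))
  have iv := intervalIntegrable_of_Ioo (h.vertGrowth_integrable.const_mul (288 * (Re + Pe)))
    le_rfl ht.1 ht.2
  -- The constant part of the rate gives the factor of t in the exponent, while the rest contributes
  -- a bounded amount.
  have e := intervalIntegral.integral_add
    (intervalIntegrable_const (μ := volume) (a := 0) (b := t) (c := |Γ| + 2 * nonlocalCoef L S)) iv
  rw [intervalIntegral.integral_const, intervalIntegral.integral_const_mul, sub_zero,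
    smul_eq_mul, mul_comm t] at e
  have h1 := mul_le_mul_of_nonneg_left (h.integral_vertGrowth_le ht)
    (show 0 ≤ 288 * (Re + Pe) by positivity)
  exact le_trans e.le (add_le_add le_rfl h1)

end Flow

end VerticalBound

/-! ### Monotonicity of the bounds in the data. -/

section Monotone

variable {L : ℝ} [Fact (0 < L)] {Re Pe Γ ε p p' y y' S S' : ℝ}

theorem sourceTotal_mono (hRe : 0 < Re) (hPe : 0 < Pe) (hS' : S ≤ S') :
    sourceTotal L Re Pe Γ ε S ≤ sourceTotal L Re Pe Γ ε S' := by
  have hγ := gam_pos (L := L)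
  have h1 : 0 ≤ profConst L Re Pe Γ ε := by unfold profConst; positivity
  unfold sourceTotal
  gcongr

theorem growthBound_nonneg (hRe : 0 < Re) (hPe : 0 < Pe) (hp : 0 ≤ p) (hy : 0 ≤ y) :
    0 ≤ growthBound Re Pe ε p y := by
  unfold growthBound rateConst growthConst
  positivity

theorem growthBound_mono (hRe : 0 < Re) (hPe : 0 < Pe) (hp' : p ≤ p') (hy' : y ≤ y') :
    growthBound Re Pe ε p y ≤ growthBound Re Pe ε p' y' := by
  have h1 := Flow.rateConst_nonneg hRe hPe
  have h2 := Flow.growthConst_nonneg hRe ε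
  unfold growthBound
  gcongr

theorem gradBound_nonneg (hRe : 0 < Re) (hPe : 0 < Pe) (hp : 0 ≤ p) (hy : 0 ≤ y) (hS : 0 ≤ S) :
    0 ≤ gradBound L Re Pe Γ ε p y S := by
  have h1 := sourceTotal_nonneg (L := L) hRe hPe Γ ε hS
  unfold gradBound
  positivity

theorem gradBound_mono (hRe : 0 < Re) (hPe : 0 < Pe) (hp : 0 ≤ p) (hy : 0 ≤ y) (hS : 0 ≤ S)
    (hp' : p ≤ p') (hy' : y ≤ y') (hS' : S ≤ S') :
    gradBound L Re Pe Γ ε p y S ≤ gradBound L Re Pe Γ ε p' y' S' := by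
  have h1 := sourceTotal_nonneg (L := L) hRe hPe Γ ε hS
  have h2 := sourceTotal_mono (L := L) (Γ := Γ) (ε := ε) hRe hPe hS'
  have h3 := growthBound_mono (ε := ε) hRe hPe hp' hy'
  have h4 := h1.trans h2
  unfold gradBound
  gcongr

theorem dissipBound_mono (hRe : 0 < Re) (hPe : 0 < Pe) (hp : 0 ≤ p) (hy : 0 ≤ y) (hS : 0 ≤ S)
    (hp' : p ≤ p') (hy' : y ≤ y') (hS' : S ≤ S') :
    dissipBound L Re Pe Γ ε p y S ≤ dissipBound L Re Pe Γ ε p' y' S' := by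
  have h1 := sourceTotal_nonneg (L := L) hRe hPe Γ ε hS
  have h2 := sourceTotal_mono (L := L) (Γ := Γ) (ε := ε) hRe hPe hS'
  have h3 := growthBound_mono (ε := ε) hRe hPe hp' hy'
  have h4 := gradBound_mono (L := L) (Γ := Γ) (ε := ε) hRe hPe hp hy hS hp' hy' hS'
  have h5 := growthBound_nonneg (ε := ε) hRe hPe hp hy
  have h6 := gradBound_nonneg (L := L) (Γ := Γ) (ε := ε) hRe hPe hp hy hS
  have h7 := h1.trans h2
  have h8 := h5.trans h3
  unfold dissipBound
  gcongr

theorem vertGrowthBound_mono (hRe : 0 < Re) (hPe : 0 < Pe) (hp : 0 ≤ p) (hy : 0 ≤ y) (hS : 0 ≤ S)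
    (hp' : p ≤ p') (hy' : y ≤ y') (hS' : S ≤ S') :
    vertGrowthBound L Re Pe Γ ε p y S ≤ vertGrowthBound L Re Pe Γ ε p' y' S' := by
  have h1 := dissipBound_mono (L := L) (Γ := Γ) (ε := ε) hRe hPe hp hy hS hp' hy' hS'
  have h2 := Flow.growthConst_nonneg hRe ε
  unfold vertGrowthBound
  gcongr

theorem sq_vnorm (a b : ℝ) : vnorm a b ^ 2 = a ^ 2 + b ^ 2 := Real.sq_sqrt (by positivity)

theorem sq_h1Norm (f : L2 L) : h1Norm f ^ 2
    = ‖f‖ ^ 2 + ‖wderiv ex f‖ ^ 2 + ‖wderiv ey f‖ ^ 2 + ‖wderiv ez f‖ ^ 2 :=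
  Real.sq_sqrt (by positivity)

/-- The superfluous b lets the delay by 2 cost the same constant for both decay rates. -/
theorem exp_shift_le {a b t : ℝ} (hb : 0 ≤ b) :
    Real.exp (-a * (t - 2)) ≤ Real.exp (-a * t) * Real.exp (2 * a + 2 * b) := by
  rw [← Real.exp_add]
  exact Real.exp_le_exp.2 (by linarith)

theorem thetaSup_le {a b : ℝ} : thetaSup a b ≤ 2 * (a ^ 2 + b ^ 2) := by
  unfold thetaSup
  nlinarith [sq_nonneg (a - b), sq_nonneg b]

end Monotone

/-! ### The final form of the estimates. -/

section Final

variable {L : ℝ} [Fact (0 < L)]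

/-- The constant in the decay estimate for the velocity. -/
def decayConst (L Re Pe Γ κ : ℝ) : ℝ :=
  gam L * Re * Γ ^ 2 / |1 / (κ * gam L * Re) - 2 / (gam L * Pe)|

/-- The bound for the gradients at large times, relative to the decay rate. -/
def largeTimeBound (L Re Pe Γ ε κ a b c d : ℝ) : ℝ :=
  Real.exp (2 * (2 / (gam L * Pe)) + 2 * (1 / (κ * gam L * Re)))
    * (a ^ 2 + b ^ 2 + (decayConst L Re Pe Γ κ + lam L Re Pe Γ) * c ^ 2)
    * uniformBound L Re Pe Γ ε (a ^ 2 + b ^ 2 + lam L Re Pe Γ * c ^ 2) (thetaSup c d)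

/-- The factor in the bound for the vertical derivatives, in terms of the `H¹` norm. -/
def verticalBound (L Re Pe Γ ε D : ℝ) : ℝ :=
  Real.exp (288 * (Re + Pe) * vertGrowthBound L Re Pe Γ ε (lam L Re Pe Γ * D) D (2 * D)) * (2 * D)

namespace Flow

variable {Re Pe Γ ε T : ℝ} {u v w θ ω φ ut vt wt θt r : ℝ → L2 L}

/-- The decay estimates are used at t - 2, where `gradOf_uniform` needs them, and shifted back to t
at the cost of a constant. -/
theorem energyOf_decay (h : Flow Re Pe Γ ε T u v w θ ω φ ut vt wt θt r) {κ : ℝ} (hκ : 1 ≤ κ)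
    (hne : Pe ≠ 2 * κ * Re) {t : ℝ} (h2 : 2 ≤ t) (ht : t ≤ T) :
    energyOf Re Pe Γ (u (t - 2)) (v (t - 2)) (w (t - 2)) (θ (t - 2))
      ≤ (Real.exp (-(2 / (gam L * Pe)) * t) + Real.exp (-(1 / (κ * gam L * Re)) * t))
        * (Real.exp (2 * (2 / (gam L * Pe)) + 2 * (1 / (κ * gam L * Re)))
          * (‖u 0‖ ^ 2 + ‖v 0‖ ^ 2 + ‖w 0‖ ^ 2
            + (decayConst L Re Pe Γ κ + lam L Re Pe Γ) * ‖θ 0‖ ^ 2)) := by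
  have hγ := gam_pos (L := L)
  have hRe := h.Re_pos
  have hPe := h.Pe_pos
  have hm : t - 2 ∈ Icc 0 T := ⟨by linarith, by linarith⟩
  have h1 := h.kinetic_decay hκ hne hm
  have h3 := h.theta_decay hm
  have l0 : 0 ≤ lam L Re Pe Γ := by unfold lam; positivity
  have c0 : 0 ≤ decayConst L Re Pe Γ κ := by unfold decayConst; positivity
  have hκ0 : 0 < κ := by linarith
  have α0 : 0 ≤ 1 / (κ * gam L * Re) := by positivity
  have β0 : 0 ≤ 2 / (gam L * Pe) := by positivity
  have e1 := exp_shift_le (a := 1 / (κ * gam L * Re)) (t := t) β0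
  have e2 := exp_shift_le (a := 2 / (gam L * Pe)) (t := t) α0
  rw [add_comm (2 * (1 / (κ * gam L * Re)))] at e1
  change _ ≤ _ + decayConst L Re Pe Γ κ * _ * _ at h1
  set X := Real.exp (2 * (2 / (gam L * Pe)) + 2 * (1 / (κ * gam L * Re)))
  have X0 : 0 < X := Real.exp_pos _
  set a := Real.exp (-(1 / (κ * gam L * Re)) * t)
  set b := Real.exp (-(2 / (gam L * Pe)) * t)
  have a0 : 0 < a := Real.exp_pos _
  have b0 : 0 < b := Real.exp_pos _
  set a' := Real.exp (-(1 / (κ * gam L * Re)) * (t - 2))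
  set b' := Real.exp (-(2 / (gam L * Pe)) * (t - 2))
  set E := ‖u 0‖ ^ 2 + ‖v 0‖ ^ 2 + ‖w 0‖ ^ 2
  have E0 : 0 ≤ E := by positivity
  set H := ‖θ 0‖ ^ 2
  have H0 : 0 ≤ H := by positivity
  have k1 : a' * E ≤ (b + a) * X * E :=
    mul_le_mul_of_nonneg_right (by nlinarith) E0
  have k2 : decayConst L Re Pe Γ κ * (b' + a') * H ≤ decayConst L Re Pe Γ κ * ((b + a) * X) * H :=
    mul_le_mul_of_nonneg_right (mul_le_mul_of_nonneg_left (by nlinarith) c0) H0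
  have k3 : b' * H ≤ (b + a) * X * H := mul_le_mul_of_nonneg_right (by nlinarith) H0
  have k4 := mul_le_mul_of_nonneg_left (h3.trans k3) l0
  unfold energyOf
  calc _ ≤ (b + a) * X * E + decayConst L Re Pe Γ κ * ((b + a) * X) * H
        + lam L Re Pe Γ * ((b + a) * X * H) := by linarith
    _ = _ := by ring

theorem gradOf_eq (h : Flow Re Pe Γ ε T u v w θ ω φ ut vt wt θt r) {t : ℝ} (ht : t ∈ Icc 0 T) :
    gradOf (u t) (v t) (w t) (θ t) = ‖curlH (u t) (v t)‖ ^ 2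
      + (‖wderiv ex (w t)‖ ^ 2 + ‖wderiv ey (w t)‖ ^ 2)
      + (‖wderiv ex (θ t)‖ ^ 2 + ‖wderiv ey (θ t)‖ ^ 2) := by
  have hV := h.mem_V t ht
  rw [curlH, ← norm_grad_eq_curl hV.u_H1.1.hasWeakDeriv hV.u_H1.2.1.hasWeakDeriv
    hV.v_H1.1.hasWeakDeriv hV.v_H1.2.1.hasWeakDeriv hV.div_free]
  rfl

theorem gradOf_decay (h : Flow Re Pe Γ ε T u v w θ ω φ ut vt wt θt r) {κ : ℝ} (hκ : 1 ≤ κ)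
    (hne : Pe ≠ 2 * κ * Re) {t : ℝ} (h2 : 2 ≤ t) (ht : t ≤ T) :
    gradOf (u t) (v t) (w t) (θ t)
      ≤ (Real.exp (-(2 / (gam L * Pe)) * t) + Real.exp (-(1 / (κ * gam L * Re)) * t))
        * largeTimeBound L Re Pe Γ ε κ (vnorm ‖u 0‖ ‖v 0‖) ‖w 0‖ ‖θ 0‖ ‖wderiv ez (θ 0)‖ := by
  have hRe := h.Re_pos
  have hPe := h.Pe_pos
  have s0 := sourceTotal_nonneg (L := L) hRe hPe Γ ε
    (thetaSup_nonneg (norm_nonneg (θ 0)) (norm_nonneg (wderiv ez (θ 0))))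
  refine (h.gradOf_uniform h2 ht).trans ((mul_le_mul_of_nonneg_left
    (h.energyOf_decay hκ hne h2 ht) ?_).trans (le_of_eq ?_))
  · unfold uniformBound
    positivity
  · unfold largeTimeBound energyOf
    rw [sq_vnorm]
    ring

theorem vertSq_growth (h : Flow Re Pe Γ ε T u v w θ ω φ ut vt wt θt r) {t : ℝ} (ht : t ∈ Icc 0 T) :
    Slice.vertSq (u t) (v t) (w t) (θ t)
      ≤ verticalBound L Re Pe Γ ε (vnorm (h1Norm (u 0)) (h1Norm (v 0)) ^ 2 + h1Norm (w 0) ^ 2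
          + h1Norm (θ 0) ^ 2)
        * Real.exp ((|Γ| + 6 / L ^ 2) * (‖θ 0‖ ^ 2 + ‖wderiv ez (θ 0)‖ ^ 2 + 1) * t) := by
  have hL : 0 < L := L_pos
  have hγ := gam_pos (L := L)
  have hRe := h.Re_pos
  have hPe := h.Pe_pos
  set D := vnorm (h1Norm (u 0)) (h1Norm (v 0)) ^ 2 + h1Norm (w 0) ^ 2 + h1Norm (θ 0) ^ 2 with hD
  -- The squared H¹ norms split into norms, horizontal gradients and vertical derivatives, so D
  -- dominates each argument of the monotone bounds.
  have eD : D = (‖u 0‖ ^ 2 + ‖v 0‖ ^ 2 + ‖w 0‖ ^ 2 + ‖θ 0‖ ^ 2)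
      + gradOf (u 0) (v 0) (w 0) (θ 0) + Slice.vertSq (u 0) (v 0) (w 0) (θ 0) := by
    rw [hD, sq_vnorm, sq_h1Norm, sq_h1Norm, sq_h1Norm, sq_h1Norm]
    unfold gradOf gradSq Slice.vertSq
    ring
  have y0 := gradOf_nonneg (u 0) (v 0) (w 0) (θ 0)
  have V0 := Slice.vertSq_nonneg (u 0) (v 0) (w 0) (θ 0)
  have p0 := energyOf_nonneg hRe hPe Γ (u 0) (v 0) (w 0) (θ 0)
  have S0 := thetaSup_nonneg (norm_nonneg (θ 0)) (norm_nonneg (wderiv ez (θ 0)))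
  have n1 := sq_nonneg ‖u 0‖
  have n2 := sq_nonneg ‖v 0‖
  have n3 := sq_nonneg ‖w 0‖
  have n4 := sq_nonneg ‖θ 0‖
  have D0 : 0 ≤ D := by rw [eD]; positivity
  have l1 : 1 ≤ lam L Re Pe Γ := by
    unfold lam
    have : 0 ≤ gam L ^ 2 * Re * Pe * Γ ^ 2 := by positivity
    linarith
  have hp : energyOf Re Pe Γ (u 0) (v 0) (w 0) (θ 0) ≤ lam L Re Pe Γ * D := by
    have a1 : ‖u 0‖ ^ 2 + ‖v 0‖ ^ 2 + ‖w 0‖ ^ 2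
        ≤ lam L Re Pe Γ * (‖u 0‖ ^ 2 + ‖v 0‖ ^ 2 + ‖w 0‖ ^ 2) :=
      le_mul_of_one_le_left (by positivity) l1
    have a2 : lam L Re Pe Γ * (‖u 0‖ ^ 2 + ‖v 0‖ ^ 2 + ‖w 0‖ ^ 2 + ‖θ 0‖ ^ 2)
        ≤ lam L Re Pe Γ * D := mul_le_mul_of_nonneg_left (by linarith) (by linarith)
    unfold energyOf
    linarith
  have hS : thetaSup ‖θ 0‖ ‖wderiv ez (θ 0)‖ ≤ 2 * D := by
    have a1 := thetaSup_le (a := ‖θ 0‖) (b := ‖wderiv ez (θ 0)‖)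
    have a2 : ‖wderiv ez (θ 0)‖ ^ 2 ≤ Slice.vertSq (u 0) (v 0) (w 0) (θ 0) := by
      unfold Slice.vertSq
      linarith [sq_nonneg ‖wderiv ez (u 0)‖, sq_nonneg ‖wderiv ez (v 0)‖,
        sq_nonneg ‖wderiv ez (w 0)‖]
    linarith
  have hG := vertGrowthBound_mono (L := L) (Γ := Γ) (ε := ε) hRe hPe p0 y0 S0 hp
    (show gradOf (u 0) (v 0) (w 0) (θ 0) ≤ D by linarith) hS
  -- Here K is found: twice the nonlocal coefficient is (3S + 2)/L², and S is at most twice the sum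
  -- of the two squared norms of θ₀, whence 6/L².
  have hK : |Γ| + 2 * nonlocalCoef L (thetaSup ‖θ 0‖ ‖wderiv ez (θ 0)‖)
      ≤ (|Γ| + 6 / L ^ 2) * (‖θ 0‖ ^ 2 + ‖wderiv ez (θ 0)‖ ^ 2 + 1) := by
    have a1 := thetaSup_le (a := ‖θ 0‖) (b := ‖wderiv ez (θ 0)‖)
    set S := thetaSup ‖θ 0‖ ‖wderiv ez (θ 0)‖
    set x := ‖θ 0‖ ^ 2 + ‖wderiv ez (θ 0)‖ ^ 2 with hx
    have x0 : 0 ≤ x := by positivity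
    have e : 2 * nonlocalCoef L S = 1 / L ^ 2 * (3 * S + 2) := by
      unfold nonlocalCoef; field_simp; ring
    have a2 : 1 / L ^ 2 * (3 * S + 2) ≤ 1 / L ^ 2 * (6 * (x + 1)) :=
      mul_le_mul_of_nonneg_left (by linarith) (by positivity)
    have a3 : 0 ≤ |Γ| * x := by positivity
    have e2 : (|Γ| + 6 / L ^ 2) * (x + 1) = |Γ| + |Γ| * x + 1 / L ^ 2 * (6 * (x + 1)) := by ring
    rw [e, e2]
    linarith
  have hK' := mul_le_mul_of_nonneg_right hK ht.1
  have hG' := mul_le_mul_of_nonneg_left hG (show 0 ≤ 288 * (Re + Pe) by positivity)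
  refine (h.vertSq_le ht).trans ?_
  rw [Real.exp_add]
  unfold verticalBound
  calc _ ≤ Real.exp ((|Γ| + 6 / L ^ 2) * (‖θ 0‖ ^ 2 + ‖wderiv ez (θ 0)‖ ^ 2 + 1) * t)
        * Real.exp (288 * (Re + Pe)
          * vertGrowthBound L Re Pe Γ ε (lam L Re Pe Γ * D) D (2 * D)) * (2 * D) := by
        gcongr
        linarith
    _ = _ := by ring

end Flow

end Final

end RotConv

end

/-! ### The theorem. -/

open RotConv in
theorem theorem1p2 (L : ℝ) [Fact (0 < L)] (Re Pe Γ ε κ : ℝ) (hRe : 0 < Re) (hPe : 0 < Pe)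
    (hε : ε ≠ 0) (hκ : 1 ≤ κ) (hPeRe : Pe ≠ 2 * κ * Re) :
    ∃ (C K T₀ : ℝ) (C₁ : ℝ → ℝ → ℝ → ℝ → ℝ) (C₂ : ℝ → ℝ → ℝ → ℝ),
      ∀ (u v w θ : ℝ → L2 L) (u₀ v₀ w₀ θ₀ : L2 L),
        IsGlobalStrongSolution Re Pe Γ ε u v w θ u₀ v₀ w₀ θ₀ →
        (∀ t : ℝ, 0 ≤ t →
          ‖θ t‖ ^ 2 ≤ Real.exp (-(2 / (gam L * Pe)) * t) * ‖θ₀‖ ^ 2) ∧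
        (∀ t : ℝ, 0 ≤ t →
          (‖u t‖ ^ 2 + ‖v t‖ ^ 2) + ‖w t‖ ^ 2 ≤
            Real.exp (-(1 / (κ * gam L * Re)) * t) * ((‖u₀‖ ^ 2 + ‖v₀‖ ^ 2) + ‖w₀‖ ^ 2)
            + C * (Real.exp (-(2 / (gam L * Pe)) * t) + Real.exp (-(1 / (κ * gam L * Re)) * t))
              * ‖θ₀‖ ^ 2) ∧
        (∀ t : ℝ, 0 ≤ t → T₀ ≤ t →
          ‖curlH (u t) (v t)‖ ^ 2
            + (‖wderiv ex (w t)‖ ^ 2 + ‖wderiv ey (w t)‖ ^ 2)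
            + (‖wderiv ex (θ t)‖ ^ 2 + ‖wderiv ey (θ t)‖ ^ 2) ≤
            (Real.exp (-(2 / (gam L * Pe)) * t) + Real.exp (-(1 / (κ * gam L * Re)) * t))
              * C₁ (vnorm ‖u₀‖ ‖v₀‖) ‖w₀‖ ‖θ₀‖ ‖wderiv ez θ₀‖) ∧
        (∀ t : ℝ, 0 ≤ t →
          (‖wderiv ez (u t)‖ ^ 2 + ‖wderiv ez (v t)‖ ^ 2)
            + ‖wderiv ez (w t)‖ ^ 2 + ‖wderiv ez (θ t)‖ ^ 2 ≤
            C₂ (vnorm (h1Norm u₀) (h1Norm v₀)) (h1Norm w₀) (h1Norm θ₀)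
              * Real.exp (K * (‖θ₀‖ ^ 2 + ‖wderiv ez θ₀‖ ^ 2 + 1) * t)) := by
  -- The time 2 is the total length of the two unit windows in `gradOf_uniform`.
  refine ⟨decayConst L Re Pe Γ κ, |Γ| + 6 / L ^ 2, 2, largeTimeBound L Re Pe Γ ε κ,
    fun x y z => verticalBound L Re Pe Γ ε (x ^ 2 + y ^ 2 + z ^ 2), ?_⟩
  intro u v w θ u₀ v₀ w₀ θ₀ hsol
  -- The length t + 1 is positive even at t = 0. The auxiliary functions may depend on the interval,
  -- but the estimates do not mention them.
  have key : ∀ t : ℝ, 0 ≤ t → ∃ ω φ ut vt wt θt r : ℝ → L2 L,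
      Flow Re Pe Γ ε (t + 1) u v w θ ω φ ut vt wt θt r := by
    intro t ht
    obtain ⟨ω, φ, h⟩ := hsol (t + 1) (by linarith)
    obtain ⟨ut, vt, wt, θt, r, hf⟩ := h.exists_flow (by linarith) hRe hPe hε
    exact ⟨ω, φ, ut, vt, wt, θt, r, hf⟩
  -- Any one interval identifies the initial data with the values at time 0.
  obtain ⟨ω', φ', h0⟩ := hsol 1 one_pos
  obtain rfl := h0.u_init
  obtain rfl := h0.v_init
  obtain rfl := h0.w_init
  obtain rfl := h0.θ_init
  refine ⟨fun t ht => ?_, fun t ht => ?_, fun t ht h2 => ?_, fun t ht => ?_⟩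
  all_goals
    obtain ⟨ω, φ, ut, vt, wt, θt, r, h⟩ := key t ht
    have hm : t ∈ Set.Icc 0 (t + 1) := ⟨ht, by linarith⟩
  · exact h.theta_decay hm
  · exact h.kinetic_decay hκ hPeRe hm
  · rw [← h.gradOf_eq hm]
    exact h.gradOf_decay hκ hPeRe h2 hm.2
  · exact h.vertSq_growth hm
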